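/- Let $k$ be a field, $H$ a finite-dimensional cocommutative Hopf algebra over $k$ with antipode $S$, and $\omega:H\otimes H\otimes H\to k$ a convolution invertible normalized Sweedler $3$-cocycle, that is, $$\omega(x,y,zt)\,\omega(xy,z,t)=\omega(y,z,t)\,\omega(x,yz,t)\,\omega(x,y,z),\qquad \omega(1,x,y)=\omega(x,1,y)=\omega(x,y,1)=\varepsilon(x)\varepsilon(y).$$ Here and below repeated occurrences of an element of $H$ stand for its Sweedler components (simplified Sweedler notation for the cocommutative $H$). Write $\omega^{-1}=\bar\omega_1\otimes\bar\omega_2\otimes\bar\omega_3\in H^*\otimes H^*\otimes H^*$ for the convolution inverse. For $\varphi\in H^*$ and $h,h'\in H$ let $h\rightharpoonup\varphi\leftharpoonup h'$ be the functional $a\mapsto\varphi(h'ah)$; let $g\triangleleft x=S(x)gx$ and $\beta(h)=\omega(h,S(h),h)$. **The quasi-Hopf algebra $H^*_\omega$.** This is the dual Hopf algebra $H^*$ with reassociator $\omega^{-1}$, antipode $\bar S(\varphi)=\varphi\circ S$ and distinguished elements $\alpha=\varepsilon$ and $\beta$. **The quantum double.** For a finite-dimensional quasi-Hopf algebra $A$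 with $\Phi=X^1\otimes X^2\otimes X^3=Y^1\otimes Y^2\otimes Y^3$ and $\Phi^{-1}=x^1\otimes x^2\otimes x^3=y^1\otimes y^2\otimes y^3$, the quantum double $D(A)$ of Hausser and Nill is the vector space $A^*\otimes A$, with elements written $\varphi\bowtie h$, with unit $\varepsilon\bowtie 1$ and multiplication $$(\varphi\bowtie h)(\psi\bowtie h')=(\Omega^1\rightharpoonup\varphi\leftharpoonup\Omega^5)(\Omega^2h_{(1,1)}\rightharpoonup\psi\leftharpoonup S^{-1}(h_2)\Omega^4)\bowtie\Omega^3h_{(1,2)}h',$$ $$\Omega=X^1_{(1,1)}y^1x^1\otimes X^1_{(1,2)}y^2x^2_1\otimes X^1_2y^3x^2_2\otimes S^{-1}(f^1X^2x^3)\otimes S^{-1}(f^2X^3),$$ where $f=f^1\otimes f^2$ is the Drinfeld twist of $A$, with inverse $f^{-1}=g^1\otimes g^2$, explicitly $$f=(S\otimes S)(\Delta^{\rm cop}(x^1))\,\gamma_A\,\Delta(x^2\beta S(x^3)),\qquad \gamma_A=S(X^2x^1_2)\alpha X^3x^2\otimes S(X^1x^1_1)\alpha x^3,$$ $$f^{-1}=\Delta(S(x^1)\alpha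 x^2)\,\delta_A\,(S\otimes S)(\Delta^{\rm cop}(x^3)),\qquad \delta_A=X^1_1x^1\beta S(X^3)\otimes X^1_2x^2\beta S(X^2x^3).$$ With $p^1\otimes p^2=x^1\otimes x^2\beta S(x^3)$, $q^1\otimes q^2=X^1\otimes S^{-1}(\alpha X^3)X^2$, $U=g^1S(q^2)\otimes g^2S(q^1)$, and $\varphi(ab)=\varphi_1(a)\varphi_2(b)$, the rest of the structure of $D(A)$ is $$\Delta(\varphi\bowtie h)=(\varepsilon\bowtie X^1Y^1)(p^1_1x^1\rightharpoonup\varphi_2\leftharpoonup Y^2S^{-1}(p^2)\bowtie p^1_2x^2h_1)\otimes(X^2_1\rightharpoonup\varphi_1\leftharpoonup S^{-1}(X^3)\bowtie X^2_2Y^3x^3h_2),$$ $$\varepsilon(\varphi\bowtie h)=\varepsilon(h)\varphi(S^{-1}(\alpha)),\qquad S(\varphi\bowtie h)=(\varepsilon\bowtie S(h)f^1)(p^1_1U^1\rightharpoonup\varphi\circ S^{-1}\leftharpoonup f^2S^{-1}(p^2)\bowtie p^1_2U^2),$$ the reassociator, $\alpha$ and $\beta$ are the images of those of $A$ under $a\mapsto\varepsilon\bowtie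 a$, and the $R$-matrix is $\sum_i(\varepsilon\bowtie S^{-1}(p^2)e_ip^1_1)\otimes(e^i\bowtie p^1_2)$ for dual bases $e_i$, $e^i$ of $A$ and $A^*$. **The structure on $D^\omega(H)=H^*\#_\sigma H$.** Put $$\sigma(x,y)(g)=\theta(g;x,y)=\omega(g,x,y)\,\omega(x,y,g\triangleleft(xy))\,\omega^{-1}(x,g\triangleleft x,y),$$ $$\nu(h)(x\otimes y)=\gamma(x,y;h)=\omega(x,y,h)\,\omega(h,x\triangleleft h,y\triangleleft h)\,\omega^{-1}(x,h,y\triangleleft h),$$ and write $\nu(h)=\nu_1(h)\otimes\nu_2(h)\in H^*\otimes H^*$; let $\sigma^{-1}$ and $\nu^{-1}$ be the convolution inverses. On the vector space $H^*\otimes H$, with elements written $\varphi\# h$, consider the unit $\varepsilon\#1$ and * the multiplication $(\varphi\# h)(\varphi'\# h')=\varphi\,(h\rightharpoonup\varphi'\leftharpoonup S(h))\,\sigma(h,h')\# hh'$; * the reassociator $(\bar\omega_1\#1)\otimes(\bar\omega_2\#1)\otimes(\bar\omega_3\#1)$; * the comultiplication $\Delta(\varphi\# h)=(\nu_1(h)\varphi_1\#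 h)\otimes(\nu_2(h)\varphi_2\# h)$ and the counit $\varepsilon(\varphi\# h)=\varphi(1)\varepsilon(h)$; * the distinguished elements $\varepsilon\#1$ (as $\alpha$) and $\beta\#1$ (as $\beta$), and the antipode $s(\varphi\# h)=[\varepsilon\# S(h)]\,[\sigma^{-1}(h,S(h))\,\bar S(\varphi\,\nu_1^{-1}(h))\,\nu_2^{-1}(h)\#1]$; * the $R$-matrix $R=\sum_i(e^i\#1)\otimes(\varepsilon\# e_i)$, with $e_i$, $e^i$ dual bases of $H$ and $H^*$. **Theorem.** $H^*_\omega$ is a quasi-Hopf algebra, its quantum double $D(H^*_\omega)$ is a quasitriangular quasi-Hopf algebra, and $D^\omega(H)=H^*\#_\sigma H$ with the structure just listed is a quasitriangular quasi-Hopf algebra. Moreover, identifying $(H^*)^*$ with $H$, the linear map $$w:D(H^*_\omega)\to D^\omega(H),\qquad w(h\bowtie\varphi)=\bar\omega_2(h)\,\bar\omega_3(S(h))\,\bar\omega_1\,(h\rightharpoonup\varphi\leftharpoonup S(h))\# h,$$ is an isomorphism of quasitriangular quasi-Hopf algebras: it is a bijective algebra map, and it carries the comultiplication, counit, reassociator,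 antipode, $\alpha$, $\beta$ and $R$-matrix of $D(H^*_\omega)$ to those of $D^\omega(H)$ listed above. -/

import Mathlib

open scoped TensorProduct

noncomputable section

namespace QuasiHopf

/-! ### Sweedler-type sums

For a multilinear expression `F`, `sum₂ t F` is `∑ F t¹ t²`, where `t = ∑ t¹ ⊗ t² ∈ V ⊗ W`
(and similarly for three and five tensor factors, bracketed to the right), and `lift₂ F` is the
linear map `t ↦ sum₂ t F`, that is, the linear map with `v ⊗ w ↦ F v w` (see `lift₂_tmul`).
These are used for multilinear `F` only. -/

section Sums

variable {k V W U X Y M : Type*} [Field k]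
  [AddCommGroup V] [Module k V] [AddCommGroup W] [Module k W] [AddCommGroup U] [Module k U]
  [AddCommGroup X] [Module k X] [AddCommGroup Y] [Module k Y] [AddCommMonoid M] [Module k M]

def lift₂ (F : V → W → M) : V ⊗[k] W →ₗ[k] M :=
  ((Module.Basis.ofVectorSpace k V).tensorProduct (Module.Basis.ofVectorSpace k W)).constr k
    fun i => F (Module.Basis.ofVectorSpace k V i.1) (Module.Basis.ofVectorSpace k W i.2)

theorem lift₂_eq_lift (F : V →ₗ[k] W →ₗ[k] M) :
    lift₂ (fun v w => F v w) = TensorProduct.lift F := by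
  refine ((Module.Basis.ofVectorSpace k V).tensorProduct
    (Module.Basis.ofVectorSpace k W)).ext fun i => ?_
  rw [lift₂, Module.Basis.constr_basis]
  simp [Module.Basis.tensorProduct_apply']

theorem lift₂_tmul (F : V → W → M)
    (h₁ : ∀ v v' w, F (v + v') w = F v w + F v' w) (h₂ : ∀ (c : k) v w, F (c • v) w = c • F v w)
    (h₃ : ∀ v w w', F v (w + w') = F v w + F v w') (h₄ : ∀ (c : k) v w, F v (c • w) = c • F v w)
    (v : V) (w : W) : lift₂ (k := k) F (v ⊗ₜ w) = F v w :=
  (LinearMap.congr_fun (lift₂_eq_lift (LinearMap.mk₂ k F h₁ h₂ h₃ h₄)) (v ⊗ₜ w)).trans (by simp)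

def lift₃ (F : V → W → U → M) : V ⊗[k] (W ⊗[k] U) →ₗ[k] M :=
  lift₂ fun v t => lift₂ (F v) t

def lift₄ (F : V → W → U → X → M) : V ⊗[k] (W ⊗[k] (U ⊗[k] X)) →ₗ[k] M :=
  lift₂ fun v t => lift₃ (F v) t

def lift₅ (F : V → W → U → X → Y → M) : V ⊗[k] (W ⊗[k] (U ⊗[k] (X ⊗[k] Y))) →ₗ[k] M :=
  lift₂ fun v t => lift₄ (F v) t

def sum₂ (t : V ⊗[k] W) (F : V → W → M) : M := lift₂ F t

def sum₃ (t : V ⊗[k] (W ⊗[k] U)) (F : V → W → U → M) : M := lift₃ F t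

def sum₅ (t : V ⊗[k] (W ⊗[k] (U ⊗[k] (X ⊗[k] Y)))) (F : V → W → U → X → Y → M) : M := lift₅ F t

end Sums

/-! ### Quasi-Hopf algebras -/

/-- The structure maps and distinguished elements of a quasi-Hopf algebra; the laws are
`QuasiHopfData.IsQuasiHopf`. -/
structure QuasiHopfData (k A : Type*) [Field k] [AddCommGroup A] [Module k A] where
  /-- multiplication -/
  mul : A →ₗ[k] A →ₗ[k] A
  /-- unit -/
  one : A
  /-- comultiplication `Δ` -/
  comul : A →ₗ[k] A ⊗[k] A
  /-- counit `ε` -/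
  counit : A →ₗ[k] k
  /-- reassociator `Φ = X¹ ⊗ X² ⊗ X³` -/
  reassoc : A ⊗[k] (A ⊗[k] A)
  /-- inverse of the reassociator, `Φ⁻¹ = x¹ ⊗ x² ⊗ x³` -/
  reassocInv : A ⊗[k] (A ⊗[k] A)
  /-- antipode `S` -/
  antipode : A →ₗ[k] A
  /-- the element `α` -/
  alpha : A
  /-- the element `β` -/
  beta : A

namespace QuasiHopfData

variable {k A : Type*} [Field k] [AddCommGroup A] [Module k A] (Q : QuasiHopfData k A)

local notation:70 a:70 " ⬝ " b:71 => QuasiHopfData.mul Q a b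

/-- Multiplication of `A ⊗ A`. -/
def mul₂ : A ⊗[k] A →ₗ[k] A ⊗[k] A →ₗ[k] A ⊗[k] A :=
  TensorProduct.map₂ Q.mul Q.mul

/-- Multiplication of `A ⊗ A ⊗ A`. -/
def mul₃ : A ⊗[k] (A ⊗[k] A) →ₗ[k] A ⊗[k] (A ⊗[k] A) →ₗ[k] A ⊗[k] (A ⊗[k] A) :=
  TensorProduct.map₂ Q.mul Q.mul₂

/-- Multiplication of `A ⊗ A ⊗ A ⊗ A`. -/
def mul₄ : A ⊗[k] (A ⊗[k] (A ⊗[k] A)) →ₗ[k] A ⊗[k] (A ⊗[k] (A ⊗[k] A)) →ₗ[k]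
    A ⊗[k] (A ⊗[k] (A ⊗[k] A)) :=
  TensorProduct.map₂ Q.mul Q.mul₃

/-- The axioms of a quasi-Hopf algebra `(A, Δ, ε, Φ, S, α, β)`. The antipode is not required to be
bijective. -/
structure IsQuasiHopf : Prop where
  mul_assoc : ∀ a b c, (a ⬝ b) ⬝ c = a ⬝ (b ⬝ c)
  one_mul : ∀ a, Q.one ⬝ a = a
  mul_one : ∀ a, a ⬝ Q.one = a
  comul_mul : ∀ a b, Q.comul (a ⬝ b) = Q.mul₂ (Q.comul a) (Q.comul b)
  comul_one : Q.comul Q.one = Q.one ⊗ₜ Q.one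
  counit_mul : ∀ a b, Q.counit (a ⬝ b) = Q.counit a * Q.counit b
  counit_one : Q.counit Q.one = 1
  counit_comul : ∀ a, (sum₂ (Q.comul a) fun a₁ a₂ => Q.counit a₁ • a₂) = a
  comul_counit : ∀ a, (sum₂ (Q.comul a) fun a₁ a₂ => Q.counit a₂ • a₁) = a
  reassoc_mul_inv : Q.mul₃ Q.reassoc Q.reassocInv = Q.one ⊗ₜ (Q.one ⊗ₜ Q.one)
  inv_mul_reassoc : Q.mul₃ Q.reassocInv Q.reassoc = Q.one ⊗ₜ (Q.one ⊗ₜ Q.one)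
  /-- `(id ⊗ Δ)(Δ(a)) = Φ (Δ ⊗ id)(Δ(a)) Φ⁻¹` -/
  coassoc : ∀ a,
    (sum₂ (Q.comul a) fun a₁ a₂ => a₁ ⊗ₜ[k] Q.comul a₂) =
      Q.mul₃ (Q.mul₃ Q.reassoc
        (sum₂ (Q.comul a) fun a₁ a₂ => sum₂ (Q.comul a₁) fun b c => b ⊗ₜ[k] (c ⊗ₜ[k] a₂)))
        Q.reassocInv
  /-- `(1 ⊗ Φ) (id ⊗ Δ ⊗ id)(Φ) (Φ ⊗ 1) = (id ⊗ id ⊗ Δ)(Φ) (Δ ⊗ id ⊗ id)(Φ)` -/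
  pentagon :
    Q.mul₄
      (Q.mul₄ (Q.one ⊗ₜ[k] Q.reassoc)
        (sum₃ Q.reassoc fun X₁ X₂ X₃ =>
          sum₂ (Q.comul X₂) fun b c => X₁ ⊗ₜ[k] (b ⊗ₜ[k] (c ⊗ₜ[k] X₃))))
      (sum₃ Q.reassoc fun X₁ X₂ X₃ => X₁ ⊗ₜ[k] (X₂ ⊗ₜ[k] (X₃ ⊗ₜ[k] Q.one))) =
    Q.mul₄
      (sum₃ Q.reassoc fun X₁ X₂ X₃ => X₁ ⊗ₜ[k] (X₂ ⊗ₜ[k] Q.comul X₃))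
      (sum₃ Q.reassoc fun X₁ X₂ X₃ =>
        sum₂ (Q.comul X₁) fun b c => b ⊗ₜ[k] (c ⊗ₜ[k] (X₂ ⊗ₜ[k] X₃)))
  /-- `(id ⊗ ε ⊗ id)(Φ) = 1 ⊗ 1` -/
  normalized :
    (sum₃ Q.reassoc fun X₁ X₂ X₃ => Q.counit X₂ • (X₁ ⊗ₜ[k] X₃)) = Q.one ⊗ₜ Q.one
  antipode_mul : ∀ a b, Q.antipode (a ⬝ b) = Q.antipode b ⬝ Q.antipode a
  antipode_one : Q.antipode Q.one = Q.one
  /-- `S(a₁) α a₂ = ε(a) α` -/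
  antipode_left : ∀ a,
    (sum₂ (Q.comul a) fun a₁ a₂ => Q.antipode a₁ ⬝ Q.alpha ⬝ a₂) = Q.counit a • Q.alpha
  /-- `a₁ β S(a₂) = ε(a) β` -/
  antipode_right : ∀ a,
    (sum₂ (Q.comul a) fun a₁ a₂ => a₁ ⬝ Q.beta ⬝ Q.antipode a₂) = Q.counit a • Q.beta
  /-- `X¹ β S(X²) α X³ = 1` -/
  reassoc_antipode :
    (sum₃ Q.reassoc fun X₁ X₂ X₃ => X₁ ⬝ Q.beta ⬝ Q.antipode X₂ ⬝ Q.alpha ⬝ X₃) = Q.one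
  /-- `S(x¹) α x² β S(x³) = 1` -/
  reassocInv_antipode :
    (sum₃ Q.reassocInv fun x₁ x₂ x₃ =>
      Q.antipode x₁ ⬝ Q.alpha ⬝ x₂ ⬝ Q.beta ⬝ Q.antipode x₃) = Q.one

/-- `R ∈ A ⊗ A` is an `R`-matrix for the quasi-Hopf algebra `A`: it is invertible and
`Δᵒᵖ(a) R = R Δ(a)`,
`(Δ ⊗ id)(R) = (X² ⊗ X³ ⊗ X¹) R₁₃ (x¹ ⊗ x³ ⊗ x²) R₂₃ Φ`,
`(id ⊗ Δ)(R) = (x³ ⊗ x¹ ⊗ x²) R₁₃ (X² ⊗ X¹ ⊗ X³) R₁₂ Φ⁻¹`. -/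
structure IsRMatrix (R : A ⊗[k] A) : Prop where
  invertible : ∃ R' : A ⊗[k] A,
    Q.mul₂ R R' = Q.one ⊗ₜ Q.one ∧ Q.mul₂ R' R = Q.one ⊗ₜ Q.one
  comul_op : ∀ a, Q.mul₂ (TensorProduct.comm k A A (Q.comul a)) R = Q.mul₂ R (Q.comul a)
  comul_left :
    (sum₂ R fun R₁ R₂ => sum₂ (Q.comul R₁) fun b c => b ⊗ₜ[k] (c ⊗ₜ[k] R₂)) =
      Q.mul₃ (Q.mul₃ (Q.mul₃ (Q.mul₃
        (sum₃ Q.reassoc fun X₁ X₂ X₃ => X₂ ⊗ₜ[k] (X₃ ⊗ₜ[k] X₁))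
        (sum₂ R fun R₁ R₂ => R₁ ⊗ₜ[k] (Q.one ⊗ₜ[k] R₂)))
        (sum₃ Q.reassocInv fun x₁ x₂ x₃ => x₁ ⊗ₜ[k] (x₃ ⊗ₜ[k] x₂)))
        (Q.one ⊗ₜ[k] R))
        Q.reassoc
  comul_right :
    (sum₂ R fun R₁ R₂ => R₁ ⊗ₜ[k] Q.comul R₂) =
      Q.mul₃ (Q.mul₃ (Q.mul₃ (Q.mul₃
        (sum₃ Q.reassocInv fun x₁ x₂ x₃ => x₃ ⊗ₜ[k] (x₁ ⊗ₜ[k] x₂))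
        (sum₂ R fun R₁ R₂ => R₁ ⊗ₜ[k] (Q.one ⊗ₜ[k] R₂)))
        (sum₃ Q.reassoc fun X₁ X₂ X₃ => X₂ ⊗ₜ[k] (X₁ ⊗ₜ[k] X₃)))
        (sum₂ R fun R₁ R₂ => R₁ ⊗ₜ[k] (R₂ ⊗ₜ[k] Q.one)))
        Q.reassocInv

/-! ### The Drinfeld twist -/

/-- `γ = S(X² x¹₂) α X³ x² ⊗ S(X¹ x¹₁) α x³`. -/
def drinfeldGamma : A ⊗[k] A :=
  sum₃ Q.reassoc fun X₁ X₂ X₃ => sum₃ Q.reassocInv fun x₁ x₂ x₃ =>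
    sum₂ (Q.comul x₁) fun x₁₁ x₁₂ =>
      (Q.antipode (X₂ ⬝ x₁₂) ⬝ Q.alpha ⬝ X₃ ⬝ x₂) ⊗ₜ[k] (Q.antipode (X₁ ⬝ x₁₁) ⬝ Q.alpha ⬝ x₃)

/-- `δ = X¹₁ x¹ β S(X³) ⊗ X¹₂ x² β S(X² x³)`. -/
def drinfeldDelta : A ⊗[k] A :=
  sum₃ Q.reassoc fun X₁ X₂ X₃ => sum₃ Q.reassocInv fun x₁ x₂ x₃ =>
    sum₂ (Q.comul X₁) fun X₁₁ X₁₂ =>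
      (X₁₁ ⬝ x₁ ⬝ Q.beta ⬝ Q.antipode X₃) ⊗ₜ[k] (X₁₂ ⬝ x₂ ⬝ Q.beta ⬝ Q.antipode (X₂ ⬝ x₃))

/-- `(S ⊗ S)(Δᶜᵒᵖ(a))`. -/
def antipodeComulCop (a : A) : A ⊗[k] A :=
  sum₂ (Q.comul a) fun a₁ a₂ => Q.antipode a₂ ⊗ₜ[k] Q.antipode a₁

/-- The Drinfeld twist `f = (S ⊗ S)(Δᶜᵒᵖ(x¹)) γ Δ(x² β S(x³))`. -/
def drinfeldTwist : A ⊗[k] A :=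
  sum₃ Q.reassocInv fun x₁ x₂ x₃ =>
    Q.mul₂ (Q.mul₂ (Q.antipodeComulCop x₁) Q.drinfeldGamma)
      (Q.comul (x₂ ⬝ Q.beta ⬝ Q.antipode x₃))

/-- The inverse `f⁻¹ = Δ(S(x¹) α x²) δ (S ⊗ S)(Δᶜᵒᵖ(x³))` of the Drinfeld twist. -/
def drinfeldTwistInv : A ⊗[k] A :=
  sum₃ Q.reassocInv fun x₁ x₂ x₃ =>
    Q.mul₂ (Q.mul₂ (Q.comul (Q.antipode x₁ ⬝ Q.alpha ⬝ x₂)) Q.drinfeldDelta)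
      (Q.antipodeComulCop x₃)

/-! ### The quantum double of a finite-dimensional quasi-Hopf algebra -/

/-- The inverse of the antipode with respect to composition. -/
def antipodeInv : A →ₗ[k] A :=
  Ring.inverse (Q.antipode : Module.End k A)

/-- `p_R = x¹ ⊗ x² β S(x³)`. -/
def pR : A ⊗[k] A :=
  sum₃ Q.reassocInv fun x₁ x₂ x₃ => x₁ ⊗ₜ[k] (x₂ ⬝ Q.beta ⬝ Q.antipode x₃)

/-- `q_R = X¹ ⊗ S⁻¹(α X³) X²`. -/
def qR : A ⊗[k] A :=
  sum₃ Q.reassoc fun X₁ X₂ X₃ => X₁ ⊗ₜ[k] (Q.antipodeInv (Q.alpha ⬝ X₃) ⬝ X₂)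

/-- `U = g¹ S(q²) ⊗ g² S(q¹)`, where `f⁻¹ = g¹ ⊗ g²` and `q_R = q¹ ⊗ q²`. -/
def elementU : A ⊗[k] A :=
  sum₂ Q.drinfeldTwistInv fun g₁ g₂ => sum₂ Q.qR fun q₁ q₂ =>
    (g₁ ⬝ Q.antipode q₂) ⊗ₜ[k] (g₂ ⬝ Q.antipode q₁)

/-- `Ω = X¹₁₁ y¹ x¹ ⊗ X¹₁₂ y² x²₁ ⊗ X¹₂ y³ x²₂ ⊗ S⁻¹(f¹ X² x³) ⊗ S⁻¹(f² X³)`,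
where `x` and `y` are two copies of `Φ⁻¹`. -/
def elementOmega : A ⊗[k] (A ⊗[k] (A ⊗[k] (A ⊗[k] A))) :=
  sum₃ Q.reassoc fun X₁ X₂ X₃ => sum₃ Q.reassocInv fun y₁ y₂ y₃ =>
    sum₃ Q.reassocInv fun x₁ x₂ x₃ => sum₂ Q.drinfeldTwist fun f₁ f₂ =>
      sum₂ (Q.comul X₁) fun X₁' X₁₂ => sum₂ (Q.comul X₁') fun X₁₁₁ X₁₁₂ =>
        sum₂ (Q.comul x₂) fun x₂₁ x₂₂ =>
          (X₁₁₁ ⬝ y₁ ⬝ x₁) ⊗ₜ[k] ((X₁₁₂ ⬝ y₂ ⬝ x₂₁) ⊗ₜ[k] ((X₁₂ ⬝ y₃ ⬝ x₂₂) ⊗ₜ[k]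
            (Q.antipodeInv (f₁ ⬝ X₂ ⬝ x₃) ⊗ₜ[k] Q.antipodeInv (f₂ ⬝ X₃))))

/-- The convolution product `(φψ)(a) = φ(a₁) ψ(a₂)` on `A*`. -/
def dualMul (φ ψ : Module.Dual k A) : Module.Dual k A :=
  TensorProduct.dualDistrib k A A (φ ⊗ₜ ψ) ∘ₗ Q.comul

/-- `u ⇀ φ ↼ v`, the functional `a ↦ φ(v a u)`. -/
def sandwich (u : A) (φ : Module.Dual k A) (v : A) : Module.Dual k A :=
  φ ∘ₗ Q.mul.flip u ∘ₗ Q.mul v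

variable [FiniteDimensional k A]

/-- The coproduct `φ ↦ φ₁ ⊗ φ₂` of `A*`, where `φ(ab) = φ₁(a) φ₂(b)`. -/
def dualComul : Module.Dual k A →ₗ[k] Module.Dual k A ⊗[k] Module.Dual k A :=
  (TensorProduct.dualDistribEquiv k A A).symm.toLinearMap ∘ₗ
    (TensorProduct.lift Q.mul).dualMap

/-- The multiplication of the diagonal crossed product `A* ⋈ A`:
`(φ ⋈ h)(ψ ⋈ h') = (Ω¹ ⇀ φ ↼ Ω⁵)(Ω² h₁₁ ⇀ ψ ↼ S⁻¹(h₂) Ω⁴) ⋈ Ω³ h₁₂ h'`. -/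
def doubleMul : Module.Dual k A ⊗[k] A →ₗ[k] Module.Dual k A ⊗[k] A →ₗ[k]
    Module.Dual k A ⊗[k] A :=
  lift₂ fun φ h => lift₂ fun ψ h' =>
    sum₅ Q.elementOmega fun Ω₁ Ω₂ Ω₃ Ω₄ Ω₅ =>
      sum₂ (Q.comul h) fun h₁ h₂ => sum₂ (Q.comul h₁) fun h₁₁ h₁₂ =>
        Q.dualMul (Q.sandwich Ω₁ φ Ω₅)
          (Q.sandwich (Ω₂ ⬝ h₁₁) ψ (Q.antipodeInv h₂ ⬝ Ω₄)) ⊗ₜ[k] (Ω₃ ⬝ h₁₂ ⬝ h')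

/-- The embedding `a ↦ ε ⋈ a` of `A` into `A* ⋈ A`. -/
def doubleIncl : A →ₗ[k] Module.Dual k A ⊗[k] A :=
  TensorProduct.mk k (Module.Dual k A) A Q.counit

/-- The comultiplication of the quantum double:
`Δ(φ ⋈ h) = (ε ⋈ X¹ Y¹)(p¹₁ x¹ ⇀ φ₂ ↼ Y² S⁻¹(p²) ⋈ p¹₂ x² h₁)
  ⊗ (X²₁ ⇀ φ₁ ↼ S⁻¹(X³) ⋈ X²₂ Y³ x³ h₂)`,
where `X` and `Y` are two copies of `Φ`. -/
def doubleComul : Module.Dual k A ⊗[k] A →ₗ[k]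
    (Module.Dual k A ⊗[k] A) ⊗[k] (Module.Dual k A ⊗[k] A) :=
  lift₂ fun φ h =>
    sum₃ Q.reassoc fun X₁ X₂ X₃ => sum₃ Q.reassoc fun Y₁ Y₂ Y₃ =>
      sum₃ Q.reassocInv fun x₁ x₂ x₃ => sum₂ Q.pR fun p₁ p₂ =>
        sum₂ (Q.comul p₁) fun p₁₁ p₁₂ => sum₂ (Q.comul X₂) fun X₂₁ X₂₂ =>
          sum₂ (Q.dualComul φ) fun φ₁ φ₂ => sum₂ (Q.comul h) fun h₁ h₂ =>
            Q.doubleMul (Q.doubleIncl (X₁ ⬝ Y₁))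
              (Q.sandwich (p₁₁ ⬝ x₁) φ₂ (Y₂ ⬝ Q.antipodeInv p₂) ⊗ₜ[k] (p₁₂ ⬝ x₂ ⬝ h₁)) ⊗ₜ[k]
            (Q.sandwich X₂₁ φ₁ (Q.antipodeInv X₃) ⊗ₜ[k] (X₂₂ ⬝ Y₃ ⬝ x₃ ⬝ h₂))

/-- The antipode of the quantum double:
`S(φ ⋈ h) = (ε ⋈ S(h) f¹)(p¹₁ U¹ ⇀ φ ∘ S⁻¹ ↼ f² S⁻¹(p²) ⋈ p¹₂ U²)`. -/
def doubleAntipode : Module.Dual k A ⊗[k] A →ₗ[k] Module.Dual k A ⊗[k] A :=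
  lift₂ fun φ h =>
    sum₂ Q.drinfeldTwist fun f₁ f₂ => sum₂ Q.elementU fun U₁ U₂ =>
      sum₂ Q.pR fun p₁ p₂ => sum₂ (Q.comul p₁) fun p₁₁ p₁₂ =>
        Q.doubleMul (Q.doubleIncl (Q.antipode h ⬝ f₁))
          (Q.sandwich (p₁₁ ⬝ U₁) (φ ∘ₗ Q.antipodeInv) (f₂ ⬝ Q.antipodeInv p₂) ⊗ₜ[k]
            (p₁₂ ⬝ U₂))

/-- The quantum double `D(A)` of Hausser and Nill, on the vector space `A* ⊗ A`. -/
def quantumDouble : QuasiHopfData k (Module.Dual k A ⊗[k] A) where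
  mul := Q.doubleMul
  one := Q.doubleIncl Q.one
  comul := Q.doubleComul
  counit := lift₂ fun φ h => Q.counit h * φ (Q.antipodeInv Q.alpha)
  reassoc := TensorProduct.map Q.doubleIncl (TensorProduct.map Q.doubleIncl Q.doubleIncl) Q.reassoc
  reassocInv :=
    TensorProduct.map Q.doubleIncl (TensorProduct.map Q.doubleIncl Q.doubleIncl) Q.reassocInv
  antipode := Q.doubleAntipode
  alpha := Q.doubleIncl Q.alpha
  beta := Q.doubleIncl Q.beta

/-- The `R`-matrix `∑ᵢ (ε ⋈ S⁻¹(p²) eᵢ p¹₁) ⊗ (eⁱ ⋈ p¹₂)` of the quantum double, where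
`eᵢ` and `eⁱ` are dual bases of `A` and `A*`. -/
def doubleR : (Module.Dual k A ⊗[k] A) ⊗[k] (Module.Dual k A ⊗[k] A) :=
  ∑ i, sum₂ Q.pR fun p₁ p₂ => sum₂ (Q.comul p₁) fun p₁₁ p₁₂ =>
    Q.doubleIncl (Q.antipodeInv p₂ ⬝ Module.finBasis k A i ⬝ p₁₁) ⊗ₜ[k]
      ((Module.finBasis k A).coord i ⊗ₜ[k] p₁₂)

end QuasiHopfData

/-- `w` is an isomorphism from the quasi-Hopf algebra `Q` with `R`-matrix `R` onto the quasi-Hopf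
algebra `Q'` with `R`-matrix `R'`: a bijective algebra map that carries each piece of the structure
of `Q` to that of `Q'`. -/
structure IsIsomorphism {k A B : Type*} [Field k] [AddCommGroup A] [Module k A]
    [AddCommGroup B] [Module k B] (Q : QuasiHopfData k A) (R : A ⊗[k] A)
    (Q' : QuasiHopfData k B) (R' : B ⊗[k] B) (w : A →ₗ[k] B) : Prop where
  bijective : Function.Bijective w
  map_mul : ∀ a b, w (Q.mul a b) = Q'.mul (w a) (w b)
  map_one : w Q.one = Q'.one
  map_comul : ∀ a, TensorProduct.map w w (Q.comul a) = Q'.comul (w a)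
  map_counit : ∀ a, Q'.counit (w a) = Q.counit a
  map_reassoc : TensorProduct.map w (TensorProduct.map w w) Q.reassoc = Q'.reassoc
  map_reassocInv : TensorProduct.map w (TensorProduct.map w w) Q.reassocInv = Q'.reassocInv
  map_antipode : ∀ a, w (Q.antipode a) = Q'.antipode (w a)
  map_alpha : w Q.alpha = Q'.alpha
  map_beta : w Q.beta = Q'.beta
  map_R : TensorProduct.map w w R = R'

/-! ### Cocycles on a cocommutative Hopf algebra -/

section Convolution

variable {k C : Type*} [Field k] [AddCommGroup C] [Module k C] [Coalgebra k C]

/-- The convolution product `(φψ)(c) = φ(c₁) ψ(c₂)` of functionals on a coalgebra. -/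
def conv : Module.Dual k C →ₗ[k] Module.Dual k C →ₗ[k] Module.Dual k C :=
  LinearMap.mk₂ k (fun φ ψ => (WithConv.toConv φ * WithConv.toConv ψ).ofConv)
    (fun φ φ' ψ => by simp [add_mul])
    (fun c φ ψ => by rw [WithConv.toConv_smul, smul_mul_assoc, WithConv.ofConv_smul])
    (fun φ ψ ψ' => by simp [mul_add])
    (fun c φ ψ => by rw [WithConv.toConv_smul, mul_smul_comm, WithConv.ofConv_smul])

end Convolution

variable {k H : Type*} [Field k] [Ring H] [HopfAlgebra k H]

/-- The pullback of a functional along a linear map. -/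
def pullback {C D : Type*} [AddCommGroup C] [Module k C] [AddCommGroup D] [Module k D]
    (ω : WithConv (D →ₗ[k] k)) (g : C →ₗ[k] D) : WithConv (C →ₗ[k] k) :=
  WithConv.toConv (ω.ofConv ∘ₗ g)

/-- A convolution invertible `ω : H ⊗ H ⊗ H → k` is a normalized Sweedler 3-cocycle: as functions
of `x, y, z, t ∈ H` (products of functionals being convolution products)
`ω(x, y, zt) ω(xy, z, t) = ω(y, z, t) ω(x, yz, t) ω(x, y, z)`, and `ω` is trivial as soon as
one of its arguments is `1`. -/
structure IsNormalizedThreeCocycle (ω : (WithConv (H ⊗[k] (H ⊗[k] H) →ₗ[k] k))ˣ) : Prop where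
  cocycle :
    pullback (C := H ⊗[k] (H ⊗[k] (H ⊗[k] H))) ω.1
        (lift₄ fun x y z t => x ⊗ₜ (y ⊗ₜ (z * t))) *
      pullback ω.1 (lift₄ fun x y z t => (x * y) ⊗ₜ (z ⊗ₜ t)) =
    pullback ω.1 (lift₄ fun x y z t => Coalgebra.counit (R := k) x • (y ⊗ₜ (z ⊗ₜ t))) *
      pullback ω.1 (lift₄ fun x y z t => x ⊗ₜ ((y * z) ⊗ₜ t)) *
      pullback ω.1 (lift₄ fun x y z t => Coalgebra.counit (R := k) t • (x ⊗ₜ (y ⊗ₜ z)))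
  one_left : ∀ x y : H, ω.1 (1 ⊗ₜ (x ⊗ₜ y)) = Coalgebra.counit (R := k) x * Coalgebra.counit y
  one_mid : ∀ x y : H, ω.1 (x ⊗ₜ (1 ⊗ₜ y)) = Coalgebra.counit (R := k) x * Coalgebra.counit y
  one_right : ∀ x y : H, ω.1 (x ⊗ₜ (y ⊗ₜ 1)) = Coalgebra.counit (R := k) x * Coalgebra.counit y

variable (k) in
/-- `g ◁ x = S(x₁) g x₂`. -/
def adj (g x : H) : H :=
  sum₂ (Coalgebra.comul (R := k) x) fun x₁ x₂ => HopfAlgebra.antipode k x₁ * g * x₂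

/-- `h ⇀ φ ↼ h'`, the functional `a ↦ φ(h' a h)`. -/
def actBoth (h : H) (φ : Module.Dual k H) (h' : H) : Module.Dual k H :=
  φ ∘ₗ LinearMap.mulRight k h ∘ₗ LinearMap.mulLeft k h'

/-- The antipode `φ ↦ φ ∘ S` of `H*`. -/
def dualAntipode : Module.Dual k H →ₗ[k] Module.Dual k H :=
  (HopfAlgebra.antipode k (A := H)).dualMap

variable (ω : (WithConv (H ⊗[k] (H ⊗[k] H) →ₗ[k] k))ˣ)

/-- `β(h) = ω(h, S(h), h)`. -/
def betaFun : Module.Dual k H :=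
  lift₃ (fun h₁ h₂ h₃ => ω.1 (h₁ ⊗ₜ (HopfAlgebra.antipode k h₂ ⊗ₜ h₃))) ∘ₗ
    LinearMap.lTensor H Coalgebra.comul ∘ₗ Coalgebra.comul

/-- `θ(g; x, y) = ω(g, x, y) ω(x, y, g ◁ (xy)) ω⁻¹(x, g ◁ x, y)`. -/
def theta : WithConv (H ⊗[k] (H ⊗[k] H) →ₗ[k] k) :=
  ω.1 *
  pullback ω.1 (lift₃ fun g x y =>
    sum₂ (Coalgebra.comul (R := k) x) fun x₁ x₂ => sum₂ (Coalgebra.comul (R := k) y) fun y₁ y₂ =>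
      x₁ ⊗ₜ (y₁ ⊗ₜ adj k g (x₂ * y₂))) *
  pullback (ω⁻¹).1 (lift₃ fun g x y =>
    sum₂ (Coalgebra.comul (R := k) x) fun x₁ x₂ => x₁ ⊗ₜ (adj k g x₂ ⊗ₜ y))

/-- `γ(g, h; x) = ω(g, h, x) ω(x, g ◁ x, h ◁ x) ω⁻¹(g, x, h ◁ x)`. -/
def gamma : WithConv (H ⊗[k] (H ⊗[k] H) →ₗ[k] k) :=
  ω.1 *
  pullback ω.1 (lift₃ fun g h x =>
    sum₂ (Coalgebra.comul (R := k) x) fun x₁ x' => sum₂ (Coalgebra.comul (R := k) x') fun x₂ x₃ =>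
      x₁ ⊗ₜ (adj k g x₂ ⊗ₜ adj k h x₃)) *
  pullback (ω⁻¹).1 (lift₃ fun g h x =>
    sum₂ (Coalgebra.comul (R := k) x) fun x₁ x₂ => g ⊗ₜ (x₁ ⊗ₜ adj k h x₂))

/-- For a functional `θ` on `H ⊗ H ⊗ H`, the functional `g ↦ θ(g; x, y)` on `H`. -/
def firstSlot (θ : WithConv (H ⊗[k] (H ⊗[k] H) →ₗ[k] k)) (x y : H) : Module.Dual k H :=
  θ.ofConv ∘ₗ (TensorProduct.mk k H (H ⊗[k] H)).flip (x ⊗ₜ y)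

/-- `σ(x, y)(g) = θ(g; x, y)`. -/
def sigma (x y : H) : Module.Dual k H := firstSlot (theta ω) x y

/-- The convolution inverse of `σ`; it is given by the convolution inverse of `θ`. -/
def sigmaInv (x y : H) : Module.Dual k H := firstSlot (Ring.inverse (theta ω)) x y

/-- For a functional `γ` on `H ⊗ H ⊗ H`, the functional `g ⊗ h ↦ γ(g, h; x)` on `H ⊗ H`. -/
def firstTwoSlots (γ : WithConv (H ⊗[k] (H ⊗[k] H) →ₗ[k] k)) (x : H) :
    Module.Dual k (H ⊗[k] H) :=
  γ.ofConv ∘ₗ (TensorProduct.assoc k H H H).toLinearMap ∘ₗ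
    (TensorProduct.mk k (H ⊗[k] H) H).flip x

variable [FiniteDimensional k H]

/-- `ν(h) = ν₁(h) ⊗ ν₂(h) ∈ H* ⊗ H*`, where `ν(h)(x ⊗ y) = γ(x, y; h)`. -/
def nu (h : H) : Module.Dual k H ⊗[k] Module.Dual k H :=
  (TensorProduct.dualDistribEquiv k H H).symm (firstTwoSlots (gamma ω) h)

/-- The convolution inverse of `ν`; it is given by the convolution inverse of `γ`. -/
def nuInv (h : H) : Module.Dual k H ⊗[k] Module.Dual k H :=
  (TensorProduct.dualDistribEquiv k H H).symm (firstTwoSlots (Ring.inverse (gamma ω)) h)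

/-- The coproduct of `H*`, dual to the multiplication of `H`. -/
def dualHopfComul : Module.Dual k H →ₗ[k] Module.Dual k H ⊗[k] Module.Dual k H :=
  (TensorProduct.dualDistribEquiv k H H).symm.toLinearMap ∘ₗ (LinearMap.mul' k H).dualMap

/-- The identification of `(H ⊗ H ⊗ H)*` with `H* ⊗ H* ⊗ H*`. -/
def dualTriple (θ : WithConv (H ⊗[k] (H ⊗[k] H) →ₗ[k] k)) :
    Module.Dual k H ⊗[k] (Module.Dual k H ⊗[k] Module.Dual k H) :=
  LinearMap.lTensor (Module.Dual k H) (TensorProduct.dualDistribEquiv k H H).symm.toLinearMap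
    ((TensorProduct.dualDistribEquiv k H (H ⊗[k] H)).symm θ.ofConv)

/-- The quasi-Hopf algebra `H*_ω`: the dual Hopf algebra `H*` with reassociator `ω⁻¹`, the antipode
`φ ↦ φ ∘ S`, `α = ε` and `β(h) = ω(h, S(h), h)`. -/
def dualOmega : QuasiHopfData k (Module.Dual k H) where
  mul := conv
  one := Coalgebra.counit
  comul := dualHopfComul
  counit := Module.Dual.eval k H 1
  reassoc := dualTriple (ω⁻¹).1
  reassocInv := dualTriple ω.1
  antipode := dualAntipode
  alpha := Coalgebra.counit
  beta := betaFun ω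

/-! ### The quasi-Hopf algebra `D^ω(H) = H* #_σ H` -/

/-- The multiplication of `H* #_σ H`:
`(φ # h)(φ' # h') = φ (h ⇀ φ' ↼ S(h)) σ(h, h') # hh'`, in the simplified Sweedler notation. -/
def crossedMul : Module.Dual k H ⊗[k] H →ₗ[k] Module.Dual k H ⊗[k] H →ₗ[k]
    Module.Dual k H ⊗[k] H :=
  lift₂ fun φ h => lift₂ fun φ' h' =>
    sum₂ (Coalgebra.comul (R := k) h) fun h₁ t => sum₂ (Coalgebra.comul (R := k) t) fun h₂ t' =>
      sum₂ (Coalgebra.comul (R := k) t') fun h₃ h₄ =>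
        sum₂ (Coalgebra.comul (R := k) h') fun h'₁ h'₂ =>
          conv (conv φ (actBoth h₁ φ' (HopfAlgebra.antipode k h₂))) (sigma ω h₃ h'₁) ⊗ₜ[k]
            (h₄ * h'₂)

/-- The map `φ ↦ φ # 1` from `H*` to `H* #_σ H`. -/
def crossedIncl : Module.Dual k H →ₗ[k] Module.Dual k H ⊗[k] H :=
  (TensorProduct.mk k (Module.Dual k H) H).flip 1

/-- `Δ(φ # h) = (ν₁(h) φ₁ # h) ⊗ (ν₂(h) φ₂ # h)`, in the simplified Sweedler notation. -/
def crossedComul : Module.Dual k H ⊗[k] H →ₗ[k]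
    (Module.Dual k H ⊗[k] H) ⊗[k] (Module.Dual k H ⊗[k] H) :=
  lift₂ fun φ h =>
    sum₂ (Coalgebra.comul (R := k) h) fun h₁ t => sum₂ (Coalgebra.comul (R := k) t) fun h₂ h₃ =>
      sum₂ (nu ω h₁) fun ν₁ ν₂ => sum₂ (dualHopfComul φ) fun φ₁ φ₂ =>
        (conv ν₁ φ₁ ⊗ₜ[k] h₂) ⊗ₜ[k] (conv ν₂ φ₂ ⊗ₜ[k] h₃)

/-- `s(φ # h) = (ε # S(h)) (σ⁻¹(h, S(h)) S(φ ν⁻¹₁(h)) ν⁻¹₂(h) # 1)`, in the simplified Sweedler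
notation. -/
def crossedAntipode : Module.Dual k H ⊗[k] H →ₗ[k] Module.Dual k H ⊗[k] H :=
  lift₂ fun φ h =>
    sum₂ (Coalgebra.comul (R := k) h) fun h₁ t => sum₂ (Coalgebra.comul (R := k) t) fun h₂ t' =>
      sum₂ (Coalgebra.comul (R := k) t') fun h₃ h₄ => sum₂ (nuInv ω h₄) fun ν₁ ν₂ =>
        crossedMul ω (Coalgebra.counit ⊗ₜ HopfAlgebra.antipode k h₁)
          (crossedIncl (conv (conv (sigmaInv ω h₂ (HopfAlgebra.antipode k h₃))
            (dualAntipode (conv φ ν₁))) ν₂))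

/-- `D^ω(H) = H* #_σ H`, with reassociator `(ω̄₁ # 1) ⊗ (ω̄₂ # 1) ⊗ (ω̄₃ # 1)`, where
`ω⁻¹ = ω̄₁ ⊗ ω̄₂ ⊗ ω̄₃`, counit `φ # h ↦ φ(1) ε(h)`, `α = ε # 1` and `β # 1`. -/
def DOmega : QuasiHopfData k (Module.Dual k H ⊗[k] H) where
  mul := crossedMul ω
  one := crossedIncl Coalgebra.counit
  comul := crossedComul ω
  counit := lift₂ fun φ h => φ 1 * Coalgebra.counit h
  reassoc := TensorProduct.map crossedIncl (TensorProduct.map crossedIncl crossedIncl)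
    (dualTriple (ω⁻¹).1)
  reassocInv := TensorProduct.map crossedIncl (TensorProduct.map crossedIncl crossedIncl)
    (dualTriple ω.1)
  antipode := crossedAntipode ω
  alpha := crossedIncl Coalgebra.counit
  beta := crossedIncl (betaFun ω)

variable (k H) in
/-- The `R`-matrix `∑ᵢ (eⁱ # 1) ⊗ (ε # eᵢ)` of `D^ω(H)`. -/
def DOmegaR : (Module.Dual k H ⊗[k] H) ⊗[k] (Module.Dual k H ⊗[k] H) :=
  ∑ i, crossedIncl ((Module.finBasis k H).coord i) ⊗ₜ[k]
    (Coalgebra.counit ⊗ₜ[k] Module.finBasis k H i)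

/-- The map `w : (H*_ω)* ⋈ H*_ω → H* #_σ H`,
`w(h ⋈ φ) = ω̄₂(h) ω̄₃(S(h)) ω̄₁ (h ⇀ φ ↼ S(h)) # h`, in the simplified Sweedler notation, where
`ω⁻¹ = ω̄₁ ⊗ ω̄₂ ⊗ ω̄₃` and `(H*)*` is identified with `H`. -/
def wMap : Module.Dual k (Module.Dual k H) ⊗[k] Module.Dual k H →ₗ[k] Module.Dual k H ⊗[k] H :=
  lift₂ fun χ φ =>
    sum₂ (Coalgebra.comul (R := k) ((Module.evalEquiv k H).symm χ)) fun h₁ t =>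
      sum₂ (Coalgebra.comul (R := k) t) fun h₂ t' => sum₂ (Coalgebra.comul (R := k) t') fun h₃ t'' =>
        sum₂ (Coalgebra.comul (R := k) t'') fun h₄ h₅ =>
          sum₃ (dualTriple (ω⁻¹).1) fun ω₁ ω₂ ω₃ =>
            (ω₂ h₁ * ω₃ (HopfAlgebra.antipode k h₂)) •
              (conv ω₁ (actBoth h₃ φ (HopfAlgebra.antipode k h₄)) ⊗ₜ[k] h₅)

end QuasiHopf

end

open scoped TensorProduct

set_option linter.unusedSectionVars false

noncomputable section

/-! Since `H` is cocommutative, `H*` is a commutative Hopf algebra, that is, the coordinate ring of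
a finite group scheme. For a commutative `k`-algebra `R` its `R`-points are the group-like elements
of `R ⊗ H`; they form a group `Point k R H`, with the product of `R ⊗ H` as group law and the
antipode as inverse. A functional on `H` is a function on points, convolution is the pointwise
product, and a Sweedler expression in which an element occurs several times becomes the same
expression with a point `x` in every slot (`IsPoint.bind_comul`). Hence `ω` becomes an ordinary
normalized 3-cocycle on a group, with values in `Rˣ` (`IsNormalizedThreeCocycle.isGroupCocycle`),
and `θ`, `γ` become the functions known from the twisted quantum double of a finite group.

Nothing is lost in this translation. Over the ring `R = H*` there is the generic point `∑ eⁱ ⊗ eᵢ`,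
and evaluating a functional at it returns the functional. So points separate functionals, and linear
maps out of `H` are determined by their values at points. A `Probe` is a separating family of
evaluations on the target of a linear map, and `Generators` is a family on which maps out of the
source are determined. Both notions are stable under tensor products, and `Generators.ext` reduces
an equality of linear maps to an equality of scalars.

On `H* # H` the evaluation at `g` is `φ # h ↦ φ(g) h`, and the generators are `φ # x` with `x` a
point. The product `(φ # x)(ψ # y)` evaluates at `g` to `φ(g) ψ(x⁻¹gx) θ(g; x, y) xy`, and the
coproduct of `φ # x` evaluates at `(g, h)` to `φ(gh) γ(g, h; x) x ⊗ x`. Each axiom of `D^ω(H)` is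
thus an identity between values of a group cocycle: `θ_assoc` for associativity, `γ_mul` for the
multiplicativity of `Δ`, `γ_assoc` for quasi-coassociativity, `IsGroupCocycle.antipode_mul` and
`IsGroupCocycle.antipode_right` for the antipode. The laws of the `R`-matrix are, up to
normalization, the definitions of `θ` and `γ` rearranged.

For the double of `H*_ω`, the elements `f`, `U`, `p_R` and `Ω` are tensors over `H*`, so at points
they are products of values of `ω`. The map `w` sends `x ⋈ φ` to something that evaluates at `g` to
`ω(g, x, x⁻¹)⁻¹ φ(x⁻¹gx) x`. Its compatibility with product, coproduct, antipode and `R`-matrix is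
`double_mul`, `double_comul`, `double_antipode` and `double_R`. It has an explicit right inverse,
and the two spaces have the same dimension, so it is bijective. The axioms of the double are never
checked directly: once `w` is known to respect all structure, they are carried over from `D^ω(H)` by
its inverse. -/

namespace QuasiHopf

/-! ### Sweedler sums with coefficients in a commutative algebra -/

section Bind

variable {k R : Type*} [Field k] [CommRing R] [Algebra k R]
  {V W U V' W' M N N' : Type*}
  [AddCommGroup V] [Module k V] [AddCommGroup W] [Module k W] [AddCommGroup U] [Module k U]
  [AddCommGroup V'] [Module k V'] [AddCommGroup W'] [Module k W']
  [AddCommMonoid M] [Module k M]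
  [AddCommMonoid N] [Module k N] [Module R N] [IsScalarTower k R N]
  [AddCommMonoid N'] [Module k N'] [Module R N'] [IsScalarTower k R N']

/-- The value at `x = ∑ r ⊗ v` of the `R`-linear extension of `F : V → N`; for a function `F` that
is not linear, `F` is replaced by the linear map with the same values on a basis. -/
def bind (x : R ⊗[k] V) (F : V → N) : N :=
  LinearMap.liftBaseChange R ((Module.Basis.ofVectorSpace k V).constr k
    fun i => F (Module.Basis.ofVectorSpace k V i)) x

theorem bind_linear (x : R ⊗[k] V) (L : V →ₗ[k] N) :
    bind x (fun v => L v) = LinearMap.liftBaseChange R L x := by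
  rw [bind, Module.Basis.constr_self]

theorem bind_tmul_linear (r : R) (v : V) (L : V →ₗ[k] N) :
    bind (r ⊗ₜ[k] v) (fun v => L v) = r • L v := by
  rw [bind_linear, LinearMap.liftBaseChange_tmul]

theorem bind_zero_left (F : V → N) : bind (0 : R ⊗[k] V) F = 0 := map_zero _

theorem bind_add_left (x y : R ⊗[k] V) (F : V → N) : bind (x + y) F = bind x F + bind y F :=
  map_add _ _ _

/-- Extending from values on a basis commutes with linear maps, whatever function supplies the
values. For this reason the rewriting rules derived from it carry no linearity hypothesis on `F`. -/
theorem map_bind (l : N →ₗ[R] N') (x : R ⊗[k] V) (F : V → N) :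
    l (bind x F) = bind x fun v => l (F v) := by
  have : ((l.restrictScalars k) ∘ₗ (Module.Basis.ofVectorSpace k V).constr k
      fun i => F (Module.Basis.ofVectorSpace k V i)) =
      (Module.Basis.ofVectorSpace k V).constr k
        fun i => l (F (Module.Basis.ofVectorSpace k V i)) := by
    refine (Module.Basis.ofVectorSpace k V).ext fun i => ?_
    simp only [LinearMap.comp_apply, LinearMap.restrictScalars_apply, Module.Basis.constr_basis]
  rw [bind, bind, ← this, ← LinearMap.liftBaseChange_comp]
  rfl

theorem bind_pi {ι : Type*} (x : R ⊗[k] V) (F : V → ι → N) (i : ι) :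
    bind x F i = bind x fun v => F v i :=
  map_bind (LinearMap.proj i) x F

theorem bind_mul (x : R ⊗[k] V) (r : R) (F : V → R) :
    (bind x fun v => r * F v) = r * bind x F :=
  (map_bind (LinearMap.mulLeft R r) x F).symm

theorem bind_mul_right (x : R ⊗[k] V) (r : R) (F : V → R) :
    (bind x fun v => F v * r) = bind x F * r :=
  (map_bind (LinearMap.mulRight R r) x F).symm

theorem bind_smul (x : R ⊗[k] V) (r : R) (F : V → N) :
    (bind x fun v => r • F v) = r • bind x F :=
  (map_bind (LinearMap.lsmul R N r) x F).symm

theorem bind_smul_const (x : R ⊗[k] V) (n : N) (F : V → R) :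
    (bind x fun v => F v • n) = bind x F • n :=
  (map_bind (LinearMap.toSpanSingleton R N n) x F).symm

theorem bind_add (x : R ⊗[k] V) (F G : V → N) :
    (bind x fun v => F v + G v) = bind x F + bind x G := by
  have h : (Module.Basis.ofVectorSpace k V).constr k
      (fun i => F (Module.Basis.ofVectorSpace k V i) + G (Module.Basis.ofVectorSpace k V i)) =
      (Module.Basis.ofVectorSpace k V).constr k
        (fun i => F (Module.Basis.ofVectorSpace k V i)) +
      (Module.Basis.ofVectorSpace k V).constr k
        (fun i => G (Module.Basis.ofVectorSpace k V i)) := by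
    rw [← map_add]; rfl
  rw [bind, h, LinearMap.liftBaseChange, map_add]
  rfl

/-- `bind x` as a linear functional. -/
def bindₗ (x : R ⊗[k] V) : (V → N) →ₗ[R] N where
  toFun F := bind x F
  map_add' F G := bind_add x F G
  map_smul' r F := bind_smul x r F

/-- Fubini: `bind y` is an `R`-linear functional on the module of all functions `W → N`, so
`map_bind` applies to it, and `bind x F` is computed pointwise. -/
theorem bind_comm (x : R ⊗[k] V) (y : R ⊗[k] W) (F : V → W → N) :
    (bind x fun v => bind y fun w => F v w) = bind y fun w => bind x fun v => F v w := by
  have h := map_bind (bindₗ (N := N) y) x F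
  refine h.symm.trans ?_
  change bind y (bind x F) = _
  congr 1
  exact funext fun w => bind_pi x F w

theorem map_lift₂ {M' : Type*} [AddCommMonoid M'] [Module k M'] (l : M →ₗ[k] M') (F : V → W → M)
    (t : V ⊗[k] W) : l (lift₂ F t) = lift₂ (fun v w => l (F v w)) t := by
  have : l ∘ₗ lift₂ F = lift₂ fun v w => l (F v w) := by
    refine ((Module.Basis.ofVectorSpace k V).tensorProduct
      (Module.Basis.ofVectorSpace k W)).ext fun i => ?_
    simp only [lift₂, LinearMap.comp_apply, Module.Basis.constr_basis]
  rw [← this, LinearMap.comp_apply]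

theorem map_sum₂ {M' : Type*} [AddCommMonoid M'] [Module k M'] (l : M →ₗ[k] M')
    (t : V ⊗[k] W) (F : V → W → M) : l (sum₂ t F) = sum₂ t fun v w => l (F v w) :=
  map_lift₂ l F t

theorem map_sum₃ {M' : Type*} [AddCommMonoid M'] [Module k M'] (l : M →ₗ[k] M')
    (t : V ⊗[k] (W ⊗[k] U)) (F : V → W → U → M) :
    l (sum₃ t F) = sum₃ t fun v w u => l (F v w u) := by
  simp only [sum₃, lift₃, map_lift₂]

/-- A functional applied to a Sweedler sum, when its values on the terms are known. -/
theorem sum₂_eq (t : V ⊗[k] W) {F : V → W → M} (Q : V ⊗[k] W →ₗ[k] M)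
    (h : ∀ v w, F v w = Q (v ⊗ₜ w)) : sum₂ t F = Q t := by
  have : F = fun v w => TensorProduct.curry Q v w := funext₂ h
  rw [sum₂, this, lift₂_eq_lift]
  exact LinearMap.congr_fun (TensorProduct.ext' fun v w => by simp) t

theorem sum₃_eq (t : V ⊗[k] (W ⊗[k] U)) {F : V → W → U → M} (Q : V ⊗[k] (W ⊗[k] U) →ₗ[k] M)
    (h : ∀ v w u, F v w u = Q (v ⊗ₜ (w ⊗ₜ u))) : sum₃ t F = Q t := by
  refine sum₂_eq t Q fun v s => ?_
  exact sum₂_eq s (Q ∘ₗ TensorProduct.mk k V _ v) fun w u => h v w u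

theorem sum₅_eq_sum₂ {X Y : Type*} [AddCommGroup X] [Module k X] [AddCommGroup Y] [Module k Y]
    (t : V ⊗[k] (W ⊗[k] (U ⊗[k] (X ⊗[k] Y)))) (F : V → W → U → X → Y → M) :
    sum₅ t F = sum₂ t fun a s => sum₂ s fun b s => sum₃ s (F a b) := by
  unfold sum₅ lift₅ lift₄
  rfl

theorem sum₅_eq {X Y : Type*} [AddCommGroup X] [Module k X] [AddCommGroup Y] [Module k Y]
    (t : V ⊗[k] (W ⊗[k] (U ⊗[k] (X ⊗[k] Y)))) {F : V → W → U → X → Y → M}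
    (Q : V ⊗[k] (W ⊗[k] (U ⊗[k] (X ⊗[k] Y))) →ₗ[k] M)
    (h : ∀ v w u x y, F v w u x y = Q (v ⊗ₜ (w ⊗ₜ (u ⊗ₜ (x ⊗ₜ y))))) : sum₅ t F = Q t := by
  rw [sum₅_eq_sum₂]
  refine sum₂_eq t Q fun v s => ?_
  refine sum₂_eq s (Q ∘ₗ TensorProduct.mk k V _ v) fun w s => ?_
  exact sum₃_eq s (Q ∘ₗ TensorProduct.mk k V _ v ∘ₗ TensorProduct.mk k W _ w) fun u x y =>
    h v w u x y

end Bind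

/-! ### External products over the coefficient ring -/

section Box

variable {k R V W N : Type*} [Field k] [CommRing R] [Algebra k R]
  [AddCommMonoid V] [Module k V] [AddCommMonoid W] [Module k W]
  [AddCommMonoid N] [Module k N] [Module R N] [IsScalarTower k R N]

/-- `∑ x ⊗ y` as an element of the base change of the tensor product. -/
def ext₂ (f : V →ₗ[k] W →ₗ[k] N) : R ⊗[k] V →ₗ[R] R ⊗[k] W →ₗ[R] N :=
  LinearMap.liftBaseChange R
    (((LinearMap.liftBaseChangeEquiv R).restrictScalars k).toLinearMap ∘ₗ f)

@[simp] theorem ext₂_tmul (f : V →ₗ[k] W →ₗ[k] N) (r s : R) (v : V) (w : W) :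
    ext₂ f (r ⊗ₜ[k] v) (s ⊗ₜ[k] w) = (r * s) • f v w := by
  simp [ext₂, mul_smul]

/-- The element `x ⊗ y` of `R ⊗ (V ⊗ W)`. -/
def box (x : R ⊗[k] V) (y : R ⊗[k] W) : R ⊗[k] (V ⊗[k] W) :=
  ext₂ (TensorProduct.mk k R (V ⊗[k] W) 1 ∘ₗ TensorProduct.lift (TensorProduct.mk k V W) |>
    TensorProduct.curry) x y

scoped infixr:75 " ⊠ " => box

@[simp] theorem tmul_box_tmul (r s : R) (v : V) (w : W) :
    (r ⊗ₜ[k] v) ⊠ (s ⊗ₜ[k] w) = (r * s) ⊗ₜ[k] (v ⊗ₜ[k] w) := by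
  simp [box, TensorProduct.smul_tmul']

theorem add_box (x x' : R ⊗[k] V) (y : R ⊗[k] W) : (x + x') ⊠ y = x ⊠ y + x' ⊠ y := by
  simp [box]

theorem box_add (x : R ⊗[k] V) (y y' : R ⊗[k] W) : x ⊠ (y + y') = x ⊠ y + x ⊠ y' := by
  simp [box]

@[simp] theorem zero_box (y : R ⊗[k] W) : (0 : R ⊗[k] V) ⊠ y = 0 := by simp [box]

@[simp] theorem box_zero (x : R ⊗[k] V) : x ⊠ (0 : R ⊗[k] W) = 0 := by simp [box]

@[simp] theorem smul_box (r : R) (x : R ⊗[k] V) (y : R ⊗[k] W) :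
    (r • x) ⊠ y = r • (x ⊠ y) := by
  simp [box]

@[simp] theorem box_smul (r : R) (x : R ⊗[k] V) (y : R ⊗[k] W) :
    x ⊠ (r • y) = r • (x ⊠ y) := by
  simp [box]

theorem box_induction {p : R ⊗[k] V → R ⊗[k] W → Prop} (x : R ⊗[k] V) (y : R ⊗[k] W)
    (zero_left : ∀ y, p 0 y) (zero_right : ∀ x, p x 0)
    (tmul : ∀ r v s w, p (r ⊗ₜ v) (s ⊗ₜ w))
    (add_left : ∀ x x' y, p x y → p x' y → p (x + x') y)
    (add_right : ∀ x y y', p x y → p x y' → p x (y + y')) : p x y := by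
  induction x using TensorProduct.induction_on with
  | zero => exact zero_left y
  | add x x' h h' => exact add_left _ _ _ h h'
  | tmul r v =>
    induction y using TensorProduct.induction_on with
    | zero => exact zero_right _
    | add x x' h h' => exact add_right _ _ _ h h'
    | tmul s w => exact tmul r v s w

theorem liftBaseChange_box (f : V →ₗ[k] W →ₗ[k] N) (x : R ⊗[k] V) (y : R ⊗[k] W) :
    LinearMap.liftBaseChange R (TensorProduct.lift f) (x ⊠ y) = ext₂ f x y := by
  induction x, y using box_induction with
  | zero_left => simp
  | zero_right => simp
  | tmul => simp
  | add_left x x' y h h' => rw [add_box, map_add, h, h', map_add, LinearMap.add_apply]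
  | add_right x y y' h h' => rw [box_add, map_add, h, h', map_add]

end Box

section BindBox

variable {k R : Type*} [Field k] [CommRing R] [Algebra k R]
  {V W U V' W' N : Type*}
  [AddCommGroup V] [Module k V] [AddCommGroup W] [Module k W] [AddCommGroup U] [Module k U]
  [AddCommGroup V'] [Module k V'] [AddCommGroup W'] [Module k W']
  [AddCommMonoid N] [Module k N] [Module R N] [IsScalarTower k R N]

/-- Both sides are biadditive in `x` and `y`, which leaves pure tensors; there the two extensions
agree because they agree on pairs of basis vectors. A sum over a tensor thereby becomes an iterated
`bind`, one for each factor. -/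
theorem bind_box (x : R ⊗[k] V) (y : R ⊗[k] W) (F : V → W → N) :
    LinearMap.liftBaseChange R (lift₂ F) (x ⊠ y) = bind x fun v => bind y fun w => F v w := by
  induction x, y using box_induction with
  | zero_left => simp [bind_zero_left]
  | zero_right x =>
    simp only [bind_zero_left, box_zero, map_zero]
    exact ((bindₗ (N := N) x).map_zero).symm
  | tmul r v s w =>
    rw [tmul_box_tmul, LinearMap.liftBaseChange_tmul]
    simp only [bind, LinearMap.liftBaseChange_tmul, mul_smul]
    congr 1
    have : s • (lift₂ F : V ⊗[k] W →ₗ[k] N) (v ⊗ₜ w) =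
        (LinearMap.lsmul R N s).restrictScalars k (lift₂ F (v ⊗ₜ w)) := rfl
    rw [this, map_lift₂]
    refine LinearMap.congr_fun (f := (lift₂ (fun v w => s • F v w) : V ⊗[k] W →ₗ[k] N) ∘ₗ
      (TensorProduct.mk k V W).flip w) ?_ v
    refine (Module.Basis.ofVectorSpace k V).ext fun i => ?_
    rw [Module.Basis.constr_basis]
    have h2 := LinearMap.congr_fun (f := (lift₂ (fun v w => s • F v w) : V ⊗[k] W →ₗ[k] N) ∘ₗ
      (TensorProduct.mk k V W) (Module.Basis.ofVectorSpace k V i))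
      (g := (LinearMap.lsmul R N s).restrictScalars k ∘ₗ
        (Module.Basis.ofVectorSpace k W).constr k fun i_1 =>
        F (Module.Basis.ofVectorSpace k V i) (Module.Basis.ofVectorSpace k W i_1)) ?_ w
    · exact h2
    · refine (Module.Basis.ofVectorSpace k W).ext fun j => ?_
      have h3 := Module.Basis.constr_basis ((Module.Basis.ofVectorSpace k V).tensorProduct
        (Module.Basis.ofVectorSpace k W)) k (fun i => s • F (Module.Basis.ofVectorSpace k V i.1)
          (Module.Basis.ofVectorSpace k W i.2)) (i, j)
      rw [Module.Basis.tensorProduct_apply] at h3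
      simp only [LinearMap.comp_apply, Module.Basis.constr_basis]
      exact h3
  | add_left x x' y h h' => rw [add_box, map_add, h, h', bind_add_left]
  | add_right x y y' h h' =>
    rw [box_add, map_add, h, h', ← bind_add]
    simp only [bind_add_left]

theorem bind_bilinear (x : R ⊗[k] V) (y : R ⊗[k] W) (f : V →ₗ[k] W →ₗ[k] N) :
    (bind x fun v => bind y fun w => f v w) = ext₂ f x y := by
  rw [← bind_box, lift₂_eq_lift, liftBaseChange_box]

theorem bind_sum₂ (x : R ⊗[k] V) (t : W ⊗[k] U) (F : V → W → U → N) :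
    (bind x fun v => sum₂ t (F v)) = sum₂ t fun w u => bind x fun v => F v w u := by
  let l : (W → U → N) →ₗ[R] N :=
    { toFun := fun G => sum₂ t G
      map_add' := fun G G' => by
        have h : (lift₂ (G + G') : W ⊗[k] U →ₗ[k] N) = lift₂ G + lift₂ G' := by
          rw [lift₂, lift₂, lift₂, ← map_add]; rfl
        rw [sum₂, h]; rfl
      map_smul' := fun r G =>
        (map_sum₂ ((LinearMap.lsmul R N r).restrictScalars k) t G).symm }
  have := map_bind l x F
  refine this.symm.trans ?_
  change sum₂ t (bind x F) = _
  congr 1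
  funext w u
  rw [bind_pi, bind_pi]

theorem bind_sum₃ {X : Type*} [AddCommGroup X] [Module k X] (x : R ⊗[k] V)
    (t : W ⊗[k] (U ⊗[k] X)) (F : V → W → U → X → N) :
    (bind x fun v => sum₃ t (F v)) = sum₃ t fun w u z => bind x fun v => F v w u z := by
  have h : (fun v => sum₃ t (F v)) = fun v => sum₂ t fun w s => sum₂ s (F v w) := rfl
  rw [h, bind_sum₂]
  simp only [bind_sum₂]
  rfl

theorem bind_sum₅ {X Y Z : Type*} [AddCommGroup X] [Module k X] [AddCommGroup Y] [Module k Y]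
    [AddCommGroup Z] [Module k Z] (x : R ⊗[k] Z)
    (t : V ⊗[k] (W ⊗[k] (U ⊗[k] (X ⊗[k] Y)))) (F : Z → V → W → U → X → Y → N) :
    (bind x fun z => sum₅ t (F z)) = sum₅ t fun a b c d e => bind x fun z => F z a b c d e := by
  simp only [sum₅_eq_sum₂, bind_sum₂, bind_sum₃]

end BindBox

/-! ### Evaluation of functionals on `R ⊗ V` -/

section Ev

variable {k R : Type*} [Field k] [CommRing R] [Algebra k R]
  {V W U V' W' M N : Type*}
  [AddCommMonoid V] [Module k V] [AddCommMonoid W] [Module k W] [AddCommMonoid U] [Module k U]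
  [AddCommMonoid V'] [Module k V'] [AddCommMonoid W'] [Module k W']
  [AddCommMonoid M] [Module k M]
  [AddCommMonoid N] [Module k N] [Module R N] [IsScalarTower k R N]

/-- The value `φ(x) ∈ R` of a functional at `x ∈ R ⊗ V`. -/
def ev (x : R ⊗[k] V) : Module.Dual k V →ₗ[k] R where
  toFun φ := LinearMap.liftBaseChange R (Algebra.linearMap k R ∘ₗ φ) x
  map_add' φ ψ := by rw [LinearMap.comp_add, LinearMap.liftBaseChange, map_add]; rfl
  map_smul' c φ := by
    induction x using TensorProduct.induction_on with
    | zero => simp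
    | tmul r v => simp [Algebra.smul_def, mul_left_comm]
    | add x y hx hy => rw [map_add, hx, hy, map_add, smul_add]

@[simp] theorem ev_tmul (r : R) (v : V) (φ : Module.Dual k V) :
    ev (r ⊗ₜ[k] v) φ = r * algebraMap k R (φ v) := rfl

theorem ev_apply (x : R ⊗[k] V) (φ : Module.Dual k V) :
    ev x φ = LinearMap.liftBaseChange R (Algebra.linearMap k R ∘ₗ φ) x := rfl

@[simp] theorem ev_zero_left (φ : Module.Dual k V) : ev (0 : R ⊗[k] V) φ = 0 := by simp [ev_apply]

theorem ev_add_left (x y : R ⊗[k] V) (φ : Module.Dual k V) : ev (x + y) φ = ev x φ + ev y φ := by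
  simp [ev_apply]

theorem ev_smul_left (r : R) (x : R ⊗[k] V) (φ : Module.Dual k V) :
    ev (r • x) φ = r * ev x φ := by
  rw [ev_apply, map_smul, smul_eq_mul, ev_apply]

theorem ev_comp (x : R ⊗[k] V) (φ : Module.Dual k W) (f : V →ₗ[k] W) :
    ev x (φ ∘ₗ f) = ev (f.baseChange R x) φ := by
  induction x using TensorProduct.induction_on with
  | zero => simp
  | tmul r v => simp
  | add x y hx hy => rw [ev_add_left, hx, hy, map_add, ev_add_left]

@[simp] theorem baseChange_map_box (f : V →ₗ[k] V') (g : W →ₗ[k] W') (x : R ⊗[k] V)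
    (y : R ⊗[k] W) :
    (TensorProduct.map f g).baseChange R (x ⊠ y) = f.baseChange R x ⊠ g.baseChange R y := by
  induction x, y using box_induction with
  | zero_left => simp
  | zero_right => simp
  | tmul => simp
  | add_left x x' y h h' => rw [add_box, map_add, h, h', map_add, add_box]
  | add_right x y y' h h' => rw [box_add, map_add, h, h', map_add, box_add]

@[simp] theorem baseChange_comm_box (x : R ⊗[k] V) (y : R ⊗[k] W) :
    (TensorProduct.comm k V W).toLinearMap.baseChange R (x ⊠ y) = y ⊠ x := by
  induction x, y using box_induction with
  | zero_left => simp
  | zero_right => simp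
  | tmul => simp [mul_comm]
  | add_left x x' y h h' => rw [add_box, map_add, h, h', box_add]
  | add_right x y y' h h' => rw [box_add, map_add, h, h', add_box]

@[simp] theorem baseChange_assoc_box (x : R ⊗[k] V) (y : R ⊗[k] W) (z : R ⊗[k] U) :
    (TensorProduct.assoc k V W U).toLinearMap.baseChange R ((x ⊠ y) ⊠ z) = x ⊠ y ⊠ z := by
  induction x, y using box_induction with
  | zero_left => simp
  | zero_right => simp
  | add_left x x' y h h' => rw [add_box, add_box, map_add, h, h', add_box]
  | add_right x y y' h h' => rw [box_add, add_box, map_add, h, h', add_box, box_add]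
  | tmul r v s w =>
    induction z using TensorProduct.induction_on with
    | zero => simp
    | tmul => simp [mul_assoc]
    | add x y hx hy => rw [box_add, map_add, hx, hy, box_add, box_add]

/-- The interchange of the two middle factors, phrased for maps `F` and `G` that differ by it on
pure tensors. It computes the coproduct of an external product of group-like elements. -/
theorem box_induction₄ {x : R ⊗[k] V} {y : R ⊗[k] W} {z : R ⊗[k] V'} {t : R ⊗[k] W'}
    (F : V ⊗[k] W →ₗ[k] V' ⊗[k] W' →ₗ[k] N) (G : V ⊗[k] V' →ₗ[k] W ⊗[k] W' →ₗ[k] N)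
    (h : ∀ v w v' w', F (v ⊗ₜ w) (v' ⊗ₜ w') = G (v ⊗ₜ v') (w ⊗ₜ w')) :
    ext₂ F (x ⊠ y) (z ⊠ t) = ext₂ G (x ⊠ z) (y ⊠ t) := by
  induction x, y using box_induction with
  | zero_left => simp
  | zero_right => simp
  | add_left x x' y h h' => simp only [add_box, map_add, LinearMap.add_apply, h, h']
  | add_right x y y' h h' => simp only [box_add, add_box, map_add, LinearMap.add_apply, h, h']
  | tmul r v s w =>
    induction z, t using box_induction with
    | zero_left => simp
    | zero_right => simp
    | add_left x x' y h h' => simp only [box_add, add_box, map_add, LinearMap.add_apply, h, h']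
    | add_right x y y' h h' => simp only [box_add, map_add, h, h']
    | tmul r' v' s' w' =>
      simp only [tmul_box_tmul, ext₂_tmul, h]
      congr 1
      ring

theorem ev_mul'_map_box (x : R ⊗[k] V) (y : R ⊗[k] W) (φ : Module.Dual k V)
    (ψ : Module.Dual k W) :
    ev (x ⊠ y) (LinearMap.mul' k k ∘ₗ TensorProduct.map φ ψ) = ev x φ * ev y ψ := by
  induction x, y using box_induction with
  | zero_left => simp
  | zero_right => simp
  | tmul r v s w => simp; ring
  | add_left x x' y h h' => rw [add_box, ev_add_left, h, h', ev_add_left, add_mul]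
  | add_right x y y' h h' => rw [box_add, ev_add_left, h, h', ev_add_left, mul_add]

end Ev

/-! ### Group-like elements of a coalgebra after base change -/

section IsPoint

variable {k R : Type*} [Field k] [CommRing R] [Algebra k R]
  {C D V : Type*} [AddCommGroup C] [Module k C] [Coalgebra k C]
  [AddCommGroup D] [Module k D] [Coalgebra k D] [AddCommGroup V] [Module k V]
  {M N : Type*} [AddCommMonoid M] [Module k M]
  [AddCommMonoid N] [Module k N] [Module R N] [IsScalarTower k R N]

/-- Group-like elements of `R ⊗ C`. -/
structure IsPoint (x : R ⊗[k] C) : Prop where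
  comul : (Coalgebra.comul (R := k) (A := C)).baseChange R x = x ⊠ x
  counit : ev x Coalgebra.counit = 1

/-- Since `Δ(x) = x ⊠ x`, the two Sweedler components turn into two independent occurrences of the
same point. This makes the simplified Sweedler notation literal and drives every later computation.
-/
theorem IsPoint.bind_comul {x : R ⊗[k] C} (hx : IsPoint x) (F : C → C → N) :
    (bind x fun c => sum₂ (Coalgebra.comul (R := k) c) F) =
      bind x fun a => bind x fun b => F a b := by
  have h : (fun c => sum₂ (Coalgebra.comul (R := k) c) F) =
      fun c => (lift₂ F ∘ₗ (Coalgebra.comul (R := k) (A := C)) : C →ₗ[k] N) c := rfl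
  rw [h, bind_linear, ← bind_box, ← hx.comul]
  clear h hx
  induction x using TensorProduct.induction_on with
  | zero => simp
  | tmul r v => simp
  | add x y hx hy => simp only [map_add, hx, hy]

/-- Convolution is dual to the comultiplication, so on group-like elements it is the pointwise
product of functions. -/
theorem IsPoint.ev_mul {x : R ⊗[k] C} (hx : IsPoint x) (φ ψ : WithConv (C →ₗ[k] k)) :
    ev x (φ * ψ).ofConv = ev x φ.ofConv * ev x ψ.ofConv := by
  rw [LinearMap.convMul_def, WithConv.ofConv_toConv, ← LinearMap.comp_assoc, ev_comp, hx.comul,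
    ev_mul'_map_box]

theorem IsPoint.ev_one {x : R ⊗[k] C} (hx : IsPoint x) :
    ev x (1 : WithConv (C →ₗ[k] k)).ofConv = 1 := hx.counit

theorem IsPoint.ev_conv {x : R ⊗[k] C} (hx : IsPoint x) (φ ψ : Module.Dual k C) :
    ev x (conv φ ψ) = ev x φ * ev x ψ := hx.ev_mul _ _

theorem IsPoint.box {x : R ⊗[k] C} {y : R ⊗[k] D} (hx : IsPoint x) (hy : IsPoint y) :
    IsPoint (x ⊠ y) where
  comul := by
    have h : Coalgebra.comul (R := k) (A := C ⊗[k] D) =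
      (TensorProduct.tensorTensorTensorComm k C C D D).toLinearMap ∘ₗ
        TensorProduct.map Coalgebra.comul Coalgebra.comul := rfl
    rw [h, LinearMap.baseChange_comp, LinearMap.comp_apply, baseChange_map_box, hx.comul, hy.comul]
    have key := box_induction₄ (x := x) (y := x) (z := y) (t := y) (TensorProduct.curry
      (TensorProduct.mk k R _ 1 ∘ₗ (TensorProduct.tensorTensorTensorComm k C C D D).toLinearMap))
      (TensorProduct.curry (TensorProduct.mk k R _ 1)) (by simp)
    rw [← liftBaseChange_box, ← liftBaseChange_box] at key
    have e : ∀ {A B : Type _} [AddCommGroup A] [Module k A] [AddCommGroup B] [Module k B]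
        (f : A →ₗ[k] B) (z : R ⊗[k] A), LinearMap.liftBaseChange R (TensorProduct.mk k R _ 1 ∘ₗ f) z
        = f.baseChange R z := by
      intro A B _ _ _ _ f z
      induction z using TensorProduct.induction_on with
      | zero => simp
      | tmul r v => simp [TensorProduct.smul_tmul']
      | add x y hx hy => simp only [map_add, hx, hy]
    have e1 : TensorProduct.lift (TensorProduct.curry
      (TensorProduct.mk k R _ 1 ∘ₗ (TensorProduct.tensorTensorTensorComm k C C D D).toLinearMap)) =
      TensorProduct.mk k R _ 1 ∘ₗ (TensorProduct.tensorTensorTensorComm k C C D D).toLinearMap :=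
      TensorProduct.ext' fun v w => by simp
    have e2 : TensorProduct.lift (TensorProduct.curry
      (TensorProduct.mk k R ((C ⊗[k] D) ⊗[k] (C ⊗[k] D)) 1)) =
      TensorProduct.mk k R _ 1 ∘ₗ LinearMap.id :=
      TensorProduct.ext' fun v w => by simp
    rw [e1, e2, e, e] at key
    simpa using key
  counit := by
    have h : Coalgebra.counit (R := k) (A := C ⊗[k] D) =
        LinearMap.mul' k k ∘ₗ TensorProduct.map Coalgebra.counit Coalgebra.counit :=
      TensorProduct.ext' fun v w => by simp [mul_comm]
    rw [h, ev_mul'_map_box, hx.counit, hy.counit, one_mul]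

end IsPoint

/-! ### The group of points of a Hopf algebra -/

section Point

variable {k R H : Type*} [Field k] [CommRing R] [Algebra k R] [Ring H] [HopfAlgebra k H]

theorem box_mul_box (a b c d : R ⊗[k] H) : (a ⊠ b) * (c ⊠ d) = (a * c) ⊠ (b * d) := by
  induction a, b using box_induction with
  | zero_left => simp
  | zero_right => simp
  | add_left x x' y h h' => simp only [add_box, add_mul, h, h']
  | add_right x y y' h h' => simp only [box_add, add_mul, h, h']
  | tmul r v s w =>
    induction c, d using box_induction with
    | zero_left => simp
    | zero_right => simp
    | add_left x x' y h h' => simp only [add_box, mul_add, h, h']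
    | add_right x y y' h h' => simp only [box_add, mul_add, h, h']
    | tmul r' v' s' w' =>
      simp only [tmul_box_tmul, Algebra.TensorProduct.tmul_mul_tmul]
      congr 1
      ring

theorem baseChange_comul_mul (x y : R ⊗[k] H) :
    (Coalgebra.comul (R := k) (A := H)).baseChange R (x * y) =
      (Coalgebra.comul (R := k) (A := H)).baseChange R x *
        (Coalgebra.comul (R := k) (A := H)).baseChange R y :=
  map_mul (Algebra.TensorProduct.map (AlgHom.id k R) (Bialgebra.comulAlgHom k H)) x y

theorem ev_counit_mul (x y : R ⊗[k] H) :
    ev (x * y) (Coalgebra.counit (R := k) (A := H)) =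
      ev x Coalgebra.counit * ev y Coalgebra.counit := by
  have h : ∀ x : R ⊗[k] H, ev x (Coalgebra.counit (R := k) (A := H)) =
      Algebra.TensorProduct.lift (AlgHom.id k R) ((Algebra.ofId k R).comp (Bialgebra.counitAlgHom k H))
        (fun _ _ => Commute.all _ _) x := by
    intro x
    induction x using TensorProduct.induction_on with
    | zero => simp
    | tmul r v => simp [Algebra.ofId_apply]
    | add x y hx hy => rw [ev_add_left, map_add, hx, hy]
  rw [h, h, h, map_mul]

theorem baseChange_mul'_box (x y : R ⊗[k] H) :
    (LinearMap.mul' k H).baseChange R (x ⊠ y) = x * y := by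
  induction x, y using box_induction with
  | zero_left => simp
  | zero_right => simp
  | tmul r v s w => simp
  | add_left x x' y h h' => rw [add_box, map_add, h, h', add_mul]
  | add_right x y y' h h' => rw [box_add, map_add, h, h', mul_add]

theorem one_box_one : (1 : R ⊗[k] H) ⊠ (1 : R ⊗[k] H) = 1 := by
  rw [Algebra.TensorProduct.one_def, tmul_box_tmul, mul_one]; rfl

theorem baseChange_linearMap_counit (x : R ⊗[k] H) :
    (Algebra.linearMap k H ∘ₗ Coalgebra.counit (R := k) (A := H)).baseChange R x =
      ev x Coalgebra.counit • 1 := by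
  induction x using TensorProduct.induction_on with
  | zero => simp
  | tmul r v =>
    simp [Algebra.TensorProduct.one_def, TensorProduct.smul_tmul', Algebra.algebraMap_eq_smul_one]
  | add x y hx hy => rw [ev_add_left, map_add, hx, hy, add_smul]

namespace IsPoint

variable {x y : R ⊗[k] H}

theorem mul (hx : IsPoint x) (hy : IsPoint y) : IsPoint (x * y) where
  comul := by rw [baseChange_comul_mul, hx.comul, hy.comul, box_mul_box]
  counit := by rw [ev_counit_mul, hx.counit, hy.counit, one_mul]

theorem one : IsPoint (1 : R ⊗[k] H) where
  comul := by
    rw [one_box_one]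
    exact map_one (Algebra.TensorProduct.map (AlgHom.id k R) (Bialgebra.comulAlgHom k H))
  counit := by simp [Algebra.TensorProduct.one_def]

theorem mul_antipode (hx : IsPoint x) :
    x * (HopfAlgebra.antipode k (A := H)).baseChange R x = 1 := by
  have h := congrArg (fun f => LinearMap.baseChange R f x)
    (HopfAlgebra.mul_antipode_lTensor_comul (R := k) (A := H))
  simp only [LinearMap.baseChange_comp, LinearMap.comp_apply, hx.comul, LinearMap.lTensor,
    baseChange_map_box, baseChange_mul'_box, LinearMap.baseChange_id, LinearMap.id_apply] at h
  rw [h, ← LinearMap.comp_apply, ← LinearMap.baseChange_comp, baseChange_linearMap_counit,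
    hx.counit, one_smul]

theorem antipode_mul (hx : IsPoint x) :
    (HopfAlgebra.antipode k (A := H)).baseChange R x * x = 1 := by
  have h := congrArg (fun f => LinearMap.baseChange R f x)
    (HopfAlgebra.mul_antipode_rTensor_comul (R := k) (A := H))
  simp only [LinearMap.baseChange_comp, LinearMap.comp_apply, hx.comul, LinearMap.rTensor,
    baseChange_map_box, baseChange_mul'_box, LinearMap.baseChange_id, LinearMap.id_apply] at h
  rw [h, ← LinearMap.comp_apply, ← LinearMap.baseChange_comp, baseChange_linearMap_counit,
    hx.counit, one_smul]

/-- `Δ(S(x))` is a left inverse and `S(x) ⊠ S(x)` a right inverse of `x ⊠ x`, so they coincide. -/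
theorem antipode (hx : IsPoint x) :
    IsPoint ((HopfAlgebra.antipode k (A := H)).baseChange R x) where
  comul := by
    have h1 := congrArg ((Coalgebra.comul (R := k) (A := H)).baseChange R) hx.antipode_mul
    rw [baseChange_comul_mul, hx.comul, one.comul, one_box_one] at h1
    have h2 : (x ⊠ x) * ((HopfAlgebra.antipode k (A := H)).baseChange R x ⊠
        (HopfAlgebra.antipode k (A := H)).baseChange R x) = 1 := by
      rw [box_mul_box, hx.mul_antipode, one_box_one]
    exact left_inv_eq_right_inv h1 h2
  counit := by
    have h := ev_counit_mul ((HopfAlgebra.antipode k (A := H)).baseChange R x) x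
    rw [hx.antipode_mul, hx.counit, mul_one, one.counit] at h
    exact h.symm

end IsPoint

variable (k R H) in
/-- The group of group-like elements of `R ⊗ H`. -/
structure Point where
  val : R ⊗[k] H
  isPoint : IsPoint val

namespace Point

@[ext] theorem ext {x y : Point k R H} (h : x.val = y.val) : x = y := by
  cases x; cases y; congr

instance : Mul (Point k R H) := ⟨fun x y => ⟨x.val * y.val, x.isPoint.mul y.isPoint⟩⟩
instance : One (Point k R H) := ⟨⟨1, .one⟩⟩
instance : Inv (Point k R H) :=
  ⟨fun x => ⟨(HopfAlgebra.antipode k (A := H)).baseChange R x.val, x.isPoint.antipode⟩⟩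

theorem val_mul (x y : Point k R H) : (x * y).val = x.val * y.val := rfl
theorem val_one : (1 : Point k R H).val = 1 := rfl
theorem val_inv (x : Point k R H) :
    (x⁻¹).val = (HopfAlgebra.antipode k (A := H)).baseChange R x.val := rfl

instance : Group (Point k R H) :=
  Group.ofLeftAxioms (fun _ _ _ => ext (mul_assoc _ _ _)) (fun _ => ext (one_mul _))
    (fun x => ext x.isPoint.antipode_mul)

end Point

end Point

section

/-! ### Change of coefficient ring -/

section BaseChangePoints

variable {k R R' : Type*} [Field k] [CommRing R] [Algebra k R] [CommRing R'] [Algebra k R']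
  {V W C H N : Type*} [AddCommMonoid V] [Module k V] [AddCommMonoid W] [Module k W]
  [AddCommGroup C] [Module k C] [Coalgebra k C] [Ring H] [HopfAlgebra k H]

/-- The change of scalars `R ⊗ V → R' ⊗ V` along `R → R'`. -/
def scal (f : R →ₐ[k] R') : R ⊗[k] V →ₗ[k] R' ⊗[k] V := f.toLinearMap.rTensor V

@[simp] theorem scal_tmul (f : R →ₐ[k] R') (r : R) (v : V) :
    scal f (r ⊗ₜ[k] v) = f r ⊗ₜ v := rfl

@[simp] theorem scal_box (f : R →ₐ[k] R') (x : R ⊗[k] V) (y : R ⊗[k] W) :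
    scal f (x ⊠ y) = scal f x ⊠ scal f y := by
  induction x, y using box_induction with
  | zero_left => simp
  | zero_right => simp
  | tmul => simp
  | add_left x x' y h h' => rw [add_box, map_add, h, h', map_add, add_box]
  | add_right x y y' h h' => rw [box_add, map_add, h, h', map_add, box_add]

theorem scal_baseChange (f : R →ₐ[k] R') (L : V →ₗ[k] W) (x : R ⊗[k] V) :
    scal f (L.baseChange R x) = L.baseChange R' (scal f x) := by
  induction x using TensorProduct.induction_on with
  | zero => simp
  | tmul r v => simp
  | add x y hx hy => simp only [map_add, hx, hy]

theorem ev_scal (f : R →ₐ[k] R') (x : R ⊗[k] V) (φ : Module.Dual k V) :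
    ev (scal f x) φ = f (ev x φ) := by
  induction x using TensorProduct.induction_on with
  | zero => simp
  | tmul r v => simp
  | add x y hx hy => simp only [map_add, ev_add_left, hx, hy]

theorem IsPoint.scal (f : R →ₐ[k] R') {x : R ⊗[k] C} (hx : IsPoint x) : IsPoint (scal f x) where
  comul := by rw [← scal_baseChange, hx.comul, scal_box]
  counit := by rw [ev_scal, hx.counit, map_one]

/-- The change of scalars of a point. -/
def Point.scal (f : R →ₐ[k] R') (x : Point k R H) : Point k R' H := ⟨_, x.isPoint.scal f⟩

end BaseChangePoints

/-! ### The generic point -/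

section Generic

variable {k C : Type*} [Field k] [AddCommGroup C] [Module k C] [Coalgebra k C]
  [Coalgebra.IsCocomm k C] [FiniteDimensional k C]

variable (k C) in
/-- The generic group-like element `∑ eⁱ ⊗ eᵢ`. -/
def generic : WithConv (C →ₗ[k] k) ⊗[k] C :=
  ∑ i, WithConv.toConv ((Module.finBasis k C).coord i) ⊗ₜ Module.finBasis k C i

/-- The coordinates of `φ` in the dual basis are its values on the basis. Evaluation at the generic
point is therefore the identity of `C*`, and this one point already separates functionals. -/
theorem ev_generic (φ : Module.Dual k C) : ev (generic k C) φ = WithConv.toConv φ := by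
  have : ev (generic k C) φ =
      ∑ i, φ (Module.finBasis k C i) • WithConv.toConv ((Module.finBasis k C).coord i) := by
    rw [generic, ev_apply, map_sum]
    refine Finset.sum_congr rfl fun i _ => ?_
    rw [LinearMap.liftBaseChange_tmul, smul_eq_mul, LinearMap.comp_apply, Algebra.linearMap_apply,
      mul_comm, ← Algebra.smul_def]
  rw [this]
  refine WithConv.ext ((Module.finBasis k C).ext fun j => ?_)
  simp

/-- Elements of `R ⊗ V` are detected by the functionals on `V`. -/
theorem eq_of_ev {R V : Type*} [CommRing R] [Algebra k R] [AddCommGroup V] [Module k V]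
    {x y : R ⊗[k] V} (h : ∀ φ : Module.Dual k V, ev x φ = ev y φ) : x = y := by
  classical
  have e : ∀ (i) (x : R ⊗[k] V), (TensorProduct.equivFinsuppOfBasisRight
      (Module.Basis.ofVectorSpace k V) x) i = ev x ((Module.Basis.ofVectorSpace k V).coord i) := by
    intro i x
    induction x using TensorProduct.induction_on with
    | zero => simp
    | tmul r v => simp [Algebra.smul_def, mul_comm]
    | add x y hx hy => simp only [map_add, Finsupp.add_apply, ev_add_left, hx, hy]
  refine (TensorProduct.equivFinsuppOfBasisRight (Module.Basis.ofVectorSpace k V)).injective ?_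
  ext i
  rw [e, e, h]

/-- Tested against `φ ⊗ ψ`, both sides of `Δ(x) = x ⊠ x` give the convolution product of `φ` and
`ψ`. Cocommutativity enters through the coefficient ring: the convolution algebra `C*` has to be
commutative. -/
theorem isPoint_generic : IsPoint (generic k C) where
  comul := by
    refine eq_of_ev fun F => ?_
    rw [← ev_comp, ev_generic]
    obtain ⟨t, rfl⟩ := (TensorProduct.dualDistribEquiv k C C).surjective F
    induction t using TensorProduct.induction_on with
    | zero => simp
    | tmul φ ψ =>
      have : (TensorProduct.dualDistribEquiv k C C) (φ ⊗ₜ ψ) =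
          LinearMap.mul' k k ∘ₗ TensorProduct.map φ ψ :=
        TensorProduct.ext' fun v w => by simp
      rw [this, ev_mul'_map_box, ev_generic, ev_generic, LinearMap.comp_assoc]
      rfl
    | add x y hx hy => rw [map_add, map_add, LinearMap.add_comp, WithConv.toConv_add, hx, hy]
  counit := ev_generic _

end Generic

universe u v w₁ w₂ w₃ w₄

/-! ### Separating families of evaluations and determining families of elements -/

section Probe

variable (k : Type u) [Field k]

/-- A family of linear maps `V → R ⊗ K`, for varying `R`, that separates the elements of `V`. -/
structure Probe (V : Type w₁) (K : Type w₂) [AddCommGroup V] [Module k V]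
    [AddCommGroup K] [Module k K] where
  mem : ∀ (R : Type max u v) [CommRing R] [Algebra k R], (V →ₗ[k] R ⊗[k] K) → Prop
  sep : ∀ x : V, (∀ (R : Type max u v) [CommRing R] [Algebra k R] (E : V →ₗ[k] R ⊗[k] K),
    mem R E → E x = 0) → x = 0
  map : ∀ {R R' : Type max u v} [CommRing R] [Algebra k R] [CommRing R'] [Algebra k R']
    (f : R →ₐ[k] R') (E : V →ₗ[k] R ⊗[k] K), mem R E → mem R' (scal f ∘ₗ E)

/-- A family of elements of `R ⊗ Z`, for varying `R`, on which linear maps are determined. -/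
structure Generators (Z : Type w₁) [AddCommGroup Z] [Module k Z] where
  mem : ∀ (R : Type max u v) [CommRing R] [Algebra k R], R ⊗[k] Z → Prop
  gen : ∀ (R : Type max u v) [CommRing R] [Algebra k R] (L : Z →ₗ[k] R),
    (∀ (R' : Type max u v) [CommRing R'] [Algebra k R'] (f : R →ₐ[k] R') (z : R' ⊗[k] Z),
      mem R' z → LinearMap.liftBaseChange R' (f.toLinearMap ∘ₗ L) z = 0) → L = 0
  map : ∀ {R R' : Type max u v} [CommRing R] [Algebra k R] [CommRing R'] [Algebra k R']
    (f : R →ₐ[k] R') (z : R ⊗[k] Z), mem R z → mem R' (scal f z)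

end Probe

section BoxMap

variable {k V K V' K' : Type*} [Field k]
  [AddCommMonoid V] [Module k V] [AddCommMonoid K] [Module k K]
  [AddCommMonoid V'] [Module k V'] [AddCommMonoid K'] [Module k K']

/-- The map `v ⊗ v' ↦ E v ⊗ E' v'`. -/
def boxMap {R : Type*} [CommRing R] [Algebra k R] (E : V →ₗ[k] R ⊗[k] K)
    (E' : V' →ₗ[k] R ⊗[k] K') : V ⊗[k] V' →ₗ[k] R ⊗[k] (K ⊗[k] K') :=
  TensorProduct.lift (LinearMap.mk₂ k (fun v v' => E v ⊠ E' v')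
    (fun v v' w => by rw [map_add, add_box])
    (fun c v w => by rw [map_smul, ← algebraMap_smul R c (E v), smul_box, algebraMap_smul])
    (fun v v' w => by rw [map_add, box_add])
    (fun c v w => by rw [map_smul, ← algebraMap_smul R c (E' w), box_smul, algebraMap_smul]))

@[simp] theorem boxMap_tmul {R : Type*} [CommRing R] [Algebra k R] (E : V →ₗ[k] R ⊗[k] K)
    (E' : V' →ₗ[k] R ⊗[k] K') (v : V) (v' : V') : boxMap E E' (v ⊗ₜ v') = E v ⊠ E' v' := rfl

theorem liftBaseChange_boxMap {R : Type*} [CommRing R] [Algebra k R] (E : V →ₗ[k] R ⊗[k] K)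
    (E' : V' →ₗ[k] R ⊗[k] K') (x : R ⊗[k] V) (y : R ⊗[k] V') :
    LinearMap.liftBaseChange R (boxMap E E') (x ⊠ y) =
      LinearMap.liftBaseChange R E x ⊠ LinearMap.liftBaseChange R E' y := by
  induction x, y using box_induction with
  | zero_left => simp
  | zero_right => simp
  | tmul r v s w => simp [mul_smul]; rw [smul_comm]
  | add_left x x' y h h' => rw [add_box, map_add, h, h', map_add, add_box]
  | add_right x y y' h h' => rw [box_add, map_add, h, h', map_add, box_add]

end BoxMap

section ProbeLemmas

variable {k : Type u} [Field k] {V : Type w₁} {K : Type w₂} {V' : Type w₃} {K' : Type w₄}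
  [AddCommGroup V] [Module k V] [AddCommGroup K] [Module k K]
  [AddCommGroup V'] [Module k V'] [AddCommGroup K'] [Module k K']

theorem Probe.ext (p : Probe.{u, v} k V K) {x y : V}
    (h : ∀ (R : Type max u v) [CommRing R] [Algebra k R] (E : V →ₗ[k] R ⊗[k] K),
      p.mem R E → E x = E y) : x = y :=
  sub_eq_zero.1 <| p.sep _ fun R _ _ E hE => by rw [map_sub, h R E hE, sub_self]

/-- The proof principle behind all later equalities of linear maps. Evaluating `T - T'` by `E` and
contracting with a functional gives a linear map into `R`. The generators decide whether it vanishes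
after a further change of scalars, and the evaluations follow this change by `Probe.map`. -/
theorem Generators.ext (G : Generators.{u, v} k V') (p : Probe.{u, v} k V K) {T T' : V' →ₗ[k] V}
    (h : ∀ (R : Type max u v) [CommRing R] [Algebra k R] (E : V →ₗ[k] R ⊗[k] K), p.mem R E →
      ∀ z : R ⊗[k] V', G.mem R z →
      LinearMap.liftBaseChange R E (T.baseChange R z) =
        LinearMap.liftBaseChange R E (T'.baseChange R z)) : T = T' := by
  ext a
  refine p.ext fun R _ _ E hE => ?_
  refine eq_of_ev fun φ => ?_
  let L : V' →ₗ[k] R :=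
    (TensorProduct.rid k R).toLinearMap ∘ₗ φ.lTensor R ∘ₗ E ∘ₗ (T - T')
  have hl : ∀ x : R ⊗[k] K, (TensorProduct.rid k R) (φ.lTensor R x) = ev x φ := by
    intro x
    induction x using TensorProduct.induction_on with
    | zero => simp
    | tmul r v => simp [Algebra.smul_def, mul_comm]
    | add x y hx hy => simp only [map_add, ev_add_left, hx, hy]
  have hL : ∀ a, L a = ev (E (T a)) φ - ev (E (T' a)) φ := by
    intro a
    change (TensorProduct.rid k R) (φ.lTensor R (E (T a - T' a))) = _
    rw [map_sub, map_sub, map_sub, hl, hl]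
  have h0 : L = 0 := by
    refine G.gen R L fun R' _ _ f z hz => ?_
    have h' := h R' _ (p.map f E hE) z hz
    have key : ∀ z : R' ⊗[k] V', LinearMap.liftBaseChange R' (f.toLinearMap ∘ₗ L) z =
        ev (LinearMap.liftBaseChange R' (scal f ∘ₗ E) (T.baseChange R' z)) φ -
        ev (LinearMap.liftBaseChange R' (scal f ∘ₗ E) (T'.baseChange R' z)) φ := by
      intro z
      induction z using TensorProduct.induction_on with
      | zero => simp
      | tmul r v =>
        simp only [LinearMap.liftBaseChange_tmul, LinearMap.baseChange_tmul, LinearMap.comp_apply,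
          AlgHom.toLinearMap_apply, hL, map_sub, ev_smul_left, ev_scal, smul_eq_mul, mul_sub]
      | add x y hx hy => simp only [map_add, hx, hy, ev_add_left]; ring
    rw [key, h', sub_self]
  have := hL a
  rw [h0, LinearMap.zero_apply] at this
  exact (sub_eq_zero.1 this.symm)

/-- Tensor product of probes. -/
def Probe.tensor (p : Probe.{u, v} k V K) (p' : Probe.{u, v} k V' K') :
    Probe.{u, v} k (V ⊗[k] V') (K ⊗[k] K') where
  mem R _ _ E := ∃ E₁ E₂, p.mem R E₁ ∧ p'.mem R E₂ ∧ E = boxMap E₁ E₂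
  map f E := by
    rintro ⟨E₁, E₂, h₁, h₂, rfl⟩
    refine ⟨_, _, p.map f _ h₁, p'.map f _ h₂, TensorProduct.ext' fun v w => by simp⟩
  sep t ht := by
    classical
    -- The two factors may be evaluated over unrelated rings `R₁` and `R₂`: both evaluations can be
    -- moved to `R₁ ⊗ R₂`, where the hypothesis applies.
    have h1 : ∀ (R₁ : Type max u v) [CommRing R₁] [Algebra k R₁] (E₁ : V →ₗ[k] R₁ ⊗[k] K)
        (R₂ : Type max u v) [CommRing R₂] [Algebra k R₂] (E₂ : V' →ₗ[k] R₂ ⊗[k] K'),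
        p.mem R₁ E₁ → p'.mem R₂ E₂ → TensorProduct.map E₁ E₂ t = 0 := by
      intro R₁ _ _ E₁ R₂ _ _ E₂ h₁ h₂
      have := ht (R₁ ⊗[k] R₂) _ ⟨_, _, p.map Algebra.TensorProduct.includeLeft _ h₁,
        p'.map Algebra.TensorProduct.includeRight _ h₂, rfl⟩
      have e : (TensorProduct.tensorTensorTensorComm k R₁ R₂ K K').toLinearMap ∘ₗ
          boxMap (scal Algebra.TensorProduct.includeLeft ∘ₗ E₁)
            (scal Algebra.TensorProduct.includeRight ∘ₗ E₂) = TensorProduct.map E₁ E₂ := by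
        refine TensorProduct.ext' fun v w => ?_
        simp only [LinearMap.comp_apply, boxMap_tmul, TensorProduct.map_tmul]
        generalize E₁ v = a
        generalize E₂ w = b
        induction a using TensorProduct.induction_on with
        | zero => simp
        | add x y hx hy => simp only [map_add, add_box, TensorProduct.add_tmul, hx, hy]
        | tmul r a =>
          induction b using TensorProduct.induction_on with
          | zero => simp
          | add x y hx hy => simp only [map_add, box_add, TensorProduct.tmul_add, hx, hy]
          | tmul s b => simp
      rw [← e, LinearMap.comp_apply, this, map_zero]
    let B := Module.Basis.ofVectorSpace k V
    let B' := Module.Basis.ofVectorSpace k V'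
    -- Contracting the second evaluation with a functional `μ` leaves an element of `V`, which
    -- vanishes because all its evaluations under `p` do.
    have h2 : ∀ (R₂ : Type max u v) [CommRing R₂] [Algebra k R₂] (E₂ : V' →ₗ[k] R₂ ⊗[k] K'),
        p'.mem R₂ E₂ → ∀ μ : Module.Dual k (R₂ ⊗[k] K'),
        TensorProduct.rid k V ((μ ∘ₗ E₂).lTensor V t) = 0 := by
      intro R₂ _ _ E₂ h₂ μ
      refine p.sep _ fun R₁ _ _ E₁ h₁ => ?_
      have e : E₁ ∘ₗ (TensorProduct.rid k V).toLinearMap ∘ₗ (μ ∘ₗ E₂).lTensor V =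
          (TensorProduct.rid k _).toLinearMap ∘ₗ μ.lTensor _ ∘ₗ TensorProduct.map E₁ E₂ :=
        TensorProduct.ext' fun v w => by simp
      have := LinearMap.congr_fun e t
      simp only [LinearMap.comp_apply, h1 R₁ E₁ R₂ E₂ h₁ h₂, map_zero] at this
      exact this
    -- Now the first factor is contracted by an arbitrary functional; the resulting element of `V'`
    -- vanishes by `p'` and `h2`.
    have h3 : ∀ f : Module.Dual k V, TensorProduct.lid k V' (f.rTensor V' t) = 0 := by
      intro f
      refine p'.sep _ fun R₂ _ _ E₂ h₂ => ?_
      rw [← Module.forall_dual_apply_eq_zero_iff k]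
      intro μ
      have e : μ ∘ₗ E₂ ∘ₗ (TensorProduct.lid k V').toLinearMap ∘ₗ f.rTensor V' =
          f ∘ₗ (TensorProduct.rid k V).toLinearMap ∘ₗ (μ ∘ₗ E₂).lTensor V :=
        TensorProduct.ext' fun v w => by simp [mul_comm]
      have := LinearMap.congr_fun e t
      simp only [LinearMap.comp_apply] at this
      refine this.trans ?_
      have h := h2 R₂ E₂ h₂ μ
      simp only [LinearEquiv.coe_coe] at h ⊢
      rw [h, map_zero]
    refine (TensorProduct.equivFinsuppOfBasisLeft B).injective ?_
    ext i
    have e : ∀ t : V ⊗[k] V', TensorProduct.equivFinsuppOfBasisLeft B t i =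
        TensorProduct.lid k V' ((B.coord i).rTensor V' t) := by
      intro t
      induction t using TensorProduct.induction_on with
      | zero => simp
      | tmul r v => simp
      | add x y hx hy => simp only [map_add, Finsupp.add_apply, hx, hy]
    rw [e, h3, map_zero, Finsupp.zero_apply]

/-- Tensor product of families of generators. -/
def Generators.tensor (G : Generators.{u, v} k V) (G' : Generators.{u, v} k V') :
    Generators.{u, v} k (V ⊗[k] V') where
  mem R _ _ z := ∃ x y, G.mem R x ∧ G'.mem R y ∧ z = x ⊠ y
  map f z := by
    rintro ⟨x, y, hx, hy, rfl⟩
    exact ⟨_, _, G.map f _ hx, G'.map f _ hy, scal_box f x y⟩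
  gen R _ _ L hL := by
    refine TensorProduct.ext' fun a b => ?_
    refine LinearMap.congr_fun (f := L ∘ₗ TensorProduct.mk k V V' a) (g := 0) ?_ b
    refine G'.gen R _ fun R₁ _ _ f y hy => ?_
    -- The second argument is filled with the generator `y` over `R₁`. What remains is linear in the
    -- first argument, and `G` decides it over a further ring `R₂`.
    let L₁ : V →ₗ[k] R₁ :=
      ((ext₂ (TensorProduct.curry (f.toLinearMap ∘ₗ L))).flip y).restrictScalars k ∘ₗ
        TensorProduct.mk k R₁ V 1
    have h₁ : ∀ a, L₁ a =
        LinearMap.liftBaseChange R₁ (f.toLinearMap ∘ₗ L ∘ₗ TensorProduct.mk k V V' a) y := by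
      intro a
      simp only [L₁, LinearMap.comp_apply, LinearMap.restrictScalars_apply, LinearMap.flip_apply,
        TensorProduct.mk_apply]
      clear hy
      induction y using TensorProduct.induction_on with
      | zero => simp
      | tmul r v => simp
      | add x y hx hy => simp only [map_add, hx, hy]
    have h₂ : L₁ = 0 := by
      refine G.gen R₁ _ fun R₂ _ _ f₂ x hx => ?_
      have := hL R₂ (f₂.comp f) _ ⟨x, _, hx, G'.map f₂ _ hy, rfl⟩
      rw [← this]
      clear this h₁ hx hy
      induction x using TensorProduct.induction_on with
      | zero => simp
      | add x x' hx hx' => rw [map_add, add_box, map_add, hx, hx']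
      | tmul r a =>
        simp only [L₁, LinearMap.comp_apply, LinearMap.restrictScalars_apply, LinearMap.flip_apply,
          TensorProduct.mk_apply, LinearMap.liftBaseChange_tmul]
        induction y using TensorProduct.induction_on with
        | zero => simp
        | tmul s v => simp [mul_assoc]
        | add x y hx hy => simp only [map_add, smul_add, hx, hy, box_add]
    rw [← h₁, h₂, LinearMap.zero_apply]

variable (k V) in
/-- The elements `1 ⊗ v`. -/
def Generators.const : Generators.{u, v} k V where
  mem R _ _ z := ∃ v, z = 1 ⊗ₜ v
  map f z := by
    rintro ⟨v, rfl⟩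
    exact ⟨v, by simp⟩
  gen R _ _ L h := by
    ext v
    simpa using h R (AlgHom.id k R) _ ⟨v, rfl⟩

end ProbeLemmas

/-! ### Points of a finite-dimensional cocommutative Hopf algebra -/

section HopfProbes

variable (k : Type u) (H : Type v) [Field k] [Ring H] [HopfAlgebra k H] [Coalgebra.IsCocomm k H]
  [FiniteDimensional k H]

/-- The points of `H`. -/
def Generators.points : Generators.{u, v} k H where
  mem R _ _ z := IsPoint z
  map f z h := h.scal f
  gen R _ _ L h := by
    -- At the generic point over `H* ⊗ R` the hypothesis reads `∑ eⁱ ⊗ L eᵢ = 0`; reading the first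
    -- factor at `eⱼ` recovers `L eⱼ`.
    have h' := h (WithConv (H →ₗ[k] k) ⊗[k] R) Algebra.TensorProduct.includeRight
      (scal Algebra.TensorProduct.includeLeft (generic k H)) (isPoint_generic.scal _)
    refine (Module.finBasis k H).ext fun j => ?_
    have h2 := congrArg (TensorProduct.lid k R) <| congrArg
      (((LinearMap.applyₗ (Module.finBasis k H j) : (H →ₗ[k] k) →ₗ[k] k) ∘ₗ
      (WithConv.linearEquiv k (H →ₗ[k] k)).toLinearMap).rTensor R) h'
    rw [generic] at h2
    simpa [Finsupp.single_apply] using h2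

variable {H} {R : Type*} [CommRing R] [Algebra k R] in
/-- The map `φ ⊗ h ↦ φ(g) ⊗ h`. -/
def evD (g : Point k R H) : Module.Dual k H ⊗[k] H →ₗ[k] R ⊗[k] H :=
  (ev g.val).rTensor H

/-- The elements of `H* ⊗ H` are separated by the evaluations of `H*` at the points of `H`. -/
def Probe.points : Probe.{u, v} k (Module.Dual k H ⊗[k] H) H where
  mem R _ _ E := ∃ g : Point k R H, E = evD k g
  map f E := by
    rintro ⟨g, rfl⟩
    exact ⟨g.scal f, TensorProduct.ext' fun φ h => by simp [evD, Point.scal, ev_scal]⟩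
  sep x hx := by
    have := hx (WithConv (H →ₗ[k] k)) _ ⟨⟨generic k H, isPoint_generic⟩, rfl⟩
    -- At the generic point the evaluation of `H* ⊗ H` is the identity, up to the type synonym for
    -- the convolution algebra.
    have e : evD k ⟨generic k H, isPoint_generic⟩ =
        (WithConv.linearEquiv k (H →ₗ[k] k)).symm.toLinearMap.rTensor H :=
      TensorProduct.ext' fun φ h => by simp [evD, ev_generic]
    rw [e] at this
    have h2 := congrArg ((WithConv.linearEquiv k (H →ₗ[k] k)).toLinearMap.rTensor H) this
    rw [← LinearMap.comp_apply, ← LinearMap.rTensor_comp] at h2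
    simpa using h2

/-- The elements of `H*` are separated by the evaluations at the points of `H`. -/
def Probe.dual : Probe.{u, v} k (Module.Dual k H) k where
  mem R _ _ E := ∃ g : Point k R H, E = (TensorProduct.rid k R).symm.toLinearMap ∘ₗ ev g.val
  map f E := by
    rintro ⟨g, rfl⟩
    refine ⟨g.scal f, ?_⟩
    ext φ
    simp [Point.scal, ev_scal]
  sep x hx := by
    have := hx (WithConv (H →ₗ[k] k)) _ ⟨⟨generic k H, isPoint_generic⟩, rfl⟩
    have h2 := congrArg (TensorProduct.rid k _) this
    simpa [ev_generic] using h2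

end HopfProbes

end

/-! ### Identities for 3-cocycles on a group -/

section GroupCocycle

variable {G M : Type*} [Group G] [AddCommGroup M]

/-- Normalized 3-cocycles on a group, with trivial coefficients. -/
structure IsGroupCocycle (w : G → G → G → M) : Prop where
  cocycle : ∀ x y z t, w x y (z * t) + w (x * y) z t = w y z t + w x (y * z) t + w x y z
  one_left : ∀ x y, w 1 x y = 0
  one_mid : ∀ x y, w x 1 y = 0
  one_right : ∀ x y, w x y 1 = 0

/-- `θ(g; x, y)` for a group. -/
def gθ (w : G → G → G → M) (g x y : G) : M :=
  w g x y + w x y ((x * y)⁻¹ * g * (x * y)) - w x (x⁻¹ * g * x) y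

/-- `γ(g, h; x)` for a group. -/
def gγ (w : G → G → G → M) (g h x : G) : M :=
  w g h x + w x (x⁻¹ * g * x) (x⁻¹ * h * x) - w g x (x⁻¹ * h * x)

/-- The Drinfeld twist `f(g, h)` for a group. -/
def gF (w : G → G → G → M) (g h : G) : M := w (h⁻¹ * g⁻¹) g h - w h⁻¹ g⁻¹ g

namespace IsGroupCocycle

variable {w : G → G → G → M} (hw : IsGroupCocycle w)
include hw

/-- The cocycle identity at `(x, x⁻¹, x, x⁻¹)`. It is the source of the axiom `S(x¹) α x² β S(x³) =
1` for `β(x) = ω(x, x⁻¹, x)`. -/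
theorem inv_mid (x : G) : w x⁻¹ x x⁻¹ + w x x⁻¹ x = 0 := by
  have h := hw.cocycle x x⁻¹ x x⁻¹
  simp only [mul_inv_cancel, inv_mul_cancel, hw.one_left, hw.one_mid, hw.one_right] at h
  linear_combination (norm := abel) -h

theorem θ_one_left (x y : G) : gθ w 1 x y = 0 := by
  simp [gθ, hw.one_left, hw.one_mid, hw.one_right]
theorem θ_one_mid (x y : G) : gθ w x 1 y = 0 := by
  simp [gθ, hw.one_left, hw.one_mid]
theorem θ_one_right (x y : G) : gθ w x y 1 = 0 := by
  simp [gθ, hw.one_mid, hw.one_right]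
theorem γ_one_left (x y : G) : gγ w 1 x y = 0 := by
  simp [gγ, hw.one_left, hw.one_mid]
theorem γ_one_mid (x y : G) : gγ w x 1 y = 0 := by
  simp [gγ, hw.one_mid, hw.one_right]
theorem γ_one_right (x y : G) : gγ w x y 1 = 0 := by
  simp [gγ, hw.one_left, hw.one_mid, hw.one_right]

/-- The alternating sum of the four cocycle identities obtained by inserting `g` in each of the four
positions around `x, y, z`, conjugated by the letters it has passed. It expresses the associativity
of `D^ω(H)`. -/
theorem θ_assoc (g x y z : G) :
    gθ w g x y + gθ w g (x * y) z = gθ w (x⁻¹ * g * x) y z + gθ w g x (y * z) := by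
  linear_combination (norm := skip) hw.cocycle x (x⁻¹ * g * x) y z - hw.cocycle g x y z +
    hw.cocycle x y z (z⁻¹ * y⁻¹ * x⁻¹ * g * x * y * z) -
    hw.cocycle x y (y⁻¹ * x⁻¹ * g * x * y) z
  simp only [gθ, mul_assoc, mul_inv_rev, mul_inv_cancel_left]
  abel

/-- One cocycle identity for each of the six shuffles of `(g, h)` with `(x, y)`, taken with the sign
of the shuffle; `g` and `h` are conjugated by those of `x, y` that stand before them. It expresses
the multiplicativity of the coproduct. -/
theorem γ_mul (g h x y : G) :
    gγ w g h (x * y) + gθ w (g * h) x y =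
      gγ w g h x + gγ w (x⁻¹ * g * x) (x⁻¹ * h * x) y + gθ w g x y + gθ w h x y := by
  linear_combination (norm := skip) hw.cocycle g h x y - hw.cocycle g x (x⁻¹ * h * x) y +
    hw.cocycle x (x⁻¹ * g * x) (x⁻¹ * h * x) y + hw.cocycle g x y (y⁻¹ * x⁻¹ * h * x * y) -
    hw.cocycle x (x⁻¹ * g * x) y (y⁻¹ * x⁻¹ * h * x * y) +
    hw.cocycle x y (y⁻¹ * x⁻¹ * g * x * y) (y⁻¹ * x⁻¹ * h * x * y)
  simp only [gγ, gθ, mul_assoc, mul_inv_rev, mul_inv_cancel_left]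
  abel

/-- The same principle for the four shuffles of `(g, h, z)` with `x`. It expresses
quasi-coassociativity. -/
theorem γ_assoc (g h z x : G) :
    gγ w g (h * z) x + gγ w h z x + w g h z =
      gγ w (g * h) z x + gγ w g h x + w (x⁻¹ * g * x) (x⁻¹ * h * x) (x⁻¹ * z * x) := by
  linear_combination (norm := skip) -hw.cocycle g h z x + hw.cocycle g h x (x⁻¹ * z * x) +
    hw.cocycle x (x⁻¹ * g * x) (x⁻¹ * h * x) (x⁻¹ * z * x) -
    hw.cocycle g x (x⁻¹ * h * x) (x⁻¹ * z * x)
  simp only [gγ, mul_assoc, mul_inv_cancel_left]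
  abel

/-- `θ_assoc` for the triple `(x, x⁻¹, x)`, where normalization removes the other two terms. -/
theorem θ_inv (g x : G) : gθ w (x * g * x⁻¹) x x⁻¹ = gθ w g x⁻¹ x := by
  have h := hw.θ_assoc (x * g * x⁻¹) x x⁻¹ x
  simp only [mul_inv_cancel, inv_mul_cancel, hw.θ_one_mid, hw.θ_one_right] at h
  simp only [mul_assoc, inv_mul_cancel, inv_mul_cancel_left, mul_one] at h ⊢
  linear_combination (norm := abel) h

/-- No further cocycle identity is needed: this combines `γ_mul` for the pair `K⁻¹, K`, whose
product is `1`, with `θ_assoc` applied twice to telescope the inverses. -/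
theorem antipode_mul (K x y : G) :
    gθ w K (x * y) (x * y)⁻¹ + gγ w K⁻¹ K (x * y) - gθ w K⁻¹ x y =
      gθ w (x⁻¹ * K * x) y y⁻¹ + gγ w (x⁻¹ * K⁻¹ * x) (x⁻¹ * K * x) y + gθ w K x x⁻¹ +
        gγ w K⁻¹ K x - gθ w ((x * y)⁻¹ * K * (x * y)) y⁻¹ x⁻¹ := by
  have h := hw.γ_mul K⁻¹ K x y
  rw [inv_mul_cancel, hw.θ_one_left] at h
  linear_combination (norm := skip) h - hw.θ_assoc K (x * y) y⁻¹ x⁻¹ + hw.θ_assoc K x y y⁻¹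
  simp only [mul_assoc, mul_inv_rev, mul_inv_cancel,
    mul_one, hw.θ_one_right]
  abel

/-- Measures how `β` changes under conjugation by `x`, in terms of `γ`; this is what the axiom `a₁ β
S(a₂) = ε(a) β` requires in `D^ω(H)`. -/
theorem antipode_right (g x : G) :
    gγ w g g⁻¹ x + w (x⁻¹ * g * x) (x⁻¹ * g * x)⁻¹ (x⁻¹ * g * x) =
      gγ w g⁻¹ g x + w g g⁻¹ g := by
  linear_combination (norm := skip) hw.cocycle g x (x⁻¹ * g⁻¹ * x) (x⁻¹ * g * x) -
    hw.cocycle x (x⁻¹ * g * x) (x⁻¹ * g⁻¹ * x) (x⁻¹ * g * x) -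
    hw.cocycle g g⁻¹ x (x⁻¹ * g * x) + hw.cocycle g g⁻¹ g x
  simp only [gγ, mul_assoc, mul_inv_rev, inv_inv, mul_inv_cancel_left, inv_mul_cancel_left,
    mul_inv_cancel, inv_mul_cancel, hw.one_left, hw.one_mid, hw.one_right]
  abel

-- Holds for any function `w`, since the terms of `γ` and `θ` match one by one after expansion. It
-- is the relation `Δᵒᵖ(a) R = R Δ(a)`.
omit hw in
theorem γ_comm (g h x : G) :
    gγ w h g x + gθ w h x (x⁻¹ * g * x) = gγ w g (g⁻¹ * h * g) x + gθ w h g x := by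
  simp only [gγ, gθ, mul_assoc, mul_inv_rev, mul_inv_cancel_left]
  abel

/-- Compares the scalar that `Ω` attaches to a product in the double with `θ`. The two differ by the
values at `(g, x, x⁻¹)` that occur in `wMap`, in the way 2-cocycles differ by a twisted coboundary.
-/
theorem double_mul (g x y : G) :
    w x y ((x * y)⁻¹ * g * (x * y)) + w x (y * ((x * y)⁻¹ * g * (x * y))) y⁻¹ +
        gF w y⁻¹ x⁻¹ - w (x * (y * ((x * y)⁻¹ * g * (x * y)))) y⁻¹ x⁻¹ +
        w g x x⁻¹ + w (x⁻¹ * g * x) y y⁻¹ =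
      w g (x * y) (x * y)⁻¹ + gθ w g x y := by
  linear_combination (norm := skip) -hw.cocycle g (x * y) y⁻¹ x⁻¹ -
    hw.cocycle x (x⁻¹ * g * x) y y⁻¹ + hw.cocycle g x y y⁻¹
  simp only [gF, gθ, mul_assoc, mul_inv_rev, inv_inv, mul_inv_cancel_left,
    mul_inv_cancel, mul_one, hw.one_right]
  abel

/-- The analogue of `double_mul` for the coproducts: the values of the reassociator and of `p_R`
combine with those at `(g, x, x⁻¹)` to give `γ`. -/
theorem double_comul (g h x : G) :
    w x (x⁻¹ * g * x) (x⁻¹ * h * x) + w (g * x) x⁻¹ x + w x⁻¹ x x⁻¹ + w (g * h) x x⁻¹ =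
      w g (h * x) x⁻¹ + w g x (x⁻¹ * h * x) + w g x x⁻¹ + w h x x⁻¹ + gγ w g h x := by
  linear_combination (norm := skip) hw.cocycle g h x x⁻¹ + hw.cocycle g x x⁻¹ x -
    hw.cocycle x x⁻¹ x x⁻¹
  simp only [gγ, mul_assoc,
    mul_inv_cancel, inv_mul_cancel, hw.one_left, hw.one_mid, hw.one_right]
  abel

/-- The cocycle identity at `(hg, g⁻¹, g, g⁻¹)`: the value of `p_R` cancels the scalar in `wMap`. -/
theorem double_R (g h : G) : w (h * g) g⁻¹ g + w g⁻¹ g g⁻¹ = w h g g⁻¹ := by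
  linear_combination (norm := skip) -hw.cocycle (h * g) g⁻¹ g g⁻¹
  simp only [mul_assoc,
    mul_inv_cancel, inv_mul_cancel, mul_one, hw.one_mid, hw.one_right]
  abel

end IsGroupCocycle

end GroupCocycle

/-! ### Rules for moving sums over points inward -/

section Push

variable {k R : Type*} [Field k] [CommRing R] [Algebra k R]
  {V W U V' W' M N H : Type*}
  [AddCommGroup V] [Module k V] [AddCommGroup W] [Module k W] [AddCommGroup U] [Module k U]
  [AddCommGroup V'] [Module k V'] [AddCommGroup W'] [Module k W']
  [AddCommMonoid M] [Module k M]
  [AddCommMonoid N] [Module k N] [Module R N] [IsScalarTower k R N]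
  [Ring H] [HopfAlgebra k H]

/-- The unit law for `bind`. A sum ends here once its variable has been isolated in a single slot,
and the slot is then filled by the point itself. -/
theorem bind_one_tmul (x : R ⊗[k] V) : (bind x fun v => (1 : R) ⊗ₜ[k] v) = x := by
  have h : (fun v => (1 : R) ⊗ₜ[k] v) = fun v => TensorProduct.mk k R V 1 v := rfl
  rw [h, bind_linear]
  induction x using TensorProduct.induction_on with
  | zero => simp
  | tmul r v => simp [TensorProduct.smul_tmul']
  | add x y hx hy => simp only [map_add, hx, hy]

theorem bind_mul_left (x : R ⊗[k] V) (y : R ⊗[k] H) (F : V → R ⊗[k] H) :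
    (bind x fun v => y * F v) = y * bind x F :=
  (map_bind (LinearMap.mulLeft R y) x F).symm

theorem bind_mul_right' (x : R ⊗[k] V) (y : R ⊗[k] H) (F : V → R ⊗[k] H) :
    (bind x fun v => F v * y) = bind x F * y :=
  (map_bind (LinearMap.mulRight R y) x F).symm

end Push

section Push

variable {k R : Type*} [Field k] [CommRing R] [Algebra k R] {V W U N : Type*} [AddCommMonoid W]
  [Module k W] [AddCommMonoid U] [Module k U]

theorem one_tmul_tmul (u : U) (w : W) :
    (1 : R) ⊗ₜ[k] (u ⊗ₜ[k] w) = (1 ⊗ₜ u) ⊠ (1 ⊗ₜ w) := by simp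

theorem one_tmul_apply (f : W →ₗ[k] U) (w : W) :
    (1 : R) ⊗ₜ[k] (f w) = f.baseChange R (1 ⊗ₜ w) := by simp

variable [AddCommGroup V] [Module k V] [AddCommMonoid N] [Module k N] [Module R N]
  [IsScalarTower k R N]

theorem bind_box_left (x : R ⊗[k] V) (y : R ⊗[k] W) (F : V → R ⊗[k] U) :
    (bind x fun v => y ⊠ F v) = y ⊠ bind x F :=
  (map_bind { toFun := fun z => y ⊠ z, map_add' := box_add y, map_smul' := fun r z => by simp }
    x F).symm

theorem bind_box_right (x : R ⊗[k] V) (y : R ⊗[k] W) (F : V → R ⊗[k] U) :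
    (bind x fun v => F v ⊠ y) = bind x F ⊠ y :=
  (map_bind { toFun := fun z => z ⊠ y, map_add' := fun a b => add_box a b y,
              map_smul' := fun r z => by simp } x F).symm

theorem bind_baseChange (x : R ⊗[k] V) (f : W →ₗ[k] U) (F : V → R ⊗[k] W) :
    (bind x fun v => f.baseChange R (F v)) = f.baseChange R (bind x F) :=
  (map_bind (f.baseChange R) x F).symm

theorem bind_liftBaseChange (x : R ⊗[k] V) (f : W →ₗ[k] N) (F : V → R ⊗[k] W) :
    (bind x fun v => LinearMap.liftBaseChange R f (F v)) = LinearMap.liftBaseChange R f (bind x F) :=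
  (map_bind (LinearMap.liftBaseChange R f) x F).symm

end Push

section Push

variable {k R : Type*} [Field k] [CommRing R] [Algebra k R]
  {V W U V' W' M N H : Type*}
  [AddCommGroup V] [Module k V] [AddCommGroup W] [Module k W] [AddCommGroup U] [Module k U]
  [AddCommGroup V'] [Module k V'] [AddCommGroup W'] [Module k W']
  [AddCommMonoid M] [Module k M]
  [AddCommMonoid N] [Module k N] [Module R N] [IsScalarTower k R N]
  [Ring H] [HopfAlgebra k H]

theorem bind_ev (x : R ⊗[k] V) (φ : Module.Dual k W) (F : V → R ⊗[k] W) :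
    (bind x fun v => ev (F v) φ) = ev (bind x F) φ :=
  bind_liftBaseChange x _ F

theorem bind_evₗ (φ : R ⊗[k] Module.Dual k V) (x : R ⊗[k] V) :
    (bind φ fun φ => ev x φ) = LinearMap.liftBaseChange R (ev x) φ := bind_linear _ _

theorem one_tmul_mul (a b : H) : (1 : R) ⊗ₜ[k] (a * b) = (1 ⊗ₜ a) * (1 ⊗ₜ b) := by simp

theorem algebraMap_dual (φ : Module.Dual k V) (v : V) :
    algebraMap k R (φ v) = ev ((1 : R) ⊗ₜ[k] v) φ := by simp

theorem baseChange_eq_bind (f : V →ₗ[k] M) (z : R ⊗[k] V) :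
    f.baseChange R z = bind z fun v => (1 : R) ⊗ₜ[k] f v := by
  have h : (fun v => (1 : R) ⊗ₜ[k] f v) = fun v => (TensorProduct.mk k R M 1 ∘ₗ f) v := rfl
  rw [h, bind_linear]
  induction z using TensorProduct.induction_on with
  | zero => simp
  | tmul r v => simp [TensorProduct.smul_tmul']
  | add x y hx hy => simp only [map_add, hx, hy]

theorem baseChange_lift₂_box (x : R ⊗[k] V) (y : R ⊗[k] W) (F : V → W → M) :
    (lift₂ F : V ⊗[k] W →ₗ[k] M).baseChange R (x ⊠ y) =
      bind x fun v => bind y fun w => (1 : R) ⊗ₜ[k] F v w := by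
  rw [← bind_box, baseChange_eq_bind, ← bind_linear]
  congr 1
  exact funext fun t => map_lift₂ (TensorProduct.mk k R M 1) F t

theorem baseChange_lift₃_box (x : R ⊗[k] V) (y : R ⊗[k] W) (z : R ⊗[k] U) (F : V → W → U → M) :
    (lift₃ F : V ⊗[k] (W ⊗[k] U) →ₗ[k] M).baseChange R (x ⊠ y ⊠ z) =
      bind x fun v => bind y fun w => bind z fun u => (1 : R) ⊗ₜ[k] F v w u := by
  rw [lift₃, baseChange_lift₂_box]
  congr 1
  funext v
  rw [← baseChange_lift₂_box, baseChange_eq_bind]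

theorem baseChange_lift₄_box (x : R ⊗[k] V) (y : R ⊗[k] W) (z : R ⊗[k] U) (t : R ⊗[k] V')
    (F : V → W → U → V' → M) :
    (lift₄ F : V ⊗[k] (W ⊗[k] (U ⊗[k] V')) →ₗ[k] M).baseChange R (x ⊠ y ⊠ z ⊠ t) =
      bind x fun v => bind y fun w => bind z fun u => bind t fun v' => (1 : R) ⊗ₜ[k] F v w u v' := by
  rw [lift₄, baseChange_lift₂_box]
  congr 1
  funext v
  rw [← baseChange_lift₃_box, baseChange_eq_bind]

theorem bind_mul_linear (x y : R ⊗[k] H) (L : H →ₗ[k] N) :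
    (bind x fun a => bind y fun b => L (a * b)) = LinearMap.liftBaseChange R L (x * y) := by
  refine (bind_bilinear x y ((LinearMap.mul k H).compr₂ L)).trans ?_
  induction x, y using box_induction with
  | zero_left => simp
  | zero_right => simp
  | tmul r v s w => simp
  | add_left x x' y h h' => rw [map_add, LinearMap.add_apply, add_mul, map_add, h, h']
  | add_right x y y' h h' => rw [map_add, mul_add, map_add, h, h']

theorem one_tmul_sum₂ (t : V ⊗[k] W) (F : V → W → M) :
    (1 : R) ⊗ₜ[k] (sum₂ t F) = sum₂ t fun v w => (1 : R) ⊗ₜ[k] F v w :=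
  map_sum₂ (TensorProduct.mk k R M 1) t F

theorem one_tmul_smul (φ : Module.Dual k V) (v : V) (m : M) :
    (1 : R) ⊗ₜ[k] (φ v • m) = ev ((1 : R) ⊗ₜ[k] v) φ • ((1 : R) ⊗ₜ[k] m) := by
  simp [TensorProduct.smul_tmul', Algebra.smul_def]

theorem one_tmul_adj (g x : H) :
    (1 : R) ⊗ₜ[k] adj k g x = sum₂ (Coalgebra.comul (R := k) x) fun x₁ x₂ =>
      (HopfAlgebra.antipode k).baseChange R (1 ⊗ₜ x₁) * (1 ⊗ₜ g) * (1 ⊗ₜ x₂) := by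
  rw [adj, one_tmul_sum₂]
  simp

end Push

/-! ### The values of `ω`, `θ` and `γ` at points -/

section Cocycle

variable {k R H : Type*} [Field k] [CommRing R] [Algebra k R] [Ring H] [HopfAlgebra k H]

theorem ev_pullback {C D : Type*} [AddCommGroup C] [Module k C] [AddCommGroup D] [Module k D]
    (ω : WithConv (D →ₗ[k] k)) (g : C →ₗ[k] D) (X : R ⊗[k] C) :
    ev X (pullback ω g).ofConv = ev (g.baseChange R X) ω.ofConv := ev_comp _ _ _

variable (ω : (WithConv (H ⊗[k] (H ⊗[k] H) →ₗ[k] k))ˣ)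

/-- The value of `ω` at three points. -/
def om (x y z : Point k R H) : Rˣ where
  val := ev (x.val ⊠ y.val ⊠ z.val) ω.1.ofConv
  inv := ev (x.val ⊠ y.val ⊠ z.val) (ω⁻¹).1.ofConv
  val_inv := by
    rw [← (x.isPoint.box (y.isPoint.box z.isPoint)).ev_mul, Units.mul_inv,
      (x.isPoint.box (y.isPoint.box z.isPoint)).ev_one]
  inv_val := by
    rw [← (x.isPoint.box (y.isPoint.box z.isPoint)).ev_mul, Units.inv_mul,
      (x.isPoint.box (y.isPoint.box z.isPoint)).ev_one]

theorem ev_om (x y z : Point k R H) :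
    ev (x.val ⊠ y.val ⊠ z.val) ω.1.ofConv = om ω x y z := rfl

theorem ev_om_inv (x y z : Point k R H) :
    ev (x.val ⊠ y.val ⊠ z.val) (ω⁻¹).1.ofConv = ((om ω x y z)⁻¹ : Rˣ) := rfl

/-- The value of `ω` at three points, written additively. -/
def omA (x y z : Point k R H) : Additive Rˣ := Additive.ofMul (om ω x y z)

variable {ω}

/-- At `x ⊠ y ⊠ z ⊠ t` the convolution products become products in `R`, each pullback becomes a
value of `ω` at products of the points, and the counits become `1`. -/
theorem IsNormalizedThreeCocycle.isGroupCocycle (hω : IsNormalizedThreeCocycle ω) :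
    IsGroupCocycle (omA (R := R) ω) where
  cocycle x y z t := by
    have h := congrArg (fun F => ev (x.val ⊠ y.val ⊠ z.val ⊠ t.val) (WithConv.ofConv F)) hω.cocycle
    have hp := x.isPoint.box (y.isPoint.box (z.isPoint.box t.isPoint))
    simp only [hp.ev_mul, ev_pullback, baseChange_lift₄_box, one_tmul_tmul, one_tmul_mul,
      one_tmul_smul, bind_box_left, bind_box_right, bind_mul_left, bind_mul_right', bind_smul,
      bind_smul_const, bind_one_tmul, bind_ev, x.isPoint.counit, t.isPoint.counit, one_smul] at h
    refine Additive.toMul.injective (Units.ext ?_)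
    exact h
  one_left x y := by
    -- The normalization is given for elements of `H`; it extends by `R`-linearity to `R ⊗ H`, and
    -- so to points.
    have h : ∀ X Y : R ⊗[k] H, ev ((1 : R ⊗[k] H) ⊠ X ⊠ Y) ω.1.ofConv =
        ev X Coalgebra.counit * ev Y Coalgebra.counit := by
      intro X Y
      rw [Algebra.TensorProduct.one_def]
      induction X, Y using box_induction with
      | zero_left => simp
      | zero_right => simp
      | tmul r v s w => simp [hω.one_left]; ring
      | add_left x x' y h h' => simp only [add_box, box_add, ev_add_left, h, h', add_mul]
      | add_right x y y' h h' => simp only [box_add, ev_add_left, h, h', mul_add]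
    refine Additive.toMul.injective (Units.ext ?_)
    refine (h x.val y.val).trans ?_
    rw [x.isPoint.counit, y.isPoint.counit]; simp
  one_mid x y := by
    have h : ∀ X Y : R ⊗[k] H, ev (X ⊠ (1 : R ⊗[k] H) ⊠ Y) ω.1.ofConv =
        ev X Coalgebra.counit * ev Y Coalgebra.counit := by
      intro X Y
      rw [Algebra.TensorProduct.one_def]
      induction X, Y using box_induction with
      | zero_left => simp
      | zero_right => simp
      | tmul r v s w => simp [hω.one_mid]; ring
      | add_left x x' y h h' => simp only [add_box, ev_add_left, h, h', add_mul]
      | add_right x y y' h h' => simp only [box_add, ev_add_left, h, h', mul_add]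
    refine Additive.toMul.injective (Units.ext ?_)
    refine (h x.val y.val).trans ?_
    rw [x.isPoint.counit, y.isPoint.counit]; simp
  one_right x y := by
    have h : ∀ X Y : R ⊗[k] H, ev (X ⊠ Y ⊠ (1 : R ⊗[k] H)) ω.1.ofConv =
        ev X Coalgebra.counit * ev Y Coalgebra.counit := by
      intro X Y
      rw [Algebra.TensorProduct.one_def]
      induction X, Y using box_induction with
      | zero_left => simp
      | zero_right => simp
      | tmul r v s w => simp [hω.one_right]; ring
      | add_left x x' y h h' => simp only [add_box, ev_add_left, h, h', add_mul]
      | add_right x y y' h h' => simp only [box_add, add_box, ev_add_left, h, h', mul_add]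
    refine Additive.toMul.injective (Units.ext ?_)
    refine (h x.val y.val).trans ?_
    rw [x.isPoint.counit, y.isPoint.counit]; simp

variable (ω)

/-- The value of `θ` at three points. -/
def tht (g x y : Point k R H) : Rˣ :=
  om ω g x y * om ω x y ((x * y)⁻¹ * g * (x * y)) * (om ω x (x⁻¹ * g * x) y)⁻¹

/-- The value of `γ` at three points. -/
def gam (g h x : Point k R H) : Rˣ :=
  om ω g h x * om ω x (x⁻¹ * g * x) (x⁻¹ * h * x) * (om ω g x (x⁻¹ * h * x))⁻¹

/-- The two Sweedler components of `x` become `x⁻¹` and `x`, so `g ◁ x` turns into conjugation in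
the group of points. -/
theorem bind_adj (g x : Point k R H) :
    (bind g.val fun a => bind x.val fun b => (1 : R) ⊗ₜ adj k a b) = (x⁻¹ * g * x).val := by
  simp only [one_tmul_adj, x.isPoint.bind_comul, bind_mul_left, bind_mul_right',
    bind_baseChange, bind_one_tmul]
  rfl

/-- The multiplication `g, x ↦ g ◁ x` as a bilinear map. -/
def adjₗ : H →ₗ[k] H →ₗ[k] H :=
  LinearMap.mk₂ k (adj k)
    (fun g g' x => by
      have h : ∀ g (t : H ⊗[k] H), (sum₂ t fun x₁ x₂ => HopfAlgebra.antipode k x₁ * g * x₂) =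
        LinearMap.mul' k H (((LinearMap.mulRight k g) ∘ₗ HopfAlgebra.antipode k).rTensor H t) :=
        fun g t => sum₂_eq t (LinearMap.mul' k H ∘ₗ
          ((LinearMap.mulRight k g) ∘ₗ HopfAlgebra.antipode k).rTensor H) (by simp)
      simp only [adj, h]
      rw [← map_add, ← LinearMap.add_apply, ← LinearMap.rTensor_add, ← LinearMap.add_comp]
      congr 3
      congr 1
      ext
      simp [mul_add])
    (fun c g x => by
      rw [adj, adj]
      refine Eq.trans ?_ (map_sum₂ (LinearMap.lsmul k H c) _ _).symm
      simp)
    (fun g x x' => by rw [adj, map_add, sum₂, map_add]; rfl)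
    (fun c g x => by rw [adj, map_smul, sum₂, map_smul]; rfl)

theorem bind_adj_mul (g x y : Point k R H) :
    (bind g.val fun a => bind x.val fun b => bind y.val fun c => (1 : R) ⊗ₜ adj k a (b * c)) =
      ((x * y)⁻¹ * g * (x * y)).val := by
  rw [← bind_adj]
  congr 1
  funext a
  exact (bind_mul_linear x.val y.val (TensorProduct.mk k R H 1 ∘ₗ adjₗ a)).trans
    (bind_linear _ (TensorProduct.mk k R H 1 ∘ₗ adjₗ a)).symm

theorem ev_theta (g x y : Point k R H) :
    ev (g.val ⊠ x.val ⊠ y.val) (theta ω).ofConv = tht ω g x y := by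
  have hp := g.isPoint.box (x.isPoint.box y.isPoint)
  rw [theta, hp.ev_mul, hp.ev_mul, ev_pullback, ev_pullback, ev_om]
  have h1 : (lift₃ fun g x y : H =>
    sum₂ (Coalgebra.comul (R := k) x) fun x₁ x₂ => sum₂ (Coalgebra.comul (R := k) y) fun y₁ y₂ =>
      x₁ ⊗ₜ[k] (y₁ ⊗ₜ[k] adj k g (x₂ * y₂))).baseChange R (g.val ⊠ x.val ⊠ y.val) =
      x.val ⊠ y.val ⊠ ((x * y)⁻¹ * g * (x * y)).val := by
    simp only [baseChange_lift₃_box, one_tmul_sum₂, bind_sum₂, x.isPoint.bind_comul,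
      y.isPoint.bind_comul, one_tmul_tmul, bind_box_left, bind_box_right, bind_one_tmul]
    rw [bind_adj_mul]
  have h2 : (lift₃ fun g x y : H =>
    sum₂ (Coalgebra.comul (R := k) x) fun x₁ x₂ =>
      x₁ ⊗ₜ[k] (adj k g x₂ ⊗ₜ[k] y)).baseChange R (g.val ⊠ x.val ⊠ y.val) =
      x.val ⊠ (x⁻¹ * g * x).val ⊠ y.val := by
    simp only [baseChange_lift₃_box, one_tmul_sum₂, bind_sum₂, x.isPoint.bind_comul,
      one_tmul_tmul, bind_box_left, bind_box_right, bind_one_tmul]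
    rw [← bind_adj g x]
  rw [h1, h2]
  rfl

theorem ev_gamma (g h x : Point k R H) :
    ev (g.val ⊠ h.val ⊠ x.val) (gamma ω).ofConv = gam ω g h x := by
  have hp := g.isPoint.box (h.isPoint.box x.isPoint)
  rw [gamma, hp.ev_mul, hp.ev_mul, ev_pullback, ev_pullback, ev_om]
  have h1 : (lift₃ fun g h x : H =>
    sum₂ (Coalgebra.comul (R := k) x) fun x₁ x' => sum₂ (Coalgebra.comul (R := k) x') fun x₂ x₃ =>
      x₁ ⊗ₜ[k] (adj k g x₂ ⊗ₜ[k] adj k h x₃)).baseChange R (g.val ⊠ h.val ⊠ x.val) =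
      x.val ⊠ (x⁻¹ * g * x).val ⊠ (x⁻¹ * h * x).val := by
    simp only [baseChange_lift₃_box, one_tmul_sum₂, x.isPoint.bind_comul,
      one_tmul_tmul, bind_box_left, bind_box_right, bind_one_tmul]
    rw [← bind_adj g x, ← bind_adj h x]
  have h2 : (lift₃ fun g h x : H =>
    sum₂ (Coalgebra.comul (R := k) x) fun x₁ x₂ =>
      g ⊗ₜ[k] (x₁ ⊗ₜ[k] adj k h x₂)).baseChange R (g.val ⊠ h.val ⊠ x.val) =
      g.val ⊠ x.val ⊠ (x⁻¹ * h * x).val := by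
    simp only [baseChange_lift₃_box, one_tmul_sum₂, x.isPoint.bind_comul,
      one_tmul_tmul, bind_box_left, bind_box_right, bind_one_tmul]
    rw [← bind_adj h x]
  rw [h1, h2]
  rfl

theorem tht_additive (g x y : Point k R H) :
    Additive.ofMul (tht ω g x y) = gθ (omA ω) g x y := by
  simp only [gθ, omA, ← ofMul_mul, ← ofMul_div, div_eq_mul_inv, tht]

theorem gam_additive (g x y : Point k R H) :
    Additive.ofMul (gam ω g x y) = gγ (omA ω) g x y := by
  simp only [gγ, omA, ← ofMul_mul, ← ofMul_div, div_eq_mul_inv, gam]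

end Cocycle

/-! ### Evaluation of tensors of functionals -/

section EvT

variable {k R V W V' W' : Type*} [CommSemiring k] [CommSemiring R] [Algebra k R]
  [AddCommMonoid V] [Module k V] [AddCommMonoid W] [Module k W]
  [AddCommMonoid V'] [Module k V'] [AddCommMonoid W'] [Module k W']

/-- The linear map `v ⊗ w ↦ f v * g w`. -/
def evT (f : V →ₗ[k] R) (g : W →ₗ[k] R) : V ⊗[k] W →ₗ[k] R :=
  LinearMap.mul' k R ∘ₗ TensorProduct.map f g

@[simp] theorem evT_tmul (f : V →ₗ[k] R) (g : W →ₗ[k] R) (v : V) (w : W) :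
    evT f g (v ⊗ₜ w) = f v * g w := by simp [evT]

theorem evT_map (f : V →ₗ[k] R) (g : W →ₗ[k] R) (a : V' →ₗ[k] V) (b : W' →ₗ[k] W)
    (t : V' ⊗[k] W') : evT f g (TensorProduct.map a b t) = evT (f ∘ₗ a) (g ∘ₗ b) t := by
  induction t using TensorProduct.induction_on with
  | zero => simp
  | add x y hx hy => simp only [map_add, hx, hy]
  | tmul => simp

theorem evT_map₂ {f : V →ₗ[k] R} {g : W →ₗ[k] R} {m : V →ₗ[k] V →ₗ[k] V}
    {m' : W →ₗ[k] W →ₗ[k] W} (hf : ∀ a b, f (m a b) = f a * f b)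
    (hg : ∀ a b, g (m' a b) = g a * g b) (s t : V ⊗[k] W) :
    evT f g (TensorProduct.map₂ m m' s t) = evT f g s * evT f g t := by
  induction s using TensorProduct.induction_on with
  | zero => simp
  | add x y hx hy => simp only [map_add, LinearMap.add_apply, hx, hy, add_mul]
  | tmul a b =>
    induction t using TensorProduct.induction_on with
    | zero => simp
    | add x y hx hy => simp only [map_add, hx, hy, mul_add]
    | tmul c d => simp [hf, hg]; ring

end EvT

section Lift

variable {k R V W M N : Type*} [Field k] [CommRing R] [Algebra k R]
  [AddCommMonoid V] [Module k V] [AddCommMonoid W] [Module k W]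
  [AddCommMonoid M] [Module k M]
  [AddCommMonoid N] [Module k N] [Module R N] [IsScalarTower k R N]

theorem liftBaseChange_lift (E : M →ₗ[k] N) (f : V →ₗ[k] W →ₗ[k] M) (s : R ⊗[k] V)
    (t : R ⊗[k] W) :
    LinearMap.liftBaseChange R E ((TensorProduct.lift f).baseChange R (s ⊠ t)) =
      ext₂ (f.compr₂ E) s t := by
  induction s, t using box_induction with
  | zero_left => simp
  | zero_right => simp
  | tmul => simp
  | add_left x x' y h h' => rw [add_box, map_add, map_add, h, h', map_add, LinearMap.add_apply]
  | add_right x y y' h h' => rw [box_add, map_add, map_add, h, h', map_add]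

theorem liftBaseChange_add_map (f g : V →ₗ[k] N) (z : R ⊗[k] V) :
    LinearMap.liftBaseChange R (f + g) z =
      LinearMap.liftBaseChange R f z + LinearMap.liftBaseChange R g z := by
  rw [LinearMap.liftBaseChange, map_add]; rfl

end Lift

/-! ### Products seen through evaluations -/

section Laws

variable {k R : Type*} [Field k] [CommRing R] [Algebra k R]
  {V W U V' W' M N B K B' K' : Type*}
  [AddCommGroup V] [Module k V] [AddCommGroup W] [Module k W] [AddCommGroup U] [Module k U]
  [AddCommGroup V'] [Module k V'] [AddCommGroup W'] [Module k W']
  [AddCommMonoid B] [Module k B] [AddCommMonoid K] [Module k K]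
  [AddCommMonoid B'] [Module k B'] [AddCommMonoid K'] [Module k K']
  [AddCommMonoid M] [Module k M]
  [AddCommMonoid N] [Module k N] [Module R N] [IsScalarTower k R N]

theorem sum₂_smul (t : V ⊗[k] W) (r : R) (F : V → W → N) :
    (sum₂ t fun v w => r • F v w) = r • sum₂ t F :=
  (map_sum₂ ((LinearMap.lsmul R N r).restrictScalars k) t F).symm

theorem ext₂_eq_bind (f : V →ₗ[k] W →ₗ[k] N) (x : R ⊗[k] V) (y : R ⊗[k] W) :
    ext₂ f x y = bind x fun v => LinearMap.liftBaseChange R (f v) y := by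
  rw [← bind_bilinear]
  simp only [bind_linear]

/-- Unfolds a bilinear operation defined by two nested `lift₂`, such as the products of `D^ω(H)` and
of the double, into sums over its four variables. -/
theorem ext₂_lift₂ (F : V → W → V' → W' → M) (E : M →ₗ[k] N) (a : R ⊗[k] V) (b : R ⊗[k] W)
    (c : R ⊗[k] V') (d : R ⊗[k] W') :
    ext₂ ((lift₂ fun v w => (lift₂ (F v w) : V' ⊗[k] W' →ₗ[k] M)).compr₂ E) (a ⊠ b) (c ⊠ d) =
      bind a fun v => bind b fun w => bind c fun v' => bind d fun w' => E (F v w v' w') := by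
  rw [ext₂_eq_bind]
  -- Evaluation at `c ⊠ d` is regarded as a linear function of the inner map, so that it can pass
  -- through the outer `lift₂`.
  let l : (V' ⊗[k] W' →ₗ[k] M) →ₗ[k] N :=
    { toFun := fun f => LinearMap.liftBaseChange R (E ∘ₗ f) (c ⊠ d)
      map_add' := fun f g => by
        rw [LinearMap.comp_add, LinearMap.liftBaseChange, map_add]; rfl
      map_smul' := fun r f => by
        have : E ∘ₗ (r • f) = (algebraMap k R r) • (E ∘ₗ f) := by ext; simp
        rw [this, LinearMap.liftBaseChange, map_smul, LinearMap.smul_apply, algebraMap_smul]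
        rfl }
  have h : (fun t => LinearMap.liftBaseChange R (((lift₂ fun v w =>
      (lift₂ (F v w) : V' ⊗[k] W' →ₗ[k] M)).compr₂ E) t) (c ⊠ d)) =
      fun t => (lift₂ fun v w => l (lift₂ (F v w)) : V ⊗[k] W →ₗ[k] N) t := by
    funext t
    rw [← map_lift₂ l]
    rfl
  rw [h, bind_linear, bind_box]
  congr 1
  funext v
  congr 1
  funext w
  rw [← bind_box]
  change LinearMap.liftBaseChange R (E ∘ₗ lift₂ (F v w)) (c ⊠ d) = _
  congr 2
  exact LinearMap.ext fun t => map_lift₂ E _ t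

theorem map_lift₂_tmul (F : V → W → M) (E : M →ₗ[k] N) (v : V) (w : W) :
    E (lift₂ (k := k) F (v ⊗ₜ w)) =
      bind ((1 : R) ⊗ₜ[k] v) fun v => bind ((1 : R) ⊗ₜ[k] w) fun w => E (F v w) := by
  rw [← bind_box, map_lift₂]
  simp

/-- The evaluation `E (u v)` is computed from `E u`, and from `E' v` if `E u` is a multiple of
`x`. -/
def MulLaw (mul : B →ₗ[k] B →ₗ[k] B) (E : B →ₗ[k] R ⊗[k] K) (x : R ⊗[k] K)
    (E' : B →ₗ[k] R ⊗[k] K) (L : K →ₗ[k] R ⊗[k] K) : Prop :=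
  ∃ P : B →ₗ[k] K →ₗ[k] R ⊗[k] K,
    (∀ u v, E (mul u v) = LinearMap.liftBaseChange R (P v) (E u)) ∧
    ∀ v, LinearMap.liftBaseChange R (P v) x = LinearMap.liftBaseChange R L (E' v)

/-- To evaluate a product at `g`, the right factor is needed at `x⁻¹gx`, with `x` read off from the
left factor. Hence the left evaluation has to be a multiple of a fixed `x` before `E'` can be
applied to the right factor. -/
theorem MulLaw.rel {mul : B →ₗ[k] B →ₗ[k] B} {E : B →ₗ[k] R ⊗[k] K} {x y : R ⊗[k] K}
    {E' : B →ₗ[k] R ⊗[k] K} {L : K →ₗ[k] R ⊗[k] K} (h : MulLaw mul E x E' L)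
    {s t : R ⊗[k] B} {c d : R} (hs : LinearMap.liftBaseChange R E s = c • x)
    (ht : LinearMap.liftBaseChange R E' t = d • y) :
    LinearMap.liftBaseChange R E ((TensorProduct.lift mul).baseChange R (s ⊠ t)) =
      (c * d) • LinearMap.liftBaseChange R L y := by
  obtain ⟨P, h₁, h₂⟩ := h
  have e : ∀ s t, ext₂ (mul.compr₂ E) s t = ext₂ P t (LinearMap.liftBaseChange R E s) := by
    intro s t
    induction s, t using box_induction with
    | zero_left => simp
    | zero_right => simp
    | tmul r u s v =>
      simp only [ext₂_tmul, LinearMap.compr₂_apply, h₁, LinearMap.liftBaseChange_tmul, map_smul]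
      generalize E u = z
      induction z using TensorProduct.induction_on with
      | zero => simp
      | tmul r' h => simp only [LinearMap.liftBaseChange_tmul, ext₂_tmul, smul_smul]; congr 1; ring
      | add x y hx hy => simp only [map_add, smul_add, hx, hy]
    | add_left x x' y h h' => simp only [map_add, LinearMap.add_apply, h, h']
    | add_right x y y' h h' => simp only [map_add, LinearMap.add_apply, h, h']
  have e₂ : ∀ t, ext₂ P t x = LinearMap.liftBaseChange R L (LinearMap.liftBaseChange R E' t) := by
    intro t
    induction t using TensorProduct.induction_on with
    | zero => simp
    | add t t' ht ht' => simp only [map_add, LinearMap.add_apply, ht, ht']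
    | tmul r v =>
      rw [LinearMap.liftBaseChange_tmul, map_smul, ← h₂, ext₂, LinearMap.liftBaseChange_tmul]
      rfl
  rw [liftBaseChange_lift, e, hs, map_smul, e₂, ht, map_smul, mul_smul]

/-- Supplies the multiplication rules of `D ⊗ D` and `D ⊗ D ⊗ D` from the rule of `D` alone. -/
theorem MulLaw.tensor {mul : B →ₗ[k] B →ₗ[k] B} {E : B →ₗ[k] R ⊗[k] K} {x : R ⊗[k] K}
    {E' : B →ₗ[k] R ⊗[k] K} {L : K →ₗ[k] R ⊗[k] K} (h : MulLaw mul E x E' L)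
    {mul' : B' →ₗ[k] B' →ₗ[k] B'} {F : B' →ₗ[k] R ⊗[k] K'} {x' : R ⊗[k] K'}
    {F' : B' →ₗ[k] R ⊗[k] K'} {L' : K' →ₗ[k] R ⊗[k] K'} (h' : MulLaw mul' F x' F' L') :
    MulLaw (TensorProduct.map₂ mul mul') (boxMap E F) (x ⊠ x') (boxMap E' F') (boxMap L L') := by
  obtain ⟨P, h₁, h₂⟩ := h
  obtain ⟨P', h₁', h₂'⟩ := h'
  let bm : (K →ₗ[k] R ⊗[k] K) →ₗ[k] (K' →ₗ[k] R ⊗[k] K') →ₗ[k]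
      (K ⊗[k] K' →ₗ[k] R ⊗[k] (K ⊗[k] K')) :=
    LinearMap.mk₂ k boxMap
      (fun f f' g => TensorProduct.ext' fun a b => by simp [add_box])
      (fun c f g => TensorProduct.ext' fun a b => by
        simp only [boxMap_tmul, LinearMap.smul_apply]
        rw [← algebraMap_smul R c (f a), smul_box, algebraMap_smul])
      (fun f g g' => TensorProduct.ext' fun a b => by simp [box_add])
      (fun c f g => TensorProduct.ext' fun a b => by
        simp only [boxMap_tmul, LinearMap.smul_apply]
        rw [← algebraMap_smul R c (g b), box_smul, algebraMap_smul])
  have hb : ∀ v v', TensorProduct.lift (bm.compl₁₂ P P') (v ⊗ₜ v') = boxMap (P v) (P' v') :=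
    fun v v' => rfl
  refine ⟨TensorProduct.lift (bm.compl₁₂ P P'), fun u v => ?_, fun v => ?_⟩
  · induction v using TensorProduct.induction_on with
    | zero => simp
    | add v w hv hw =>
      rw [map_add, map_add, map_add, hv, hw, liftBaseChange_add_map]
    | tmul v v' =>
      induction u using TensorProduct.induction_on with
      | zero => simp
      | add v w hv hw => simp only [map_add, LinearMap.add_apply, hv, hw]
      | tmul u u' =>
        rw [TensorProduct.map₂_apply_tmul, TensorProduct.map_tmul, boxMap_tmul, boxMap_tmul, h₁, h₁', hb,
          liftBaseChange_boxMap]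
  · induction v using TensorProduct.induction_on with
    | zero => simp
    | add v w hv hw =>
      rw [map_add, map_add, map_add, ← hv, ← hw, liftBaseChange_add_map]
    | tmul v v' =>
      rw [hb, liftBaseChange_boxMap, h₂, h₂', boxMap_tmul, liftBaseChange_boxMap]

theorem sum₂_evT (t : V ⊗[k] W) (r : R) (f : V →ₗ[k] R) (g : W →ₗ[k] R) {F : V → W → R}
    (h : ∀ v w, F v w = r * (f v * g w)) : sum₂ t F = r * evT f g t :=
  sum₂_eq t (LinearMap.mulLeft k r ∘ₗ evT f g) (by simpa using h)

theorem sum₃_evT (t : V ⊗[k] (W ⊗[k] U)) (r : R) (f : V →ₗ[k] R) (g : W →ₗ[k] R)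
    (l : U →ₗ[k] R) {F : V → W → U → R} (h : ∀ v w u, F v w u = r * (f v * (g w * l u))) :
    sum₃ t F = r * evT f (evT g l) t :=
  sum₃_eq t (LinearMap.mulLeft k r ∘ₗ evT f (evT g l)) (by simpa using h)

theorem sum₂_evT_smul (t : V ⊗[k] W) (r : R) (f : V →ₗ[k] R) (g : W →ₗ[k] R) (n : N)
    {F : V → W → N} (h : ∀ v w, F v w = (r * (f v * g w)) • n) :
    sum₂ t F = (r * evT f g t) • n :=
  sum₂_eq t ((LinearMap.toSpanSingleton R N n).restrictScalars k ∘ₗ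
    LinearMap.mulLeft k r ∘ₗ evT f g) (by simpa using h)

theorem evT_dualDistribEquiv_symm [FiniteDimensional k V] [FiniteDimensional k W]
    (x : R ⊗[k] V) (y : R ⊗[k] W) (F : Module.Dual k (V ⊗[k] W)) :
    evT (ev x) (ev y) ((TensorProduct.dualDistribEquiv k V W).symm F) = ev (x ⊠ y) F := by
  obtain ⟨t, rfl⟩ := (TensorProduct.dualDistribEquiv k V W).surjective F
  rw [LinearEquiv.symm_apply_apply]
  induction t using TensorProduct.induction_on with
  | zero => simp
  | add x y hx hy => simp only [map_add, hx, hy]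
  | tmul φ ψ =>
    have : (TensorProduct.dualDistribEquiv k V W) (φ ⊗ₜ ψ) =
        LinearMap.mul' k k ∘ₗ TensorProduct.map φ ψ := TensorProduct.ext' fun v w => by simp
    rw [this, ev_mul'_map_box, evT_tmul]

end Laws

/-! ### The multiplication of `H* # H` at points -/

section Crossed

variable {k R H : Type*} [Field k] [CommRing R] [Algebra k R] [Ring H] [HopfAlgebra k H]
variable (ω : (WithConv (H ⊗[k] (H ⊗[k] H) →ₗ[k] k))ˣ)

theorem ev_actBoth (X : R ⊗[k] H) (h h' : H) (φ : Module.Dual k H) :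
    ev X (actBoth h φ h') = ev ((1 ⊗ₜ h') * X * (1 ⊗ₜ h)) φ := by
  rw [actBoth, ev_comp]
  congr 2
  induction X using TensorProduct.induction_on with
  | zero => simp
  | tmul r v => simp
  | add x y hx hy => simp only [map_add, hx, hy, mul_add, add_mul]

theorem ev_firstSlot (X : R ⊗[k] H) (θ : WithConv (H ⊗[k] (H ⊗[k] H) →ₗ[k] k)) (x y : H) :
    ev X (firstSlot θ x y) = ev (X ⊠ (1 ⊗ₜ x) ⊠ (1 ⊗ₜ y)) θ.ofConv := by
  rw [firstSlot, ev_comp]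
  congr 2
  induction X using TensorProduct.induction_on with
  | zero => simp
  | tmul r v => simp
  | add x y hx hy => simp only [map_add, hx, hy, add_box]

theorem ev_firstTwoSlots (X Y : R ⊗[k] H) (γ : WithConv (H ⊗[k] (H ⊗[k] H) →ₗ[k] k)) (x : H) :
    ev (X ⊠ Y) (firstTwoSlots γ x) = ev (X ⊠ Y ⊠ (1 ⊗ₜ x)) γ.ofConv := by
  rw [firstTwoSlots, ev_comp]
  congr 2
  induction X, Y using box_induction with
  | zero_left => simp
  | zero_right => simp
  | tmul => simp
  | add_left x x' y h h' => simp only [map_add, h, h', add_box]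
  | add_right x x' y h h' => simp only [map_add, h, h', add_box, box_add]

theorem evD_tmul (g : Point k R H) (φ : Module.Dual k H) (h : H) :
    evD k g (φ ⊗ₜ h) = ev g.val φ • ((1 : R) ⊗ₜ[k] h) := by
  simp [evD, TensorProduct.smul_tmul']

theorem liftBaseChange_evD_box (g : Point k R H) (Φ : R ⊗[k] Module.Dual k H) (X : R ⊗[k] H) :
    LinearMap.liftBaseChange R (evD k g) (Φ ⊠ X) = LinearMap.liftBaseChange R (ev g.val) Φ • X := by
  induction Φ, X using box_induction with
  | zero_left => simp
  | zero_right => simp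
  | tmul r v s w => simp [evD_tmul, TensorProduct.smul_tmul']; congr 1; ring
  | add_left x x' y h h' => simp only [map_add, h, h', add_box, add_smul]
  | add_right x x' y h h' => simp only [map_add, h, h', box_add, smul_add]

/-- The map `h ↦ θ(g; x, h) x h`. -/
def mulArg (g x : Point k R H) : H →ₗ[k] R ⊗[k] H :=
  lift₂ (fun a b => ev (g.val ⊠ x.val ⊠ (1 ⊗ₜ a)) (theta ω).ofConv • (x.val * (1 ⊗ₜ b))) ∘ₗ
    Coalgebra.comul

theorem mulArg_point (g x y : Point k R H) :
    LinearMap.liftBaseChange R (mulArg ω g x) y.val = (tht ω g x y : R) • (x * y).val := by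
  have h : (fun v => mulArg ω g x v) = fun v => sum₂ (Coalgebra.comul (R := k) v) fun a b =>
    ev (g.val ⊠ x.val ⊠ (1 ⊗ₜ a)) (theta ω).ofConv • (x.val * ((1 : R) ⊗ₜ[k] b)) := rfl
  rw [← bind_linear, h, y.isPoint.bind_comul]
  simp only [bind_smul, bind_smul_const, bind_mul_left, bind_one_tmul, bind_ev, bind_box_left,
    ev_theta]
  rfl

theorem ext₂_crossedMul (g : Point k R H) (Φ Ψ : R ⊗[k] Module.Dual k H) (X Y : R ⊗[k] H) :
    ext₂ ((crossedMul ω).compr₂ (evD k g)) (Φ ⊠ X) (Ψ ⊠ Y) =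
      LinearMap.liftBaseChange R (ev g.val) Φ •
      bind X fun h => bind Ψ fun φ' => bind Y fun h' =>
        sum₂ (Coalgebra.comul (R := k) h) fun h₁ t => sum₂ (Coalgebra.comul (R := k) t) fun h₂ t' =>
        sum₂ (Coalgebra.comul (R := k) t') fun h₃ h₄ =>
        sum₂ (Coalgebra.comul (R := k) h') fun h'₁ h'₂ =>
          (ev ((HopfAlgebra.antipode k).baseChange R (1 ⊗ₜ h₂) * g.val * (1 ⊗ₜ h₁)) φ' *
            ev (g.val ⊠ (1 ⊗ₜ h₃) ⊠ (1 ⊗ₜ h'₁)) (theta ω).ofConv) •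
            ((1 ⊗ₜ h₄) * ((1 : R) ⊗ₜ[k] h'₂)) := by
  rw [crossedMul, ext₂_lift₂]
  simp only [map_sum₂, evD_tmul, g.isPoint.ev_conv, ev_actBoth, sigma, ev_firstSlot, mul_assoc,
    mul_smul, one_tmul_mul, one_tmul_apply]
  rw [← bind_evₗ, ← bind_smul_const]
  congr 1
  funext φ
  simp only [sum₂_smul, bind_smul]

/-- Convolution is pointwise at `g`, so the left factor `φ # h` contributes the scalar `φ(g)` and
otherwise behaves as `ε # h`. If `h` is a point `x`, the action on the right factor is conjugation
of `g` by `x`. -/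
theorem mulLaw_crossedMul (g x : Point k R H) :
    MulLaw (B := Module.Dual k H ⊗[k] H) (crossedMul ω) (evD k g) x.val (evD k (x⁻¹ * g * x)) (mulArg ω g x) := by
  have key : ∀ (φ ψ : Module.Dual k H) (h h' : H), evD k g (crossedMul ω (φ ⊗ₜ h) (ψ ⊗ₜ h')) =
      ext₂ (R := R) ((crossedMul ω).compr₂ (evD k g)) ((1 ⊗ₜ φ) ⊠ (1 ⊗ₜ h)) ((1 ⊗ₜ ψ) ⊠ (1 ⊗ₜ h')) := by
    intro φ ψ h h'
    simp
  -- The witness multiplies `ε # h` by `v` and evaluates at `g`.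
  refine ⟨(((crossedMul ω).compr₂ (evD k g)) ∘ₗ
    (TensorProduct.mk k (Module.Dual k H) H Coalgebra.counit)).flip, fun u v => ?_, fun v => ?_⟩
  · induction v using TensorProduct.induction_on with
    | zero => simp
    | add v w hv hw =>
      rw [map_add, map_add, map_add, hv, hw, liftBaseChange_add_map]
    | tmul ψ h' =>
      induction u using TensorProduct.induction_on with
      | zero => simp
      | add v w hv hw => simp only [map_add, LinearMap.add_apply, hv, hw]
      | tmul φ h =>
        rw [evD_tmul, map_smul, LinearMap.liftBaseChange_tmul, one_smul]
        simp only [LinearMap.flip_apply, LinearMap.comp_apply, LinearMap.compr₂_apply,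
          TensorProduct.mk_apply]
        rw [key, key, ext₂_crossedMul, ext₂_crossedMul, smul_smul]
        simp [g.isPoint.counit]
  · induction v using TensorProduct.induction_on with
    | zero => simp
    | add v w hv hw =>
      rw [map_add, map_add, map_add, ← hv, ← hw, liftBaseChange_add_map]
    | tmul ψ h' =>
      rw [evD_tmul, map_smul, LinearMap.liftBaseChange_tmul, one_smul]
      have e : ∀ X : R ⊗[k] H, LinearMap.liftBaseChange R ((((crossedMul ω).compr₂ (evD k g)) ∘ₗ
          (TensorProduct.mk k (Module.Dual k H) H Coalgebra.counit)).flip (ψ ⊗ₜ h')) X =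
          ext₂ ((crossedMul ω).compr₂ (evD k g)) ((1 ⊗ₜ Coalgebra.counit) ⊠ X)
            ((1 ⊗ₜ ψ) ⊠ (1 ⊗ₜ h')) := by
        intro X
        induction X using TensorProduct.induction_on with
        | zero => simp
        | tmul r h => simp
        | add X Y hX hY => rw [map_add, hX, hY, box_add, map_add, LinearMap.add_apply]
      have e' : ∀ F : H → H → R ⊗[k] H, (bind ((1 : R) ⊗ₜ[k] h') fun h' =>
          sum₂ (Coalgebra.comul (R := k) h') F) = sum₂ (Coalgebra.comul (R := k) h') F :=
        fun F => (bind_tmul_linear 1 h' (lift₂ F ∘ₗ Coalgebra.comul)).trans (one_smul _ _)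
      rw [e, ext₂_crossedMul]
      simp only [bind_sum₂, e', x.isPoint.bind_comul]
      simp only [bind_smul_const, bind_mul_left, bind_one_tmul, bind_evₗ,
        bind_ev, bind_box_left, bind_box_right, bind_mul_right', bind_baseChange, bind_smul,
        LinearMap.liftBaseChange_tmul, one_smul, mul_smul, g.isPoint.counit, sum₂_smul]
      rfl

end Crossed

section

/-! ### The structure of `H*` at points -/

section DualEval

variable {k R H : Type*} [Field k] [CommRing R] [Algebra k R] [Ring H] [HopfAlgebra k H]
  [Coalgebra.IsCocomm k H]
variable (ω : (WithConv (H ⊗[k] (H ⊗[k] H) →ₗ[k] k))ˣ)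

theorem ev_dualAntipode (x : Point k R H) (φ : Module.Dual k H) :
    ev x.val (dualAntipode φ) = ev (x⁻¹).val φ :=
  ev_comp _ _ _

theorem ev_one_val (φ : Module.Dual k H) : ev (1 : Point k R H).val φ = algebraMap k R (φ 1) := by
  rw [Point.val_one, Algebra.TensorProduct.one_def, ev_tmul, one_mul]

theorem ev_betaFun (x : Point k R H) : ev x.val (betaFun ω) = om ω x x⁻¹ x := by
  rw [betaFun, ev_comp, LinearMap.baseChange_comp, LinearMap.comp_apply, x.isPoint.comul,
    LinearMap.lTensor, baseChange_map_box, x.isPoint.comul, LinearMap.baseChange_id,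
    LinearMap.id_apply]
  have e : (lift₃ fun h₁ h₂ h₃ : H => ω.1 (h₁ ⊗ₜ[k] (HopfAlgebra.antipode k h₂ ⊗ₜ[k] h₃))) =
      ω.1.ofConv ∘ₗ TensorProduct.map LinearMap.id
        (TensorProduct.map (HopfAlgebra.antipode k) LinearMap.id) :=
    LinearMap.ext fun t => sum₃_eq t _ fun _ _ _ => rfl
  rw [e, ev_comp, baseChange_map_box, baseChange_map_box, LinearMap.baseChange_id,
    LinearMap.id_apply]
  rfl

variable [FiniteDimensional k H]

theorem evT_dualHopfComul (x y : Point k R H) (φ : Module.Dual k H) :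
    evT (ev x.val) (ev y.val) (dualHopfComul φ) = ev (x * y).val φ := by
  rw [dualHopfComul, LinearMap.comp_apply, LinearEquiv.coe_coe, evT_dualDistribEquiv_symm]
  exact (ev_comp _ _ _).trans (by rw [baseChange_mul'_box]; rfl)

theorem evT_dualTriple (x y z : R ⊗[k] H) (θ : WithConv (H ⊗[k] (H ⊗[k] H) →ₗ[k] k)) :
    evT (ev x) (evT (ev y) (ev z)) (dualTriple θ) = ev (x ⊠ y ⊠ z) θ.ofConv := by
  rw [dualTriple, LinearMap.lTensor, evT_map, LinearMap.comp_id,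
    ← evT_dualDistribEquiv_symm x (y ⊠ z)]
  congr 2
  exact LinearMap.ext fun F => evT_dualDistribEquiv_symm y z F

theorem evT_dualTriple_omega (x y z : Point k R H) :
    evT (ev x.val) (evT (ev y.val) (ev z.val)) (dualTriple ω.1) = om ω x y z := by
  rw [evT_dualTriple, ev_om]

theorem evT_dualTriple_omegaInv (x y z : Point k R H) :
    evT (ev x.val) (evT (ev y.val) (ev z.val)) (dualTriple (ω⁻¹).1) = ((om ω x y z)⁻¹ : Rˣ) := by
  rw [evT_dualTriple, ev_om_inv]

end DualEval

section Separation

universe u v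

variable {k : Type u} {H : Type v} [Field k] [Ring H] [HopfAlgebra k H] [Coalgebra.IsCocomm k H]

theorem boxMap_mk_comp {R V W K K' : Type*} [CommRing R] [Algebra k R] [AddCommGroup V]
    [Module k V] [AddCommGroup W] [Module k W] [AddCommGroup K] [Module k K] [AddCommGroup K']
    [Module k K'] (f : V →ₗ[k] R) (g : W →ₗ[k] R) (m : K) (n : K') :
    boxMap ((TensorProduct.mk k R K).flip m ∘ₗ f) ((TensorProduct.mk k R K').flip n ∘ₗ g) =
      (TensorProduct.mk k R (K ⊗[k] K')).flip (m ⊗ₜ n) ∘ₗ evT f g :=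
  TensorProduct.ext' fun v w => by simp

/-- Each evaluation of the probe `p` factors through a functional from the family `P`. -/
def Probe.IsScalar {V K : Type*} [AddCommGroup V] [Module k V] [AddCommGroup K] [Module k K]
    (p : Probe.{u, v} k V K)
    (P : ∀ (R : Type max u v) [CommRing R] [Algebra k R], (V →ₗ[k] R) → Prop) : Prop :=
  ∀ (R : Type max u v) [CommRing R] [Algebra k R] (E : V →ₗ[k] R ⊗[k] K), p.mem R E →
    ∃ f n, P R f ∧ E = (TensorProduct.mk k R K).flip n ∘ₗ f

theorem Probe.IsScalar.tensor {V W K K' : Type*} [AddCommGroup V] [Module k V] [AddCommGroup W]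
    [Module k W] [AddCommGroup K] [Module k K] [AddCommGroup K'] [Module k K']
    {p : Probe.{u, v} k V K} {p' : Probe.{u, v} k W K'}
    {P : ∀ (R : Type max u v) [CommRing R] [Algebra k R], (V →ₗ[k] R) → Prop}
    {P' : ∀ (R : Type max u v) [CommRing R] [Algebra k R], (W →ₗ[k] R) → Prop}
    (h : p.IsScalar P) (h' : p'.IsScalar P') :
    (p.tensor p').IsScalar fun R _ _ f => ∃ f₁ f₂, P R f₁ ∧ P' R f₂ ∧ f = evT f₁ f₂ := by
  rintro R _ _ _ ⟨E, E', hE, hE', rfl⟩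
  obtain ⟨f, n, hf, rfl⟩ := h R E hE
  obtain ⟨f', n', hf', rfl⟩ := h' R E' hE'
  exact ⟨_, _, ⟨f, f', hf, hf', rfl⟩, boxMap_mk_comp f f' n n'⟩

theorem Probe.IsScalar.ext {V K : Type*} [AddCommGroup V] [Module k V] [AddCommGroup K]
    [Module k K] {p : Probe.{u, v} k V K}
    {P : ∀ (R : Type max u v) [CommRing R] [Algebra k R], (V →ₗ[k] R) → Prop}
    (h : p.IsScalar P) {s t : V}
    (hst : ∀ (R : Type max u v) [CommRing R] [Algebra k R] (f : V →ₗ[k] R), P R f → f s = f t) :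
    s = t := by
  refine p.ext fun R _ _ E hE => ?_
  obtain ⟨f, n, hf, rfl⟩ := h R E hE
  rw [LinearMap.comp_apply, hst R f hf, LinearMap.comp_apply]

variable [FiniteDimensional k H]

theorem Probe.dual_isScalar : (Probe.dual.{u, v} k H).IsScalar
    fun R _ _ f => ∃ x : Point k R H, f = ev x.val := by
  rintro R _ _ _ ⟨x, rfl⟩
  exact ⟨_, 1, ⟨x, rfl⟩, LinearMap.ext fun φ => rfl⟩

theorem dual_ext {φ ψ : Module.Dual k H} (h : ∀ (R : Type max u v) [CommRing R] [Algebra k R]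
    (x : Point k R H), ev x.val φ = ev x.val ψ) : φ = ψ := by
  refine Probe.dual_isScalar.ext ?_
  rintro R _ _ _ ⟨x, rfl⟩
  exact h R x

theorem dual_ext₂ {s t : Module.Dual k H ⊗[k] Module.Dual k H}
    (h : ∀ (R : Type max u v) [CommRing R] [Algebra k R] (x y : Point k R H),
      evT (ev x.val) (ev y.val) s = evT (ev x.val) (ev y.val) t) : s = t := by
  refine (Probe.dual_isScalar.tensor Probe.dual_isScalar).ext ?_
  rintro R _ _ _ ⟨_, _, ⟨x, rfl⟩, ⟨y, rfl⟩, rfl⟩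
  exact h R x y

theorem dual_ext₃ {s t : Module.Dual k H ⊗[k] (Module.Dual k H ⊗[k] Module.Dual k H)}
    (h : ∀ (R : Type max u v) [CommRing R] [Algebra k R] (x y z : Point k R H),
      evT (ev x.val) (evT (ev y.val) (ev z.val)) s =
        evT (ev x.val) (evT (ev y.val) (ev z.val)) t) : s = t := by
  refine (Probe.dual_isScalar.tensor (Probe.dual_isScalar.tensor Probe.dual_isScalar)).ext ?_
  rintro R _ _ _ ⟨_, _, ⟨x, rfl⟩, ⟨_, _, ⟨y, rfl⟩, ⟨z, rfl⟩, rfl⟩, rfl⟩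
  exact h R x y z

theorem dual_ext₄ {s t : Module.Dual k H ⊗[k] (Module.Dual k H ⊗[k] (Module.Dual k H ⊗[k]
      Module.Dual k H))}
    (h : ∀ (R : Type max u v) [CommRing R] [Algebra k R] (x y z a : Point k R H),
      evT (ev x.val) (evT (ev y.val) (evT (ev z.val) (ev a.val))) s =
        evT (ev x.val) (evT (ev y.val) (evT (ev z.val) (ev a.val))) t) : s = t := by
  refine (Probe.dual_isScalar.tensor (Probe.dual_isScalar.tensor
    (Probe.dual_isScalar.tensor Probe.dual_isScalar))).ext ?_
  rintro R _ _ _ ⟨_, _, ⟨x, rfl⟩, ⟨_, _, ⟨y, rfl⟩, ⟨_, _, ⟨z, rfl⟩, ⟨a, rfl⟩, rfl⟩, rfl⟩, rfl⟩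
  exact h R x y z a

end Separation

/-! ### `H*_ω` is a quasi-Hopf algebra -/

section Omega

universe u v
variable {k : Type u} {H : Type v} [Field k] [Ring H] [HopfAlgebra k H] [Coalgebra.IsCocomm k H]
  [FiniteDimensional k H]
variable (ω : (WithConv (H ⊗[k] (H ⊗[k] H) →ₗ[k] k))ˣ)

section
variable {R : Type*} [CommRing R] [Algebra k R]

theorem dualOmega_mul : (dualOmega ω).mul = conv := rfl
theorem dualOmega_one : (dualOmega ω).one = Coalgebra.counit (R := k) := rfl
theorem dualOmega_comul : (dualOmega ω).comul = dualHopfComul := rfl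
theorem dualOmega_counit (φ : Module.Dual k H) : (dualOmega ω).counit φ = φ 1 := rfl
theorem dualOmega_reassoc : (dualOmega ω).reassoc = dualTriple (ω⁻¹).1 := rfl
theorem dualOmega_reassocInv : (dualOmega ω).reassocInv = dualTriple ω.1 := rfl
theorem dualOmega_antipode : (dualOmega ω).antipode = dualAntipode := rfl
theorem dualOmega_alpha : (dualOmega ω).alpha = Coalgebra.counit (R := k) := rfl
theorem dualOmega_beta : (dualOmega ω).beta = betaFun ω := rfl

theorem Point.ev_conv (x : Point k R H) (φ ψ : Module.Dual k H) :
    ev x.val (conv φ ψ) = ev x.val φ * ev x.val ψ := x.isPoint.ev_conv φ ψ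

theorem Point.ev_counit (x : Point k R H) : ev x.val (Coalgebra.counit (R := k)) = 1 :=
  x.isPoint.counit

theorem dualOmega_mul₂ (x y : Point k R H) (s t : Module.Dual k H ⊗[k] Module.Dual k H) :
    evT (ev x.val) (ev y.val) ((dualOmega ω).mul₂ s t) =
      evT (ev x.val) (ev y.val) s * evT (ev x.val) (ev y.val) t :=
  evT_map₂ x.ev_conv y.ev_conv s t

theorem dualOmega_mul₃ (x y z : Point k R H)
    (s t : Module.Dual k H ⊗[k] (Module.Dual k H ⊗[k] Module.Dual k H)) :
    evT (ev x.val) (evT (ev y.val) (ev z.val)) ((dualOmega ω).mul₃ s t) =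
      evT (ev x.val) (evT (ev y.val) (ev z.val)) s *
        evT (ev x.val) (evT (ev y.val) (ev z.val)) t :=
  evT_map₂ x.ev_conv (dualOmega_mul₂ ω y z) s t

theorem dualOmega_mul₄ (x y z a : Point k R H)
    (s t : Module.Dual k H ⊗[k] (Module.Dual k H ⊗[k] (Module.Dual k H ⊗[k] Module.Dual k H))) :
    evT (ev x.val) (evT (ev y.val) (evT (ev z.val) (ev a.val))) ((dualOmega ω).mul₄ s t) =
      evT (ev x.val) (evT (ev y.val) (evT (ev z.val) (ev a.val))) s *
        evT (ev x.val) (evT (ev y.val) (evT (ev z.val) (ev a.val))) t :=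
  evT_map₂ x.ev_conv (dualOmega_mul₃ ω y z a) s t

end

variable {ω}

/-- Tested at points, the product of `H*` is pointwise and its coproduct is the group law.
Conjugation by the reassociator is trivial because its values lie in a commutative ring; the
pentagon is the cocycle identity, and the axioms joining antipode and reassociator come from the
choice of `β` and `inv_mid`. -/
theorem IsNormalizedThreeCocycle.dualOmega_isQuasiHopf (hω : IsNormalizedThreeCocycle ω) :
    (dualOmega ω).IsQuasiHopf where
  mul_assoc a b c := dual_ext fun R _ _ x => by
    simp only [dualOmega_mul, x.ev_conv, mul_assoc]
  one_mul a := dual_ext fun R _ _ x => by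
    simp only [dualOmega_mul, dualOmega_one, x.ev_conv, x.ev_counit, one_mul]
  mul_one a := dual_ext fun R _ _ x => by
    simp only [dualOmega_mul, dualOmega_one, x.ev_conv, x.ev_counit, mul_one]
  comul_mul a b := dual_ext₂ fun R _ _ x y => by
    simp only [dualOmega_mul, dualOmega_mul₂, dualOmega_comul, evT_dualHopfComul, Point.ev_conv]
  comul_one := dual_ext₂ fun R _ _ x y => by
    simp only [dualOmega_one, dualOmega_comul, evT_dualHopfComul, Point.ev_counit, evT_tmul,
      mul_one]
  counit_mul a b := by
    have := (1 : Point k k H).ev_conv a b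
    change (conv a b) 1 = a 1 * b 1
    simpa only [ev_one_val, Algebra.algebraMap_self, RingHom.id_apply] using this
  counit_one := by
    have := (1 : Point k k H).ev_counit
    change Coalgebra.counit (R := k) (1 : H) = 1
    simpa only [ev_one_val, Algebra.algebraMap_self, RingHom.id_apply] using this
  counit_comul a := dual_ext fun R _ _ x => by
    rw [map_sum₂, sum₂_evT _ 1 (ev (1 : Point k R H).val) (ev x.val), dualOmega_comul,
      evT_dualHopfComul, one_mul, one_mul]
    intro v w
    rw [map_smul, dualOmega_counit, ev_one_val, one_mul, Algebra.smul_def]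
  comul_counit a := dual_ext fun R _ _ x => by
    rw [map_sum₂, sum₂_evT _ 1 (ev x.val) (ev (1 : Point k R H).val), dualOmega_comul,
      evT_dualHopfComul, mul_one, one_mul]
    intro v w
    rw [map_smul, dualOmega_counit, ev_one_val, one_mul, Algebra.smul_def, mul_comm]
  reassoc_mul_inv := dual_ext₃ fun R _ _ x y z => by
    simp only [dualOmega_mul₃, dualOmega_reassoc, dualOmega_reassocInv, evT_dualTriple_omegaInv,
      dualOmega_one, evT_tmul, Point.ev_counit, mul_one]
    rw [evT_dualTriple_omega, Units.inv_mul]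
  inv_mul_reassoc := dual_ext₃ fun R _ _ x y z => by
    simp only [dualOmega_mul₃, dualOmega_reassoc, dualOmega_reassocInv, evT_dualTriple_omegaInv,
      dualOmega_one, evT_tmul, Point.ev_counit, mul_one]
    rw [evT_dualTriple_omega, Units.mul_inv]
  coassoc a := dual_ext₃ fun R _ _ x y z => by
    simp only [dualOmega_mul₃, dualOmega_reassoc, dualOmega_reassocInv, evT_dualTriple_omegaInv]
    rw [evT_dualTriple_omega]
    simp only [map_sum₂]
    rw [sum₂_evT _ 1 (ev x.val) (ev (y * z).val), sum₂_evT _ 1 (ev (x * y).val) (ev z.val)]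
    · simp only [dualOmega_comul, evT_dualHopfComul, one_mul, mul_assoc]
      rw [mul_comm (ev _ a), Units.inv_mul_cancel_left]
    · intro v w
      rw [sum₂_evT _ (ev z.val w) (ev x.val) (ev y.val)]
      · rw [dualOmega_comul, evT_dualHopfComul]; ring
      · intro b c; simp only [evT_tmul]; ring
    · intro v w
      simp only [evT_tmul, dualOmega_comul, evT_dualHopfComul, one_mul]
  pentagon := dual_ext₄ fun R _ _ x y z t => by
    simp only [dualOmega_mul₄]
    simp only [evT_tmul, map_sum₃, map_sum₂]
    -- Each factor of the pentagon is a sum over the reassociator in which a coproduct multiplies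
    -- two neighbouring points; it collapses to one value of `ω⁻¹`.
    have h₁ := sum₃_evT (dualOmega ω).reassoc 1 (ev x.val) (ev (y * z).val) (ev t.val)
      (F := fun X₁ X₂ X₃ => sum₂ ((dualOmega ω).comul X₂) fun b c =>
        ev x.val X₁ * (ev y.val b * (ev z.val c * ev t.val X₃))) fun X₁ X₂ X₃ => by
        rw [sum₂_evT _ (ev x.val X₁ * ev t.val X₃) (ev y.val) (ev z.val) fun b c => by ring,
          dualOmega_comul, evT_dualHopfComul]; ring
    have h₂ := sum₃_evT (dualOmega ω).reassoc 1 (ev x.val) (ev y.val) (ev z.val)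
      (F := fun X₁ X₂ X₃ => ev x.val X₁ * (ev y.val X₂ * (ev z.val X₃ *
        ev t.val (dualOmega ω).one))) fun X₁ X₂ X₃ => by
        rw [dualOmega_one, t.ev_counit]; ring
    have h₃ := sum₃_evT (dualOmega ω).reassoc 1 (ev x.val) (ev y.val) (ev (z * t).val)
      (F := fun X₁ X₂ X₃ => ev x.val X₁ * (ev y.val X₂ * evT (ev z.val) (ev t.val)
        ((dualOmega ω).comul X₃))) fun X₁ X₂ X₃ => by
        rw [dualOmega_comul, evT_dualHopfComul]; ring
    have h₄ := sum₃_evT (dualOmega ω).reassoc 1 (ev (x * y).val) (ev z.val) (ev t.val)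
      (F := fun X₁ X₂ X₃ => sum₂ ((dualOmega ω).comul X₁) fun b c =>
        ev x.val b * (ev y.val c * (ev z.val X₂ * ev t.val X₃))) fun X₁ X₂ X₃ => by
        rw [sum₂_evT _ (ev z.val X₂ * ev t.val X₃) (ev x.val) (ev y.val) fun b c => by ring,
          dualOmega_comul, evT_dualHopfComul]; ring
    rw [h₁, h₂, h₃, h₄]
    simp only [dualOmega_reassoc, evT_dualTriple_omegaInv, dualOmega_one, Point.ev_counit, one_mul,
      ← Units.val_mul]
    congr 1
    -- The reassociator is `ω⁻¹`, so the pentagon is the inverse of the cocycle identity.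
    have := hω.isGroupCocycle.cocycle x y z t
    apply Additive.ofMul.injective
    simp only [ofMul_mul, ofMul_inv]
    simp only [omA] at this
    linear_combination (norm := abel) this
  normalized := dual_ext₂ fun R _ _ x y => by
    rw [map_sum₃, sum₃_evT _ 1 (ev x.val) (ev (1 : Point k R H).val) (ev y.val)]
    · rw [dualOmega_reassoc, evT_dualTriple_omegaInv, evT_tmul, dualOmega_one, Point.ev_counit,
        Point.ev_counit, mul_one, one_mul]
      have : om ω x 1 y = 1 := hω.isGroupCocycle.one_mid x y
      rw [this, inv_one, Units.val_one]
    · intro X₁ X₂ X₃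
      rw [map_smul, dualOmega_counit, ev_one_val, evT_tmul, Algebra.smul_def]; ring
  antipode_mul a b := dual_ext fun R _ _ x => by
    simp only [dualOmega_mul, dualOmega_antipode, ev_dualAntipode, Point.ev_conv, mul_comm]
  antipode_one := dual_ext fun R _ _ x => by
    simp only [dualOmega_one, dualOmega_antipode, ev_dualAntipode, Point.ev_counit]
  antipode_left a := dual_ext fun R _ _ x => by
    rw [map_sum₂, sum₂_evT _ 1 (ev (x⁻¹).val) (ev x.val), dualOmega_comul, evT_dualHopfComul,
      inv_mul_cancel, ev_one_val, map_smul, dualOmega_counit, dualOmega_alpha, x.ev_counit,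
      Algebra.smul_def]
    · ring
    · intro a b
      simp only [dualOmega_mul, Point.ev_conv, dualOmega_antipode, ev_dualAntipode,
        dualOmega_alpha, Point.ev_counit]
      ring
  antipode_right a := dual_ext fun R _ _ x => by
    rw [map_sum₂, sum₂_evT _ (ev x.val (betaFun ω)) (ev x.val) (ev (x⁻¹).val), dualOmega_comul,
      evT_dualHopfComul, mul_inv_cancel, ev_one_val, map_smul, dualOmega_counit, dualOmega_beta,
      Algebra.smul_def]
    · ring
    · intro a b
      simp only [dualOmega_mul, Point.ev_conv, dualOmega_antipode, ev_dualAntipode,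
        dualOmega_beta]
      ring
  reassoc_antipode := dual_ext fun R _ _ x => by
    rw [map_sum₃, sum₃_evT _ (ev x.val (betaFun ω)) (ev x.val) (ev (x⁻¹).val) (ev x.val),
      dualOmega_reassoc, evT_dualTriple_omegaInv, ev_betaFun, Units.mul_inv, dualOmega_one,
      x.ev_counit]
    intro a b c
    simp only [dualOmega_mul, Point.ev_conv, dualOmega_antipode, ev_dualAntipode,
        dualOmega_beta, dualOmega_alpha, Point.ev_counit]
    ring
  reassocInv_antipode := dual_ext fun R _ _ x => by
    rw [map_sum₃, sum₃_evT _ (ev x.val (betaFun ω)) (ev (x⁻¹).val) (ev x.val) (ev (x⁻¹).val),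
      dualOmega_reassocInv, evT_dualTriple_omega, ev_betaFun, dualOmega_one,
      x.ev_counit, ← Units.val_mul]
    · have : om ω x⁻¹ x x⁻¹ * om ω x x⁻¹ x = 1 := hω.isGroupCocycle.inv_mid x
      rw [mul_comm, this, Units.val_one]
    · intro a b c
      simp only [dualOmega_mul, Point.ev_conv, dualOmega_antipode, ev_dualAntipode,
        dualOmega_beta, dualOmega_alpha, Point.ev_counit]
      ring

end Omega

end

/-! ### Sweedler sums written as linear maps, and their naturality -/

section Composites

variable {k V W U X M N : Type*} [Field k]
  [AddCommGroup V] [Module k V] [AddCommGroup W] [Module k W] [AddCommGroup U] [Module k U]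
  [AddCommGroup X] [Module k X] [AddCommMonoid M] [Module k M] [AddCommMonoid N] [Module k N]

theorem sum₂_comul_right (C : W →ₗ[k] U) (t : V ⊗[k] W) :
    (sum₂ t fun a b => a ⊗ₜ[k] C b) = TensorProduct.map LinearMap.id C t :=
  sum₂_eq t _ fun _ _ => rfl

theorem sum₂_assoc (s : V ⊗[k] W) (u : U) :
    (sum₂ s fun b c => b ⊗ₜ[k] (c ⊗ₜ[k] u)) = TensorProduct.assoc k V W U (s ⊗ₜ u) :=
  sum₂_eq s ((TensorProduct.assoc k V W U).toLinearMap ∘ₗ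
    (TensorProduct.mk k (V ⊗[k] W) U).flip u) fun _ _ => rfl

theorem sum₂_comul_left (C : X →ₗ[k] V ⊗[k] W) (t : X ⊗[k] U) :
    (sum₂ t fun a d => sum₂ (C a) fun b c => b ⊗ₜ[k] (c ⊗ₜ[k] d)) =
      TensorProduct.assoc k V W U (TensorProduct.map C LinearMap.id t) :=
  sum₂_eq t ((TensorProduct.assoc k V W U).toLinearMap ∘ₗ TensorProduct.map C LinearMap.id)
    fun _ _ => sum₂_assoc _ _

theorem sum₂_smul_left (f : V →ₗ[k] k) (t : V ⊗[k] W) :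
    (sum₂ t fun a b => f a • b) = TensorProduct.lid k W (TensorProduct.map f LinearMap.id t) :=
  sum₂_eq t ((TensorProduct.lid k W).toLinearMap ∘ₗ TensorProduct.map f LinearMap.id)
    fun _ _ => by simp

theorem sum₂_smul_right (f : W →ₗ[k] k) (t : V ⊗[k] W) :
    (sum₂ t fun a b => f b • a) = TensorProduct.rid k V (TensorProduct.map LinearMap.id f t) :=
  sum₂_eq t ((TensorProduct.rid k V).toLinearMap ∘ₗ TensorProduct.map LinearMap.id f)
    fun _ _ => by simp

theorem sum₂_insert_mid (e : W) (t : V ⊗[k] U) :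
    (sum₂ t fun a b => a ⊗ₜ[k] (e ⊗ₜ[k] b)) =
      TensorProduct.map LinearMap.id (TensorProduct.mk k W U e) t :=
  sum₂_eq t _ fun _ _ => rfl

theorem sum₂_insert_right (e : U) (t : V ⊗[k] W) :
    (sum₂ t fun a b => a ⊗ₜ[k] (b ⊗ₜ[k] e)) =
      TensorProduct.map LinearMap.id ((TensorProduct.mk k W U).flip e) t :=
  sum₂_eq t _ fun _ _ => rfl

theorem sum₃_rotate (t : V ⊗[k] (W ⊗[k] U)) :
    (sum₃ t fun a b c => b ⊗ₜ[k] (c ⊗ₜ[k] a)) =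
      TensorProduct.assoc k W U V (TensorProduct.comm k V (W ⊗[k] U) t) :=
  sum₃_eq t ((TensorProduct.assoc k W U V).toLinearMap ∘ₗ
    (TensorProduct.comm k V (W ⊗[k] U)).toLinearMap) fun _ _ _ => rfl

theorem sum₃_rotate_inv (t : V ⊗[k] (W ⊗[k] U)) :
    (sum₃ t fun a b c => c ⊗ₜ[k] (a ⊗ₜ[k] b)) =
      TensorProduct.comm k (V ⊗[k] W) U ((TensorProduct.assoc k V W U).symm t) :=
  sum₃_eq t ((TensorProduct.comm k (V ⊗[k] W) U).toLinearMap ∘ₗ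
    (TensorProduct.assoc k V W U).symm.toLinearMap) fun _ _ _ => rfl

theorem sum₃_swap_right (t : V ⊗[k] (W ⊗[k] U)) :
    (sum₃ t fun a b c => a ⊗ₜ[k] (c ⊗ₜ[k] b)) =
      TensorProduct.map LinearMap.id (TensorProduct.comm k W U).toLinearMap t :=
  sum₃_eq t _ fun _ _ _ => rfl

theorem sum₃_swap_left (t : V ⊗[k] (W ⊗[k] U)) :
    (sum₃ t fun a b c => b ⊗ₜ[k] (a ⊗ₜ[k] c)) =
      TensorProduct.assoc k W V U (TensorProduct.map (TensorProduct.comm k V W).toLinearMap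
        LinearMap.id ((TensorProduct.assoc k V W U).symm t)) :=
  sum₃_eq t ((TensorProduct.assoc k W V U).toLinearMap ∘ₗ
    TensorProduct.map (TensorProduct.comm k V W).toLinearMap LinearMap.id ∘ₗ
    (TensorProduct.assoc k V W U).symm.toLinearMap) fun _ _ _ => rfl

/-- Naturality of Sweedler-type sums. -/
theorem map_sum₂_eq {V' W' : Type*} [AddCommGroup V'] [Module k V'] [AddCommGroup W']
    [Module k W'] (l : M →ₗ[k] N) (i : V →ₗ[k] V') (j : W →ₗ[k] W') (t : V ⊗[k] W)
    {F : V → W → M} {F' : V' → W' → N} (L : V' ⊗[k] W' →ₗ[k] N)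
    (hL : ∀ a b, F' a b = L (a ⊗ₜ b)) (h : ∀ a b, l (F a b) = F' (i a) (j b)) :
    l (sum₂ t F) = sum₂ (TensorProduct.map i j t) F' := by
  rw [map_sum₂, sum₂_eq _ L hL]
  exact sum₂_eq t (L ∘ₗ TensorProduct.map i j) fun a b => by rw [h, hL]; rfl

theorem map_sum₃_eq {V' W' U' : Type*} [AddCommGroup V'] [Module k V'] [AddCommGroup W']
    [Module k W'] [AddCommGroup U'] [Module k U'] (l : M →ₗ[k] N) (i : V →ₗ[k] V')
    (j : W →ₗ[k] W') (r : U →ₗ[k] U') (t : V ⊗[k] (W ⊗[k] U))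
    {F : V → W → U → M} {F' : V' → W' → U' → N} (L : V' ⊗[k] (W' ⊗[k] U') →ₗ[k] N)
    (hL : ∀ a b c, F' a b c = L (a ⊗ₜ (b ⊗ₜ c)))
    (h : ∀ a b c, l (F a b c) = F' (i a) (j b) (r c)) :
    l (sum₃ t F) = sum₃ (TensorProduct.map i (TensorProduct.map j r) t) F' := by
  rw [map_sum₃, sum₃_eq _ L hL]
  exact sum₃_eq t (L ∘ₗ TensorProduct.map i (TensorProduct.map j r)) fun a b c => by
    rw [h, hL]; rfl

theorem map_map₂ {V' W' : Type*} [AddCommGroup V'] [Module k V'] [AddCommGroup W'] [Module k W']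
    {i : V →ₗ[k] V'} {j : W →ₗ[k] W'} {m : V →ₗ[k] V →ₗ[k] V} {n : W →ₗ[k] W →ₗ[k] W}
    {m' : V' →ₗ[k] V' →ₗ[k] V'} {n' : W' →ₗ[k] W' →ₗ[k] W'}
    (hm : ∀ a b, i (m a b) = m' (i a) (i b)) (hn : ∀ a b, j (n a b) = n' (j a) (j b))
    (s t : V ⊗[k] W) : TensorProduct.map i j (TensorProduct.map₂ m n s t) =
      TensorProduct.map₂ m' n' (TensorProduct.map i j s) (TensorProduct.map i j t) := by
  induction s using TensorProduct.induction_on with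
  | zero => simp
  | add x y hx hy => simp only [map_add, LinearMap.add_apply, hx, hy]
  | tmul a b =>
    induction t using TensorProduct.induction_on with
    | zero => simp
    | add x y hx hy => simp only [map_add, hx, hy]
    | tmul c d => simp [hm, hn]

end Composites

/-! ### Transport of the axioms along homomorphisms -/

namespace QuasiHopfData

variable {k A B : Type*} [Field k] [AddCommGroup A] [Module k A] [AddCommGroup B] [Module k B]

/-- A linear map compatible with the structure maps and the distinguished elements. -/
structure IsHom (Q : QuasiHopfData k A) (Q' : QuasiHopfData k B) (i : A →ₗ[k] B) : Prop where
  map_mul : ∀ a b, i (Q.mul a b) = Q'.mul (i a) (i b)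
  map_one : i Q.one = Q'.one
  map_comul : ∀ a, TensorProduct.map i i (Q.comul a) = Q'.comul (i a)
  map_counit : ∀ a, Q'.counit (i a) = Q.counit a
  map_reassoc : TensorProduct.map i (TensorProduct.map i i) Q.reassoc = Q'.reassoc
  map_reassocInv : TensorProduct.map i (TensorProduct.map i i) Q.reassocInv = Q'.reassocInv
  map_antipode : ∀ a, i (Q.antipode a) = Q'.antipode (i a)
  map_alpha : i Q.alpha = Q'.alpha
  map_beta : i Q.beta = Q'.beta

namespace IsHom

variable {Q : QuasiHopfData k A} {Q' : QuasiHopfData k B} {i : A →ₗ[k] B} (h : Q.IsHom Q' i)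
include h

theorem map_mul₂ (s t : A ⊗[k] A) : TensorProduct.map i i (Q.mul₂ s t) =
    Q'.mul₂ (TensorProduct.map i i s) (TensorProduct.map i i t) :=
  map_map₂ h.map_mul h.map_mul s t

theorem map_mul₃ (s t : A ⊗[k] (A ⊗[k] A)) :
    TensorProduct.map i (TensorProduct.map i i) (Q.mul₃ s t) =
    Q'.mul₃ (TensorProduct.map i (TensorProduct.map i i) s)
      (TensorProduct.map i (TensorProduct.map i i) t) :=
  map_map₂ h.map_mul h.map_mul₂ s t

theorem map_mul₄ (s t : A ⊗[k] (A ⊗[k] (A ⊗[k] A))) :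
    TensorProduct.map i (TensorProduct.map i (TensorProduct.map i i)) (Q.mul₄ s t) =
    Q'.mul₄ (TensorProduct.map i (TensorProduct.map i (TensorProduct.map i i)) s)
      (TensorProduct.map i (TensorProduct.map i (TensorProduct.map i i)) t) :=
  map_map₂ h.map_mul h.map_mul₃ s t

/-- Axioms that concern only distinguished elements pass along every homomorphism, surjective or
not. They are kept separate because they are also applied to the inclusion of `H*_ω` into `D^ω(H)`.
-/
theorem comul_one (hQ : Q.comul Q.one = Q.one ⊗ₜ Q.one) :
    Q'.comul Q'.one = Q'.one ⊗ₜ Q'.one := by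
  rw [← h.map_one, ← h.map_comul, hQ, TensorProduct.map_tmul]

theorem reassoc_mul_inv (hQ : Q.mul₃ Q.reassoc Q.reassocInv = Q.one ⊗ₜ (Q.one ⊗ₜ Q.one)) :
    Q'.mul₃ Q'.reassoc Q'.reassocInv = Q'.one ⊗ₜ (Q'.one ⊗ₜ Q'.one) := by
  rw [← h.map_one, ← h.map_reassoc, ← h.map_reassocInv, ← h.map_mul₃, hQ]; rfl

theorem inv_mul_reassoc (hQ : Q.mul₃ Q.reassocInv Q.reassoc = Q.one ⊗ₜ (Q.one ⊗ₜ Q.one)) :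
    Q'.mul₃ Q'.reassocInv Q'.reassoc = Q'.one ⊗ₜ (Q'.one ⊗ₜ Q'.one) := by
  rw [← h.map_one, ← h.map_reassoc, ← h.map_reassocInv, ← h.map_mul₃, hQ]; rfl

theorem map_comul_left (t : A ⊗[k] A) :
    TensorProduct.map i (TensorProduct.map i i)
      (sum₂ t fun a₁ a₂ => sum₂ (Q.comul a₁) fun b c => b ⊗ₜ[k] (c ⊗ₜ[k] a₂)) =
    sum₂ (TensorProduct.map i i t) fun a₁ a₂ =>
      sum₂ (Q'.comul a₁) fun b c => b ⊗ₜ[k] (c ⊗ₜ[k] a₂) := by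
  refine map_sum₂_eq _ i i t ((TensorProduct.assoc k B B B).toLinearMap ∘ₗ
    TensorProduct.map Q'.comul LinearMap.id) (fun a b => sum₂_assoc _ _) fun a b => ?_
  rw [sum₂_assoc, sum₂_assoc, TensorProduct.map_map_assoc, TensorProduct.map_tmul, h.map_comul]

theorem map_comul_right (t : A ⊗[k] A) :
    TensorProduct.map i (TensorProduct.map i i) (sum₂ t fun a₁ a₂ => a₁ ⊗ₜ[k] Q.comul a₂) =
    sum₂ (TensorProduct.map i i t) fun a₁ a₂ => a₁ ⊗ₜ[k] Q'.comul a₂ :=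
  map_sum₂_eq _ i i t (TensorProduct.map LinearMap.id Q'.comul) (fun _ _ => rfl) fun a b => by
    rw [TensorProduct.map_tmul, h.map_comul]

theorem pentagon (hQ : Q.IsQuasiHopf) :
    Q'.mul₄
      (Q'.mul₄ (Q'.one ⊗ₜ[k] Q'.reassoc)
        (sum₃ Q'.reassoc fun X₁ X₂ X₃ =>
          sum₂ (Q'.comul X₂) fun b c => X₁ ⊗ₜ[k] (b ⊗ₜ[k] (c ⊗ₜ[k] X₃))))
      (sum₃ Q'.reassoc fun X₁ X₂ X₃ => X₁ ⊗ₜ[k] (X₂ ⊗ₜ[k] (X₃ ⊗ₜ[k] Q'.one))) =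
    Q'.mul₄
      (sum₃ Q'.reassoc fun X₁ X₂ X₃ => X₁ ⊗ₜ[k] (X₂ ⊗ₜ[k] Q'.comul X₃))
      (sum₃ Q'.reassoc fun X₁ X₂ X₃ =>
        sum₂ (Q'.comul X₁) fun b c => b ⊗ₜ[k] (c ⊗ₜ[k] (X₂ ⊗ₜ[k] X₃))) := by
  let i₂ := TensorProduct.map i i
  let i₃ := TensorProduct.map i i₂
  let i₄ := TensorProduct.map i i₃
  have h₁ : i₄ (sum₃ Q.reassoc fun X₁ X₂ X₃ =>
      sum₂ (Q.comul X₂) fun b c => X₁ ⊗ₜ[k] (b ⊗ₜ[k] (c ⊗ₜ[k] X₃))) =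
      sum₃ (i₃ Q.reassoc) fun X₁ X₂ X₃ =>
          sum₂ (Q'.comul X₂) fun b c => X₁ ⊗ₜ[k] (b ⊗ₜ[k] (c ⊗ₜ[k] X₃)) := by
    refine map_sum₃_eq _ i i i _ (TensorProduct.map LinearMap.id
      ((TensorProduct.assoc k B B B).toLinearMap ∘ₗ TensorProduct.map Q'.comul LinearMap.id))
      (fun a b c => ?_) fun a b c => ?_
    · exact (map_sum₂ (TensorProduct.mk k B (B ⊗[k] (B ⊗[k] B)) a) _ _).symm.trans
        (congrArg _ (sum₂_assoc _ _))
    · rw [← h.map_comul]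
      exact map_sum₂_eq i₄ i i _ (TensorProduct.mk k B (B ⊗[k] (B ⊗[k] B)) (i a) ∘ₗ
        (TensorProduct.assoc k B B B).toLinearMap ∘ₗ (TensorProduct.mk k (B ⊗[k] B) B).flip (i c))
        (fun _ _ => rfl) fun _ _ => rfl
  have h₂ : i₄ (sum₃ Q.reassoc fun X₁ X₂ X₃ => X₁ ⊗ₜ[k] (X₂ ⊗ₜ[k] (X₃ ⊗ₜ[k] Q.one))) =
      sum₃ (i₃ Q.reassoc) fun X₁ X₂ X₃ => X₁ ⊗ₜ[k] (X₂ ⊗ₜ[k] (X₃ ⊗ₜ[k] Q'.one)) :=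
    map_sum₃_eq _ i i i _ (TensorProduct.map LinearMap.id (TensorProduct.map LinearMap.id
      ((TensorProduct.mk k B B).flip Q'.one))) (fun _ _ _ => rfl) fun a b c => by
      rw [← h.map_one]; rfl
  have h₃ : i₄ (sum₃ Q.reassoc fun X₁ X₂ X₃ => X₁ ⊗ₜ[k] (X₂ ⊗ₜ[k] Q.comul X₃)) =
      sum₃ (i₃ Q.reassoc) fun X₁ X₂ X₃ => X₁ ⊗ₜ[k] (X₂ ⊗ₜ[k] Q'.comul X₃) :=
    map_sum₃_eq _ i i i _ (TensorProduct.map LinearMap.id (TensorProduct.map LinearMap.id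
      Q'.comul)) (fun _ _ _ => rfl) fun a b c => by
      rw [← h.map_comul]; rfl
  have h₄ : i₄ (sum₃ Q.reassoc fun X₁ X₂ X₃ =>
      sum₂ (Q.comul X₁) fun b c => b ⊗ₜ[k] (c ⊗ₜ[k] (X₂ ⊗ₜ[k] X₃))) =
      sum₃ (i₃ Q.reassoc) fun X₁ X₂ X₃ =>
        sum₂ (Q'.comul X₁) fun b c => b ⊗ₜ[k] (c ⊗ₜ[k] (X₂ ⊗ₜ[k] X₃)) := by
    refine map_sum₃_eq _ i i i _ ((TensorProduct.assoc k B B (B ⊗[k] B)).toLinearMap ∘ₗ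
      TensorProduct.map Q'.comul LinearMap.id) (fun a b c => sum₂_assoc _ _) fun a b c => ?_
    rw [← h.map_comul]
    exact map_sum₂_eq i₄ i i _ ((TensorProduct.assoc k B B (B ⊗[k] B)).toLinearMap ∘ₗ
      (TensorProduct.mk k (B ⊗[k] B) (B ⊗[k] B)).flip (i b ⊗ₜ i c))
      (fun _ _ => rfl) fun _ _ => rfl
  have h₅ : i₄ (Q.one ⊗ₜ[k] Q.reassoc) = Q'.one ⊗ₜ[k] i₃ Q.reassoc := by
    rw [← h.map_one]; rfl
  rw [← h.map_reassoc, ← h₁, ← h₂, ← h₃, ← h₄, ← h₅, ← h.map_mul₄, ← h.map_mul₄, ← h.map_mul₄,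
    hQ.pentagon]

theorem normalized (hQ : Q.IsQuasiHopf) :
    (sum₃ Q'.reassoc fun X₁ X₂ X₃ => Q'.counit X₂ • (X₁ ⊗ₜ[k] X₃)) = Q'.one ⊗ₜ Q'.one := by
  rw [← h.map_reassoc, ← h.map_one, ← TensorProduct.map_tmul, ← hQ.normalized]
  refine (map_sum₃_eq _ i i i _ (TensorProduct.map LinearMap.id
    ((TensorProduct.lid k B).toLinearMap ∘ₗ TensorProduct.map Q'.counit LinearMap.id))
    (fun a b c => by simp) fun a b c => ?_).symm
  rw [map_smul, h.map_counit]; rfl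

theorem map_antipode_left (t : A ⊗[k] A) :
    i (sum₂ t fun a₁ a₂ => Q.mul (Q.mul (Q.antipode a₁) Q.alpha) a₂) =
      sum₂ (TensorProduct.map i i t) fun a₁ a₂ =>
        Q'.mul (Q'.mul (Q'.antipode a₁) Q'.alpha) a₂ :=
  map_sum₂_eq i i i _ (TensorProduct.lift (Q'.mul ∘ₗ Q'.mul.flip Q'.alpha ∘ₗ Q'.antipode))
    (fun _ _ => rfl) fun a b => by simp only [h.map_mul, h.map_antipode, h.map_alpha]

theorem map_antipode_right (t : A ⊗[k] A) :
    i (sum₂ t fun a₁ a₂ => Q.mul (Q.mul a₁ Q.beta) (Q.antipode a₂)) =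
      sum₂ (TensorProduct.map i i t) fun a₁ a₂ =>
        Q'.mul (Q'.mul a₁ Q'.beta) (Q'.antipode a₂) :=
  map_sum₂_eq i i i _ (TensorProduct.lift ((Q'.mul ∘ₗ Q'.mul.flip Q'.beta).compl₂ Q'.antipode))
    (fun _ _ => rfl) fun a b => by simp only [h.map_mul, h.map_antipode, h.map_beta]

theorem reassoc_antipode (hQ : Q.IsQuasiHopf) :
    (sum₃ Q'.reassoc fun X₁ X₂ X₃ =>
      Q'.mul (Q'.mul (Q'.mul (Q'.mul X₁ Q'.beta) (Q'.antipode X₂)) Q'.alpha) X₃) = Q'.one := by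
  rw [← h.map_reassoc, ← h.map_one, ← hQ.reassoc_antipode]
  refine (map_sum₃_eq i i i i _ (TensorProduct.lift Q'.mul ∘ₗ TensorProduct.map
    (Q'.mul.flip Q'.alpha ∘ₗ TensorProduct.lift
      ((Q'.mul ∘ₗ Q'.mul.flip Q'.beta).compl₂ Q'.antipode)) LinearMap.id ∘ₗ
    (TensorProduct.assoc k B B B).symm.toLinearMap) (fun a b c => rfl) fun a b c => ?_).symm
  simp only [h.map_mul, h.map_antipode, h.map_beta, h.map_alpha]
  rfl

theorem reassocInv_antipode (hQ : Q.IsQuasiHopf) :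
    (sum₃ Q'.reassocInv fun x₁ x₂ x₃ =>
      Q'.mul (Q'.mul (Q'.mul (Q'.mul (Q'.antipode x₁) Q'.alpha) x₂) Q'.beta) (Q'.antipode x₃)) =
      Q'.one := by
  rw [← h.map_reassocInv, ← h.map_one, ← hQ.reassocInv_antipode]
  refine (map_sum₃_eq i i i i _ (TensorProduct.lift (Q'.mul.compl₂ Q'.antipode) ∘ₗ
    TensorProduct.map (Q'.mul.flip Q'.beta ∘ₗ TensorProduct.lift
      (Q'.mul ∘ₗ Q'.mul.flip Q'.alpha ∘ₗ Q'.antipode)) LinearMap.id ∘ₗ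
    (TensorProduct.assoc k B B B).symm.toLinearMap) (fun a b c => rfl) fun a b c => ?_).symm
  simp only [h.map_mul, h.map_antipode, h.map_beta, h.map_alpha]
  rfl

/-- Surjectivity serves only the axioms quantified over elements, whose arguments are replaced by
images. -/
theorem isQuasiHopf (hi : Function.Surjective i) (hQ : Q.IsQuasiHopf) : Q'.IsQuasiHopf where
  mul_assoc := by
    simp only [hi.forall, ← h.map_mul, hQ.mul_assoc, implies_true]
  one_mul := by
    simp only [hi.forall, ← h.map_mul, ← h.map_one, hQ.one_mul, implies_true]
  mul_one := by
    simp only [hi.forall, ← h.map_mul, ← h.map_one, hQ.mul_one, implies_true]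
  comul_mul := by
    simp only [hi.forall, ← h.map_mul, ← h.map_comul, hQ.comul_mul, h.map_mul₂, implies_true]
  comul_one := h.comul_one hQ.comul_one
  counit_mul := by
    simp only [hi.forall, ← h.map_mul, h.map_counit, hQ.counit_mul, implies_true]
  counit_one := by rw [← h.map_one, h.map_counit, hQ.counit_one]
  counit_comul := hi.forall.2 fun a => by
    rw [← h.map_comul]
    conv_rhs => rw [← hQ.counit_comul a]
    exact (map_sum₂_eq i i i _ (TensorProduct.lid k B ∘ₗ
      TensorProduct.map Q'.counit LinearMap.id) (fun _ _ => by simp)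
      fun a b => by rw [map_smul, h.map_counit]).symm
  comul_counit := hi.forall.2 fun a => by
    rw [← h.map_comul]
    conv_rhs => rw [← hQ.comul_counit a]
    exact (map_sum₂_eq i i i _ (TensorProduct.rid k B ∘ₗ
      TensorProduct.map LinearMap.id Q'.counit) (fun _ _ => by simp)
      fun a b => by rw [map_smul, h.map_counit]).symm
  reassoc_mul_inv := h.reassoc_mul_inv hQ.reassoc_mul_inv
  inv_mul_reassoc := h.inv_mul_reassoc hQ.inv_mul_reassoc
  coassoc := hi.forall.2 fun a => by
    rw [← h.map_comul, ← h.map_comul_left, ← h.map_comul_right, ← h.map_reassoc,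
      ← h.map_reassocInv, ← h.map_mul₃, ← h.map_mul₃, hQ.coassoc]
  pentagon := h.pentagon hQ
  normalized := h.normalized hQ
  antipode_mul := by
    simp only [hi.forall, ← h.map_mul, ← h.map_antipode, hQ.antipode_mul, implies_true]
  antipode_one := by rw [← h.map_one, ← h.map_antipode, hQ.antipode_one]
  antipode_left := hi.forall.2 fun a => by
    rw [← h.map_comul, ← h.map_antipode_left, hQ.antipode_left, map_smul, h.map_counit,
      h.map_alpha]
  antipode_right := hi.forall.2 fun a => by
    rw [← h.map_comul, ← h.map_antipode_right, hQ.antipode_right, map_smul, h.map_counit,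
      h.map_beta]
  reassoc_antipode := h.reassoc_antipode hQ
  reassocInv_antipode := h.reassocInv_antipode hQ

theorem isRMatrix (hi : Function.Surjective i) {R : A ⊗[k] A} (hR : Q.IsRMatrix R) :
    Q'.IsRMatrix (TensorProduct.map i i R) := by
  have h₁ : ∀ t : A ⊗[k] (A ⊗[k] A), TensorProduct.map i (TensorProduct.map i i)
      (sum₃ t fun X₁ X₂ X₃ => X₂ ⊗ₜ[k] (X₃ ⊗ₜ[k] X₁)) =
      sum₃ (TensorProduct.map i (TensorProduct.map i i) t)
        fun X₁ X₂ X₃ => X₂ ⊗ₜ[k] (X₃ ⊗ₜ[k] X₁) := fun t =>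
    map_sum₃_eq _ i i i _ ((TensorProduct.assoc k B B B).toLinearMap ∘ₗ
      (TensorProduct.comm k B (B ⊗[k] B)).toLinearMap) (fun _ _ _ => rfl) fun _ _ _ => rfl
  have h₂ : ∀ t : A ⊗[k] (A ⊗[k] A), TensorProduct.map i (TensorProduct.map i i)
      (sum₃ t fun X₁ X₂ X₃ => X₁ ⊗ₜ[k] (X₃ ⊗ₜ[k] X₂)) =
      sum₃ (TensorProduct.map i (TensorProduct.map i i) t)
        fun X₁ X₂ X₃ => X₁ ⊗ₜ[k] (X₃ ⊗ₜ[k] X₂) := fun t =>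
    map_sum₃_eq _ i i i _ (TensorProduct.map LinearMap.id (TensorProduct.comm k B B).toLinearMap)
      (fun _ _ _ => rfl) fun _ _ _ => rfl
  have h₃ : ∀ t : A ⊗[k] (A ⊗[k] A), TensorProduct.map i (TensorProduct.map i i)
      (sum₃ t fun X₁ X₂ X₃ => X₃ ⊗ₜ[k] (X₁ ⊗ₜ[k] X₂)) =
      sum₃ (TensorProduct.map i (TensorProduct.map i i) t)
        fun X₁ X₂ X₃ => X₃ ⊗ₜ[k] (X₁ ⊗ₜ[k] X₂) := fun t =>
    map_sum₃_eq _ i i i _ ((TensorProduct.comm k (B ⊗[k] B) B).toLinearMap ∘ₗ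
      (TensorProduct.assoc k B B B).symm.toLinearMap) (fun _ _ _ => rfl) fun _ _ _ => rfl
  have h₄ : ∀ t : A ⊗[k] (A ⊗[k] A), TensorProduct.map i (TensorProduct.map i i)
      (sum₃ t fun X₁ X₂ X₃ => X₂ ⊗ₜ[k] (X₁ ⊗ₜ[k] X₃)) =
      sum₃ (TensorProduct.map i (TensorProduct.map i i) t)
        fun X₁ X₂ X₃ => X₂ ⊗ₜ[k] (X₁ ⊗ₜ[k] X₃) := fun t =>
    map_sum₃_eq _ i i i _ ((TensorProduct.assoc k B B B).toLinearMap ∘ₗ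
      TensorProduct.map (TensorProduct.comm k B B).toLinearMap LinearMap.id ∘ₗ
      (TensorProduct.assoc k B B B).symm.toLinearMap) (fun _ _ _ => rfl) fun _ _ _ => rfl
  have h₅ : TensorProduct.map i (TensorProduct.map i i)
      (sum₂ R fun R₁ R₂ => R₁ ⊗ₜ[k] (Q.one ⊗ₜ[k] R₂)) =
      sum₂ (TensorProduct.map i i R) fun R₁ R₂ => R₁ ⊗ₜ[k] (Q'.one ⊗ₜ[k] R₂) :=
    map_sum₂_eq _ i i _ (TensorProduct.map LinearMap.id (TensorProduct.mk k B B Q'.one))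
      (fun _ _ => rfl) fun _ _ => by rw [← h.map_one]; rfl
  have h₆ : TensorProduct.map i (TensorProduct.map i i)
      (sum₂ R fun R₁ R₂ => R₁ ⊗ₜ[k] (R₂ ⊗ₜ[k] Q.one)) =
      sum₂ (TensorProduct.map i i R) fun R₁ R₂ => R₁ ⊗ₜ[k] (R₂ ⊗ₜ[k] Q'.one) :=
    map_sum₂_eq _ i i _ (TensorProduct.map LinearMap.id ((TensorProduct.mk k B B).flip Q'.one))
      (fun _ _ => rfl) fun _ _ => by rw [← h.map_one]; rfl
  have h₇ : TensorProduct.map i (TensorProduct.map i i) (Q.one ⊗ₜ R) =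
      Q'.one ⊗ₜ TensorProduct.map i i R := by rw [← h.map_one]; rfl
  refine ⟨?_, hi.forall.2 fun a => ?_, ?_, ?_⟩
  · obtain ⟨R', hR', hR''⟩ := hR.invertible
    refine ⟨TensorProduct.map i i R', ?_, ?_⟩
    · rw [← h.map_mul₂, hR', TensorProduct.map_tmul, h.map_one]
    · rw [← h.map_mul₂, hR'', TensorProduct.map_tmul, h.map_one]
  · rw [← h.map_comul, ← TensorProduct.map_comm, ← h.map_mul₂, hR.comul_op, h.map_mul₂]
  · rw [← h.map_comul_left, ← h.map_reassoc, ← h.map_reassocInv, ← h₁, ← h₂, ← h₅, ← h₇,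
      ← h.map_mul₃, ← h.map_mul₃, ← h.map_mul₃, ← h.map_mul₃, hR.comul_left]
  · rw [← h.map_comul_right, ← h.map_reassoc, ← h.map_reassocInv, ← h₃, ← h₄, ← h₅, ← h₆,
      ← h.map_mul₃, ← h.map_mul₃, ← h.map_mul₃, ← h.map_mul₃, hR.comul_right]

end IsHom

end QuasiHopfData

section

/-! ### Convolution inverses of `θ` and `γ` -/

section Inverses

universe u v
variable {k : Type u} {H : Type v} [Field k] [Ring H] [HopfAlgebra k H] [Coalgebra.IsCocomm k H]
  [FiniteDimensional k H]

variable (k) in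
/-- The identity evaluation of the base field. -/
def Probe.scalars : Probe.{u, v} k k k where
  mem R _ _ E := E = TensorProduct.mk k R k 1
  sep x h := by
    -- The base field itself may live in a smaller universe than the coefficient rings, so it is
    -- lifted.
    have := h (ULift.{v} k) (TensorProduct.mk k _ k 1) rfl
    have := congrArg (TensorProduct.rid k (ULift.{v} k)) this
    simpa using congrArg ULift.down this
  map := by
    rintro R R' _ _ _ _ f _ rfl
    exact LinearMap.ext fun x => by simp

theorem baseChange_dual {R V : Type*} [CommRing R] [Algebra k R] [AddCommGroup V] [Module k V]
    (f : Module.Dual k V) (z : R ⊗[k] V) :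
    LinearMap.baseChange R f z = ev z f ⊗ₜ[k] (1 : k) := by
  induction z using TensorProduct.induction_on with
  | zero => simp
  | add x y hx hy => rw [map_add, hx, hy, ev_add_left, TensorProduct.add_tmul]
  | tmul r v =>
    rw [LinearMap.baseChange_tmul, ev_tmul, mul_comm, ← Algebra.smul_def,
      TensorProduct.smul_tmul, smul_eq_mul, mul_one]

theorem liftBaseChange_mk {R V : Type*} [CommRing R] [Algebra k R] [AddCommMonoid V] [Module k V]
    (z : R ⊗[k] V) : LinearMap.liftBaseChange R (TensorProduct.mk k R V 1) z = z := by
  induction z using TensorProduct.induction_on with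
  | zero => simp
  | add x y hx hy => rw [map_add, hx, hy]
  | tmul r v => simp [TensorProduct.smul_tmul']

theorem Generators.functional_ext {V : Type*} [AddCommGroup V] [Module k V]
    (G : Generators.{u, v} k V) {f f' : Module.Dual k V}
    (h : ∀ (R : Type max u v) [CommRing R] [Algebra k R] (z : R ⊗[k] V), G.mem R z →
      ev z f = ev z f') : f = f' := by
  refine G.ext (Probe.scalars k) ?_
  rintro R _ _ _ rfl z hz
  rw [liftBaseChange_mk, liftBaseChange_mk, baseChange_dual, baseChange_dual, h R z hz]

theorem functional_ext₃ {f f' : Module.Dual k (H ⊗[k] (H ⊗[k] H))}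
    (h : ∀ (R : Type max u v) [CommRing R] [Algebra k R] (x y z : Point k R H),
      ev (x.val ⊠ y.val ⊠ z.val) f = ev (x.val ⊠ y.val ⊠ z.val) f') : f = f' := by
  refine ((Generators.points k H).tensor ((Generators.points k H).tensor
    (Generators.points k H))).functional_ext ?_
  rintro R _ _ _ ⟨x, _, hx, ⟨y, z, hy, hz, rfl⟩, rfl⟩
  exact h R ⟨x, hx⟩ ⟨y, hy⟩ ⟨z, hz⟩

variable (ω : (WithConv (H ⊗[k] (H ⊗[k] H) →ₗ[k] k))ˣ)

section
variable {R : Type*} [CommRing R] [Algebra k R]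

theorem om_inv (x y z : Point k R H) : om ω⁻¹ x y z = (om ω x y z)⁻¹ := Units.ext rfl

theorem tht_inv (g x y : Point k R H) : tht ω⁻¹ g x y = (tht ω g x y)⁻¹ := by
  simp only [tht, om_inv, mul_inv_rev, inv_inv, mul_comm]

theorem gam_inv (g x y : Point k R H) : gam ω⁻¹ g x y = (gam ω g x y)⁻¹ := by
  simp only [gam, om_inv, mul_inv_rev, inv_inv, mul_comm, mul_left_comm]

end

/-- `Ring.inverse` is zero on non-units, so invertibility has to be shown: at every point the
function `θ` built from `ω⁻¹` takes the inverse value. -/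
theorem inverse_theta : Ring.inverse (theta ω) = theta ω⁻¹ := by
  have h : theta ω * theta ω⁻¹ = 1 := by
    apply WithConv.ofConv_injective
    refine functional_ext₃ fun R _ _ x y z => ?_
    have hp := x.isPoint.box (y.isPoint.box z.isPoint)
    rw [hp.ev_mul, hp.ev_one, ev_theta, ev_theta, tht_inv, Units.mul_inv]
  exact Ring.inverse_unit ⟨theta ω, theta ω⁻¹, h, (mul_comm _ _).trans h⟩

theorem inverse_gamma : Ring.inverse (gamma ω) = gamma ω⁻¹ := by
  have h : gamma ω * gamma ω⁻¹ = 1 := by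
    apply WithConv.ofConv_injective
    refine functional_ext₃ fun R _ _ x y z => ?_
    have hp := x.isPoint.box (y.isPoint.box z.isPoint)
    rw [hp.ev_mul, hp.ev_one, ev_gamma, ev_gamma, gam_inv, Units.mul_inv]
  exact Ring.inverse_unit ⟨gamma ω, gamma ω⁻¹, h, (mul_comm _ _).trans h⟩

end Inverses

/-! ### Calculus of evaluations that are multiples of a fixed element -/

section Val

variable {k R V W K K' : Type*} [Field k] [CommRing R] [Algebra k R]
  [AddCommMonoid V] [Module k V] [AddCommMonoid W] [Module k W]
  [AddCommMonoid K] [Module k K] [AddCommMonoid K'] [Module k K']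

/-- The evaluation of `z` under `E` is `c x`. -/
def Val (E : V →ₗ[k] R ⊗[k] K) (z : R ⊗[k] V) (c : R) (x : R ⊗[k] K) : Prop :=
  LinearMap.liftBaseChange R E z = c • x

theorem Val.eq {E : V →ₗ[k] R ⊗[k] K} {z z' : R ⊗[k] V} {c c' : R} {x x' : R ⊗[k] K}
    (h : Val E z c x) (h' : Val E z' c' x') (hc : c = c') (hx : x = x') :
    LinearMap.liftBaseChange R E z = LinearMap.liftBaseChange R E z' := by
  rw [h, h', hc, hx]

theorem Val.congr {E E' : V →ₗ[k] R ⊗[k] K} {z z' : R ⊗[k] V} {c c' : R} {x x' : R ⊗[k] K}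
    (h : Val E z c x) (hE : E = E') (hz : z = z') (hc : c = c') (hx : x = x') :
    Val E' z' c' x' := by
  subst hE hz hc hx; exact h

theorem Val.box {E : V →ₗ[k] R ⊗[k] K} {E' : W →ₗ[k] R ⊗[k] K'} {z : R ⊗[k] V} {z' : R ⊗[k] W}
    {c c' : R} {x : R ⊗[k] K} {x' : R ⊗[k] K'} (h : Val E z c x) (h' : Val E' z' c' x') :
    Val (boxMap E E') (z ⊠ z') (c * c') (x ⊠ x') := by
  rw [Val, liftBaseChange_boxMap, h, h', smul_box, box_smul, smul_smul]

theorem Val.smul {E : V →ₗ[k] R ⊗[k] K} {z : R ⊗[k] V} {c : R} {x : R ⊗[k] K} (h : Val E z c x)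
    (r : R) : Val E (r • z) (r * c) x := by
  rw [Val, map_smul, h, smul_smul]

theorem val_one_tmul {E : V →ₗ[k] R ⊗[k] K} {v : V} {c : R} {x : R ⊗[k] K} (h : E v = c • x) :
    Val E (1 ⊗ₜ v) c x := by
  rw [Val, LinearMap.liftBaseChange_tmul, one_smul, h]

/-- The evaluation `E' (C u)` is computed from `E u`. -/
def OpLaw (C : V →ₗ[k] W) (E' : W →ₗ[k] R ⊗[k] K') (E : V →ₗ[k] R ⊗[k] K)
    (M : K →ₗ[k] R ⊗[k] K') : Prop :=
  ∀ u, E' (C u) = LinearMap.liftBaseChange R M (E u)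

theorem OpLaw.val {C : V →ₗ[k] W} {E' : W →ₗ[k] R ⊗[k] K'} {E : V →ₗ[k] R ⊗[k] K}
    {M : K →ₗ[k] R ⊗[k] K'} (h : OpLaw C E' E M) {z : R ⊗[k] V} {c : R} {x : R ⊗[k] K}
    (hz : Val E z c x) : LinearMap.liftBaseChange R E' (C.baseChange R z) =
      c • LinearMap.liftBaseChange R M x := by
  have : ∀ z : R ⊗[k] V, LinearMap.liftBaseChange R E' (C.baseChange R z) =
      LinearMap.liftBaseChange R M (LinearMap.liftBaseChange R E z) := by
    intro z
    induction z using TensorProduct.induction_on with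
    | zero => simp
    | add x y hx hy => simp only [map_add, hx, hy]
    | tmul r v => simp only [LinearMap.baseChange_tmul, LinearMap.liftBaseChange_tmul, h v, map_smul]
  rw [this, hz, map_smul]

theorem OpLaw.tensor {V' W' K'' K''' : Type*} [AddCommMonoid V'] [Module k V'] [AddCommMonoid W']
    [Module k W'] [AddCommMonoid K''] [Module k K''] [AddCommMonoid K'''] [Module k K''']
    {C : V →ₗ[k] W} {E' : W →ₗ[k] R ⊗[k] K'} {E : V →ₗ[k] R ⊗[k] K} {M : K →ₗ[k] R ⊗[k] K'}
    (h : OpLaw C E' E M)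
    {D : V' →ₗ[k] W'} {F' : W' →ₗ[k] R ⊗[k] K'''} {F : V' →ₗ[k] R ⊗[k] K''}
    {N : K'' →ₗ[k] R ⊗[k] K'''} (h' : OpLaw D F' F N) :
    OpLaw (TensorProduct.map C D) (boxMap E' F') (boxMap E F) (boxMap M N) := by
  intro u
  induction u using TensorProduct.induction_on with
  | zero => simp
  | add x y hx hy => simp only [map_add, hx, hy]
  | tmul a b => rw [TensorProduct.map_tmul, boxMap_tmul, boxMap_tmul, h, h', liftBaseChange_boxMap]

theorem OpLaw.id (E : V →ₗ[k] R ⊗[k] K) : OpLaw LinearMap.id E E (TensorProduct.mk k R K 1) :=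
  fun u => by rw [liftBaseChange_mk]; rfl

theorem baseChange_apply_eq (f : V →ₗ[k] W →ₗ[k] K) (v : V) (z : R ⊗[k] W) :
    (f v).baseChange R z = (TensorProduct.lift f).baseChange R ((1 ⊗ₜ v) ⊠ z) := by
  induction z using TensorProduct.induction_on with
  | zero => simp
  | add x y hx hy => rw [map_add, hx, hy, box_add, map_add]
  | tmul r v => simp

theorem baseChange_flip_apply_eq (f : V →ₗ[k] W →ₗ[k] K) (w : W) (z : R ⊗[k] V) :
    (f.flip w).baseChange R z = (TensorProduct.lift f).baseChange R (z ⊠ (1 ⊗ₜ w)) := by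
  induction z using TensorProduct.induction_on with
  | zero => simp
  | add x y hx hy => rw [map_add, hx, hy, add_box, map_add]
  | tmul r v => simp

@[simp] theorem baseChange_assoc_symm_box {U : Type*} [AddCommMonoid U] [Module k U]
    (x : R ⊗[k] V) (y : R ⊗[k] W) (z : R ⊗[k] U) :
    (TensorProduct.assoc k V W U).symm.toLinearMap.baseChange R (x ⊠ y ⊠ z) = (x ⊠ y) ⊠ z := by
  rw [← baseChange_assoc_box, ← LinearMap.comp_apply, ← LinearMap.baseChange_comp]
  simp

theorem liftBaseChange_mk_comp (f : V →ₗ[k] W) (z : R ⊗[k] V) :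
    LinearMap.liftBaseChange R (TensorProduct.mk k R W 1 ∘ₗ f) z = f.baseChange R z := by
  induction z using TensorProduct.induction_on with
  | zero => simp
  | add x y hx hy => rw [map_add, hx, hy, map_add]
  | tmul r v => simp [TensorProduct.smul_tmul']

theorem OpLaw.assoc {U K'' : Type*} [AddCommMonoid U] [Module k U] [AddCommMonoid K'']
    [Module k K''] (E : V →ₗ[k] R ⊗[k] K) (F : W →ₗ[k] R ⊗[k] K') (G : U →ₗ[k] R ⊗[k] K'') :
    OpLaw (TensorProduct.assoc k V W U).toLinearMap (boxMap E (boxMap F G))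
      (boxMap (boxMap E F) G)
      (TensorProduct.mk k R _ 1 ∘ₗ (TensorProduct.assoc k K K' K'').toLinearMap) := by
  intro u
  rw [liftBaseChange_mk_comp]
  induction u using TensorProduct.induction_on with
  | zero => simp
  | add x y hx hy => simp only [map_add, hx, hy]
  | tmul a c =>
    induction a using TensorProduct.induction_on with
    | zero => simp
    | add x y hx hy => simp only [TensorProduct.add_tmul, map_add, hx, hy]
    | tmul a b =>
      rw [boxMap_tmul, boxMap_tmul, baseChange_assoc_box]
      simp

theorem OpLaw.comm (E : V →ₗ[k] R ⊗[k] K) (F : W →ₗ[k] R ⊗[k] K') :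
    OpLaw (TensorProduct.comm k V W).toLinearMap (boxMap F E) (boxMap E F)
      (TensorProduct.mk k R _ 1 ∘ₗ (TensorProduct.comm k K K').toLinearMap) := by
  intro u
  rw [liftBaseChange_mk_comp]
  induction u using TensorProduct.induction_on with
  | zero => simp
  | add x y hx hy => simp only [map_add, hx, hy]
  | tmul a b => rw [boxMap_tmul, baseChange_comm_box]; simp

end Val

/-! ### Products and coproducts of `D^ω(H)` at points -/

section Crossed

variable {k R H : Type*} [Field k] [CommRing R] [Algebra k R] [Ring H] [HopfAlgebra k H]
  [Coalgebra.IsCocomm k H]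
variable (ω : (WithConv (H ⊗[k] (H ⊗[k] H) →ₗ[k] k))ˣ)

theorem val_generator (g x : Point k R H) (φ : Module.Dual k H) :
    Val (evD k g) ((1 ⊗ₜ φ) ⊠ x.val) (ev g.val φ) x.val := by
  rw [Val, liftBaseChange_evD_box, LinearMap.liftBaseChange_tmul, one_smul]

theorem val_crossedIncl (g : Point k R H) (φ : Module.Dual k H) :
    Val (evD k g) (1 ⊗ₜ crossedIncl φ) (ev g.val φ) (1 : Point k R H).val :=
  val_one_tmul (evD_tmul g φ 1)

/-- The product formula of the twisted double of a group: the right factor is seen at the conjugate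
of `g` by the point of the left factor. -/
theorem val_crossedMul {g x y : Point k R H} {s t : R ⊗[k] (Module.Dual k H ⊗[k] H)} {c d : R}
    (hs : Val (evD k g) s c x.val) (ht : Val (evD k (x⁻¹ * g * x)) t d y.val) :
    Val (evD k g) ((TensorProduct.lift (crossedMul ω)).baseChange R (s ⊠ t)) (c * d * tht ω g x y)
      (x * y).val := by
  rw [Val, (mulLaw_crossedMul ω g x).rel hs ht, mulArg_point, smul_smul]

variable [FiniteDimensional k H]

theorem val_crossedMul₂ {g g' x x' y y' : Point k R H}
    {s t : R ⊗[k] ((Module.Dual k H ⊗[k] H) ⊗[k] (Module.Dual k H ⊗[k] H))} {c d : R}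
    (hs : Val (boxMap (evD k g) (evD k g')) s c (x.val ⊠ x'.val))
    (ht : Val (boxMap (evD k (x⁻¹ * g * x)) (evD k (x'⁻¹ * g' * x'))) t d (y.val ⊠ y'.val)) :
    Val (boxMap (evD k g) (evD k g')) ((TensorProduct.lift (DOmega ω).mul₂).baseChange R (s ⊠ t))
      (c * d * (tht ω g x y * tht ω g' x' y')) ((x * y).val ⊠ (x' * y').val) := by
  rw [Val]
  refine (((mulLaw_crossedMul ω g x).tensor (mulLaw_crossedMul ω g' x')).rel hs ht).trans ?_
  rw [liftBaseChange_boxMap, mulArg_point, mulArg_point, smul_box, box_smul, smul_smul, smul_smul,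
    mul_assoc (c * d)]

theorem val_crossedMul₃ {g g' g'' x x' x'' y y' y'' : Point k R H}
    {s t : R ⊗[k] ((Module.Dual k H ⊗[k] H) ⊗[k] ((Module.Dual k H ⊗[k] H) ⊗[k]
      (Module.Dual k H ⊗[k] H)))} {c d : R}
    (hs : Val (boxMap (evD k g) (boxMap (evD k g') (evD k g''))) s c
      (x.val ⊠ x'.val ⊠ x''.val))
    (ht : Val (boxMap (evD k (x⁻¹ * g * x)) (boxMap (evD k (x'⁻¹ * g' * x'))
      (evD k (x''⁻¹ * g'' * x'')))) t d (y.val ⊠ y'.val ⊠ y''.val)) :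
    Val (boxMap (evD k g) (boxMap (evD k g') (evD k g'')))
      ((TensorProduct.lift (DOmega ω).mul₃).baseChange R (s ⊠ t))
      (c * d * (tht ω g x y * (tht ω g' x' y' * tht ω g'' x'' y'')))
      ((x * y).val ⊠ (x' * y').val ⊠ (x'' * y'').val) := by
  rw [Val]
  refine (((mulLaw_crossedMul ω g x).tensor ((mulLaw_crossedMul ω g' x').tensor
    (mulLaw_crossedMul ω g'' x''))).rel hs ht).trans ?_
  rw [liftBaseChange_boxMap, liftBaseChange_boxMap, mulArg_point, mulArg_point, mulArg_point,
    smul_box, smul_box, box_smul, box_smul, box_smul, smul_smul, smul_smul, smul_smul]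
  congr 1
  ring

/-- The map `h ↦ γ(g, g'; h) h ⊗ h`. -/
def comulArg (g g' : Point k R H) : H →ₗ[k] R ⊗[k] (H ⊗[k] H) :=
  lift₂ (fun a t => lift₂ (fun b c => ev (g.val ⊠ g'.val ⊠ (1 ⊗ₜ a)) (gamma ω).ofConv •
    (((1 : R) ⊗ₜ[k] b) ⊠ (1 ⊗ₜ c))) (Coalgebra.comul (R := k) t)) ∘ₗ Coalgebra.comul

theorem comulArg_apply (g g' : Point k R H) (h : H) : comulArg ω g g' h =
    sum₂ (Coalgebra.comul (R := k) h) fun a t => sum₂ (Coalgebra.comul (R := k) t) fun b c =>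
      ev (g.val ⊠ g'.val ⊠ (1 ⊗ₜ a)) (gamma ω).ofConv • (((1 : R) ⊗ₜ[k] b) ⊠ (1 ⊗ₜ c)) := rfl

theorem comulArg_point (g g' x : Point k R H) :
    LinearMap.liftBaseChange R (comulArg ω g g') x.val =
      (gam ω g g' x : R) • (x.val ⊠ x.val) := by
  rw [← bind_linear]
  simp only [comulArg_apply, x.isPoint.bind_comul, bind_smul, bind_smul_const, bind_box_left,
    bind_box_right, bind_one_tmul, bind_ev, ev_gamma]

theorem evT_nu (X Y : R ⊗[k] H) (h : H) :
    evT (ev X) (ev Y) (nu ω h) = ev (X ⊠ Y ⊠ (1 ⊗ₜ h)) (gamma ω).ofConv := by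
  rw [nu, evT_dualDistribEquiv_symm, ev_firstTwoSlots]

theorem evT_nuInv (X Y : R ⊗[k] H) (h : H) :
    evT (ev X) (ev Y) (nuInv ω h) = ev (X ⊠ Y ⊠ (1 ⊗ₜ h)) (Ring.inverse (gamma ω)).ofConv := by
  rw [nuInv, evT_dualDistribEquiv_symm, ev_firstTwoSlots]

/-- Evaluating `Δ(φ)` at `(g, g')` gives `φ(gg')`, so only the evaluation of the argument at `gg'`
matters; the factor `ν` contributes `γ(g, g'; -)`. -/
theorem opLaw_crossedComul (g g' : Point k R H) :
    OpLaw (crossedComul ω) (boxMap (evD k g) (evD k g')) (evD k (g * g')) (comulArg ω g g') := by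
  intro u
  induction u using TensorProduct.induction_on with
  | zero => simp
  | add x y hx hy => simp only [map_add, hx, hy]
  | tmul φ h =>
    rw [evD_tmul, map_smul, LinearMap.liftBaseChange_tmul, one_smul, crossedComul,
      map_lift₂_tmul (R := R)]
    have key : ∀ (φ : Module.Dual k H) (h : H),
        boxMap (evD k g) (evD k g') (sum₂ (Coalgebra.comul (R := k) h) fun h₁ t =>
          sum₂ (Coalgebra.comul (R := k) t) fun h₂ h₃ =>
          sum₂ (nu ω h₁) fun ν₁ ν₂ => sum₂ (dualHopfComul φ) fun φ₁ φ₂ =>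
            (conv ν₁ φ₁ ⊗ₜ[k] h₂) ⊗ₜ[k] (conv ν₂ φ₂ ⊗ₜ[k] h₃)) =
        ev (g * g').val φ • comulArg ω g g' h := by
      intro φ h
      simp only [map_sum₂, boxMap_tmul, evD_tmul, Point.ev_conv, comulArg_apply, ← sum₂_smul]
      congr 1
      funext h₁ t
      congr 1
      funext h₂ h₃
      rw [smul_smul]
      rw [sum₂_evT_smul _ (ev (g * g').val φ) (ev g.val) (ev g'.val), evT_nu]
      intro ν₁ ν₂
      rw [sum₂_evT_smul _ (ev g.val ν₁ * ev g'.val ν₂) (ev g.val) (ev g'.val), evT_dualHopfComul]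
      · congr 1; ring
      · intro φ₁ φ₂
        rw [smul_box, box_smul, smul_smul]
        congr 1; ring
    simp only [key, bind_smul]
    rw [bind_smul_const, bind_linear, bind_linear, LinearMap.liftBaseChange_tmul,
      LinearMap.liftBaseChange_tmul, one_smul, one_smul]

theorem val_crossedComul {g g' x : Point k R H} {z : R ⊗[k] (Module.Dual k H ⊗[k] H)} {c : R}
    (hz : Val (evD k (g * g')) z c x.val) :
    Val (boxMap (evD k g) (evD k g')) ((crossedComul ω).baseChange R z) (c * gam ω g g' x)
      (x.val ⊠ x.val) := by
  rw [Val, (opLaw_crossedComul ω g g').val hz, comulArg_point, smul_smul]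

end Crossed

end

section

/-! ### The antipode of `D^ω(H)` at points -/

section Antipode

universe u v
variable {k : Type u} {H : Type v} {R : Type*} [Field k] [CommRing R] [Algebra k R] [Ring H]
  [HopfAlgebra k H] [Coalgebra.IsCocomm k H]
variable (ω : (WithConv (H ⊗[k] (H ⊗[k] H) →ₗ[k] k))ˣ)

/-- Moves one copy of `x` inside the three others, so that the factor of the antipode that contains
it separates from the rest. -/
theorem bind_rotate {V N : Type*} [AddCommGroup V] [Module k V] [AddCommMonoid N] [Module k N]
    [Module R N] [IsScalarTower k R N] (x : R ⊗[k] V) (F : V → V → V → V → N) :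
    (bind x fun a => bind x fun b => bind x fun c => bind x fun d => F a b c d) =
      bind x fun b => bind x fun c => bind x fun d => bind x fun a => F a b c d := by
  rw [bind_comm]
  refine congrArg (bind x) (funext fun b => ?_)
  rw [bind_comm]
  refine congrArg (bind x) (funext fun c => ?_)
  rw [bind_comm]

/-- The counit of a point is `1`, so a scalar is recovered from the corresponding multiple of a
point. -/
theorem smul_point_injective (x : Point k R H) {c d : R} (h : c • x.val = d • x.val) : c = d := by
  have := congrArg (fun z => ev z (Coalgebra.counit (R := k))) h
  simpa only [ev_smul_left, x.isPoint.counit, mul_one] using this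

theorem smul_point_injective₂ (x y : Point k R H) {c d : R}
    (h : c • (x.val ⊠ y.val) = d • (x.val ⊠ y.val)) : c = d := by
  have := congrArg (fun z => ev z (Coalgebra.counit (R := k))) h
  simpa only [ev_smul_left, (x.isPoint.box y.isPoint).counit, mul_one] using this

/-- The element `Φ` does not depend on `g`. The counit and the antipode evaluate a product at `1`
and at inverses of conjugates of `g`, so a formula at one fixed `g` would not suffice for them. -/
theorem crossedMul_generators (x y : Point k R H) (φ ψ : Module.Dual k H) :
    ∃ Φ : R ⊗[k] Module.Dual k H,
      (TensorProduct.lift (crossedMul ω)).baseChange R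
        (((1 ⊗ₜ φ) ⊠ x.val) ⊠ ((1 ⊗ₜ ψ) ⊠ y.val)) = Φ ⊠ (x * y).val ∧
      ∀ g : Point k R H, LinearMap.liftBaseChange R (ev g.val) Φ =
        ev g.val φ * ev (x⁻¹ * g * x).val ψ * tht ω g x y := by
  have h : ∃ Φ : R ⊗[k] Module.Dual k H,
      (TensorProduct.lift (crossedMul ω)).baseChange R
        (((1 ⊗ₜ φ) ⊠ x.val) ⊠ ((1 ⊗ₜ ψ) ⊠ y.val)) = Φ ⊠ (x * y).val := by
    refine ⟨bind ((1 : R) ⊗ₜ[k] φ) fun φ => bind x.val fun h₁ => bind x.val fun h₂ =>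
      bind x.val fun h₃ => bind ((1 : R) ⊗ₜ[k] ψ) fun ψ => bind y.val fun h' => (1 : R) ⊗ₜ[k]
        conv (conv φ (actBoth h₁ ψ (HopfAlgebra.antipode k h₂))) (sigma ω h₃ h'), ?_⟩
    rw [← liftBaseChange_mk ((TensorProduct.lift (crossedMul ω)).baseChange R _),
      liftBaseChange_lift, crossedMul, ext₂_lift₂]
    simp only [TensorProduct.mk_apply, one_tmul_sum₂, bind_sum₂, x.isPoint.bind_comul,
      y.isPoint.bind_comul, one_tmul_tmul, one_tmul_mul, bind_box_left, bind_box_right,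
      bind_mul_left, bind_mul_right', bind_one_tmul]
    rfl
  obtain ⟨Φ, hΦ⟩ := h
  refine ⟨Φ, hΦ, fun g => smul_point_injective (x * y) ?_⟩
  rw [← liftBaseChange_evD_box, ← hΦ]
  exact val_crossedMul ω (val_generator g x φ) (val_generator _ y ψ)

theorem baseChange_flip_mk {V W : Type*} [AddCommMonoid V] [Module k V] [AddCommMonoid W]
    [Module k W] (z : R ⊗[k] V) (w : W) :
    ((TensorProduct.mk k V W).flip w).baseChange R z = z ⊠ (1 ⊗ₜ w) := by
  induction z using TensorProduct.induction_on with
  | zero => simp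
  | add x y hx hy => rw [map_add, hx, hy, add_box]
  | tmul r v => simp

section Shuffle

variable {A B K : Type*} [AddCommGroup A] [Module k A] [AddCommGroup B] [Module k B]
  [AddCommMonoid K] [Module k K]

theorem sum₂_shuffle (m : A →ₗ[k] A →ₗ[k] A) (t s : A ⊗[k] A) (b b' : B) :
    (sum₂ t fun t₁ t₂ => sum₂ s fun s₁ s₂ => (m t₁ s₁ ⊗ₜ[k] b) ⊗ₜ[k] (m t₂ s₂ ⊗ₜ[k] b')) =
      TensorProduct.tensorTensorTensorComm k A A B B
        (TensorProduct.map₂ m m t s ⊗ₜ (b ⊗ₜ b')) := by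
  refine sum₂_eq t ((TensorProduct.tensorTensorTensorComm k A A B B).toLinearMap ∘ₗ
      (TensorProduct.mk k (A ⊗[k] A) (B ⊗[k] B)).flip (b ⊗ₜ b') ∘ₗ
      (TensorProduct.map₂ m m).flip s) fun t₁ t₂ => ?_
  exact sum₂_eq s ((TensorProduct.tensorTensorTensorComm k A A B B).toLinearMap ∘ₗ
      (TensorProduct.mk k (A ⊗[k] A) (B ⊗[k] B)).flip (b ⊗ₜ b') ∘ₗ
      (TensorProduct.map₂ m m) (t₁ ⊗ₜ t₂)) fun s₁ s₂ => rfl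

theorem baseChange_shuffle (φ ψ : A) (x y : R ⊗[k] B) :
    (TensorProduct.tensorTensorTensorComm k A A B B).toLinearMap.baseChange R
      ((1 ⊗ₜ (φ ⊗ₜ ψ)) ⊠ x ⊠ y) = ((1 ⊗ₜ φ) ⊠ x) ⊠ ((1 ⊗ₜ ψ) ⊠ y) := by
  induction x, y using box_induction with
  | zero_left => simp
  | zero_right => simp
  | tmul r v s w => simp
  | add_left x x' y h h' => simp only [add_box, box_add, map_add, h, h']
  | add_right x y y' h h' => simp only [box_add, map_add, h, h']

/-- The functional part `Ψ` of a coproduct is not a pure tensor. By linearity its evaluation is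
nevertheless determined by the formula on pure tensors. -/
theorem liftBaseChange_shuffle {T : (A ⊗[k] B) ⊗[k] (A ⊗[k] B) →ₗ[k] R ⊗[k] K} {f g : A →ₗ[k] R}
    {x y : R ⊗[k] B} {z : R ⊗[k] K}
    (h : ∀ φ ψ, LinearMap.liftBaseChange R T (((1 ⊗ₜ φ) ⊠ x) ⊠ ((1 ⊗ₜ ψ) ⊠ y)) = (f φ * g ψ) • z)
    (Ψ : R ⊗[k] (A ⊗[k] A)) :
    LinearMap.liftBaseChange R T
      ((TensorProduct.tensorTensorTensorComm k A A B B).toLinearMap.baseChange R (Ψ ⊠ x ⊠ y)) =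
      LinearMap.liftBaseChange R (evT f g) Ψ • z := by
  induction Ψ using TensorProduct.induction_on with
  | zero => simp
  | add a b ha hb => rw [add_box, map_add, map_add, ha, hb, map_add, add_smul]
  | tmul r t =>
    induction t using TensorProduct.induction_on with
    | zero => simp
    | add a b ha hb => rw [TensorProduct.tmul_add, add_box, map_add, map_add, ha, hb, map_add,
        add_smul]
    | tmul φ ψ =>
      rw [← mul_one r, ← smul_eq_mul, ← TensorProduct.smul_tmul', smul_box, map_smul, map_smul,
        baseChange_shuffle, h, map_smul, LinearMap.liftBaseChange_tmul, one_smul, evT_tmul,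
        smul_assoc]

end Shuffle

variable [FiniteDimensional k H]

/-- As for products, one `Ψ` serves all pairs `(g, h)`, which allows its two legs to be evaluated at
the points that the counit and antipode axioms call for. -/
theorem crossedComul_generators (x : Point k R H) (φ : Module.Dual k H) :
    ∃ Ψ : R ⊗[k] (Module.Dual k H ⊗[k] Module.Dual k H),
      (crossedComul ω).baseChange R ((1 ⊗ₜ φ) ⊠ x.val) =
        (TensorProduct.tensorTensorTensorComm k _ _ H H).toLinearMap.baseChange R
          (Ψ ⊠ x.val ⊠ x.val) ∧
      ∀ g h : Point k R H, LinearMap.liftBaseChange R (evT (ev g.val) (ev h.val)) Ψ =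
        ev (g * h).val φ * gam ω g h x := by
  have h : ∃ Ψ : R ⊗[k] (Module.Dual k H ⊗[k] Module.Dual k H),
      (crossedComul ω).baseChange R ((1 ⊗ₜ φ) ⊠ x.val) =
        (TensorProduct.tensorTensorTensorComm k _ _ H H).toLinearMap.baseChange R
          (Ψ ⊠ x.val ⊠ x.val) := by
    refine ⟨bind ((1 : R) ⊗ₜ[k] φ) fun φ => bind x.val fun h₁ =>
      (1 : R) ⊗ₜ[k] TensorProduct.map₂ conv conv (nu ω h₁) (dualHopfComul φ), ?_⟩
    rw [crossedComul, baseChange_lift₂_box]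
    simp only [sum₂_shuffle, one_tmul_sum₂, x.isPoint.bind_comul]
    simp only [← LinearEquiv.coe_coe,
      one_tmul_apply (TensorProduct.tensorTensorTensorComm k _ _ H H).toLinearMap]
    simp only [one_tmul_tmul, bind_baseChange, bind_box_left, bind_box_right, bind_one_tmul]
  obtain ⟨Ψ, hΨ⟩ := h
  refine ⟨Ψ, hΨ, fun g h => smul_point_injective₂ x x ?_⟩
  have e := liftBaseChange_shuffle (T := boxMap (evD k g) (evD k h)) (f := ev g.val)
    (g := ev h.val) (x := x.val) (y := x.val) (z := x.val ⊠ x.val)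
    (fun φ ψ => (val_generator g x φ).box (val_generator h x ψ)) Ψ
  rw [← e, ← hΨ]
  exact val_crossedComul ω (val_generator (g * h) x φ)

theorem crossedAntipode_generators (x : Point k R H) (φ : Module.Dual k H) :
    ∃ Ξ : R ⊗[k] Module.Dual k H,
      (crossedAntipode ω).baseChange R ((1 ⊗ₜ φ) ⊠ x.val) =
        (TensorProduct.lift (crossedMul ω)).baseChange R
          (((1 ⊗ₜ Coalgebra.counit) ⊠ (x⁻¹).val) ⊠ crossedIncl.baseChange R Ξ) ∧
      ∀ g : Point k R H, LinearMap.liftBaseChange R (ev g.val) Ξ =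
        ev (g⁻¹).val φ * ((tht ω g x x⁻¹)⁻¹ * (gam ω g⁻¹ g x)⁻¹ : Rˣ) := by
  refine ⟨bind ((1 : R) ⊗ₜ[k] φ) fun φ => bind x.val fun h₂ => bind x.val fun h₃ =>
    bind x.val fun h₄ => (1 : R) ⊗ₜ[k] sum₂ (nuInv ω h₄) fun ν₁ ν₂ =>
      conv (conv (sigmaInv ω h₂ (HopfAlgebra.antipode k h₃)) (dualAntipode (conv φ ν₁))) ν₂,
    ?_, fun g => ?_⟩
  · have key : ∀ (φ : Module.Dual k H) (h₁ h₂ h₃ h₄ : H),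
        (sum₂ (nuInv ω h₄) fun ν₁ ν₂ =>
          crossedMul ω (Coalgebra.counit ⊗ₜ HopfAlgebra.antipode k h₁)
            (crossedIncl (conv (conv (sigmaInv ω h₂ (HopfAlgebra.antipode k h₃))
              (dualAntipode (conv φ ν₁))) ν₂))) =
        TensorProduct.lift (crossedMul ω) ((Coalgebra.counit ⊗ₜ HopfAlgebra.antipode k h₁) ⊗ₜ
          crossedIncl (sum₂ (nuInv ω h₄) fun ν₁ ν₂ =>
            conv (conv (sigmaInv ω h₂ (HopfAlgebra.antipode k h₃)) (dualAntipode (conv φ ν₁)))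
              ν₂)) := by
      intro φ h₁ h₂ h₃ h₄
      rw [map_sum₂, TensorProduct.lift.tmul, map_sum₂]
    rw [crossedAntipode, baseChange_lift₂_box]
    simp only [key, one_tmul_sum₂, x.isPoint.bind_comul]
    refine (congrArg (bind _) (funext fun φ => bind_rotate _ _)).trans ?_
    simp only [one_tmul_apply (TensorProduct.lift (crossedMul ω)), one_tmul_tmul,
      one_tmul_apply crossedIncl, one_tmul_apply (HopfAlgebra.antipode k),
      bind_baseChange, bind_box_left, bind_box_right, bind_one_tmul, ← Point.val_inv]
    simp only [one_tmul_sum₂]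
  · rw [← bind_liftBaseChange]
    simp only [← bind_liftBaseChange, LinearMap.liftBaseChange_tmul, one_smul, map_sum₂,
      Point.ev_conv, ev_dualAntipode, sigmaInv, inverse_theta, ev_firstSlot]
    simp only [one_tmul_apply (HopfAlgebra.antipode k)]
    have key : ∀ (φ : Module.Dual k H) (h₄ : H) (c : R),
        (sum₂ (nuInv ω h₄) fun ν₁ ν₂ => c * (ev (g⁻¹).val φ * ev (g⁻¹).val ν₁) * ev g.val ν₂) =
        c * ev (g⁻¹).val φ * ev ((g⁻¹).val ⊠ g.val ⊠ (1 ⊗ₜ h₄)) (gamma ω⁻¹).ofConv := by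
      intro φ h₄ c
      rw [← inverse_gamma, ← evT_nuInv]
      exact sum₂_eq _ ((LinearMap.mulLeft k (c * ev (g⁻¹).val φ)) ∘ₗ evT (ev (g⁻¹).val) (ev g.val))
        fun ν₁ ν₂ => by simp; ring
    simp only [key, bind_mul, bind_mul_right, bind_ev, bind_box_left, bind_box_right, bind_one_tmul,
      bind_baseChange, bind_evₗ, LinearMap.liftBaseChange_tmul, one_smul, ← Point.val_inv, ev_gamma,
      ev_theta, tht_inv, gam_inv]
    push_cast
    ring

/-- The left factor `ε # x⁻¹` in the definition of the antipode moves the evaluation of the other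
factor from `g` to `xgx⁻¹`, which accounts for the conjugates. -/
theorem val_crossedAntipode (g x : Point k R H) (φ : Module.Dual k H) :
    Val (evD k g) ((crossedAntipode ω).baseChange R ((1 ⊗ₜ φ) ⊠ x.val))
      (ev ((x * g * x⁻¹)⁻¹).val φ * ((tht ω (x * g * x⁻¹) x x⁻¹)⁻¹ *
        (gam ω (x * g * x⁻¹)⁻¹ (x * g * x⁻¹) x)⁻¹ * tht ω g x⁻¹ 1 : Rˣ)) (x⁻¹).val := by
  obtain ⟨Ξ, h, hΞ⟩ := crossedAntipode_generators ω x φ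
  have h₁ := val_generator g x⁻¹ (Coalgebra.counit (R := k))
  have h₂ : Val (evD k (x⁻¹⁻¹ * g * x⁻¹)) (crossedIncl.baseChange R Ξ)
      (LinearMap.liftBaseChange R (ev (x⁻¹⁻¹ * g * x⁻¹).val) Ξ) (1 : Point k R H).val := by
    rw [crossedIncl, baseChange_flip_mk]
    exact liftBaseChange_evD_box _ _ _
  refine (val_crossedMul ω h₁ h₂).congr rfl h.symm ?_ ?_
  · rw [hΞ, inv_inv, g.ev_counit]
    push_cast
    ring
  · rw [mul_one]

theorem liftBaseChange_crossedAntipode (g x : Point k R H) (Φ : R ⊗[k] Module.Dual k H) :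
    Val (evD k g) ((crossedAntipode ω).baseChange R (Φ ⊠ x.val))
      (LinearMap.liftBaseChange R (ev ((x * g * x⁻¹)⁻¹).val) Φ *
        ((tht ω (x * g * x⁻¹) x x⁻¹)⁻¹ *
        (gam ω (x * g * x⁻¹)⁻¹ (x * g * x⁻¹) x)⁻¹ * tht ω g x⁻¹ 1 : Rˣ)) (x⁻¹).val := by
  rw [Val]
  induction Φ using TensorProduct.induction_on with
  | zero => simp
  | add a b ha hb => simp only [add_box, map_add, ha, hb, add_mul, add_smul]
  | tmul r φ =>
    have h := val_crossedAntipode ω g x φ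
    rw [← mul_one r, ← smul_eq_mul, ← TensorProduct.smul_tmul', smul_box, map_smul, map_smul, h,
      map_smul, LinearMap.liftBaseChange_tmul, one_smul, smul_smul, smul_eq_mul, mul_assoc r]

end Antipode

end

section

/-! ### The group identities, written multiplicatively -/

section Multiplicative

variable {k R H : Type*} [Field k] [CommRing R] [Algebra k R] [Ring H] [HopfAlgebra k H]
  [Coalgebra.IsCocomm k H]
variable {ω : (WithConv (H ⊗[k] (H ⊗[k] H) →ₗ[k] k))ˣ} (hω : IsNormalizedThreeCocycle ω)
include hω

theorem om_one_left (x y : Point k R H) : om ω 1 x y = 1 :=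
  Additive.ofMul.injective (hω.isGroupCocycle.one_left x y)

theorem om_one_mid (x y : Point k R H) : om ω x 1 y = 1 :=
  Additive.ofMul.injective (hω.isGroupCocycle.one_mid x y)

theorem tht_one_mid (x y : Point k R H) : tht ω x 1 y = 1 :=
  Additive.ofMul.injective ((tht_additive ω _ _ _).trans (hω.isGroupCocycle.θ_one_mid x y))

theorem tht_one_right (x y : Point k R H) : tht ω x y 1 = 1 :=
  Additive.ofMul.injective ((tht_additive ω _ _ _).trans (hω.isGroupCocycle.θ_one_right x y))

theorem gam_one_left (x y : Point k R H) : gam ω 1 x y = 1 :=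
  Additive.ofMul.injective ((gam_additive ω _ _ _).trans (hω.isGroupCocycle.γ_one_left x y))

theorem gam_one_mid (x y : Point k R H) : gam ω x 1 y = 1 :=
  Additive.ofMul.injective ((gam_additive ω _ _ _).trans (hω.isGroupCocycle.γ_one_mid x y))

theorem gam_one_right (x y : Point k R H) : gam ω x y 1 = 1 :=
  Additive.ofMul.injective ((gam_additive ω _ _ _).trans (hω.isGroupCocycle.γ_one_right x y))

theorem tht_assoc (g x y z : Point k R H) :
    tht ω g x y * tht ω g (x * y) z = tht ω (x⁻¹ * g * x) y z * tht ω g x (y * z) := by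
  apply Additive.ofMul.injective
  simp only [ofMul_mul, tht_additive]
  exact hω.isGroupCocycle.θ_assoc g x y z

theorem gam_mul (g h x y : Point k R H) :
    gam ω g h (x * y) * tht ω (g * h) x y =
      gam ω g h x * gam ω (x⁻¹ * g * x) (x⁻¹ * h * x) y * tht ω g x y * tht ω h x y := by
  apply Additive.ofMul.injective
  simp only [ofMul_mul, tht_additive, gam_additive]
  exact hω.isGroupCocycle.γ_mul g h x y

theorem gam_assoc (g h z x : Point k R H) :
    gam ω g (h * z) x * gam ω h z x * om ω g h z =
      gam ω (g * h) z x * gam ω g h x * om ω (x⁻¹ * g * x) (x⁻¹ * h * x) (x⁻¹ * z * x) := by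
  apply Additive.ofMul.injective
  simp only [ofMul_mul, gam_additive]
  exact hω.isGroupCocycle.γ_assoc g h z x

theorem tht_inv_right (g x : Point k R H) : tht ω (x * g * x⁻¹) x x⁻¹ = tht ω g x⁻¹ x := by
  apply Additive.ofMul.injective
  simp only [tht_additive]
  exact hω.isGroupCocycle.θ_inv g x

theorem tht_gam_antipode_mul (K x y : Point k R H) :
    tht ω K (x * y) (x * y)⁻¹ * gam ω K⁻¹ K (x * y) / tht ω K⁻¹ x y =
      tht ω (x⁻¹ * K * x) y y⁻¹ * gam ω (x⁻¹ * K⁻¹ * x) (x⁻¹ * K * x) y * tht ω K x x⁻¹ *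
        gam ω K⁻¹ K x / tht ω ((x * y)⁻¹ * K * (x * y)) y⁻¹ x⁻¹ := by
  apply Additive.ofMul.injective
  simp only [ofMul_mul, ofMul_div, tht_additive, gam_additive]
  exact hω.isGroupCocycle.antipode_mul K x y

theorem gam_antipode_right (g x : Point k R H) :
    gam ω g g⁻¹ x * om ω (x⁻¹ * g * x) (x⁻¹ * g * x)⁻¹ (x⁻¹ * g * x) =
      gam ω g⁻¹ g x * om ω g g⁻¹ g := by
  apply Additive.ofMul.injective
  simp only [ofMul_mul, gam_additive]
  exact hω.isGroupCocycle.antipode_right g x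

end Multiplicative

/-! ### Generators of `H* # H` -/

section CrossedGenerators

universe u v w₁ w₂ w₃
variable {k : Type u} {H : Type v} [Field k] [Ring H] [HopfAlgebra k H] [Coalgebra.IsCocomm k H]
  [FiniteDimensional k H]

variable (k H) in
/-- The elements `φ # x` for functionals `φ` and points `x`. -/
def Generators.crossed : Generators.{u, v} k (Module.Dual k H ⊗[k] H) :=
  (Generators.const k (Module.Dual k H)).tensor (Generators.points k H)

theorem Generators.crossed_mem {R : Type max u v} [CommRing R] [Algebra k R]
    {z : R ⊗[k] (Module.Dual k H ⊗[k] H)} (h : (Generators.crossed.{u, v} k H).mem R z) :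
    ∃ (φ : Module.Dual k H) (x : Point k R H), z = (1 ⊗ₜ φ) ⊠ x.val := by
  obtain ⟨_, x, ⟨φ, rfl⟩, hx, rfl⟩ := h
  exact ⟨φ, ⟨x, hx⟩, rfl⟩

section
variable {B : Type w₁} {V : Type w₂} {K : Type w₃} [AddCommGroup B] [Module k B] [AddCommGroup V]
  [Module k V] [AddCommGroup K] [Module k K]

theorem Generators.ext₂ (G : Generators.{u, v} k B) (p : Probe.{u, v} k V K)
    {T T' : B ⊗[k] B →ₗ[k] V}
    (h : ∀ (R : Type max u v) [CommRing R] [Algebra k R] (E : V →ₗ[k] R ⊗[k] K), p.mem R E →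
      ∀ x y : R ⊗[k] B, G.mem R x → G.mem R y →
      LinearMap.liftBaseChange R E (T.baseChange R (x ⊠ y)) =
        LinearMap.liftBaseChange R E (T'.baseChange R (x ⊠ y))) : T = T' := by
  refine (G.tensor G).ext p fun R _ _ E hE z hz => ?_
  obtain ⟨x, y, hx, hy, rfl⟩ := hz
  exact h R E hE x y hx hy

theorem Generators.ext₃ (G : Generators.{u, v} k B) (p : Probe.{u, v} k V K)
    {T T' : B ⊗[k] (B ⊗[k] B) →ₗ[k] V}
    (h : ∀ (R : Type max u v) [CommRing R] [Algebra k R] (E : V →ₗ[k] R ⊗[k] K), p.mem R E →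
      ∀ x y z : R ⊗[k] B, G.mem R x → G.mem R y → G.mem R z →
      LinearMap.liftBaseChange R E (T.baseChange R (x ⊠ y ⊠ z)) =
        LinearMap.liftBaseChange R E (T'.baseChange R (x ⊠ y ⊠ z))) : T = T' := by
  refine (G.tensor (G.tensor G)).ext p fun R _ _ E hE z hz => ?_
  obtain ⟨x, _, hx, ⟨y, z, hy, hz, rfl⟩, rfl⟩ := hz
  exact h R E hE x y z hx hy hz

theorem Generators.ext_tensor₂ (G : Generators.{u, v} k B) (p : Probe.{u, v} k V K)
    {T T' : B →ₗ[k] V ⊗[k] V}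
    (h : ∀ (R : Type max u v) [CommRing R] [Algebra k R] (E E' : V →ₗ[k] R ⊗[k] K), p.mem R E →
      p.mem R E' → ∀ x : R ⊗[k] B, G.mem R x →
      LinearMap.liftBaseChange R (boxMap E E') (T.baseChange R x) =
        LinearMap.liftBaseChange R (boxMap E E') (T'.baseChange R x)) : T = T' := by
  refine G.ext (p.tensor p) ?_
  rintro R _ _ _ ⟨E, E', hE, hE', rfl⟩ z hz
  exact h R E E' hE hE' z hz

theorem Generators.ext_tensor₃ (G : Generators.{u, v} k B) (p : Probe.{u, v} k V K)
    {T T' : B →ₗ[k] V ⊗[k] (V ⊗[k] V)}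
    (h : ∀ (R : Type max u v) [CommRing R] [Algebra k R] (E E' E'' : V →ₗ[k] R ⊗[k] K),
      p.mem R E → p.mem R E' → p.mem R E'' → ∀ x : R ⊗[k] B, G.mem R x →
      LinearMap.liftBaseChange R (boxMap E (boxMap E' E'')) (T.baseChange R x) =
        LinearMap.liftBaseChange R (boxMap E (boxMap E' E'')) (T'.baseChange R x)) : T = T' := by
  refine G.ext (p.tensor (p.tensor p)) ?_
  rintro R _ _ _ ⟨E, _, hE, ⟨E', E'', hE', hE'', rfl⟩, rfl⟩ z hz
  exact h R E E' E'' hE hE' hE'' z hz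

theorem Generators.ext₂_tensor₂ (G : Generators.{u, v} k B) (p : Probe.{u, v} k V K)
    {T T' : B ⊗[k] B →ₗ[k] V ⊗[k] V}
    (h : ∀ (R : Type max u v) [CommRing R] [Algebra k R] (E E' : V →ₗ[k] R ⊗[k] K), p.mem R E →
      p.mem R E' → ∀ x y : R ⊗[k] B, G.mem R x → G.mem R y →
      LinearMap.liftBaseChange R (boxMap E E') (T.baseChange R (x ⊠ y)) =
        LinearMap.liftBaseChange R (boxMap E E') (T'.baseChange R (x ⊠ y))) : T = T' := by
  refine (G.tensor G).ext_tensor₂ p ?_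
  rintro R _ _ E E' hE hE' _ ⟨x, y, hx, hy, rfl⟩
  exact h R E E' hE hE' x y hx hy

theorem Generators.functional_ext₂ (G : Generators.{u, v} k B) {f f' : Module.Dual k (B ⊗[k] B)}
    (h : ∀ (R : Type max u v) [CommRing R] [Algebra k R] (x y : R ⊗[k] B), G.mem R x → G.mem R y →
      ev (x ⊠ y) f = ev (x ⊠ y) f') : f = f' := by
  refine (G.tensor G).functional_ext ?_
  rintro R _ _ _ ⟨x, y, hx, hy, rfl⟩
  exact h R x y hx hy

theorem Probe.ext_tensor₂ (p : Probe.{u, v} k V K) {s t : V ⊗[k] V}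
    (h : ∀ (R : Type max u v) [CommRing R] [Algebra k R] (E E' : V →ₗ[k] R ⊗[k] K), p.mem R E →
      p.mem R E' → boxMap E E' s = boxMap E E' t) : s = t := by
  refine (p.tensor p).ext ?_
  rintro R _ _ _ ⟨E, E', hE, hE', rfl⟩
  exact h R E E' hE hE'

theorem Probe.ext_tensor₃ (p : Probe.{u, v} k V K) {s t : V ⊗[k] (V ⊗[k] V)}
    (h : ∀ (R : Type max u v) [CommRing R] [Algebra k R] (E E' E'' : V →ₗ[k] R ⊗[k] K),
      p.mem R E → p.mem R E' → p.mem R E'' →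
      boxMap E (boxMap E' E'') s = boxMap E (boxMap E' E'') t) : s = t := by
  refine (p.tensor (p.tensor p)).ext ?_
  rintro R _ _ _ ⟨E, _, hE, ⟨E', E'', hE', hE'', rfl⟩, rfl⟩
  exact h R E E' E'' hE hE' hE''

end

section
variable {V : Type w₁} {K : Type w₂} [AddCommGroup V] [Module k V] [AddCommGroup K] [Module k K]

theorem crossed_ext (p : Probe.{u, v} k V K) {T T' : Module.Dual k H ⊗[k] H →ₗ[k] V}
    (h : ∀ (R : Type max u v) [CommRing R] [Algebra k R] (E : V →ₗ[k] R ⊗[k] K), p.mem R E →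
      ∀ (φ : Module.Dual k H) (x : Point k R H),
      LinearMap.liftBaseChange R E (T.baseChange R ((1 ⊗ₜ φ) ⊠ x.val)) =
        LinearMap.liftBaseChange R E (T'.baseChange R ((1 ⊗ₜ φ) ⊠ x.val))) : T = T' := by
  refine (Generators.crossed k H).ext p fun R _ _ E hE z hz => ?_
  obtain ⟨φ, x, rfl⟩ := Generators.crossed_mem hz
  exact h R E hE φ x

theorem crossed_ext₂ (p : Probe.{u, v} k V K)
    {T T' : (Module.Dual k H ⊗[k] H) ⊗[k] (Module.Dual k H ⊗[k] H) →ₗ[k] V}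
    (h : ∀ (R : Type max u v) [CommRing R] [Algebra k R] (E : V →ₗ[k] R ⊗[k] K), p.mem R E →
      ∀ (φ ψ : Module.Dual k H) (x y : Point k R H),
      LinearMap.liftBaseChange R E (T.baseChange R (((1 ⊗ₜ φ) ⊠ x.val) ⊠ ((1 ⊗ₜ ψ) ⊠ y.val))) =
        LinearMap.liftBaseChange R E
          (T'.baseChange R (((1 ⊗ₜ φ) ⊠ x.val) ⊠ ((1 ⊗ₜ ψ) ⊠ y.val)))) : T = T' := by
  refine (Generators.crossed k H).ext₂ p fun R _ _ E hE s t hs ht => ?_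
  obtain ⟨φ, x, rfl⟩ := Generators.crossed_mem hs
  obtain ⟨ψ, y, rfl⟩ := Generators.crossed_mem ht
  exact h R E hE φ ψ x y

theorem crossed_ext₃ (p : Probe.{u, v} k V K)
    {T T' : (Module.Dual k H ⊗[k] H) ⊗[k] ((Module.Dual k H ⊗[k] H) ⊗[k]
      (Module.Dual k H ⊗[k] H)) →ₗ[k] V}
    (h : ∀ (R : Type max u v) [CommRing R] [Algebra k R] (E : V →ₗ[k] R ⊗[k] K), p.mem R E →
      ∀ (φ ψ χ : Module.Dual k H) (x y z : Point k R H),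
      LinearMap.liftBaseChange R E (T.baseChange R
          (((1 ⊗ₜ φ) ⊠ x.val) ⊠ ((1 ⊗ₜ ψ) ⊠ y.val) ⊠ ((1 ⊗ₜ χ) ⊠ z.val))) =
        LinearMap.liftBaseChange R E (T'.baseChange R
          (((1 ⊗ₜ φ) ⊠ x.val) ⊠ ((1 ⊗ₜ ψ) ⊠ y.val) ⊠ ((1 ⊗ₜ χ) ⊠ z.val)))) : T = T' := by
  refine (Generators.crossed k H).ext₃ p fun R _ _ E hE r s t hr hs ht => ?_
  obtain ⟨φ, x, rfl⟩ := Generators.crossed_mem hr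
  obtain ⟨ψ, y, rfl⟩ := Generators.crossed_mem hs
  obtain ⟨χ, z, rfl⟩ := Generators.crossed_mem ht
  exact h R E hE φ ψ χ x y z

end

end CrossedGenerators

/-! ### Reassociator, iterated coproducts and counit at points -/

section CrossedLaws

variable {k R H : Type*} [Field k] [CommRing R] [Algebra k R] [Ring H] [HopfAlgebra k H]
  [Coalgebra.IsCocomm k H]
variable (ω : (WithConv (H ⊗[k] (H ⊗[k] H) →ₗ[k] k))ˣ)

theorem liftBaseChange_comp_apply {V W N : Type*} [AddCommMonoid V] [Module k V] [AddCommMonoid W]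
    [Module k W] [AddCommMonoid N] [Module k N] [Module R N] [IsScalarTower k R N]
    (f : V →ₗ[k] W) (E : W →ₗ[k] N) (z : R ⊗[k] V) :
    LinearMap.liftBaseChange R (E ∘ₗ f) z = LinearMap.liftBaseChange R E (f.baseChange R z) := by
  induction z using TensorProduct.induction_on with
  | zero => simp
  | add x y hx hy => simp only [map_add, hx, hy]
  | tmul r v => simp

theorem baseChange_toSpanSingleton_comp {V W : Type*} [AddCommMonoid V] [Module k V]
    [AddCommMonoid W] [Module k W] (f : Module.Dual k V) (w : W) (z : R ⊗[k] V) :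
    (LinearMap.toSpanSingleton k W w ∘ₗ f).baseChange R z = ev z f • (1 ⊗ₜ w) := by
  induction z using TensorProduct.induction_on with
  | zero => simp
  | add x y hx hy => rw [map_add, hx, hy, ev_add_left, add_smul]
  | tmul r v =>
    simp only [LinearMap.baseChange_tmul, LinearMap.comp_apply, LinearMap.toSpanSingleton_apply,
      ev_tmul, TensorProduct.smul_tmul', smul_eq_mul, mul_one, ← TensorProduct.smul_tmul]
    rw [mul_comm r, ← Algebra.smul_def]

theorem baseChange_lid_map {V W : Type*} [AddCommMonoid V] [Module k V]
    [AddCommMonoid W] [Module k W] (f : Module.Dual k V) (a : R ⊗[k] V) (b : R ⊗[k] W) :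
    ((TensorProduct.lid k W).toLinearMap ∘ₗ TensorProduct.map f LinearMap.id).baseChange R (a ⊠ b) =
      ev a f • b := by
  induction a, b using box_induction with
  | zero_left => simp
  | zero_right => simp
  | add_left x x' y h h' => simp only [add_box, map_add, h, h', ev_add_left, add_smul]
  | add_right x y y' h h' => simp only [box_add, map_add, h, h', smul_add]
  | tmul r v s w =>
    simp only [tmul_box_tmul, LinearMap.baseChange_tmul, LinearMap.comp_apply,
      TensorProduct.map_tmul, LinearEquiv.coe_coe, TensorProduct.lid_tmul, LinearMap.id_apply,
      ev_tmul, TensorProduct.smul_tmul', smul_eq_mul, ← TensorProduct.smul_tmul]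
    rw [Algebra.smul_def]
    congr 1; ring

theorem baseChange_rid_map {V W : Type*} [AddCommMonoid V] [Module k V]
    [AddCommMonoid W] [Module k W] (f : Module.Dual k V) (a : R ⊗[k] V) (b : R ⊗[k] W) :
    ((TensorProduct.rid k W).toLinearMap ∘ₗ TensorProduct.map LinearMap.id f).baseChange R (b ⊠ a) =
      ev a f • b := by
  induction a, b using box_induction with
  | zero_left => simp
  | zero_right => simp
  | add_left x x' y h h' => simp only [box_add, map_add, h, h', ev_add_left, add_smul]
  | add_right x y y' h h' => simp only [add_box, map_add, h, h', smul_add]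
  | tmul r v s w =>
    simp only [tmul_box_tmul, LinearMap.baseChange_tmul, LinearMap.comp_apply,
      TensorProduct.map_tmul, LinearEquiv.coe_coe, TensorProduct.rid_tmul, LinearMap.id_apply,
      ev_tmul, TensorProduct.smul_tmul', smul_eq_mul, ← TensorProduct.smul_tmul]
    rw [Algebra.smul_def]
    congr 1; ring

theorem lift_comp_eq {A B C : Type*} [AddCommMonoid A] [Module k A] [AddCommMonoid B] [Module k B]
    [AddCommMonoid C] [Module k C] (m : B →ₗ[k] C →ₗ[k] B) (f : A →ₗ[k] B) :
    TensorProduct.lift (m ∘ₗ f) = TensorProduct.lift m ∘ₗ TensorProduct.map f LinearMap.id :=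
  TensorProduct.ext' fun _ _ => rfl

theorem lift_compl₂_comp_eq {A B C D E : Type*} [AddCommMonoid A] [Module k A] [AddCommMonoid B]
    [Module k B] [AddCommMonoid C] [Module k C] [AddCommMonoid D] [Module k D] [AddCommMonoid E]
    [Module k E] (m : B →ₗ[k] C →ₗ[k] E) (f : A →ₗ[k] B) (g : D →ₗ[k] C) :
    TensorProduct.lift ((m ∘ₗ f).compl₂ g) = TensorProduct.lift m ∘ₗ TensorProduct.map f g :=
  TensorProduct.ext' fun _ _ => rfl

theorem evD_crossedIncl (g : Point k R H) (φ : Module.Dual k H) :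
    evD k g (crossedIncl φ) = ev g.val φ • (1 : Point k R H).val :=
  evD_tmul g φ 1

theorem boxMap_crossedIncl (g h : Point k R H) (t : Module.Dual k H ⊗[k] Module.Dual k H) :
    boxMap (evD k g) (evD k h) (TensorProduct.map crossedIncl crossedIncl t) =
      evT (ev g.val) (ev h.val) t • ((1 : Point k R H).val ⊠ (1 : Point k R H).val) := by
  induction t using TensorProduct.induction_on with
  | zero => simp
  | add x y hx hy => simp only [map_add, hx, hy, add_smul]
  | tmul φ ψ =>
    rw [TensorProduct.map_tmul, boxMap_tmul, evD_crossedIncl, evD_crossedIncl, smul_box, box_smul,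
      smul_smul, evT_tmul]

theorem boxMap_crossedIncl₃ (g h l : Point k R H)
    (t : Module.Dual k H ⊗[k] (Module.Dual k H ⊗[k] Module.Dual k H)) :
    boxMap (evD k g) (boxMap (evD k h) (evD k l))
      (TensorProduct.map crossedIncl (TensorProduct.map crossedIncl crossedIncl) t) =
      evT (ev g.val) (evT (ev h.val) (ev l.val)) t •
        ((1 : Point k R H).val ⊠ (1 : Point k R H).val ⊠ (1 : Point k R H).val) := by
  induction t using TensorProduct.induction_on with
  | zero => simp
  | add x y hx hy => simp only [map_add, hx, hy, add_smul]
  | tmul φ t =>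
    rw [TensorProduct.map_tmul, boxMap_tmul, evD_crossedIncl, boxMap_crossedIncl, smul_box,
      box_smul, smul_smul, evT_tmul]

variable [FiniteDimensional k H]

theorem val_reassoc (g h l : Point k R H) :
    Val (boxMap (evD k g) (boxMap (evD k h) (evD k l))) (1 ⊗ₜ (DOmega ω).reassoc)
      ((om ω g h l)⁻¹ : Rˣ)
      ((1 : Point k R H).val ⊠ (1 : Point k R H).val ⊠ (1 : Point k R H).val) :=
  val_one_tmul ((boxMap_crossedIncl₃ g h l _).trans (by rw [evT_dualTriple_omegaInv]))

theorem val_reassocInv (g h l : Point k R H) :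
    Val (boxMap (evD k g) (boxMap (evD k h) (evD k l))) (1 ⊗ₜ (DOmega ω).reassocInv)
      (om ω g h l)
      ((1 : Point k R H).val ⊠ (1 : Point k R H).val ⊠ (1 : Point k R H).val) :=
  val_one_tmul ((boxMap_crossedIncl₃ g h l _).trans (by rw [evT_dualTriple_omega]))

theorem val_comul_left {g h l x : Point k R H} {z : R ⊗[k] (Module.Dual k H ⊗[k] H)} {c : R}
    (hz : Val (evD k (g * h * l)) z c x.val) :
    Val (boxMap (evD k g) (boxMap (evD k h) (evD k l)))
      ((TensorProduct.assoc k _ _ _).toLinearMap.baseChange R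
        ((TensorProduct.map (crossedComul ω) LinearMap.id).baseChange R
          ((crossedComul ω).baseChange R z))) (c * gam ω (g * h) l x * gam ω g h x)
      (x.val ⊠ x.val ⊠ x.val) := by
  have h₁ := ((opLaw_crossedComul ω g h).tensor (OpLaw.id (evD k l))).val (val_crossedComul ω hz)
  rw [liftBaseChange_boxMap, comulArg_point, liftBaseChange_mk, smul_box, smul_smul] at h₁
  have h₂ := (OpLaw.assoc (evD k g) (evD k h) (evD k l)).val h₁
  rwa [liftBaseChange_mk_comp, baseChange_assoc_box] at h₂

theorem val_comul_right {g h l x : Point k R H} {z : R ⊗[k] (Module.Dual k H ⊗[k] H)} {c : R}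
    (hz : Val (evD k (g * (h * l))) z c x.val) :
    Val (boxMap (evD k g) (boxMap (evD k h) (evD k l)))
      ((TensorProduct.map LinearMap.id (crossedComul ω)).baseChange R
          ((crossedComul ω).baseChange R z)) (c * gam ω g (h * l) x * gam ω h l x)
      (x.val ⊠ x.val ⊠ x.val) := by
  have h₁ := ((OpLaw.id (evD k g)).tensor (opLaw_crossedComul ω h l)).val (val_crossedComul ω hz)
  rwa [liftBaseChange_boxMap, comulArg_point, liftBaseChange_mk, box_smul, smul_smul] at h₁

theorem lift₂_mul {V W : Type*} [AddCommGroup V] [Module k V] [AddCommGroup W] [Module k W]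
    (f : Module.Dual k V) (g : Module.Dual k W) :
    (lift₂ fun v w => f v * g w) = LinearMap.mul' k k ∘ₗ TensorProduct.map f g :=
  LinearMap.ext fun t => sum₂_eq t (LinearMap.mul' k k ∘ₗ TensorProduct.map f g) fun _ _ => rfl

theorem DOmega_counit_eq : (DOmega ω).counit =
    LinearMap.mul' k k ∘ₗ TensorProduct.map (Module.Dual.eval k H 1) Coalgebra.counit :=
  lift₂_mul (Module.Dual.eval k H 1) Coalgebra.counit

theorem ev_counit_box (x : Point k R H) (Φ : R ⊗[k] Module.Dual k H) :
    ev (Φ ⊠ x.val) (DOmega ω).counit =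
      LinearMap.liftBaseChange R (ev (1 : Point k R H).val) Φ := by
  rw [DOmega_counit_eq, ev_mul'_map_box, x.isPoint.counit, mul_one]
  induction Φ using TensorProduct.induction_on with
  | zero => simp
  | add x y hx hy => rw [ev_add_left, map_add, hx, hy]
  | tmul r φ => rw [ev_tmul, LinearMap.liftBaseChange_tmul, ev_one_val]; rfl

theorem ev_counit_generator (x : Point k R H) (φ : Module.Dual k H) :
    ev ((1 ⊗ₜ φ) ⊠ x.val) (DOmega ω).counit = ev (1 : Point k R H).val φ := by
  rw [ev_counit_box, LinearMap.liftBaseChange_tmul, one_smul]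

end CrossedLaws

end

section

/-! ### The quasi-bialgebra and antipode axioms of `D^ω(H)` -/

section CrossedAxioms

universe u v
variable {k : Type u} {H : Type v} [Field k] [Ring H] [HopfAlgebra k H] [Coalgebra.IsCocomm k H]
  [FiniteDimensional k H]
variable {ω : (WithConv (H ⊗[k] (H ⊗[k] H) →ₗ[k] k))ˣ} (hω : IsNormalizedThreeCocycle ω)
include hω

theorem crossed_assoc : TensorProduct.lift (crossedMul ω) ∘ₗ
    TensorProduct.map (TensorProduct.lift (crossedMul ω)) LinearMap.id ∘ₗ
      (TensorProduct.assoc k _ _ _).symm.toLinearMap =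
    TensorProduct.lift (crossedMul ω) ∘ₗ
      TensorProduct.map LinearMap.id (TensorProduct.lift (crossedMul ω)) := by
  refine crossed_ext₃ (Probe.points k H) ?_
  rintro R _ _ _ ⟨g, rfl⟩ φ ψ χ x y z
  simp only [LinearMap.baseChange_comp, LinearMap.comp_apply, baseChange_assoc_symm_box,
    baseChange_map_box, LinearMap.baseChange_id, LinearMap.id_apply]
  refine (val_crossedMul ω (val_crossedMul ω (val_generator g x φ) (val_generator _ y ψ))
    (val_generator _ z χ)).eq (val_crossedMul ω (val_generator g x φ)
    (val_crossedMul ω (val_generator _ y ψ) (val_generator _ z χ))) ?_ (by rw [mul_assoc])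
  have h := congrArg Units.val (tht_assoc hω g x y z)
  push_cast at h
  simp only [mul_inv_rev, mul_assoc] at h ⊢
  linear_combination (ev g.val φ * ev (x⁻¹ * (g * x)).val ψ *
    ev (y⁻¹ * (x⁻¹ * (g * (x * y)))).val χ) * h

theorem crossed_one_mul : crossedMul ω (DOmega ω).one = LinearMap.id := by
  refine crossed_ext (Probe.points k H) ?_
  rintro R _ _ _ ⟨g, rfl⟩ φ x
  rw [baseChange_apply_eq, LinearMap.baseChange_id, LinearMap.id_apply]
  refine (val_crossedMul ω (val_crossedIncl g Coalgebra.counit) (val_generator _ x φ)).eq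
    (val_generator g x φ) ?_ (by rw [one_mul])
  simp [tht_one_mid hω, g.ev_counit]

theorem crossed_mul_one : (crossedMul ω).flip (DOmega ω).one = LinearMap.id := by
  refine crossed_ext (Probe.points k H) ?_
  rintro R _ _ _ ⟨g, rfl⟩ φ x
  rw [baseChange_flip_apply_eq, LinearMap.baseChange_id, LinearMap.id_apply]
  refine (val_crossedMul ω (val_generator g x φ) (val_crossedIncl _ Coalgebra.counit)).eq
    (val_generator g x φ) ?_ (by rw [mul_one])
  simp [tht_one_right hω, Point.ev_counit]

theorem crossed_comul_mul : crossedComul ω ∘ₗ TensorProduct.lift (crossedMul ω) =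
    TensorProduct.lift (DOmega ω).mul₂ ∘ₗ TensorProduct.map (crossedComul ω) (crossedComul ω) := by
  refine (Generators.crossed k H).ext₂_tensor₂ (Probe.points k H) ?_
  rintro R _ _ _ _ ⟨g, rfl⟩ ⟨h, rfl⟩ s t hs ht
  obtain ⟨φ, x, rfl⟩ := Generators.crossed_mem hs
  obtain ⟨ψ, y, rfl⟩ := Generators.crossed_mem ht
  simp only [LinearMap.baseChange_comp, LinearMap.comp_apply, baseChange_map_box]
  refine (val_crossedComul ω (val_crossedMul ω (val_generator (g * h) x φ)
    (val_generator _ y ψ))).eq (val_crossedMul₂ ω (val_crossedComul ω (val_generator _ x φ))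
    (val_crossedComul ω (val_generator _ y ψ))) ?_ rfl
  have e := congrArg Units.val (gam_mul hω g h x y)
  push_cast at e
  simp only [mul_assoc, mul_inv_cancel_left] at e ⊢
  linear_combination (ev (g * h).val φ * ev (x⁻¹ * (g * (h * x))).val ψ) * e

/-- Conjugation by the reassociator does not cancel here: the factor on the right is seen at the
conjugates by `x`. Thus `ω(g, h, l)⁻¹` meets `ω(x⁻¹gx, x⁻¹hx, x⁻¹lx)`, and `gam_assoc` is exactly
this comparison. -/
theorem crossed_coassoc : TensorProduct.map LinearMap.id (crossedComul ω) ∘ₗ crossedComul ω =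
    (DOmega ω).mul₃.flip (DOmega ω).reassocInv ∘ₗ (DOmega ω).mul₃ (DOmega ω).reassoc ∘ₗ
      (TensorProduct.assoc k _ _ _).toLinearMap ∘ₗ
      TensorProduct.map (crossedComul ω) LinearMap.id ∘ₗ crossedComul ω := by
  refine (Generators.crossed k H).ext_tensor₃ (Probe.points k H) ?_
  rintro R _ _ _ _ _ ⟨g, rfl⟩ ⟨h, rfl⟩ ⟨l, rfl⟩ z hz
  obtain ⟨φ, x, rfl⟩ := Generators.crossed_mem hz
  simp only [LinearMap.baseChange_comp, LinearMap.comp_apply]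
  rw [baseChange_flip_apply_eq, baseChange_apply_eq]
  refine (val_comul_right ω (val_generator (g * (h * l)) x φ)).eq
    (val_crossedMul₃ ω (val_crossedMul₃ ω (val_reassoc ω g h l)
      (val_comul_left ω (val_generator _ x φ))) (val_reassocInv ω _ _ _)) ?_ (by simp only [one_mul, mul_one])
  have e := congrArg Units.val (gam_assoc hω g h l x)
  have e' := Units.inv_mul (om ω g h l)
  push_cast at e
  simp only [tht_one_mid hω, tht_one_right hω, inv_one, one_mul, mul_one, Units.val_one,
    mul_assoc] at e e' ⊢
  linear_combination (ev (g * (h * l)).val φ * ((om ω g h l)⁻¹ : Rˣ)) * e -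
    ev (g * (h * l)).val φ * gam ω g (h * l) x * gam ω h l x * e'

end CrossedAxioms

section CrossedCounit

universe u v
variable {k : Type u} {H : Type v} [Field k] [Ring H] [HopfAlgebra k H] [Coalgebra.IsCocomm k H]
  [FiniteDimensional k H]
variable {ω : (WithConv (H ⊗[k] (H ⊗[k] H) →ₗ[k] k))ˣ} (hω : IsNormalizedThreeCocycle ω)
include hω



theorem crossed_counit_comul : ((TensorProduct.lid k _).toLinearMap ∘ₗ
    TensorProduct.map (DOmega ω).counit LinearMap.id) ∘ₗ crossedComul ω = LinearMap.id := by
  refine crossed_ext (Probe.points k H) ?_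
  rintro R _ _ _ ⟨g, rfl⟩ φ x
  obtain ⟨Ψ, h, hΨ⟩ := crossedComul_generators ω x φ
  rw [LinearMap.baseChange_comp, LinearMap.comp_apply, h, LinearMap.baseChange_id,
    LinearMap.id_apply, ← liftBaseChange_comp_apply]
  refine (liftBaseChange_shuffle (f := ev (1 : Point k R H).val) (g := ev g.val) (z := x.val)
    (fun φ ψ => ?_) Ψ).trans ?_
  · rw [liftBaseChange_comp_apply, baseChange_lid_map, map_smul, val_generator g x ψ, smul_smul,
      ev_counit_generator]
  · rw [hΨ, val_generator g x φ, gam_one_left hω, one_mul, Units.val_one, mul_one]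

theorem crossed_comul_counit : ((TensorProduct.rid k _).toLinearMap ∘ₗ
    TensorProduct.map LinearMap.id (DOmega ω).counit) ∘ₗ crossedComul ω = LinearMap.id := by
  refine crossed_ext (Probe.points k H) ?_
  rintro R _ _ _ ⟨g, rfl⟩ φ x
  obtain ⟨Ψ, h, hΨ⟩ := crossedComul_generators ω x φ
  rw [LinearMap.baseChange_comp, LinearMap.comp_apply, h, LinearMap.baseChange_id,
    LinearMap.id_apply, ← liftBaseChange_comp_apply]
  refine (liftBaseChange_shuffle (f := ev g.val) (g := ev (1 : Point k R H).val) (z := x.val)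
    (fun φ ψ => ?_) Ψ).trans ?_
  · rw [liftBaseChange_comp_apply, baseChange_rid_map, map_smul, val_generator g x φ, smul_smul,
      ev_counit_generator, mul_comm]
  · rw [hΨ, val_generator g x φ, gam_one_mid hω, mul_one, Units.val_one, mul_one]

theorem crossed_counit_mul : (DOmega ω).counit ∘ₗ TensorProduct.lift (crossedMul ω) =
    LinearMap.mul' k k ∘ₗ TensorProduct.map (DOmega ω).counit (DOmega ω).counit := by
  refine (Generators.crossed k H).functional_ext₂ ?_
  intro R _ _ s t h₁ h₂
  obtain ⟨φ, x, rfl⟩ := Generators.crossed_mem h₁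
  obtain ⟨ψ, y, rfl⟩ := Generators.crossed_mem h₂
  obtain ⟨Φ, h, hΦ⟩ := crossedMul_generators ω x y φ ψ
  rw [ev_comp, h, ev_counit_box, ev_mul'_map_box, ev_counit_generator, ev_counit_generator, hΦ]
  have : tht ω 1 x y = 1 :=
    Additive.ofMul.injective ((tht_additive ω _ _ _).trans (hω.isGroupCocycle.θ_one_left x y))
  simp [this]

theorem crossed_antipode_mul : crossedAntipode ω ∘ₗ TensorProduct.lift (crossedMul ω) =
    TensorProduct.lift (crossedMul ω) ∘ₗ
      TensorProduct.map (crossedAntipode ω) (crossedAntipode ω) ∘ₗ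
      (TensorProduct.comm k _ _).toLinearMap := by
  refine crossed_ext₂ (Probe.points k H) ?_
  rintro R _ _ _ ⟨g, rfl⟩ φ ψ x y
  obtain ⟨Φ, h, hΦ⟩ := crossedMul_generators ω x y φ ψ
  simp only [LinearMap.baseChange_comp, LinearMap.comp_apply, baseChange_map_box,
    baseChange_comm_box, h]
  refine (liftBaseChange_crossedAntipode ω g (x * y) Φ).eq (val_crossedMul ω
    (val_crossedAntipode ω g y ψ) (val_crossedAntipode ω _ x φ)) ?_ (by rw [mul_inv_rev])
  -- The antipode evaluates at conjugates, hence `K = xyg(xy)⁻¹`. The identity is inverted because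
  -- the antipode contains `σ⁻¹` and `ν⁻¹`.
  have e := congrArg (fun u : Rˣ => (u⁻¹ : Rˣ).val) (tht_gam_antipode_mul hω (x * y * g * (x * y)⁻¹) x y)
  rw [hΦ]
  simp only [tht_one_right hω, mul_one]
  simp only [mul_inv_rev, inv_inv, mul_assoc, inv_mul_cancel_left,
    inv_mul_cancel, mul_one, div_eq_mul_inv] at e ⊢
  push_cast at e ⊢
  linear_combination (ev (x * (y * (g⁻¹ * (y⁻¹ * x⁻¹)))).val φ * ev (y * (g⁻¹ * y⁻¹)).val ψ) * e

theorem crossed_antipode_left : (TensorProduct.lift (crossedMul ω ∘ₗ crossedAntipode ω)) ∘ₗ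
    crossedComul ω = LinearMap.toSpanSingleton k _ (DOmega ω).one ∘ₗ (DOmega ω).counit := by
  refine crossed_ext (Probe.points k H) ?_
  rintro R _ _ _ ⟨g, rfl⟩ φ x
  obtain ⟨Ψ, h, hΨ⟩ := crossedComul_generators ω x φ
  rw [LinearMap.baseChange_comp, LinearMap.comp_apply, h, baseChange_toSpanSingleton_comp,
    ← liftBaseChange_comp_apply, map_smul]
  have h₁ : LinearMap.liftBaseChange R (evD k g) (1 ⊗ₜ (DOmega ω).one) = _ :=
    val_crossedIncl g Coalgebra.counit
  -- Evaluated at `g`, the antipode sees its argument at `(xgx⁻¹)⁻¹` and the right factor is seen at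
  -- `xgx⁻¹`. The product of these two points is `1`, which produces the counit.
  refine (liftBaseChange_shuffle (f := ev ((x * g * x⁻¹)⁻¹).val) (g := ev (x * g * x⁻¹).val)
    (z := ((gam ω (x * g * x⁻¹)⁻¹ (x * g * x⁻¹) x)⁻¹ : Rˣ).val • (1 : Point k R H).val)
    (fun φ ψ => ?_) Ψ).trans ?_
  · rw [liftBaseChange_comp_apply, lift_comp_eq, LinearMap.baseChange_comp, LinearMap.comp_apply,
      baseChange_map_box, LinearMap.baseChange_id, LinearMap.id_apply]
    refine (val_crossedMul ω (val_crossedAntipode ω g x φ) (val_generator _ x ψ)).trans ?_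
    rw [smul_smul, tht_inv_right hω, tht_one_right hω, inv_mul_cancel, inv_inv]
    congr 1
    have e' := Units.inv_mul (tht ω g x⁻¹ x)
    push_cast
    linear_combination (ev ((x * g * x⁻¹)⁻¹).val φ * ev (x * g * x⁻¹).val ψ *
      ((gam ω (x * g * x⁻¹)⁻¹ (x * g * x⁻¹) x)⁻¹ : Rˣ)) * e'
  · rw [hΨ, smul_smul, ev_counit_generator, h₁, g.ev_counit,
      smul_smul, mul_assoc, Units.mul_inv, inv_mul_cancel]

theorem crossed_antipode_right : (TensorProduct.lift
      ((crossedMul ω ∘ₗ (crossedMul ω).flip (DOmega ω).beta).compl₂ (crossedAntipode ω))) ∘ₗ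
    crossedComul ω = LinearMap.toSpanSingleton k _ (DOmega ω).beta ∘ₗ (DOmega ω).counit := by
  refine crossed_ext (Probe.points k H) ?_
  rintro R _ _ _ ⟨g, rfl⟩ φ x
  obtain ⟨Ψ, h, hΨ⟩ := crossedComul_generators ω x φ
  rw [LinearMap.baseChange_comp, LinearMap.comp_apply, h, baseChange_toSpanSingleton_comp,
    ← liftBaseChange_comp_apply, map_smul]
  have h₁ : LinearMap.liftBaseChange R (evD k g) (1 ⊗ₜ (DOmega ω).beta) = _ :=
    val_crossedIncl g (betaFun ω)
  -- Here the legs are evaluated at `g` and `g⁻¹`: the point `x⁻¹gx` reached after the left factor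
  -- is conjugated back by the antipode.
  refine (liftBaseChange_shuffle (f := ev g.val) (g := ev (g⁻¹).val)
    (z := ((gam ω g⁻¹ g x)⁻¹ * om ω (x⁻¹ * g * x) (x⁻¹ * g * x)⁻¹ (x⁻¹ * g * x) : Rˣ).val •
      (1 : Point k R H).val)
    (fun φ ψ => ?_) Ψ).trans ?_
  · rw [liftBaseChange_comp_apply, lift_compl₂_comp_eq, LinearMap.baseChange_comp, LinearMap.comp_apply,
      baseChange_map_box, baseChange_flip_apply_eq]
    refine (val_crossedMul ω (val_crossedMul ω (val_generator g x φ)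
      (val_crossedIncl _ (betaFun ω))) (val_crossedAntipode ω _ x ψ)).trans ?_
    rw [smul_smul, tht_one_right hω, tht_one_right hω, ev_betaFun, mul_one, mul_inv_cancel]
    simp only [mul_assoc, mul_inv_rev, inv_inv, mul_inv_cancel_left, mul_inv_cancel, mul_one]
    congr 1
    have e' := Units.inv_mul (tht ω g x x⁻¹)
    push_cast
    linear_combination (ev g.val φ * ev (g⁻¹).val ψ * ((gam ω g⁻¹ g x)⁻¹ : Rˣ) *
      om ω (x⁻¹ * (g * x)) (x⁻¹ * (g⁻¹ * x)) (x⁻¹ * (g * x))) * e'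
  · rw [hΨ, smul_smul, ev_counit_generator, h₁, ev_betaFun,
      smul_smul, mul_assoc, mul_inv_cancel]
    congr 2
    rw [← Units.val_mul]
    congr 1
    -- The value of `β` at `x⁻¹gx` is exchanged for its value at `g`.
    rw [mul_left_comm, gam_antipode_right hω, inv_mul_cancel_left]

end CrossedCounit

/-! ### A criterion for quasi-Hopf algebras -/

section GenericCriterion

variable {k : Type*} [Field k]

/-- Axioms on distinguished elements are inherited from `Q`. The others are required as equalities
of linear maps, the form in which generators and probes can test them. -/
theorem QuasiHopfData.isQuasiHopf_of_isHom {A B : Type*} [AddCommGroup A] [Module k A]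
    [AddCommGroup B] [Module k B] {Q : QuasiHopfData k A} {Q' : QuasiHopfData k B} {i : A →ₗ[k] B}
    (h : Q.IsHom Q' i) (hQ : Q.IsQuasiHopf)
    (mul_assoc : TensorProduct.lift Q'.mul ∘ₗ
        TensorProduct.map (TensorProduct.lift Q'.mul) LinearMap.id ∘ₗ
          (TensorProduct.assoc k _ _ _).symm.toLinearMap =
        TensorProduct.lift Q'.mul ∘ₗ TensorProduct.map LinearMap.id (TensorProduct.lift Q'.mul))
    (one_mul : Q'.mul Q'.one = LinearMap.id)
    (mul_one : Q'.mul.flip Q'.one = LinearMap.id)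
    (comul_mul : Q'.comul ∘ₗ TensorProduct.lift Q'.mul =
      TensorProduct.lift Q'.mul₂ ∘ₗ TensorProduct.map Q'.comul Q'.comul)
    (counit_mul : Q'.counit ∘ₗ TensorProduct.lift Q'.mul =
      LinearMap.mul' k k ∘ₗ TensorProduct.map Q'.counit Q'.counit)
    (counit_comul : ((TensorProduct.lid k _).toLinearMap ∘ₗ
      TensorProduct.map Q'.counit LinearMap.id) ∘ₗ Q'.comul = LinearMap.id)
    (comul_counit : ((TensorProduct.rid k _).toLinearMap ∘ₗ
      TensorProduct.map LinearMap.id Q'.counit) ∘ₗ Q'.comul = LinearMap.id)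
    (coassoc : TensorProduct.map LinearMap.id Q'.comul ∘ₗ Q'.comul =
      Q'.mul₃.flip Q'.reassocInv ∘ₗ Q'.mul₃ Q'.reassoc ∘ₗ
        (TensorProduct.assoc k _ _ _).toLinearMap ∘ₗ
        TensorProduct.map Q'.comul LinearMap.id ∘ₗ Q'.comul)
    (antipode_mul : Q'.antipode ∘ₗ TensorProduct.lift Q'.mul =
      TensorProduct.lift Q'.mul ∘ₗ TensorProduct.map Q'.antipode Q'.antipode ∘ₗ
        (TensorProduct.comm k _ _).toLinearMap)
    (alpha : Q'.alpha = Q'.one)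
    (antipode_left : TensorProduct.lift (Q'.mul ∘ₗ Q'.antipode) ∘ₗ Q'.comul =
      LinearMap.toSpanSingleton k _ Q'.one ∘ₗ Q'.counit)
    (antipode_right : TensorProduct.lift
      ((Q'.mul ∘ₗ Q'.mul.flip Q'.beta).compl₂ Q'.antipode) ∘ₗ Q'.comul =
      LinearMap.toSpanSingleton k _ Q'.beta ∘ₗ Q'.counit) : Q'.IsQuasiHopf where
  mul_assoc a b c := LinearMap.congr_fun mul_assoc (a ⊗ₜ (b ⊗ₜ c))
  one_mul a := LinearMap.congr_fun one_mul a
  mul_one a := LinearMap.congr_fun mul_one a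
  comul_mul a b := LinearMap.congr_fun comul_mul (a ⊗ₜ b)
  comul_one := h.comul_one hQ.comul_one
  counit_mul a b := LinearMap.congr_fun counit_mul (a ⊗ₜ b)
  counit_one := by rw [← h.map_one, h.map_counit, hQ.counit_one]
  counit_comul a := (sum₂_smul_left _ _).trans (LinearMap.congr_fun counit_comul a)
  comul_counit a := (sum₂_smul_right _ _).trans (LinearMap.congr_fun comul_counit a)
  reassoc_mul_inv := h.reassoc_mul_inv hQ.reassoc_mul_inv
  inv_mul_reassoc := h.inv_mul_reassoc hQ.inv_mul_reassoc
  coassoc a := by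
    rw [sum₂_comul_right, sum₂_comul_left]
    exact LinearMap.congr_fun coassoc a
  pentagon := h.pentagon hQ
  normalized := h.normalized hQ
  antipode_mul a b := LinearMap.congr_fun antipode_mul (a ⊗ₜ b)
  antipode_one := by rw [← h.map_one, ← h.map_antipode, hQ.antipode_one]
  antipode_left a := by
    have h₁ : ∀ a, Q'.mul a Q'.one = a := LinearMap.congr_fun mul_one
    rw [alpha]
    refine (sum₂_eq _ (TensorProduct.lift (Q'.mul ∘ₗ Q'.antipode)) fun a b => ?_).trans
      (LinearMap.congr_fun antipode_left a)
    rw [h₁]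
    rfl
  antipode_right a :=
    (sum₂_eq _ (TensorProduct.lift ((Q'.mul ∘ₗ Q'.mul.flip Q'.beta).compl₂ Q'.antipode))
      fun a b => rfl).trans (LinearMap.congr_fun antipode_right a)
  reassoc_antipode := h.reassoc_antipode hQ
  reassocInv_antipode := h.reassocInv_antipode hQ

end GenericCriterion

/-! ### `D^ω(H)` is a quasi-Hopf algebra -/

section CrossedQuasiHopf

variable {k H : Type*} [Field k] [Ring H] [HopfAlgebra k H] [Coalgebra.IsCocomm k H]
  [FiniteDimensional k H]
variable {ω : (WithConv (H ⊗[k] (H ⊗[k] H) →ₗ[k] k))ˣ} (hω : IsNormalizedThreeCocycle ω)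

theorem val_one_tmul_iff {R V K : Type*} [CommRing R] [Algebra k R] [AddCommMonoid V] [Module k V]
    [AddCommMonoid K] [Module k K] {E : V →ₗ[k] R ⊗[k] K} {v : V} {c : R} {x : R ⊗[k] K} :
    Val E (1 ⊗ₜ v) c x ↔ E v = c • x := by
  rw [Val, LinearMap.liftBaseChange_tmul, one_smul]

include hω

theorem crossedIncl_mul (φ ψ : Module.Dual k H) :
    crossedIncl (conv φ ψ) = crossedMul ω (crossedIncl φ) (crossedIncl ψ) := by
  refine (Probe.points k H).ext ?_
  rintro R _ _ _ ⟨g, rfl⟩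
  have h := val_crossedMul ω (val_crossedIncl g φ) (val_crossedIncl _ ψ)
  rw [tmul_box_tmul, one_mul, LinearMap.baseChange_tmul, val_one_tmul_iff] at h
  refine (evD_crossedIncl g (conv φ ψ)).trans (Eq.trans ?_ h.symm)
  rw [tht_one_mid hω, g.ev_conv]
  simp

theorem crossedComul_crossedIncl (φ : Module.Dual k H) :
    TensorProduct.map crossedIncl crossedIncl (dualHopfComul φ) =
      crossedComul ω (crossedIncl φ) := by
  refine (Probe.points k H).ext_tensor₂ ?_
  rintro R _ _ _ _ ⟨g, rfl⟩ ⟨h, rfl⟩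
  have e := val_crossedComul ω (val_crossedIncl (g * h) φ)
  rw [LinearMap.baseChange_tmul, val_one_tmul_iff] at e
  refine (boxMap_crossedIncl g h _).trans (Eq.trans ?_ e.symm)
  rw [gam_one_right hω, Units.val_one, mul_one]
  congr 1
  exact evT_dualHopfComul g h φ

omit hω in
theorem DOmega_counit_crossedIncl (φ : Module.Dual k H) :
    (DOmega ω).counit (crossedIncl φ) = φ 1 := by
  rw [DOmega_counit_eq, crossedIncl, LinearMap.comp_apply, LinearMap.flip_apply,
    TensorProduct.mk_apply, TensorProduct.map_tmul, LinearMap.mul'_apply, Bialgebra.counit_one,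
    mul_one]
  rfl

theorem crossedAntipode_crossedIncl (φ : Module.Dual k H) :
    crossedIncl (dualAntipode φ) = crossedAntipode ω (crossedIncl φ) := by
  refine (Probe.points k H).ext ?_
  rintro R _ _ _ ⟨g, rfl⟩
  have h := val_crossedAntipode ω g 1 φ
  rw [Point.val_one, Algebra.TensorProduct.one_def, tmul_box_tmul, one_mul,
    LinearMap.baseChange_tmul, val_one_tmul_iff] at h
  refine (evD_crossedIncl g (dualAntipode φ)).trans (Eq.trans ?_ h.symm)
  rw [ev_dualAntipode]
  simp [tht_one_mid hω, gam_one_right hω]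

/-- `θ` and `γ` are trivial when one of their arguments is `1`, so `H* # 1` carries the untwisted
structure of `H*_ω`. -/
theorem isHom_crossedIncl :
    QuasiHopfData.IsHom (dualOmega ω) (DOmega ω) crossedIncl where
  map_mul := crossedIncl_mul hω
  map_one := rfl
  map_comul := crossedComul_crossedIncl hω
  map_counit := DOmega_counit_crossedIncl
  map_reassoc := rfl
  map_reassocInv := rfl
  map_antipode := crossedAntipode_crossedIncl hω
  map_alpha := rfl
  map_beta := rfl


theorem IsNormalizedThreeCocycle.DOmega_isQuasiHopf : (DOmega ω).IsQuasiHopf :=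
  QuasiHopfData.isQuasiHopf_of_isHom (isHom_crossedIncl hω) hω.dualOmega_isQuasiHopf
    (crossed_assoc hω) (crossed_one_mul hω) (crossed_mul_one hω) (crossed_comul_mul hω)
    (crossed_counit_mul hω) (crossed_counit_comul hω) (crossed_comul_counit hω) (crossed_coassoc hω)
    (crossed_antipode_mul hω) rfl (crossed_antipode_left hω) (crossed_antipode_right hω)

end CrossedQuasiHopf

end

/-! ### Permuting and inserting tensor factors under evaluation -/

section Insert

variable {k R V W U K K' K'' : Type*} [Field k] [CommRing R] [Algebra k R]
  [AddCommMonoid V] [Module k V] [AddCommMonoid W] [Module k W] [AddCommMonoid U] [Module k U]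
  [AddCommMonoid K] [Module k K] [AddCommMonoid K'] [Module k K'] [AddCommMonoid K''] [Module k K'']

/-- The map `z ↦ y ⊗ z`. -/
def insertLeft (y : R ⊗[k] K) : K' →ₗ[k] R ⊗[k] (K ⊗[k] K') where
  toFun z := y ⊠ (1 ⊗ₜ z)
  map_add' a b := by rw [TensorProduct.tmul_add, box_add]
  map_smul' c a := by
    rw [TensorProduct.tmul_smul, ← algebraMap_smul R c ((1 : R) ⊗ₜ[k] a), box_smul, algebraMap_smul,
      RingHom.id_apply]

/-- The map `z ↦ z ⊗ y`. -/
def insertRight (y : R ⊗[k] K) : K' →ₗ[k] R ⊗[k] (K' ⊗[k] K) where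
  toFun z := (1 ⊗ₜ z) ⊠ y
  map_add' a b := by rw [TensorProduct.tmul_add, add_box]
  map_smul' c a := by
    rw [TensorProduct.tmul_smul, ← algebraMap_smul R c ((1 : R) ⊗ₜ[k] a), smul_box, algebraMap_smul,
      RingHom.id_apply]

theorem liftBaseChange_insertLeft (y : R ⊗[k] K) (z : R ⊗[k] K') :
    LinearMap.liftBaseChange R (insertLeft y) z = y ⊠ z := by
  induction z using TensorProduct.induction_on with
  | zero => simp
  | add a b ha hb => rw [map_add, ha, hb, box_add]
  | tmul r v =>
    rw [LinearMap.liftBaseChange_tmul]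
    change r • (y ⊠ (1 ⊗ₜ v)) = _
    rw [← box_smul, TensorProduct.smul_tmul', smul_eq_mul, mul_one]

theorem liftBaseChange_insertRight (y : R ⊗[k] K) (z : R ⊗[k] K') :
    LinearMap.liftBaseChange R (insertRight y) z = z ⊠ y := by
  induction z using TensorProduct.induction_on with
  | zero => simp
  | add a b ha hb => rw [map_add, ha, hb, add_box]
  | tmul r v =>
    rw [LinearMap.liftBaseChange_tmul]
    change r • ((1 ⊗ₜ v) ⊠ y) = _
    rw [← smul_box, TensorProduct.smul_tmul', smul_eq_mul, mul_one]

theorem OpLaw.mk_left {E : V →ₗ[k] R ⊗[k] K} (F : W →ₗ[k] R ⊗[k] K') {u : V} {y : R ⊗[k] K}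
    (hu : E u = y) : OpLaw (TensorProduct.mk k V W u) (boxMap E F) F (insertLeft y) := fun w => by
  rw [liftBaseChange_insertLeft, ← hu]; rfl

theorem OpLaw.mk_right {E : V →ₗ[k] R ⊗[k] K} (F : W →ₗ[k] R ⊗[k] K') {u : V} {y : R ⊗[k] K}
    (hu : E u = y) : OpLaw ((TensorProduct.mk k W V).flip u) (boxMap F E) F (insertRight y) :=
  fun w => by rw [liftBaseChange_insertRight, ← hu]; rfl

theorem OpLaw.assoc_symm (E : V →ₗ[k] R ⊗[k] K) (F : W →ₗ[k] R ⊗[k] K') (G : U →ₗ[k] R ⊗[k] K'') :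
    OpLaw (TensorProduct.assoc k V W U).symm.toLinearMap (boxMap (boxMap E F) G)
      (boxMap E (boxMap F G))
      (TensorProduct.mk k R _ 1 ∘ₗ (TensorProduct.assoc k K K' K'').symm.toLinearMap) := by
  intro u
  rw [liftBaseChange_mk_comp]
  induction u using TensorProduct.induction_on with
  | zero => simp
  | add x y hx hy => simp only [map_add, hx, hy]
  | tmul c a =>
    induction a using TensorProduct.induction_on with
    | zero => simp
    | add x y hx hy => simp only [TensorProduct.tmul_add, map_add, hx, hy]
    | tmul a b =>
      rw [boxMap_tmul, boxMap_tmul, baseChange_assoc_symm_box]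
      simp

theorem Val.comm {E : V →ₗ[k] R ⊗[k] K} {F : W →ₗ[k] R ⊗[k] K'} {z : R ⊗[k] (V ⊗[k] W)} {c : R}
    {x : R ⊗[k] K} {y : R ⊗[k] K'} (h : Val (boxMap E F) z c (x ⊠ y)) :
    Val (boxMap F E) ((TensorProduct.comm k V W).toLinearMap.baseChange R z) c (y ⊠ x) := by
  have := (OpLaw.comm E F).val h
  rwa [liftBaseChange_mk_comp, baseChange_comm_box] at this

theorem Val.assoc {E : V →ₗ[k] R ⊗[k] K} {F : W →ₗ[k] R ⊗[k] K'} {G : U →ₗ[k] R ⊗[k] K''}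
    {z : R ⊗[k] ((V ⊗[k] W) ⊗[k] U)} {c : R}
    {x : R ⊗[k] K} {y : R ⊗[k] K'} {t : R ⊗[k] K''} (h : Val (boxMap (boxMap E F) G) z c ((x ⊠ y) ⊠ t)) :
    Val (boxMap E (boxMap F G)) ((TensorProduct.assoc k V W U).toLinearMap.baseChange R z) c
      (x ⊠ y ⊠ t) := by
  have := (OpLaw.assoc E F G).val h
  rwa [liftBaseChange_mk_comp, baseChange_assoc_box] at this

theorem Val.assoc_symm {E : V →ₗ[k] R ⊗[k] K} {F : W →ₗ[k] R ⊗[k] K'} {G : U →ₗ[k] R ⊗[k] K''}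
    {z : R ⊗[k] (V ⊗[k] (W ⊗[k] U))} {c : R}
    {x : R ⊗[k] K} {y : R ⊗[k] K'} {t : R ⊗[k] K''} (h : Val (boxMap E (boxMap F G)) z c (x ⊠ y ⊠ t)) :
    Val (boxMap (boxMap E F) G) ((TensorProduct.assoc k V W U).symm.toLinearMap.baseChange R z) c
      ((x ⊠ y) ⊠ t) := by
  have := (OpLaw.assoc_symm E F G).val h
  rwa [liftBaseChange_mk_comp, baseChange_assoc_symm_box] at this

theorem Val.map_id_left {C : V →ₗ[k] W} {E : V →ₗ[k] R ⊗[k] K} {E' : W →ₗ[k] R ⊗[k] K'}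
    {M : K →ₗ[k] R ⊗[k] K'} (h : OpLaw C E' E M) {F : U →ₗ[k] R ⊗[k] K''} {c : R}
    {z : R ⊗[k] (U ⊗[k] V)} {x : R ⊗[k] K''} {y : R ⊗[k] K} (hz : Val (boxMap F E) z c (x ⊠ y)) :
    Val (boxMap F E') ((TensorProduct.map LinearMap.id C).baseChange R z) c
      (x ⊠ LinearMap.liftBaseChange R M y) := by
  have := ((OpLaw.id F).tensor h).val hz
  rwa [liftBaseChange_boxMap, liftBaseChange_mk] at this

theorem Val.map_id_right {C : V →ₗ[k] W} {E : V →ₗ[k] R ⊗[k] K} {E' : W →ₗ[k] R ⊗[k] K'}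
    {M : K →ₗ[k] R ⊗[k] K'} (h : OpLaw C E' E M) {F : U →ₗ[k] R ⊗[k] K''} {c : R}
    {z : R ⊗[k] (V ⊗[k] U)} {x : R ⊗[k] K''} {y : R ⊗[k] K} (hz : Val (boxMap E F) z c (y ⊠ x)) :
    Val (boxMap E' F) ((TensorProduct.map C LinearMap.id).baseChange R z) c
      (LinearMap.liftBaseChange R M y ⊠ x) := by
  have := (h.tensor (OpLaw.id F)).val hz
  rwa [liftBaseChange_boxMap, liftBaseChange_mk] at this

end Insert

section DualBases

variable {k R V K : Type*} [Field k] [CommRing R] [Algebra k R] [AddCommGroup V] [Module k V]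
  [FiniteDimensional k V] [AddCommMonoid K] [Module k K]

theorem sum_ev_coord_smul (x : R ⊗[k] V) :
    ∑ i, ev x ((Module.finBasis k V).coord i) • ((1 : R) ⊗ₜ[k] Module.finBasis k V i) = x := by
  induction x using TensorProduct.induction_on with
  | zero => simp
  | add x y hx hy =>
    simp only [ev_add_left, add_smul, Finset.sum_add_distrib]
    rw [hx, hy]
  | tmul r v =>
    conv_rhs => rw [← (Module.finBasis k V).sum_repr v, TensorProduct.tmul_sum]
    refine Finset.sum_congr rfl fun i _ => ?_
    rw [ev_tmul, TensorProduct.smul_tmul', smul_eq_mul, mul_one, ← TensorProduct.smul_tmul,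
      Algebra.smul_def, mul_comm]
    rfl

end DualBases

/-! ### The `R`-matrix of `D^ω(H)` -/

section CrossedR

variable {k R H : Type*} [Field k] [CommRing R] [Algebra k R] [Ring H] [HopfAlgebra k H]
  [Coalgebra.IsCocomm k H] [FiniteDimensional k H]
variable (ω : (WithConv (H ⊗[k] (H ⊗[k] H) →ₗ[k] k))ˣ)

theorem val_mul₂ {g g' x x' y y' : Point k R H}
    {s t : (Module.Dual k H ⊗[k] H) ⊗[k] (Module.Dual k H ⊗[k] H)} {c d : R}
    (hs : Val (boxMap (evD k g) (evD k g')) (1 ⊗ₜ s) c (x.val ⊠ x'.val))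
    (ht : Val (boxMap (evD k (x⁻¹ * g * x)) (evD k (x'⁻¹ * g' * x'))) (1 ⊗ₜ t) d
      (y.val ⊠ y'.val)) :
    Val (boxMap (evD k g) (evD k g')) (1 ⊗ₜ (DOmega ω).mul₂ s t)
      (c * d * (tht ω g x y * tht ω g' x' y')) ((x * y).val ⊠ (x' * y').val) :=
  (val_crossedMul₂ ω hs ht).congr rfl (by simp) rfl rfl

theorem val_mul₃ {g g' g'' x x' x'' y y' y'' : Point k R H}
    {s t : (Module.Dual k H ⊗[k] H) ⊗[k] ((Module.Dual k H ⊗[k] H) ⊗[k]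
      (Module.Dual k H ⊗[k] H))} {c d : R}
    (hs : Val (boxMap (evD k g) (boxMap (evD k g') (evD k g''))) (1 ⊗ₜ s) c
      (x.val ⊠ x'.val ⊠ x''.val))
    (ht : Val (boxMap (evD k (x⁻¹ * g * x)) (boxMap (evD k (x'⁻¹ * g' * x'))
      (evD k (x''⁻¹ * g'' * x'')))) (1 ⊗ₜ t) d (y.val ⊠ y'.val ⊠ y''.val)) :
    Val (boxMap (evD k g) (boxMap (evD k g') (evD k g''))) (1 ⊗ₜ (DOmega ω).mul₃ s t)
      (c * d * (tht ω g x y * (tht ω g' x' y' * tht ω g'' x'' y'')))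
      ((x * y).val ⊠ (x' * y').val ⊠ (x'' * y'').val) :=
  (val_crossedMul₃ ω hs ht).congr rfl (by simp) rfl rfl

/-- Summing `eⁱ(g) eᵢ` over dual bases gives back `g`. The map `L` is the identity for `R` and the
antipode for the inverse of `R`. -/
theorem val_sum_coord (g h : Point k R H) (L : H →ₗ[k] H) :
    Val (boxMap (evD k g) (evD k h)) (1 ⊗ₜ ∑ i, crossedIncl ((Module.finBasis k H).coord i) ⊗ₜ[k]
      (Coalgebra.counit ⊗ₜ[k] L (Module.finBasis k H i))) 1
      ((1 : Point k R H).val ⊠ L.baseChange R g.val) := by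
  refine val_one_tmul ?_
  rw [map_sum, one_smul]
  simp only [boxMap_tmul, evD_crossedIncl, evD_tmul, h.ev_counit, one_smul, smul_box, ← box_smul]
  have : ∀ (s : Finset (Fin (Module.finrank k H))) (y : R ⊗[k] H) (F : _ → R ⊗[k] H),
      ∑ i ∈ s, y ⊠ F i = y ⊠ ∑ i ∈ s, F i := by
    intro s y F
    induction s using Finset.cons_induction with
    | empty => simp
    | cons a s ha ih => rw [Finset.sum_cons, Finset.sum_cons, ih, box_add]
  rw [this]
  congr 1
  conv_rhs => rw [← sum_ev_coord_smul g.val, map_sum]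
  simp

theorem val_R (g h : Point k R H) : Val (boxMap (evD k g) (evD k h)) (1 ⊗ₜ DOmegaR k H) 1
    ((1 : Point k R H).val ⊠ g.val) := by
  refine (val_sum_coord g h LinearMap.id).congr rfl rfl rfl ?_
  rw [LinearMap.baseChange_id, LinearMap.id_apply]

theorem val_one (g : Point k R H) : Val (evD k g) (1 ⊗ₜ (DOmega ω).one) 1 (1 : Point k R H).val :=
  (val_crossedIncl g Coalgebra.counit).congr rfl rfl g.ev_counit rfl

theorem evD_one (g : Point k R H) : evD k g (DOmega ω).one = (1 : Point k R H).val := by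
  simpa [val_one_tmul_iff] using val_one ω g

theorem val_R₁₃ (g h l : Point k R H) : Val (boxMap (evD k g) (boxMap (evD k h) (evD k l)))
    (1 ⊗ₜ TensorProduct.map LinearMap.id (TensorProduct.mk k _ _ (DOmega ω).one) (DOmegaR k H)) 1
      ((1 : Point k R H).val ⊠ (1 : Point k R H).val ⊠ g.val) := by
  refine (Val.map_id_left (OpLaw.mk_left (evD k l) (evD_one ω h)) (val_R g l)).congr rfl
    (by simp) rfl ?_
  rw [liftBaseChange_insertLeft]

theorem val_R₁₂ (g h l : Point k R H) : Val (boxMap (evD k g) (boxMap (evD k h) (evD k l)))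
    (1 ⊗ₜ TensorProduct.map LinearMap.id ((TensorProduct.mk k _ _).flip (DOmega ω).one)
      (DOmegaR k H)) 1 ((1 : Point k R H).val ⊠ g.val ⊠ (1 : Point k R H).val) := by
  refine (Val.map_id_left (OpLaw.mk_right (evD k h) (evD_one ω l)) (val_R g h)).congr rfl
    (by simp) rfl ?_
  rw [liftBaseChange_insertRight]

theorem val_R₂₃ (g h l : Point k R H) : Val (boxMap (evD k g) (boxMap (evD k h) (evD k l)))
    (1 ⊗ₜ ((DOmega ω).one ⊗ₜ[k] DOmegaR k H)) 1
      ((1 : Point k R H).val ⊠ (1 : Point k R H).val ⊠ h.val) := by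
  refine ((val_one ω g).box (val_R h l)).congr rfl (by simp) (by simp) rfl

end CrossedR

section

section GenericRMatrix

variable {k A : Type*} [Field k] [AddCommGroup A] [Module k A]

theorem QuasiHopfData.isRMatrix_of_linear {Q : QuasiHopfData k A} {R R' : A ⊗[k] A}
    (mul_inv : Q.mul₂ R R' = Q.one ⊗ₜ Q.one) (inv_mul : Q.mul₂ R' R = Q.one ⊗ₜ Q.one)
    (comul_op : Q.mul₂.flip R ∘ₗ (TensorProduct.comm k _ _).toLinearMap ∘ₗ Q.comul =
      Q.mul₂ R ∘ₗ Q.comul)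
    (comul_left :
      TensorProduct.assoc k _ _ _ (TensorProduct.map Q.comul LinearMap.id R) =
      Q.mul₃ (Q.mul₃ (Q.mul₃ (Q.mul₃
        (TensorProduct.assoc k _ _ _ (TensorProduct.comm k _ _ Q.reassoc))
        (TensorProduct.map LinearMap.id (TensorProduct.mk k _ _ Q.one) R))
        (TensorProduct.map LinearMap.id (TensorProduct.comm k _ _).toLinearMap Q.reassocInv))
        (Q.one ⊗ₜ[k] R)) Q.reassoc)
    (comul_right : TensorProduct.map LinearMap.id Q.comul R =
      Q.mul₃ (Q.mul₃ (Q.mul₃ (Q.mul₃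
        (TensorProduct.comm k _ _ ((TensorProduct.assoc k _ _ _).symm Q.reassocInv))
        (TensorProduct.map LinearMap.id (TensorProduct.mk k _ _ Q.one) R))
        (TensorProduct.assoc k _ _ _ (TensorProduct.map (TensorProduct.comm k _ _).toLinearMap
          LinearMap.id ((TensorProduct.assoc k _ _ _).symm Q.reassoc))))
        (TensorProduct.map LinearMap.id ((TensorProduct.mk k _ _).flip Q.one) R))
        Q.reassocInv) : Q.IsRMatrix R where
  invertible := ⟨R', mul_inv, inv_mul⟩
  comul_op a := LinearMap.congr_fun comul_op a
  comul_left := by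
    rw [sum₂_comul_left, sum₃_rotate, sum₂_insert_mid, sum₃_swap_right]
    exact comul_left
  comul_right := by
    rw [sum₂_comul_right, sum₃_rotate_inv, sum₂_insert_mid, sum₃_swap_left, sum₂_insert_right]
    exact comul_right

end GenericRMatrix

theorem Val.unique {k R V K : Type*} [Field k] [CommRing R] [Algebra k R] [AddCommMonoid V]
    [Module k V] [AddCommMonoid K] [Module k K] {E : V →ₗ[k] R ⊗[k] K} {s t : V} {c d : R}
    {x y : R ⊗[k] K} (hs : Val E (1 ⊗ₜ s) c x) (ht : Val E (1 ⊗ₜ t) d y) (hc : c = d)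
    (hx : x = y) : E s = E t := by
  rw [val_one_tmul_iff.1 hs, val_one_tmul_iff.1 ht, hc, hx]

section CrossedR

variable {k R H : Type*} [Field k] [CommRing R] [Algebra k R] [Ring H] [HopfAlgebra k H]
  [Coalgebra.IsCocomm k H] [FiniteDimensional k H]
variable {ω : (WithConv (H ⊗[k] (H ⊗[k] H) →ₗ[k] k))ˣ}

theorem tht_comm (g h x : Point k R H) :
    gam ω h g x * tht ω h x (x⁻¹ * g * x) = gam ω g (g⁻¹ * h * g) x * tht ω h g x := by
  apply Additive.ofMul.injective
  simp only [ofMul_mul, tht_additive, gam_additive]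
  exact IsGroupCocycle.γ_comm g h x

/-- The definition of `θ` rearranged: beyond normalization, the hexagon for `(Δ ⊗ id)(R)` needs no
cocycle identity. -/
theorem tht_eq (g h l : Point k R H) :
    tht ω l g h * (om ω l g h)⁻¹ * om ω g (g⁻¹ * l * g) h *
      (om ω g h ((g * h)⁻¹ * l * (g * h)))⁻¹ = 1 := by
  apply Additive.ofMul.injective
  simp only [tht, ofMul_mul, ofMul_inv, ofMul_one]
  abel

/-- Likewise the definition of `γ`, in the order in which the hexagon for `(id ⊗ Δ)(R)` produces the
factors. -/
theorem gam_eq (g h l : Point k R H) :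
    gam ω h l g = om ω h l g * (om ω h g (g⁻¹ * l * g))⁻¹ *
      om ω g (g⁻¹ * h * g) (g⁻¹ * l * g) := by
  rw [gam]
  simp only [mul_comm, mul_left_comm]

variable (hω : IsNormalizedThreeCocycle ω)
include hω

theorem val_one_R_left (g h l : Point k R H) :
    Val (boxMap (evD k g) (boxMap (evD k h) (evD k l)))
      (1 ⊗ₜ (TensorProduct.assoc k _ _ _ (TensorProduct.map (crossedComul ω) LinearMap.id
        (DOmegaR k H)))) 1
      ((1 : Point k R H).val ⊠ (1 : Point k R H).val ⊠ (g * h).val) := by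
  have h₁ := Val.map_id_right (opLaw_crossedComul ω g h) (val_R (g * h) l)
  rw [comulArg_point, gam_one_right hω, Units.val_one, one_smul] at h₁
  exact h₁.assoc.congr rfl (by simp) rfl rfl

theorem val_one_R_right (g h l : Point k R H) :
    Val (boxMap (evD k g) (boxMap (evD k h) (evD k l)))
      (1 ⊗ₜ (TensorProduct.map LinearMap.id (crossedComul ω) (DOmegaR k H))) (gam ω h l g)
      ((1 : Point k R H).val ⊠ g.val ⊠ g.val) := by
  have h₁ := Val.map_id_left (opLaw_crossedComul ω h l) (val_R g (h * l))
  rw [comulArg_point, box_smul] at h₁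
  rw [Val] at h₁ ⊢
  rw [one_smul] at h₁
  simpa using h₁

end CrossedR

section CrossedRMatrix

universe u v
variable {k : Type u} {H : Type v} [Field k] [Ring H] [HopfAlgebra k H] [Coalgebra.IsCocomm k H]
  [FiniteDimensional k H]
variable {ω : (WithConv (H ⊗[k] (H ⊗[k] H) →ₗ[k] k))ˣ} (hω : IsNormalizedThreeCocycle ω)
include hω

theorem crossed_comul_op :
    (DOmega ω).mul₂.flip (DOmegaR k H) ∘ₗ (TensorProduct.comm k _ _).toLinearMap ∘ₗ
      crossedComul ω = (DOmega ω).mul₂ (DOmegaR k H) ∘ₗ crossedComul ω := by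
  refine (Generators.crossed k H).ext_tensor₂ (Probe.points k H) ?_
  rintro R _ _ _ _ ⟨g, rfl⟩ ⟨h, rfl⟩ z hz
  obtain ⟨φ, x, rfl⟩ := Generators.crossed_mem hz
  simp only [LinearMap.baseChange_comp, LinearMap.comp_apply]
  rw [baseChange_flip_apply_eq, baseChange_apply_eq]
  refine (val_crossedMul₂ ω (val_crossedComul ω (val_generator (h * g) x φ)).comm
    (val_R _ _)).eq (val_crossedMul₂ ω (val_R g h)
      (val_crossedComul ω (val_generator _ x φ))) ?_ ?_
  · have e := congrArg Units.val (tht_comm (ω := ω) g h x)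
    push_cast at e
    simp only [tht_one_mid hω, tht_one_right hω, inv_one, one_mul, mul_one, Units.val_one,
      mul_assoc, mul_inv_cancel_left] at e ⊢
    linear_combination (ev (h * g).val φ) * e
  · simp only [mul_one, one_mul, mul_assoc, mul_inv_cancel_left]

theorem crossed_R_left :
    TensorProduct.assoc k _ _ _ (TensorProduct.map (crossedComul ω) LinearMap.id (DOmegaR k H)) =
      (DOmega ω).mul₃ ((DOmega ω).mul₃ ((DOmega ω).mul₃ ((DOmega ω).mul₃
        (TensorProduct.assoc k _ _ _ (TensorProduct.comm k _ _ (DOmega ω).reassoc))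
        (TensorProduct.map LinearMap.id (TensorProduct.mk k _ _ (DOmega ω).one) (DOmegaR k H)))
        (TensorProduct.map LinearMap.id (TensorProduct.comm k _ _).toLinearMap
          (DOmega ω).reassocInv))
        ((DOmega ω).one ⊗ₜ[k] DOmegaR k H))
        (DOmega ω).reassoc := by
  refine (Probe.points k H).ext_tensor₃ ?_
  rintro R _ _ _ _ _ ⟨g, rfl⟩ ⟨h, rfl⟩ ⟨l, rfl⟩
  refine Val.unique (val_one_R_left hω g h l) (val_mul₃ ω (val_mul₃ ω (val_mul₃ ω (val_mul₃ ω
    ((val_reassoc ω l g h).comm.assoc.congr rfl (by simp) rfl rfl) (val_R₁₃ ω _ _ _))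
    (((val_reassocInv ω _ _ _).map_id_left (OpLaw.comm _ _)).congr rfl
      (by simp) rfl (by rw [liftBaseChange_mk_comp, baseChange_comm_box]))) (val_R₂₃ ω _ _ _))
    (val_reassoc ω _ _ _)) ?_ ?_
  · have e := congrArg Units.val (tht_eq (ω := ω) g h l)
    push_cast at e
    simp only [tht_one_mid hω, tht_one_right hω, inv_one, one_mul, mul_one, Units.val_one,
      mul_assoc, mul_inv_rev] at e ⊢
    linear_combination -e
  · simp only [inv_one, mul_one, one_mul]

theorem crossed_R_right :
    TensorProduct.map LinearMap.id (crossedComul ω) (DOmegaR k H) =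
      (DOmega ω).mul₃ ((DOmega ω).mul₃ ((DOmega ω).mul₃ ((DOmega ω).mul₃
        (TensorProduct.comm k _ _ ((TensorProduct.assoc k _ _ _).symm (DOmega ω).reassocInv))
        (TensorProduct.map LinearMap.id (TensorProduct.mk k _ _ (DOmega ω).one) (DOmegaR k H)))
        (TensorProduct.assoc k _ _ _ (TensorProduct.map (TensorProduct.comm k _ _).toLinearMap
          LinearMap.id ((TensorProduct.assoc k _ _ _).symm (DOmega ω).reassoc))))
        (TensorProduct.map LinearMap.id ((TensorProduct.mk k _ _).flip (DOmega ω).one)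
          (DOmegaR k H)))
        (DOmega ω).reassocInv := by
  refine (Probe.points k H).ext_tensor₃ ?_
  rintro R _ _ _ _ _ ⟨g, rfl⟩ ⟨h, rfl⟩ ⟨l, rfl⟩
  have key : ∀ g h l : Point k R H, Val (boxMap (evD k g) (boxMap (evD k h) (evD k l)))
      (1 ⊗ₜ (TensorProduct.assoc k _ _ _ (TensorProduct.map (TensorProduct.comm k _ _).toLinearMap
          LinearMap.id ((TensorProduct.assoc k _ _ _).symm (DOmega ω).reassoc))))
      ((om ω h g l)⁻¹ : Rˣ)
      ((1 : Point k R H).val ⊠ (1 : Point k R H).val ⊠ (1 : Point k R H).val) := by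
    intro g h l
    have h₁ := (val_reassoc ω h g l).assoc_symm.map_id_right (OpLaw.comm _ _)
    rw [liftBaseChange_mk_comp, baseChange_comm_box] at h₁
    exact h₁.assoc.congr rfl (by simp) rfl rfl
  refine Val.unique (val_one_R_right hω g h l) (val_mul₃ ω (val_mul₃ ω (val_mul₃ ω (val_mul₃ ω
    ((val_reassocInv ω h l g).assoc_symm.comm.congr rfl (by simp) rfl rfl) (val_R₁₃ ω _ _ _))
    (key _ _ _)) (val_R₁₂ ω _ _ _)) (val_reassocInv ω _ _ _)) ?_ ?_
  · have e := congrArg Units.val (gam_eq (ω := ω) g h l)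
    push_cast at e
    simp only [tht_one_mid hω, tht_one_right hω, inv_one, one_mul, mul_one, Units.val_one,
      mul_assoc] at e ⊢
    linear_combination e
  · simp only [inv_one, mul_one, one_mul]

/-- The inverse of the `R`-matrix of `D^ω(H)`. -/
def DOmegaRInv (ω : (WithConv (H ⊗[k] (H ⊗[k] H) →ₗ[k] k))ˣ) :
    (Module.Dual k H ⊗[k] H) ⊗[k] (Module.Dual k H ⊗[k] H) :=
  -- `∑ eⁱ ⊗ S(eᵢ)` has the value `1 ⊗ g⁻¹` at `(g, h)` and inverts `R` only up to `θ(h; g, g⁻¹)`.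
  -- The second factor is the function `(g, h) ↦ θ(h; g, g⁻¹)⁻¹` that corrects this.
  (DOmega ω).mul₂ (∑ i, crossedIncl ((Module.finBasis k H).coord i) ⊗ₜ[k]
      (Coalgebra.counit ⊗ₜ[k] HopfAlgebra.antipode k (Module.finBasis k H i)))
    (TensorProduct.map crossedIncl crossedIncl ((TensorProduct.dualDistribEquiv k H H).symm
      ((theta ω⁻¹).ofConv ∘ₗ TensorProduct.map LinearMap.id
        (TensorProduct.map LinearMap.id (HopfAlgebra.antipode k) ∘ₗ Coalgebra.comul) ∘ₗ
        (TensorProduct.comm k H H).toLinearMap)))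

theorem val_RInv {R : Type*} [CommRing R] [Algebra k R] (g h : Point k R H) :
    Val (boxMap (evD k g) (evD k h)) (1 ⊗ₜ DOmegaRInv ω)
      ((tht ω (g * h * g⁻¹) g g⁻¹)⁻¹ : Rˣ) ((1 : Point k R H).val ⊠ (g⁻¹).val) := by
  have key : ∀ g h : Point k R H, Val (boxMap (evD k g) (evD k h))
      (1 ⊗ₜ TensorProduct.map crossedIncl crossedIncl ((TensorProduct.dualDistribEquiv k H H).symm
      ((theta ω⁻¹).ofConv ∘ₗ TensorProduct.map LinearMap.id
        (TensorProduct.map LinearMap.id (HopfAlgebra.antipode k) ∘ₗ Coalgebra.comul) ∘ₗ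
        (TensorProduct.comm k H H).toLinearMap))) ((tht ω h g g⁻¹)⁻¹ : Rˣ)
      ((1 : Point k R H).val ⊠ (1 : Point k R H).val) := by
    intro g h
    rw [val_one_tmul_iff, boxMap_crossedIncl, evT_dualDistribEquiv_symm, ev_comp,
      LinearMap.baseChange_comp, LinearMap.comp_apply, baseChange_comm_box, baseChange_map_box,
      LinearMap.baseChange_comp, LinearMap.comp_apply, g.isPoint.comul, baseChange_map_box,
      LinearMap.baseChange_id, LinearMap.id_apply, LinearMap.id_apply,
      ← Point.val_inv, ev_theta, tht_inv]
  refine (val_mul₂ ω (x := 1) (x' := g⁻¹) (val_sum_coord g h (HopfAlgebra.antipode k))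
    (key _ _)).congr rfl rfl ?_ ?_
  · rw [tht_one_right hω, tht_one_right hω]
    simp
  · simp

theorem DOmegaR_mul_inv : (DOmega ω).mul₂ (DOmegaR k H) (DOmegaRInv ω) =
    (DOmega ω).one ⊗ₜ (DOmega ω).one := by
  refine (Probe.points k H).ext_tensor₂ ?_
  rintro R _ _ _ _ ⟨g, rfl⟩ ⟨h, rfl⟩
  refine Val.unique (val_mul₂ ω (val_R g h) (val_RInv hω _ _))
    (((val_one ω g).box (val_one ω h)).congr rfl (by simp) rfl rfl) ?_ (by simp)
  rw [tht_one_mid hω]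
  simp [mul_assoc]

theorem DOmegaR_inv_mul : (DOmega ω).mul₂ (DOmegaRInv ω) (DOmegaR k H) =
    (DOmega ω).one ⊗ₜ (DOmega ω).one := by
  refine (Probe.points k H).ext_tensor₂ ?_
  rintro R _ _ _ _ ⟨g, rfl⟩ ⟨h, rfl⟩
  refine Val.unique (val_mul₂ ω (val_RInv hω g h) (val_R _ _))
    (((val_one ω g).box (val_one ω h)).congr rfl (by simp) rfl rfl) ?_ (by simp)
  rw [tht_one_mid hω]
  simp [tht_inv_right hω]

theorem IsNormalizedThreeCocycle.DOmega_isRMatrix : (DOmega ω).IsRMatrix (DOmegaR k H) :=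
  QuasiHopfData.isRMatrix_of_linear (DOmegaR_mul_inv hω) (DOmegaR_inv_mul hω)
    (crossed_comul_op hω) (crossed_R_left hω) (crossed_R_right hω)

end CrossedRMatrix

end

section Sums

variable {k R V W U X Y M M' N : Type*} [Field k] [CommRing R] [Algebra k R]
  [AddCommGroup V] [Module k V] [AddCommGroup W] [Module k W] [AddCommGroup U] [Module k U]
  [AddCommGroup X] [Module k X] [AddCommGroup Y] [Module k Y] [AddCommMonoid M] [Module k M]
  [AddCommMonoid M'] [Module k M'] [AddCommMonoid N] [Module k N] [Module R N] [IsScalarTower k R N]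

theorem map_sum₅ (l : M →ₗ[k] M') (t : V ⊗[k] (W ⊗[k] (U ⊗[k] (X ⊗[k] Y))))
    (F : V → W → U → X → Y → M) :
    l (sum₅ t F) = sum₅ t fun a b c d e => l (F a b c d e) := by
  refine (map_sum₂ l t _).trans (congrArg (sum₂ t) (funext₂ fun a s => ?_))
  refine (map_sum₂ l s _).trans (congrArg (sum₂ s) (funext₂ fun b s => ?_))
  exact map_sum₃ l s _

theorem sum₅_evT (t : V ⊗[k] (W ⊗[k] (U ⊗[k] (X ⊗[k] Y)))) (r : R) (f : V →ₗ[k] R)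
    (g : W →ₗ[k] R) (h : U →ₗ[k] R) (l : X →ₗ[k] R) (m : Y →ₗ[k] R) {F : V → W → U → X → Y → R}
    (hF : ∀ a b c d e, F a b c d e = r * (f a * (g b * (h c * (l d * m e))))) :
    sum₅ t F = r * evT f (evT g (evT h (evT l m))) t :=
  sum₅_eq t (LinearMap.mulLeft k r ∘ₗ evT f (evT g (evT h (evT l m)))) (by simpa using hF)

end Sums

/-! ### The special elements of `H*_ω` at points -/

section DualValues

variable {k R H : Type*} [Field k] [CommRing R] [Algebra k R] [Ring H] [HopfAlgebra k H]
  [Coalgebra.IsCocomm k H] [FiniteDimensional k H]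
variable (ω : (WithConv (H ⊗[k] (H ⊗[k] H) →ₗ[k] k))ˣ)

theorem ev_dualOmega_mul (x : Point k R H) (a b : Module.Dual k H) :
    ev x.val ((dualOmega ω).mul a b) = ev x.val a * ev x.val b := x.ev_conv a b

theorem ev_dualOmega_antipode (x : Point k R H) (a : Module.Dual k H) :
    ev x.val ((dualOmega ω).antipode a) = ev (x⁻¹).val a := ev_dualAntipode x a

theorem ev_dualOmega_alpha (x : Point k R H) : ev x.val (dualOmega ω).alpha = 1 := x.ev_counit

theorem ev_dualOmega_beta (x : Point k R H) : ev x.val (dualOmega ω).beta = om ω x x⁻¹ x :=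
  ev_betaFun ω x

theorem evT_dualOmega_comul (x y : Point k R H) (a : Module.Dual k H) :
    evT (ev x.val) (ev y.val) ((dualOmega ω).comul a) = ev (x * y).val a := evT_dualHopfComul x y a

theorem evT_dualOmega_reassoc (x y z : Point k R H) :
    evT (ev x.val) (evT (ev y.val) (ev z.val)) (dualOmega ω).reassoc = ((om ω x y z)⁻¹ : Rˣ) :=
  evT_dualTriple_omegaInv ω x y z

theorem evT_dualOmega_reassocInv (x y z : Point k R H) :
    evT (ev x.val) (evT (ev y.val) (ev z.val)) (dualOmega ω).reassocInv = om ω x y z :=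
  evT_dualTriple_omega ω x y z

theorem evT_dualOmega_mul₂ (x y : Point k R H) (s t : Module.Dual k H ⊗[k] Module.Dual k H) :
    evT (ev x.val) (ev y.val) ((dualOmega ω).mul₂ s t) =
      evT (ev x.val) (ev y.val) s * evT (ev x.val) (ev y.val) t :=
  evT_map₂ (x.ev_conv) (y.ev_conv) s t

theorem evT_antipodeComulCop (x y : Point k R H) (a : Module.Dual k H) :
    evT (ev x.val) (ev y.val) ((dualOmega ω).antipodeComulCop a) = ev (y⁻¹ * x⁻¹).val a := by
  rw [QuasiHopfData.antipodeComulCop, map_sum₂]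
  simp only [evT_tmul, ev_dualOmega_antipode]
  rw [sum₂_evT _ 1 (ev (y⁻¹).val) (ev (x⁻¹).val) (fun v w => by ring), evT_dualOmega_comul, one_mul]

/-- The pattern for all elements of this kind: at points every factor is a scalar, so nested sums
separate. The constant passed to each `sum₃_evT` or `sum₂_evT` collects the values of the sums
inside it together with the variables of the sums outside. -/
theorem evT_drinfeldGamma (x y : Point k R H) :
    evT (ev x.val) (ev y.val) (dualOmega ω).drinfeldGamma =
      ((om ω y⁻¹ x⁻¹ x)⁻¹ * om ω (y⁻¹ * x⁻¹) x y : Rˣ) := by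
  rw [QuasiHopfData.drinfeldGamma]
  simp only [map_sum₃, map_sum₂, evT_tmul, ev_dualOmega_mul, ev_dualOmega_antipode,
    ev_dualOmega_alpha]
  rw [sum₃_evT _ (om ω (y⁻¹ * x⁻¹) x y : R) (ev (y⁻¹).val) (ev (x⁻¹).val) (ev x.val),
    evT_dualOmega_reassoc]
  · push_cast; ring
  intro X₁ X₂ X₃
  rw [sum₃_evT _ (ev (y⁻¹).val X₁ * ev (x⁻¹).val X₂ * ev x.val X₃) (ev (y⁻¹ * x⁻¹).val) (ev x.val)
    (ev y.val), evT_dualOmega_reassocInv]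
  · ring
  intro x₁ x₂ x₃
  rw [sum₂_evT _ (ev (y⁻¹).val X₁ * ev (x⁻¹).val X₂ * ev x.val X₃ * ev x.val x₂ * ev y.val x₃)
    (ev (y⁻¹).val) (ev (x⁻¹).val), evT_dualOmega_comul]
  · ring
  · intro v w; ring

theorem evT_drinfeldDelta (x y : Point k R H) :
    evT (ev x.val) (ev y.val) (dualOmega ω).drinfeldDelta =
      ((om ω (x * y) y⁻¹ x⁻¹)⁻¹ * om ω x y y⁻¹ * om ω x x⁻¹ x * om ω y y⁻¹ y : Rˣ) := by
  rw [QuasiHopfData.drinfeldDelta]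
  simp only [map_sum₃, map_sum₂, evT_tmul, ev_dualOmega_mul, ev_dualOmega_antipode,
    ev_dualOmega_beta]
  rw [sum₃_evT _ (om ω x y y⁻¹ * om ω x x⁻¹ x * om ω y y⁻¹ y : R) (ev (x * y).val) (ev (y⁻¹).val)
    (ev (x⁻¹).val), evT_dualOmega_reassoc]
  · push_cast; ring
  intro X₁ X₂ X₃
  rw [sum₃_evT _ (ev (x * y).val X₁ * ev (y⁻¹).val X₂ * ev (x⁻¹).val X₃ * om ω x x⁻¹ x *
    om ω y y⁻¹ y) (ev x.val) (ev y.val) (ev (y⁻¹).val), evT_dualOmega_reassocInv]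
  · ring
  intro x₁ x₂ x₃
  rw [sum₂_evT _ (ev (y⁻¹).val X₂ * ev (x⁻¹).val X₃ * ev x.val x₁ * ev y.val x₂ *
    ev (y⁻¹).val x₃ * om ω x x⁻¹ x * om ω y y⁻¹ y) (ev x.val) (ev y.val), evT_dualOmega_comul]
  · ring
  · intro v w; ring

theorem evT_pR (x y : Point k R H) :
    evT (ev x.val) (ev y.val) (dualOmega ω).pR = (om ω x y y⁻¹ * om ω y y⁻¹ y : Rˣ) := by
  rw [QuasiHopfData.pR]
  simp only [map_sum₃, evT_tmul, ev_dualOmega_mul, ev_dualOmega_antipode, ev_dualOmega_beta]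
  rw [sum₃_evT _ (om ω y y⁻¹ y : R) (ev x.val) (ev y.val) (ev (y⁻¹).val), evT_dualOmega_reassocInv]
  · push_cast; ring
  · intro a b c; ring

/-- Inversion of points is an involution, so the antipode has order two and is its own inverse; this
gives `S⁻¹` in the formulas of the double. -/
theorem dualAntipode_dualAntipode (φ : Module.Dual k H) : dualAntipode (dualAntipode φ) = φ :=
  dual_ext fun R _ _ x => by rw [ev_dualAntipode, ev_dualAntipode, inv_inv]

theorem dualOmega_antipodeInv : (dualOmega ω).antipodeInv = dualAntipode := by
  have h : (dualAntipode * dualAntipode : Module.End k (Module.Dual k H)) = 1 :=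
    LinearMap.ext dualAntipode_dualAntipode
  exact Ring.inverse_unit ⟨dualAntipode, dualAntipode, h, h⟩

theorem ev_antipodeInv (x : Point k R H) (a : Module.Dual k H) :
    ev x.val ((dualOmega ω).antipodeInv a) = ev (x⁻¹).val a := by
  rw [dualOmega_antipodeInv, ev_dualAntipode]

theorem evT_qR (x y : Point k R H) :
    evT (ev x.val) (ev y.val) (dualOmega ω).qR = ((om ω x y y⁻¹)⁻¹ : Rˣ) := by
  rw [QuasiHopfData.qR]
  simp only [map_sum₃, evT_tmul, ev_dualOmega_mul, ev_antipodeInv, ev_dualOmega_alpha]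
  rw [sum₃_evT _ 1 (ev x.val) (ev y.val) (ev (y⁻¹).val), evT_dualOmega_reassoc, one_mul]
  · intro a b c; ring

variable {ω} (hω : IsNormalizedThreeCocycle ω)
include hω

theorem om_inv_mid (x : Point k R H) : om ω x⁻¹ x x⁻¹ * om ω x x⁻¹ x = 1 :=
  Additive.ofMul.injective (hω.isGroupCocycle.inv_mid x)

/-- The outer sum contributes `ω` at `((xy)⁻¹, xy, (xy)⁻¹)` times `β(xy)`, and these cancel by
`om_inv_mid`. Thus the twist has the same values as its middle factor `γ`. -/
theorem evT_drinfeldTwist (x y : Point k R H) :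
    evT (ev x.val) (ev y.val) (dualOmega ω).drinfeldTwist =
      ((om ω y⁻¹ x⁻¹ x)⁻¹ * om ω (y⁻¹ * x⁻¹) x y : Rˣ) := by
  rw [QuasiHopfData.drinfeldTwist]
  simp only [map_sum₃, evT_dualOmega_mul₂, evT_antipodeComulCop, evT_dualOmega_comul,
    evT_drinfeldGamma, ev_dualOmega_mul, ev_dualOmega_antipode, ev_dualOmega_beta, ← mul_inv_rev]
  rw [sum₃_evT _ (((om ω y⁻¹ x⁻¹ x)⁻¹ * om ω (x * y)⁻¹ x y * om ω (x * y) (x * y)⁻¹ (x * y) : Rˣ) : R)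
    (ev ((x * y)⁻¹).val) (ev (x * y).val) (ev ((x * y)⁻¹).val), evT_dualOmega_reassocInv,
    ← Units.val_mul, mul_assoc, mul_comm (om ω (x * y) _ _), om_inv_mid hω, mul_one]
  · intro a b c; push_cast; ring

theorem evT_drinfeldTwistInv (x y : Point k R H) :
    evT (ev x.val) (ev y.val) (dualOmega ω).drinfeldTwistInv =
      (om ω (x * y)⁻¹ (x * y) (x * y)⁻¹ * ((om ω (x * y) y⁻¹ x⁻¹)⁻¹ * om ω x y y⁻¹ *
        om ω x x⁻¹ x * om ω y y⁻¹ y) : Rˣ) := by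
  rw [QuasiHopfData.drinfeldTwistInv]
  simp only [map_sum₃, evT_dualOmega_mul₂, evT_antipodeComulCop, evT_dualOmega_comul,
    evT_drinfeldDelta, ev_dualOmega_mul, ev_dualOmega_antipode, ev_dualOmega_alpha, ← mul_inv_rev]
  rw [sum₃_evT _ (((om ω (x * y) y⁻¹ x⁻¹)⁻¹ * om ω x y y⁻¹ *
        om ω x x⁻¹ x * om ω y y⁻¹ y : Rˣ) : R)
    (ev ((x * y)⁻¹).val) (ev (x * y).val) (ev ((x * y)⁻¹).val), evT_dualOmega_reassocInv,
    ← Units.val_mul, mul_comm]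
  · intro a b c; push_cast; ring

theorem evT_elementU (x y : Point k R H) :
    evT (ev x.val) (ev y.val) (dualOmega ω).elementU =
      (om ω (x * y)⁻¹ (x * y) (x * y)⁻¹ * ((om ω (x * y) y⁻¹ x⁻¹)⁻¹ * om ω x y y⁻¹ *
        om ω x x⁻¹ x * om ω y y⁻¹ y) * (om ω y⁻¹ x⁻¹ x)⁻¹ : Rˣ) := by
  rw [QuasiHopfData.elementU]
  simp only [map_sum₂, evT_tmul, ev_dualOmega_mul, ev_dualOmega_antipode]
  rw [sum₂_evT _ (((om ω y⁻¹ x⁻¹ x)⁻¹ : Rˣ) : R) (ev x.val) (ev y.val), evT_drinfeldTwistInv hω,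
    ← Units.val_mul, mul_comm]
  intro g₁ g₂
  rw [sum₂_evT _ (ev x.val g₁ * ev y.val g₂) (ev (y⁻¹).val) (ev (x⁻¹).val), evT_qR, inv_inv]
  · ring
  · intro v w; ring

theorem evT_elementOmega (a b c d e : Point k R H) :
    evT (ev a.val) (evT (ev b.val) (evT (ev c.val) (evT (ev d.val) (ev e.val))))
      (dualOmega ω).elementOmega =
      ((om ω (a * b * c) d⁻¹ e⁻¹)⁻¹ * om ω a b c * om ω a (b * c) d⁻¹ *
        ((om ω e d d⁻¹)⁻¹ * om ω (e * d) d⁻¹ e⁻¹) : Rˣ) := by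
  rw [QuasiHopfData.elementOmega]
  simp only [map_sum₃, map_sum₂, evT_tmul, ev_dualOmega_mul, ev_antipodeInv]
  rw [sum₃_evT _ (om ω a b c * om ω a (b * c) d⁻¹ *
        ((om ω e d d⁻¹)⁻¹ * om ω (e * d) d⁻¹ e⁻¹) : Rˣ).val (ev (a * b * c).val) (ev (d⁻¹).val)
    (ev (e⁻¹).val), evT_dualOmega_reassoc]
  · push_cast; ring
  intro X₁ X₂ X₃
  rw [sum₃_evT _ (ev (a * b * c).val X₁ * ev (d⁻¹).val X₂ * ev (e⁻¹).val X₃ *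
    (om ω a (b * c) d⁻¹ * ((om ω e d d⁻¹)⁻¹ * om ω (e * d) d⁻¹ e⁻¹) : Rˣ).val)
    (ev a.val) (ev b.val) (ev c.val), evT_dualOmega_reassocInv]
  · push_cast; ring
  intro y₁ y₂ y₃
  rw [sum₃_evT _ (ev (a * b * c).val X₁ * ev (d⁻¹).val X₂ * ev (e⁻¹).val X₃ *
    (ev a.val y₁ * ev b.val y₂ * ev c.val y₃) *
    ((om ω e d d⁻¹)⁻¹ * om ω (e * d) d⁻¹ e⁻¹ : Rˣ).val)
    (ev a.val) (ev (b * c).val) (ev (d⁻¹).val), evT_dualOmega_reassocInv]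
  · push_cast; ring
  intro x₁ x₂ x₃
  rw [sum₂_evT _ (ev (a * b * c).val X₁ * ev (d⁻¹).val X₂ * ev (e⁻¹).val X₃ *
    (ev a.val y₁ * ev b.val y₂ * ev c.val y₃) * (ev a.val x₁ * ev (b * c).val x₂ * ev (d⁻¹).val x₃))
    (ev (d⁻¹).val) (ev (e⁻¹).val), evT_drinfeldTwist hω, inv_inv, inv_inv]
  · push_cast; ring
  intro f₁ f₂
  rw [sum₂_evT _ (ev (d⁻¹).val X₂ * ev (e⁻¹).val X₃ *
    (ev a.val y₁ * ev b.val y₂ * ev c.val y₃) * (ev a.val x₁ * ev (b * c).val x₂ * ev (d⁻¹).val x₃) *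
    (ev (d⁻¹).val f₁ * ev (e⁻¹).val f₂)) (ev (a * b).val) (ev c.val), evT_dualOmega_comul]
  · ring
  intro X₁' X₁₂
  rw [sum₂_evT _ (ev (d⁻¹).val X₂ * ev (e⁻¹).val X₃ *
    (ev a.val y₁ * ev b.val y₂ * ev c.val y₃) * (ev a.val x₁ * ev (b * c).val x₂ * ev (d⁻¹).val x₃) *
    (ev (d⁻¹).val f₁ * ev (e⁻¹).val f₂) * ev c.val X₁₂) (ev a.val) (ev b.val), evT_dualOmega_comul]
  · ring
  intro X₁₁₁ X₁₁₂
  rw [sum₂_evT _ (ev (d⁻¹).val X₂ * ev (e⁻¹).val X₃ *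
    (ev a.val y₁ * ev b.val y₂ * ev c.val y₃) * (ev a.val x₁ * ev (d⁻¹).val x₃) *
    (ev (d⁻¹).val f₁ * ev (e⁻¹).val f₂) * ev c.val X₁₂ * ev a.val X₁₁₁ * ev b.val X₁₁₂)
    (ev b.val) (ev c.val), evT_dualOmega_comul]
  · ring
  · intro v w; ring

end DualValues

/-! ### Points in the bidual of `H` -/

section DoublePoints

variable {k R H : Type*} [Field k] [CommRing R] [Algebra k R] [Ring H] [HopfAlgebra k H]
  [FiniteDimensional k H]

/-- The image of a point of `H` in the base change of `(H*)*`. -/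
def Point.bidual (x : Point k R H) : R ⊗[k] Module.Dual k (Module.Dual k H) :=
  (Module.evalEquiv k H).toLinearMap.baseChange R x.val

theorem ev_baseChange_evalEquiv (x : R ⊗[k] H) (a : Module.Dual k H) :
    ev ((Module.evalEquiv k H).toLinearMap.baseChange R x)
      (Module.Dual.eval k (Module.Dual k H) a) = ev x a := by
  rw [← ev_comp]
  congr 1

theorem ev_bidual (x : Point k R H) (a : Module.Dual k H) :
    ev x.bidual (Module.Dual.eval k (Module.Dual k H) a) = ev x.val a :=
  ev_baseChange_evalEquiv x.val a

theorem bidual_ext {X Y : R ⊗[k] Module.Dual k (Module.Dual k H)}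
    (h : ∀ a, ev X (Module.Dual.eval k (Module.Dual k H) a) =
      ev Y (Module.Dual.eval k (Module.Dual k H) a)) : X = Y := by
  refine eq_of_ev fun F => ?_
  obtain ⟨a, rfl⟩ : ∃ a, Module.evalEquiv k (Module.Dual k H) a = F :=
    (Module.evalEquiv k (Module.Dual k H)).surjective F
  exact h a

theorem bidual_ext₂ {X Y : R ⊗[k] (Module.Dual k (Module.Dual k H) ⊗[k]
      Module.Dual k (Module.Dual k H))}
    (h : ∀ t : Module.Dual k H ⊗[k] Module.Dual k H,
      ev X (TensorProduct.dualDistrib k (Module.Dual k (Module.Dual k H))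
        (Module.Dual k (Module.Dual k H)) (TensorProduct.map (Module.Dual.eval k (Module.Dual k H))
        (Module.Dual.eval k (Module.Dual k H)) t)) =
      ev Y (TensorProduct.dualDistrib k (Module.Dual k (Module.Dual k H))
        (Module.Dual k (Module.Dual k H)) (TensorProduct.map (Module.Dual.eval k (Module.Dual k H))
        (Module.Dual.eval k (Module.Dual k H)) t))) : X = Y := by
  refine eq_of_ev (k := k) (V := Module.Dual k (Module.Dual k H) ⊗[k]
      Module.Dual k (Module.Dual k H)) fun F => ?_
  obtain ⟨s, rfl⟩ : ∃ s, TensorProduct.dualDistribEquiv k (Module.Dual k (Module.Dual k H))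
    (Module.Dual k (Module.Dual k H)) s = F := LinearEquiv.surjective _ F
  obtain ⟨t, rfl⟩ : ∃ t, TensorProduct.congr (Module.evalEquiv k (Module.Dual k H))
    (Module.evalEquiv k (Module.Dual k H)) t = s := LinearEquiv.surjective _ s
  exact h t

theorem ev_box_dualDistrib {V W : Type*} [AddCommGroup V] [Module k V] [AddCommGroup W]
    [Module k W] (X : R ⊗[k] V) (Y : R ⊗[k] W) (t : Module.Dual k V ⊗[k] Module.Dual k W) :
    ev (X ⊠ Y) (TensorProduct.dualDistrib k V W t) = evT (ev X) (ev Y) t := by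
  induction t using TensorProduct.induction_on with
  | zero => simp
  | add a b ha hb => simp only [map_add, ha, hb]
  | tmul φ ψ =>
    rw [evT_tmul, ← ev_mul'_map_box]
    congr 1

theorem ev_box_eval (x y : Point k R H) (t : Module.Dual k H ⊗[k] Module.Dual k H) :
    ev (x.bidual ⊠ y.bidual) (TensorProduct.dualDistrib k _ _
      (TensorProduct.map (Module.Dual.eval k (Module.Dual k H))
        (Module.Dual.eval k (Module.Dual k H)) t)) = evT (ev x.val) (ev y.val) t := by
  rw [ev_box_dualDistrib, evT_map]
  congr 2 <;> exact LinearMap.ext fun a => ev_bidual _ a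

variable [Coalgebra.IsCocomm k H] (ω : (WithConv (H ⊗[k] (H ⊗[k] H) →ₗ[k] k))ˣ)

theorem one_tmul_sandwich (u v : Module.Dual k H) (χ : Module.Dual k (Module.Dual k H)) :
    (1 : R) ⊗ₜ[k] (dualOmega ω).sandwich u χ v =
      ((dualOmega ω).mul.flip u ∘ₗ (dualOmega ω).mul v).dualMap.baseChange R (1 ⊗ₜ χ) := rfl

theorem one_tmul_dualMul (χ ψ : Module.Dual k (Module.Dual k H)) :
    (1 : R) ⊗ₜ[k] (dualOmega ω).dualMul χ ψ =
      ((dualOmega ω).comul.dualMap ∘ₗ TensorProduct.dualDistrib k _ _).baseChange R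
        ((1 ⊗ₜ χ) ⊠ (1 ⊗ₜ ψ)) := by
  simp [QuasiHopfData.dualMul, LinearMap.dualMap_apply']

-- A point is multiplicative on `H*`, so it is an eigenvector of both actions of `H*` on `(H*)*`.
-- All actions in the formulas of the double reduce to scalars for this reason.
@[simp] theorem baseChange_sandwich_bidual (x : Point k R H) (u v : Module.Dual k H) :
    ((dualOmega ω).mul.flip u ∘ₗ (dualOmega ω).mul v).dualMap.baseChange R x.bidual =
      (ev x.val v * ev x.val u) • x.bidual := by
  refine bidual_ext fun a => ?_
  rw [← ev_comp, ev_smul_left, ev_bidual]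
  refine (ev_bidual x ((dualOmega ω).mul ((dualOmega ω).mul v a) u)).trans ?_
  rw [ev_dualOmega_mul, ev_dualOmega_mul]
  ring

@[simp] theorem baseChange_antipodeInv_bidual (x : Point k R H) :
    (dualOmega ω).antipodeInv.dualMap.baseChange R x.bidual = (x⁻¹).bidual := by
  refine bidual_ext fun a => ?_
  rw [← ev_comp, ev_bidual]
  exact (ev_bidual x _).trans (ev_antipodeInv ω x a)

@[simp] theorem baseChange_dualMul_bidual (x y : Point k R H) :
    ((dualOmega ω).comul.dualMap ∘ₗ TensorProduct.dualDistrib k _ _).baseChange R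
      (x.bidual ⊠ y.bidual) = (x * y).bidual := by
  refine bidual_ext fun a => ?_
  rw [← ev_comp, ev_bidual, ← evT_dualOmega_comul ω, ← ev_box_eval]
  congr 1
  refine LinearMap.ext fun t => ?_
  generalize hs : (dualOmega ω).comul a = s
  have : ((Module.Dual.eval k (Module.Dual k H)) a ∘ₗ (dualOmega ω).comul.dualMap ∘ₗ
      TensorProduct.dualDistrib k (Module.Dual k H) (Module.Dual k H)) t =
      TensorProduct.dualDistrib k _ _ t s := by rw [← hs]; rfl
  rw [this]
  clear hs this
  induction s using TensorProduct.induction_on with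
  | zero => simp
  | add a b ha hb => simp only [map_add, LinearMap.add_apply, ha, hb]
  | tmul φ ψ =>
    induction t using TensorProduct.induction_on with
    | zero => simp
    | add a b ha hb => simp only [map_add, LinearMap.add_apply, ha, hb]
    | tmul φ ψ => simp

/-- A point, as a multiplicative functional on `H*`, is group-like for the coproduct of `(H*)*`. -/
theorem baseChange_dualComul_bidual (x : Point k R H) :
    (dualOmega ω).dualComul.baseChange R x.bidual = x.bidual ⊠ x.bidual := by
  refine bidual_ext₂ fun t => ?_
  rw [ev_box_eval, ← ev_comp]
  have : (TensorProduct.dualDistrib k _ _ (TensorProduct.map (Module.Dual.eval k (Module.Dual k H))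
        (Module.Dual.eval k (Module.Dual k H)) t)) ∘ₗ (dualOmega ω).dualComul =
      Module.Dual.eval k _ (TensorProduct.lift (dualOmega ω).mul t) := by
    refine LinearMap.ext fun χ => ?_
    have e : ∀ F : Module.Dual k (Module.Dual k H ⊗[k] Module.Dual k H),
        TensorProduct.dualDistrib k _ _ (TensorProduct.map (Module.Dual.eval k (Module.Dual k H))
          (Module.Dual.eval k (Module.Dual k H)) t)
          ((TensorProduct.dualDistribEquiv k _ _).symm F) = F t := by
      intro F
      obtain ⟨s, rfl⟩ := (TensorProduct.dualDistribEquiv k _ _).surjective F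
      rw [LinearEquiv.symm_apply_apply]
      induction s using TensorProduct.induction_on with
      | zero => simp
      | add a b ha hb => simp only [map_add, LinearMap.add_apply, ha, hb]
      | tmul φ ψ =>
        induction t using TensorProduct.induction_on with
        | zero => simp
        | add a b ha hb => simp only [map_add, LinearMap.add_apply, ha, hb]
        | tmul φ ψ => simp
    exact e _
  rw [this, ev_bidual]
  clear this
  induction t using TensorProduct.induction_on with
  | zero => simp
  | add a b ha hb => simp only [map_add, ha, hb]
  | tmul φ ψ => rw [TensorProduct.lift.tmul, ev_dualOmega_mul, evT_tmul]

end DoublePoints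

section

/-! ### Generators of the double -/

section DoubleGenerators

universe u v w₁ w₂ w₃

/-- The image of a family of generators under a linear equivalence. -/
def Generators.congr {k : Type u} [Field k] {Z : Type w₁} {Z' : Type w₂} [AddCommGroup Z]
    [Module k Z] [AddCommGroup Z'] [Module k Z'] (G : Generators.{u, v} k Z) (e : Z ≃ₗ[k] Z') :
    Generators.{u, v} k Z' where
  mem R _ _ z := ∃ y, G.mem R y ∧ z = e.toLinearMap.baseChange R y
  map f z := by
    rintro ⟨y, hy, rfl⟩
    exact ⟨_, G.map f y hy, scal_baseChange f _ y⟩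
  gen R _ _ L h := by
    have : L ∘ₗ e.toLinearMap = 0 := G.gen R _ fun R' _ _ f z hz => by
      rw [← LinearMap.comp_assoc, liftBaseChange_comp_apply]
      exact h R' f _ ⟨z, hz, rfl⟩
    ext z
    obtain ⟨y, rfl⟩ := e.surjective z
    exact LinearMap.congr_fun this y

variable {k : Type u} {H : Type v} [Field k] [Ring H] [HopfAlgebra k H] [Coalgebra.IsCocomm k H]
  [FiniteDimensional k H]

variable (k H) in
/-- The elements `x ⋈ φ` for points `x` and functionals `φ`. -/
def Generators.double :
    Generators.{u, v} k (Module.Dual k (Module.Dual k H) ⊗[k] Module.Dual k H) :=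
  ((Generators.points k H).congr (Module.evalEquiv k H)).tensor
    (Generators.const k (Module.Dual k H))

theorem Generators.double_mem {R : Type max u v} [CommRing R] [Algebra k R]
    {z : R ⊗[k] (Module.Dual k (Module.Dual k H) ⊗[k] Module.Dual k H)}
    (h : (Generators.double.{u, v} k H).mem R z) :
    ∃ (x : Point k R H) (φ : Module.Dual k H), z = x.bidual ⊠ (1 ⊗ₜ φ) := by
  obtain ⟨_, _, ⟨x, hx, rfl⟩, ⟨φ, rfl⟩, rfl⟩ := h
  exact ⟨⟨x, hx⟩, φ, rfl⟩

section
variable {V : Type w₁} {K : Type w₂} [AddCommGroup V] [Module k V] [AddCommGroup K] [Module k K]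

theorem double_ext (p : Probe.{u, v} k V K)
    {T T' : Module.Dual k (Module.Dual k H) ⊗[k] Module.Dual k H →ₗ[k] V}
    (h : ∀ (R : Type max u v) [CommRing R] [Algebra k R] (E : V →ₗ[k] R ⊗[k] K), p.mem R E →
      ∀ (x : Point k R H) (φ : Module.Dual k H),
      LinearMap.liftBaseChange R E (T.baseChange R (x.bidual ⊠ (1 ⊗ₜ φ))) =
        LinearMap.liftBaseChange R E (T'.baseChange R (x.bidual ⊠ (1 ⊗ₜ φ)))) : T = T' := by
  refine (Generators.double k H).ext p fun R _ _ E hE z hz => ?_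
  obtain ⟨x, φ, rfl⟩ := Generators.double_mem hz
  exact h R E hE x φ

theorem double_ext₂ (p : Probe.{u, v} k V K)
    {T T' : (Module.Dual k (Module.Dual k H) ⊗[k] Module.Dual k H) ⊗[k]
      (Module.Dual k (Module.Dual k H) ⊗[k] Module.Dual k H) →ₗ[k] V}
    (h : ∀ (R : Type max u v) [CommRing R] [Algebra k R] (E : V →ₗ[k] R ⊗[k] K), p.mem R E →
      ∀ (x y : Point k R H) (φ ψ : Module.Dual k H),
      LinearMap.liftBaseChange R E
          (T.baseChange R ((x.bidual ⊠ (1 ⊗ₜ φ)) ⊠ (y.bidual ⊠ (1 ⊗ₜ ψ)))) =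
        LinearMap.liftBaseChange R E
          (T'.baseChange R ((x.bidual ⊠ (1 ⊗ₜ φ)) ⊠ (y.bidual ⊠ (1 ⊗ₜ ψ))))) : T = T' := by
  refine (Generators.double k H).ext₂ p fun R _ _ E hE s t hs ht => ?_
  obtain ⟨x, φ, rfl⟩ := Generators.double_mem hs
  obtain ⟨y, ψ, rfl⟩ := Generators.double_mem ht
  exact h R E hE x y φ ψ

end

end DoubleGenerators

section Pull

variable {k R V W U X Y M M' N : Type*} [Field k] [CommRing R] [Algebra k R]
  [AddCommGroup V] [Module k V] [AddCommGroup W] [Module k W] [AddCommGroup U] [Module k U]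
  [AddCommGroup X] [Module k X] [AddCommGroup Y] [Module k Y] [AddCommMonoid M] [Module k M]
  [AddCommMonoid M'] [Module k M'] [AddCommMonoid N] [Module k N] [Module R N] [IsScalarTower k R N]

/-- Multiplication by `z` from the left as a linear map. -/
def boxLeft (z : R ⊗[k] M) : R ⊗[k] M' →ₗ[R] R ⊗[k] (M ⊗[k] M') where
  toFun y := z ⊠ y
  map_add' := box_add z
  map_smul' r y := by simp

theorem box_sum₂ (z : R ⊗[k] M) (t : V ⊗[k] W) (F : V → W → R ⊗[k] M') :
    z ⊠ sum₂ t F = sum₂ t fun a b => z ⊠ F a b :=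
  map_sum₂ ((boxLeft z).restrictScalars k) t F

theorem box_sum₅ (z : R ⊗[k] M) (t : V ⊗[k] (W ⊗[k] (U ⊗[k] (X ⊗[k] Y))))
    (F : V → W → U → X → Y → R ⊗[k] M') :
    z ⊠ sum₅ t F = sum₅ t fun a b c d e => z ⊠ F a b c d e :=
  map_sum₅ ((boxLeft z).restrictScalars k) t F

theorem one_tmul_sum₃ (t : V ⊗[k] (W ⊗[k] U)) (F : V → W → U → M) :
    (1 : R) ⊗ₜ[k] sum₃ t F = sum₃ t fun a b c => (1 : R) ⊗ₜ[k] F a b c :=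
  map_sum₃ (TensorProduct.mk k R M 1) t F

theorem one_tmul_sum₅ (t : V ⊗[k] (W ⊗[k] (U ⊗[k] (X ⊗[k] Y)))) (F : V → W → U → X → Y → M) :
    (1 : R) ⊗ₜ[k] sum₅ t F = sum₅ t fun a b c d e => (1 : R) ⊗ₜ[k] F a b c d e :=
  map_sum₅ (TensorProduct.mk k R M 1) t F

theorem liftBaseChange_sum₂ (E : M →ₗ[k] N) (t : V ⊗[k] W) (F : V → W → R ⊗[k] M) :
    LinearMap.liftBaseChange R E (sum₂ t F) = sum₂ t fun a b => LinearMap.liftBaseChange R E (F a b) :=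
  map_sum₂ ((LinearMap.liftBaseChange R E).restrictScalars k) t F

theorem liftBaseChange_sum₃ (E : M →ₗ[k] N) (t : V ⊗[k] (W ⊗[k] U)) (F : V → W → U → R ⊗[k] M) :
    LinearMap.liftBaseChange R E (sum₃ t F) =
      sum₃ t fun a b c => LinearMap.liftBaseChange R E (F a b c) :=
  map_sum₃ ((LinearMap.liftBaseChange R E).restrictScalars k) t F

theorem liftBaseChange_sum₅ (E : M →ₗ[k] N) (t : V ⊗[k] (W ⊗[k] (U ⊗[k] (X ⊗[k] Y))))
    (F : V → W → U → X → Y → R ⊗[k] M) :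
    LinearMap.liftBaseChange R E (sum₅ t F) =
      sum₅ t fun a b c d e => LinearMap.liftBaseChange R E (F a b c d e) :=
  map_sum₅ ((LinearMap.liftBaseChange R E).restrictScalars k) t F

end Pull

/-! ### The map `w` and the product of the double at points -/

section WMap

variable {k R H : Type*} [Field k] [CommRing R] [Algebra k R] [Ring H] [HopfAlgebra k H]
  [Coalgebra.IsCocomm k H] [FiniteDimensional k H]
variable (ω : (WithConv (H ⊗[k] (H ⊗[k] H) →ₗ[k] k))ˣ)

theorem bind_bidual_comul {N : Type*} [AddCommMonoid N] [Module k N] [Module R N]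
    [IsScalarTower k R N] (x : Point k R H) (F : H → H → N) :
    (bind x.bidual fun χ => sum₂ (Coalgebra.comul (R := k) ((Module.evalEquiv k H).symm χ)) F) =
      bind x.val fun a => bind x.val fun b => F a b := by
  rw [← x.isPoint.bind_comul]
  refine (bind_linear x.bidual (lift₂ F ∘ₗ Coalgebra.comul ∘ₗ
    (Module.evalEquiv k H).symm.toLinearMap)).trans ?_
  refine Eq.trans ?_ (bind_linear x.val (lift₂ F ∘ₗ Coalgebra.comul)).symm
  rw [Point.bidual, ← liftBaseChange_comp_apply]
  refine congrArg (fun L : H →ₗ[k] N => LinearMap.liftBaseChange R L x.val)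
    (LinearMap.ext fun a => ?_)
  simp only [LinearMap.comp_apply, LinearEquiv.coe_coe, LinearEquiv.symm_apply_apply]

theorem sum₃_smul_tmul {A B C M N : Type*} [AddCommGroup A] [Module k A] [AddCommGroup B]
    [Module k B] [AddCommGroup C] [Module k C] [AddCommMonoid M] [Module k M] [AddCommMonoid N]
    [Module k N] (t : A ⊗[k] (B ⊗[k] C)) (c : A → B → C → k) (m : A → B → C → M) (n : N) :
    (sum₃ t fun x y z => c x y z • (m x y z ⊗ₜ[k] n)) =
      (sum₃ t fun x y z => c x y z • m x y z) ⊗ₜ[k] n :=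
  (map_sum₃ ((TensorProduct.mk k M N).flip n) t fun x y z => c x y z • m x y z).symm

/-- The functional part `Φ` is independent of `g`, which is needed when the counit and the antipode
of `D^ω(H)` evaluate it at other points. -/
theorem wMap_generators (x : Point k R H) (φ : Module.Dual k H) :
    ∃ Φ : R ⊗[k] Module.Dual k H,
      (wMap ω).baseChange R (x.bidual ⊠ (1 ⊗ₜ φ)) = Φ ⊠ x.val ∧
      ∀ g : Point k R H, LinearMap.liftBaseChange R (ev g.val) Φ =
        ((om ω g x x⁻¹)⁻¹ : Rˣ) * ev (x⁻¹ * g * x).val φ := by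
  refine ⟨bind ((1 : R) ⊗ₜ[k] φ) fun φ => bind x.val fun h₁ => bind x.val fun h₂ =>
    bind x.val fun h₃ => bind x.val fun h₄ => (1 : R) ⊗ₜ[k]
      sum₃ (dualTriple (ω⁻¹).1) fun ω₁ ω₂ ω₃ => (ω₂ h₁ * ω₃ (HopfAlgebra.antipode k h₂)) •
        conv ω₁ (actBoth h₃ φ (HopfAlgebra.antipode k h₄)), ?_, fun g => ?_⟩
  · rw [wMap, baseChange_lift₂_box, bind_comm]
    simp only [sum₃_smul_tmul, one_tmul_sum₂, bind_bidual_comul, x.isPoint.bind_comul, one_tmul_tmul,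
      bind_box_left, bind_box_right, bind_one_tmul]
  · have key : ∀ (φ : Module.Dual k H) (h₁ h₂ h₃ h₄ : H),
        ev g.val (sum₃ (dualTriple (ω⁻¹).1) fun ω₁ ω₂ ω₃ =>
          (ω₂ h₁ * ω₃ (HopfAlgebra.antipode k h₂)) •
            conv ω₁ (actBoth h₃ φ (HopfAlgebra.antipode k h₄))) =
        ev ((HopfAlgebra.antipode k).baseChange R (1 ⊗ₜ h₄) * g.val * (1 ⊗ₜ h₃)) φ *
          ev (g.val ⊠ (1 ⊗ₜ h₁) ⊠ (HopfAlgebra.antipode k).baseChange R (1 ⊗ₜ h₂)) (ω⁻¹).1.ofConv := by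
      intro φ h₁ h₂ h₃ h₄
      rw [← evT_dualTriple, map_sum₃]
      refine sum₃_evT _ _ _ _ _ fun a b c => ?_
      rw [map_smul, Algebra.smul_def, map_mul, algebraMap_dual, algebraMap_dual, Point.ev_conv,
        ev_actBoth, one_tmul_apply (HopfAlgebra.antipode k), one_tmul_apply (HopfAlgebra.antipode k)]
      ring
    simp only [← bind_liftBaseChange, LinearMap.liftBaseChange_tmul, one_smul, key]
    simp only [bind_mul, bind_mul_right, bind_ev, bind_box_left, bind_box_right, bind_one_tmul,
      bind_mul_left, bind_mul_right', bind_baseChange, bind_evₗ, LinearMap.liftBaseChange_tmul,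
      one_smul, ← Point.val_inv, ev_om_inv]
    rw [mul_comm]
    rfl

theorem val_wMap_tmul (g x : Point k R H) (φ : Module.Dual k H) :
    Val (evD k g) ((wMap ω).baseChange R (x.bidual ⊠ (1 ⊗ₜ φ)))
      (((om ω g x x⁻¹)⁻¹ : Rˣ) * ev (x⁻¹ * g * x).val φ) x.val := by
  obtain ⟨Φ, h, hΦ⟩ := wMap_generators ω x φ
  rw [Val, h, liftBaseChange_evD_box, hΦ]

theorem val_wMap (g x : Point k R H) (Φ : R ⊗[k] Module.Dual k H) :
    Val (evD k g) ((wMap ω).baseChange R (x.bidual ⊠ Φ))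
      (((om ω g x x⁻¹)⁻¹ : Rˣ) * LinearMap.liftBaseChange R (ev (x⁻¹ * g * x).val) Φ) x.val := by
  rw [Val]
  induction Φ using TensorProduct.induction_on with
  | zero => simp
  | add a b ha hb => simp only [box_add, map_add, ha, hb, mul_add, add_smul]
  | tmul r φ =>
    have h := val_wMap_tmul ω g x φ
    rw [← mul_one r, ← smul_eq_mul, ← TensorProduct.smul_tmul', box_smul, map_smul, map_smul, h,
      map_smul, LinearMap.liftBaseChange_tmul, one_smul, smul_smul, smul_eq_mul, mul_left_comm r]

variable {ω} (hω : IsNormalizedThreeCocycle ω)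
include hω

/-- Since points are eigenvectors of the actions, the five legs of `Ω` are evaluated at `x, y, g, y,
x`, and the iterated coproduct of `φ` at `y, g, y⁻¹`. -/
theorem doubleMul_generators (x y : Point k R H) (φ ψ : Module.Dual k H) :
    ∃ Φ : R ⊗[k] Module.Dual k H,
      (TensorProduct.lift (dualOmega ω).doubleMul).baseChange R
        ((x.bidual ⊠ (1 ⊗ₜ φ)) ⊠ (y.bidual ⊠ (1 ⊗ₜ ψ))) = (x * y).bidual ⊠ Φ ∧
      ∀ g : Point k R H, LinearMap.liftBaseChange R (ev g.val) Φ =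
        ((om ω (x * y * g) y⁻¹ x⁻¹)⁻¹ * om ω x y g * om ω x (y * g) y⁻¹ *
        ((om ω x y y⁻¹)⁻¹ * om ω (x * y) y⁻¹ x⁻¹) : Rˣ) * ev (y * g * y⁻¹).val φ * ev g.val ψ := by
  refine ⟨bind ((1 : R) ⊗ₜ[k] φ) fun φ => bind ((1 : R) ⊗ₜ[k] ψ) fun ψ =>
    sum₅ (dualOmega ω).elementOmega fun Ω₁ Ω₂ Ω₃ Ω₄ Ω₅ =>
      sum₂ ((dualOmega ω).comul φ) fun h₁ h₂ => sum₂ ((dualOmega ω).comul h₁) fun h₁₁ h₁₂ =>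
        (ev y.val ((dualOmega ω).mul ((dualOmega ω).antipodeInv h₂) Ω₄) *
          ev y.val ((dualOmega ω).mul Ω₂ h₁₁) * (ev x.val Ω₅ * ev x.val Ω₁)) •
        ((1 : R) ⊗ₜ[k] (dualOmega ω).mul ((dualOmega ω).mul Ω₃ h₁₂) ψ), ?_, fun g => ?_⟩
  · rw [← liftBaseChange_mk ((TensorProduct.lift (dualOmega ω).doubleMul).baseChange R _),
      liftBaseChange_lift, QuasiHopfData.doubleMul, ext₂_lift₂, bind_comm]
    simp only [TensorProduct.mk_apply, one_tmul_sum₅, one_tmul_sum₂, one_tmul_tmul,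
      one_tmul_dualMul, one_tmul_sandwich, bind_sum₂, bind_sum₅, bind_box_left, bind_box_right,
      bind_one_tmul, bind_baseChange, baseChange_sandwich_bidual, smul_box, box_smul, map_smul,
      smul_smul, baseChange_dualMul_bidual, bind_smul]
    simp only [box_sum₂, box_sum₅, ← bind_box_left]
    simp only [bind_box_left, box_smul]
  · have key : ∀ φ ψ : Module.Dual k H,
        (sum₅ (dualOmega ω).elementOmega fun Ω₁ Ω₂ Ω₃ Ω₄ Ω₅ =>
          sum₂ ((dualOmega ω).comul φ) fun h₁ h₂ => sum₂ ((dualOmega ω).comul h₁) fun h₁₁ h₁₂ =>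
            (ev (y⁻¹).val h₂ * ev y.val Ω₄ * (ev y.val Ω₂ * ev y.val h₁₁) *
              (ev x.val Ω₅ * ev x.val Ω₁)) * (ev g.val Ω₃ * ev g.val h₁₂ * ev g.val ψ)) =
        ((om ω (x * y * g) y⁻¹ x⁻¹)⁻¹ * om ω x y g * om ω x (y * g) y⁻¹ *
          ((om ω x y y⁻¹)⁻¹ * om ω (x * y) y⁻¹ x⁻¹) : Rˣ) *
            ev (y * g * y⁻¹).val φ * ev g.val ψ := by
      intro φ ψ
      rw [sum₅_evT _ (ev (y * g * y⁻¹).val φ * ev g.val ψ) (ev x.val) (ev y.val) (ev g.val)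
        (ev y.val) (ev x.val), evT_elementOmega hω]
      · ring
      intro a b c d e
      rw [sum₂_evT _ (ev x.val e * ev x.val a * (ev y.val d * ev y.val b) *
        (ev g.val c * ev g.val ψ)) (ev (y * g).val) (ev (y⁻¹).val), evT_dualOmega_comul]
      · ring
      intro h₁ h₂
      rw [sum₂_evT _ (ev x.val e * ev x.val a * (ev y.val d * ev y.val b) *
        (ev g.val c * ev g.val ψ) * ev (y⁻¹).val h₂) (ev y.val) (ev g.val), evT_dualOmega_comul]
      · ring
      · intro v w; ring
    simp only [← bind_liftBaseChange, liftBaseChange_sum₅, liftBaseChange_sum₂, map_smul,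
      LinearMap.liftBaseChange_tmul, ev_dualOmega_mul, ev_antipodeInv, smul_eq_mul,
      one_mul, key]
    simp only [bind_mul, bind_mul_right, bind_evₗ, LinearMap.liftBaseChange_tmul, one_smul]

end WMap

end

section

section Multiplicative

variable {k R H : Type*} [Field k] [CommRing R] [Algebra k R] [Ring H] [HopfAlgebra k H]
  [Coalgebra.IsCocomm k H]
variable {ω : (WithConv (H ⊗[k] (H ⊗[k] H) →ₗ[k] k))ˣ} (hω : IsNormalizedThreeCocycle ω)
include hω

theorem om_double_mul (g x y : Point k R H) :
    (om ω g (x * y) (x * y)⁻¹)⁻¹ *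
      ((om ω (x * y * ((x * y)⁻¹ * g * (x * y))) y⁻¹ x⁻¹)⁻¹ *
        om ω x y ((x * y)⁻¹ * g * (x * y)) * om ω x (y * ((x * y)⁻¹ * g * (x * y))) y⁻¹ *
        ((om ω x y y⁻¹)⁻¹ * om ω (x * y) y⁻¹ x⁻¹)) =
    (om ω g x x⁻¹)⁻¹ * (om ω (x⁻¹ * g * x) y y⁻¹)⁻¹ * tht ω g x y := by
  apply Additive.ofMul.injective
  simp only [ofMul_mul, ofMul_inv, tht_additive]
  have h := hω.isGroupCocycle.double_mul g x y
  simp only [gF, inv_inv, omA, mul_assoc] at h ⊢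
  linear_combination (norm := abel) h

theorem om_double_comul (g h x : Point k R H) :
    om ω x (x⁻¹ * g * x) (x⁻¹ * h * x) * (om ω (x * (x⁻¹ * g * x)) x⁻¹ x * om ω x⁻¹ x x⁻¹) *
      (om ω g x (x⁻¹ * h * x))⁻¹ * (om ω g (x * (x⁻¹ * h * x)) x⁻¹)⁻¹ *
      ((om ω g x x⁻¹)⁻¹ * (om ω h x x⁻¹)⁻¹) =
    (om ω (g * h) x x⁻¹)⁻¹ * gam ω g h x := by
  apply Additive.ofMul.injective
  simp only [ofMul_mul, ofMul_inv, gam_additive]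
  have h := hω.isGroupCocycle.double_comul g h x
  simp only [omA, mul_assoc, mul_inv_cancel_left] at h ⊢
  linear_combination (norm := abel) h

end Multiplicative

/-! ### `w` is multiplicative and fixes `H*` -/

section WMapLaws

universe u v
variable {k : Type u} {H : Type v} [Field k] [Ring H] [HopfAlgebra k H] [Coalgebra.IsCocomm k H]
  [FiniteDimensional k H]
variable {ω : (WithConv (H ⊗[k] (H ⊗[k] H) →ₗ[k] k))ˣ} (hω : IsNormalizedThreeCocycle ω)

theorem bidual_one {R : Type*} [CommRing R] [Algebra k R] :
    (1 : Point k R H).bidual = 1 ⊗ₜ (dualOmega ω).counit := by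
  rw [Point.bidual, Point.val_one, Algebra.TensorProduct.one_def, LinearMap.baseChange_tmul]
  rfl

theorem one_tmul_doubleIncl {R : Type*} [CommRing R] [Algebra k R] (a : Module.Dual k H) :
    (1 : R) ⊗ₜ[k] (dualOmega ω).doubleIncl a = (1 : Point k R H).bidual ⊠ (1 ⊗ₜ a) := by
  rw [bidual_one (ω := ω), ← one_tmul_tmul]
  rfl

include hω

theorem wMap_mul : wMap ω ∘ₗ TensorProduct.lift (dualOmega ω).doubleMul =
    TensorProduct.lift (crossedMul ω) ∘ₗ TensorProduct.map (wMap ω) (wMap ω) := by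
  refine double_ext₂ (Probe.points k H) ?_
  rintro R _ _ _ ⟨g, rfl⟩ x y φ ψ
  obtain ⟨Φ, h, hΦ⟩ := doubleMul_generators hω x y φ ψ
  rw [LinearMap.baseChange_comp, LinearMap.comp_apply, h, LinearMap.baseChange_comp,
    LinearMap.comp_apply, baseChange_map_box]
  refine (val_wMap ω g (x * y) Φ).eq (val_crossedMul ω (val_wMap_tmul ω g x φ)
    (val_wMap_tmul ω _ y ψ)) ?_ rfl
  rw [hΦ]
  have e := congrArg Units.val (om_double_mul hω g x y)
  have e₁ : y * ((x * y)⁻¹ * g * (x * y)) * y⁻¹ = x⁻¹ * g * x := by group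
  have e₂ : y⁻¹ * (x⁻¹ * g * x) * y = (x * y)⁻¹ * g * (x * y) := by group
  rw [e₁, e₂]
  push_cast at e ⊢
  linear_combination (ev (x⁻¹ * g * x).val φ * ev ((x * y)⁻¹ * g * (x * y)).val ψ) * e

theorem wMap_doubleMul (a b : Module.Dual k (Module.Dual k H) ⊗[k] Module.Dual k H) :
    wMap ω ((dualOmega ω).doubleMul a b) = crossedMul ω (wMap ω a) (wMap ω b) :=
  LinearMap.congr_fun (wMap_mul hω) (a ⊗ₜ b)

/-- The counit of `H*` is evaluation at `1`, so `ε ⋈ a` is the generator with point `1`; there the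
scalar in `w` is trivial by normalization. -/
theorem wMap_comp_doubleIncl : wMap ω ∘ₗ (dualOmega ω).doubleIncl = crossedIncl := by
  refine LinearMap.ext fun a => (Probe.points k H).ext ?_
  rintro R _ _ _ ⟨g, rfl⟩
  have h := val_wMap_tmul ω g 1 a
  rw [← one_tmul_doubleIncl (ω := ω), LinearMap.baseChange_tmul, Val,
    LinearMap.liftBaseChange_tmul, one_smul] at h
  rw [evD_crossedIncl, LinearMap.comp_apply, h]
  simp [om_one_mid hω]

theorem wMap_doubleIncl (a : Module.Dual k H) :
    wMap ω ((dualOmega ω).doubleIncl a) = crossedIncl a :=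
  LinearMap.congr_fun (wMap_comp_doubleIncl hω) a

theorem wMap_counit : (DOmega ω).counit ∘ₗ wMap ω = (dualOmega ω).quantumDouble.counit := by
  refine (Generators.double k H).functional_ext fun R _ _ z hz => ?_
  obtain ⟨x, φ, rfl⟩ := Generators.double_mem hz
  obtain ⟨Φ, h, hΦ⟩ := wMap_generators ω x φ
  have e : (dualOmega ω).quantumDouble.counit = LinearMap.mul' k k ∘ₗ
      TensorProduct.map (Module.Dual.eval k (Module.Dual k H)
        ((dualOmega ω).antipodeInv (dualOmega ω).alpha)) (dualOmega ω).counit := by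
    refine Eq.trans ?_ (lift₂_mul _ _)
    simp only [QuasiHopfData.quantumDouble, mul_comm]
    rfl
  rw [ev_comp, h, ev_counit_box, hΦ, e, ev_mul'_map_box, ev_bidual, ev_antipodeInv,
    ev_dualOmega_alpha, om_one_left hω]
  simp [ev_one_val, dualOmega_counit]

end WMapLaws

/-! ### The coproduct of the double under `w` -/

section Comul

variable {k R H : Type*} [Field k] [CommRing R] [Algebra k R] [Ring H] [HopfAlgebra k H]
  [Coalgebra.IsCocomm k H] [FiniteDimensional k H]
variable {ω : (WithConv (H ⊗[k] (H ⊗[k] H) →ₗ[k] k))ˣ}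

theorem bind_dualComul {N : Type*} [AddCommMonoid N] [Module k N] [Module R N]
    [IsScalarTower k R N] (x : Point k R H)
    (F : Module.Dual k (Module.Dual k H) → Module.Dual k (Module.Dual k H) → N) :
    (bind x.bidual fun χ => sum₂ ((dualOmega ω).dualComul χ) F) =
      bind x.bidual fun χ => bind x.bidual fun ψ => F χ ψ := by
  rw [← bind_box, ← baseChange_dualComul_bidual ω, ← liftBaseChange_comp_apply, ← bind_linear]
  rfl

theorem bind_wMap_sandwich (g x : Point k R H) (u v a : Module.Dual k H) :
    (bind x.bidual fun χ => evD k g (wMap ω ((dualOmega ω).sandwich u χ v ⊗ₜ a))) =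
      (((om ω g x x⁻¹)⁻¹ : Rˣ) * (ev x.val v * ev x.val u * ev (x⁻¹ * g * x).val a)) • x.val := by
  have h := val_wMap_tmul ω g x a
  rw [Val] at h
  rw [mul_left_comm, ← smul_smul, ← h, ← map_smul, ← map_smul, ← smul_box,
    ← baseChange_sandwich_bidual, ← liftBaseChange_comp_apply]
  refine (bind_linear x.bidual ((evD k g ∘ₗ wMap ω) ∘ₗ
    (TensorProduct.mk k _ _).flip a ∘ₗ
    ((dualOmega ω).mul.flip u ∘ₗ (dualOmega ω).mul v).dualMap)).trans ?_
  rw [liftBaseChange_comp_apply, LinearMap.baseChange_comp, LinearMap.comp_apply,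
    baseChange_flip_mk]

variable (hω : IsNormalizedThreeCocycle ω)
include hω

/-- `w` is already multiplicative, so a left factor `ε ⋈ b` becomes multiplication by `b # 1`, that
is, by the scalar `b(g)`. The coproduct and the antipode of the double both contain such a product,
which then need not be expanded by `Ω`. -/
theorem val_wMap_incl_mul {g x : Point k R H}
    {z : R ⊗[k] (Module.Dual k (Module.Dual k H) ⊗[k] Module.Dual k H)} {c : R}
    (hz : Val (evD k g) ((wMap ω).baseChange R z) c x.val) (b : Module.Dual k H) :
    Val (evD k g) ((wMap ω ∘ₗ (dualOmega ω).doubleMul ((dualOmega ω).doubleIncl b)).baseChange R z)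
      (ev g.val b * c) x.val := by
  have e : wMap ω ∘ₗ (dualOmega ω).doubleMul ((dualOmega ω).doubleIncl b) =
      crossedMul ω (crossedIncl b) ∘ₗ wMap ω := LinearMap.ext fun a => by
    rw [LinearMap.comp_apply, wMap_doubleMul hω, wMap_doubleIncl hω]; rfl
  have hz' : Val (evD k ((1 : Point k R H)⁻¹ * g * 1)) ((wMap ω).baseChange R z) c x.val := by
    simpa using hz
  rw [e, LinearMap.baseChange_comp, LinearMap.comp_apply, baseChange_apply_eq]
  refine (val_crossedMul ω (val_crossedIncl g b) hz').congr rfl rfl ?_ (by rw [one_mul])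
  rw [tht_one_mid hω, Units.val_one, mul_one]

/-- The map `T` is the identity for the coproduct and composition with `S⁻¹` for the antipode, where
the point `x` is replaced by `y = x⁻¹`. -/
theorem bind_wMap_incl_mul (g x y : Point k R H)
    {T : Module.Dual k (Module.Dual k H) →ₗ[k] Module.Dual k (Module.Dual k H)}
    (hT : T.baseChange R x.bidual = y.bidual) (u v a b : Module.Dual k H) :
    (bind x.bidual fun χ => evD k g (wMap ω ((dualOmega ω).doubleMul ((dualOmega ω).doubleIncl b)
      ((dualOmega ω).sandwich u (T χ) v ⊗ₜ a)))) =
      (ev g.val b * (((om ω g y y⁻¹)⁻¹ : Rˣ) *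
        (ev y.val v * ev y.val u * ev (y⁻¹ * g * y).val a))) • y.val := by
  have h := val_wMap_incl_mul hω ((val_wMap_tmul ω g y a).smul (ev y.val v * ev y.val u) |>.congr rfl
    (map_smul _ _ _).symm rfl rfl) b
  rw [Val, ← smul_box, ← baseChange_sandwich_bidual, ← liftBaseChange_comp_apply, ← hT] at h
  rw [mul_left_comm ((om ω g y y⁻¹)⁻¹ : Rˣ).val, ← h]
  refine (bind_linear x.bidual ((evD k g ∘ₗ wMap ω ∘ₗ
    (dualOmega ω).doubleMul ((dualOmega ω).doubleIncl b)) ∘ₗ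
    (TensorProduct.mk k _ _).flip a ∘ₗ
    ((dualOmega ω).mul.flip u ∘ₗ (dualOmega ω).mul v).dualMap ∘ₗ T)).trans ?_
  rw [liftBaseChange_comp_apply, LinearMap.baseChange_comp, LinearMap.comp_apply,
    baseChange_flip_mk, LinearMap.baseChange_comp, LinearMap.comp_apply]

end Comul

end

section BoxMapComp

variable {k R V W V' W' K K' : Type*} [Field k] [CommRing R] [Algebra k R]
  [AddCommMonoid V] [Module k V] [AddCommMonoid W] [Module k W]
  [AddCommMonoid V'] [Module k V'] [AddCommMonoid W'] [Module k W']
  [AddCommMonoid K] [Module k K] [AddCommMonoid K'] [Module k K']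

theorem boxMap_comp_map (E : V' →ₗ[k] R ⊗[k] K) (E' : W' →ₗ[k] R ⊗[k] K') (f : V →ₗ[k] V')
    (f' : W →ₗ[k] W') :
    boxMap E E' ∘ₗ TensorProduct.map f f' = boxMap (E ∘ₗ f) (E' ∘ₗ f') :=
  TensorProduct.ext' fun _ _ => rfl

end BoxMapComp

section SumSmul

variable {k R V W U N : Type*} [Field k] [CommRing R] [Algebra k R]
  [AddCommGroup V] [Module k V] [AddCommGroup W] [Module k W] [AddCommGroup U] [Module k U]
  [AddCommMonoid N] [Module k N] [Module R N] [IsScalarTower k R N]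

theorem sum₂_smul_const (t : V ⊗[k] W) (n : N) (F : V → W → R) :
    (sum₂ t fun a b => F a b • n) = sum₂ t F • n :=
  (map_sum₂ ((LinearMap.toSpanSingleton R N n).restrictScalars k) t F).symm

theorem sum₃_smul_const (t : V ⊗[k] (W ⊗[k] U)) (n : N) (F : V → W → U → R) :
    (sum₃ t fun a b c => F a b c • n) = sum₃ t F • n :=
  (map_sum₃ ((LinearMap.toSpanSingleton R N n).restrictScalars k) t F).symm

theorem bind_one_tmul_sum₂ (f : U →ₗ[k] V ⊗[k] W) (u : U) (F : V → W → N) :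
    (bind ((1 : R) ⊗ₜ[k] u) fun u => sum₂ (f u) F) = sum₂ (f u) F :=
  (bind_tmul_linear 1 u (lift₂ F ∘ₗ f)).trans (one_smul _ _)

end SumSmul

section Comul

variable {k R H : Type*} [Field k] [CommRing R] [Algebra k R] [Ring H] [HopfAlgebra k H]
  [Coalgebra.IsCocomm k H] [FiniteDimensional k H]
variable {ω : (WithConv (H ⊗[k] (H ⊗[k] H) →ₗ[k] k))ˣ} (hω : IsNormalizedThreeCocycle ω)
include hω

/-- All legs are evaluated at `g`, `x`, `x⁻¹` or the conjugates of `g` and `h` by `x`, or at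
products of these; each sum then contributes a single value, and `om_double_comul` identifies the
product of these values. -/
theorem val_doubleComul (g h x : Point k R H) (φ : Module.Dual k H) :
    LinearMap.liftBaseChange R (boxMap (evD k g ∘ₗ wMap ω) (evD k h ∘ₗ wMap ω))
      ((dualOmega ω).doubleComul.baseChange R (x.bidual ⊠ (1 ⊗ₜ φ))) =
      ((om ω (g * h) x x⁻¹)⁻¹ * gam ω g h x * ev (x⁻¹ * g * x * (x⁻¹ * h * x)).val φ : R) •
        (x.val ⊠ x.val) := by
  rw [QuasiHopfData.doubleComul, baseChange_lift₂_box, bind_comm]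
  simp only [one_tmul_sum₃, one_tmul_sum₂, ← bind_liftBaseChange, liftBaseChange_sum₃,
    liftBaseChange_sum₂, LinearMap.liftBaseChange_tmul, one_smul, boxMap_tmul,
    LinearMap.comp_apply]
  simp only [bind_sum₃, bind_sum₂, bind_dualComul, bind_box_left, bind_box_right]
  have B := bind_wMap_incl_mul hω g x x (T := LinearMap.id) (by simp)
  simp only [LinearMap.id_apply] at B
  simp only [B, bind_wMap_sandwich, smul_box, box_smul, smul_smul, ev_dualOmega_mul,
    ev_antipodeInv, bind_one_tmul_sum₂]
  simp only [sum₂_smul_const, sum₃_smul_const]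
  congr 1
  have e := congrArg Units.val (om_double_comul hω g h x)
  push_cast at e
  -- The target is replaced by the unsimplified product, so that the sums can be matched with its
  -- factors one at a time, from the outside in.
  rw [← e]
  rw [sum₃_evT _ ((om ω x (x⁻¹ * g * x) (x⁻¹ * h * x) * (om ω (x * (x⁻¹ * g * x)) x⁻¹ x *
    om ω x⁻¹ x x⁻¹) * (om ω g x (x⁻¹ * h * x))⁻¹ * ((om ω g x x⁻¹)⁻¹ * (om ω h x x⁻¹)⁻¹) : Rˣ) *
    ev (x⁻¹ * g * x * (x⁻¹ * h * x)).val φ) (ev g.val) (ev (x * (x⁻¹ * h * x)).val)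
    (ev (x⁻¹).val), evT_dualOmega_reassoc]
  · push_cast; ring
  intro X₁ X₂ X₃
  rw [sum₃_evT _ ((om ω x (x⁻¹ * g * x) (x⁻¹ * h * x) * (om ω (x * (x⁻¹ * g * x)) x⁻¹ x *
    om ω x⁻¹ x x⁻¹) * ((om ω g x x⁻¹)⁻¹ * (om ω h x x⁻¹)⁻¹) : Rˣ) *
    ev (x⁻¹ * g * x * (x⁻¹ * h * x)).val φ * (ev g.val X₁ * ev (x * (x⁻¹ * h * x)).val X₂ *
    ev (x⁻¹).val X₃)) (ev g.val) (ev x.val) (ev (x⁻¹ * h * x).val), evT_dualOmega_reassoc]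
  · push_cast; ring
  intro Y₁ Y₂ Y₃
  rw [sum₃_evT _ (((om ω (x * (x⁻¹ * g * x)) x⁻¹ x *
    om ω x⁻¹ x x⁻¹) * ((om ω g x x⁻¹)⁻¹ * (om ω h x x⁻¹)⁻¹) : Rˣ) *
    ev (x⁻¹ * g * x * (x⁻¹ * h * x)).val φ * (ev g.val X₁ * ev (x * (x⁻¹ * h * x)).val X₂ *
    ev (x⁻¹).val X₃) * (ev g.val Y₁ * ev x.val Y₂ * ev (x⁻¹ * h * x).val Y₃)) (ev x.val)
    (ev (x⁻¹ * g * x).val) (ev (x⁻¹ * h * x).val), evT_dualOmega_reassocInv]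
  · push_cast; ring
  intro x₁ x₂ x₃
  rw [sum₂_evT _ (((om ω g x x⁻¹)⁻¹ * (om ω h x x⁻¹)⁻¹ : Rˣ) *
    ev (x⁻¹ * g * x * (x⁻¹ * h * x)).val φ * (ev g.val X₁ * ev (x * (x⁻¹ * h * x)).val X₂ *
    ev (x⁻¹).val X₃) * (ev g.val Y₁ * ev x.val Y₂ * ev (x⁻¹ * h * x).val Y₃) *
    (ev x.val x₁ * ev (x⁻¹ * g * x).val x₂ * ev (x⁻¹ * h * x).val x₃))
    (ev (x * (x⁻¹ * g * x)).val) (ev (x⁻¹).val), evT_pR, inv_inv]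
  · push_cast; ring
  intro p₁ p₂
  rw [sum₂_evT _ (((om ω g x x⁻¹)⁻¹ * (om ω h x x⁻¹)⁻¹ : Rˣ) *
    ev (x⁻¹ * g * x * (x⁻¹ * h * x)).val φ * (ev g.val X₁ * ev (x * (x⁻¹ * h * x)).val X₂ *
    ev (x⁻¹).val X₃) * (ev g.val Y₁ * ev x.val Y₂ * ev (x⁻¹ * h * x).val Y₃) *
    (ev x.val x₁ * ev (x⁻¹ * g * x).val x₂ * ev (x⁻¹ * h * x).val x₃) * ev (x⁻¹).val p₂)
    (ev x.val) (ev (x⁻¹ * g * x).val), evT_dualOmega_comul]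
  · ring
  intro p₁₁ p₁₂
  rw [sum₂_evT _ (((om ω g x x⁻¹)⁻¹ * (om ω h x x⁻¹)⁻¹ : Rˣ) *
    ev (x⁻¹ * g * x * (x⁻¹ * h * x)).val φ * (ev g.val X₁ *
    ev (x⁻¹).val X₃) * (ev g.val Y₁ * ev x.val Y₂ * ev (x⁻¹ * h * x).val Y₃) *
    (ev x.val x₁ * ev (x⁻¹ * g * x).val x₂ * ev (x⁻¹ * h * x).val x₃) * ev (x⁻¹).val p₂ *
    (ev x.val p₁₁ * ev (x⁻¹ * g * x).val p₁₂))
    (ev x.val) (ev (x⁻¹ * h * x).val), evT_dualOmega_comul]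
  · ring
  intro X₂₁ X₂₂
  rw [sum₂_evT _ (((om ω g x x⁻¹)⁻¹ * (om ω h x x⁻¹)⁻¹ : Rˣ) * (ev g.val X₁ *
    ev (x⁻¹).val X₃) * (ev g.val Y₁ * ev x.val Y₂ * ev (x⁻¹ * h * x).val Y₃) *
    (ev x.val x₁ * ev (x⁻¹ * g * x).val x₂ * ev (x⁻¹ * h * x).val x₃) * ev (x⁻¹).val p₂ *
    (ev x.val p₁₁ * ev (x⁻¹ * g * x).val p₁₂) * (ev x.val X₂₁ * ev (x⁻¹ * h * x).val X₂₂))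
    (ev (x⁻¹ * g * x).val) (ev (x⁻¹ * h * x).val), evT_dualOmega_comul]
  · ring
  · intro v w; push_cast; ring

end Comul

/-! ### The antipode of the double under `w` -/

section AntipodeCocycle

namespace IsGroupCocycle

variable {G M : Type*} [Group G] [AddCommGroup M] {w : G → G → G → M} (hw : IsGroupCocycle w)
include hw

/-- The left side collects the values of the Drinfeld twist, of `p_R` and of `U` together with the
scalar of `wMap` at `x⁻¹`; the right side is the antipode of `D^ω(H)` after `wMap`. Eight instances
of the cocycle identity account for the difference. -/
theorem double_antipode (g x : G) :
    gF w g x⁻¹ + (w (x⁻¹ * (x * g * x⁻¹)) x x⁻¹ + w x x⁻¹ x) +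
      (w (x⁻¹ * (x * g * x⁻¹))⁻¹ (x⁻¹ * (x * g * x⁻¹)) (x⁻¹ * (x * g * x⁻¹))⁻¹ +
        (-w (x⁻¹ * (x * g * x⁻¹)) (x * g * x⁻¹)⁻¹ x + w x⁻¹ (x * g * x⁻¹) (x * g * x⁻¹)⁻¹ +
          w x⁻¹ x x⁻¹ + w (x * g * x⁻¹) (x * g * x⁻¹)⁻¹ (x * g * x⁻¹)) -
        w (x * g * x⁻¹)⁻¹ x x⁻¹) - w g x⁻¹ x =
      -w (x * g * x⁻¹)⁻¹ x x⁻¹ + (-gθ w (x * g * x⁻¹) x x⁻¹ -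
        gγ w (x * g * x⁻¹)⁻¹ (x * g * x⁻¹) x + gθ w g x⁻¹ 1) := by
  linear_combination (norm := skip) hw.cocycle (g * x⁻¹) (x * g⁻¹ * x⁻¹) x x⁻¹
    - hw.cocycle (x * g⁻¹) (g * x⁻¹) (x * g⁻¹) x⁻¹
    - hw.cocycle (g * x⁻¹) x x⁻¹ x
    - hw.cocycle (x * g⁻¹ * x⁻¹) (x * g * x⁻¹) (x * g⁻¹ * x⁻¹) (x * g * x⁻¹)
    - hw.cocycle (x * g⁻¹ * x⁻¹) (x * g * x⁻¹) x x⁻¹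
    - hw.cocycle (x * g⁻¹) x⁻¹ (x * g * x⁻¹) (x * g⁻¹ * x⁻¹)
    + hw.cocycle (x * g⁻¹ * x⁻¹) x g x⁻¹
    - hw.cocycle (x * g⁻¹ * x⁻¹) x x⁻¹ (x * g * x⁻¹)
  simp only [gF, gθ, gγ, mul_assoc, mul_inv_rev, inv_inv, mul_inv_cancel_left, inv_mul_cancel_left,
    mul_inv_cancel, inv_mul_cancel, mul_one, one_mul, inv_one, hw.one_left, hw.one_mid, hw.one_right]
  abel

end IsGroupCocycle

end AntipodeCocycle

section

section MapComul

universe u v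
variable {k : Type u} {H : Type v} [Field k] [Ring H] [HopfAlgebra k H] [Coalgebra.IsCocomm k H]
  [FiniteDimensional k H]
variable {ω : (WithConv (H ⊗[k] (H ⊗[k] H) →ₗ[k] k))ˣ} (hω : IsNormalizedThreeCocycle ω)
include hω

theorem wMap_comul : TensorProduct.map (wMap ω) (wMap ω) ∘ₗ (dualOmega ω).doubleComul =
    crossedComul ω ∘ₗ wMap ω := by
  refine (Generators.double k H).ext_tensor₂ (Probe.points k H) ?_
  rintro R _ _ _ _ ⟨g, rfl⟩ ⟨h, rfl⟩ z hz
  obtain ⟨x, φ, rfl⟩ := Generators.double_mem hz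
  rw [LinearMap.baseChange_comp, LinearMap.comp_apply, ← liftBaseChange_comp_apply,
    boxMap_comp_map, val_doubleComul hω, LinearMap.baseChange_comp, LinearMap.comp_apply,
    val_crossedComul ω (val_wMap_tmul ω (g * h) x φ)]
  have e : x⁻¹ * g * x * (x⁻¹ * h * x) = x⁻¹ * (g * h) * x := by group
  rw [e]
  congr 1
  ring

end MapComul

section BindOne

variable {k R V N : Type*} [Field k] [CommRing R] [Algebra k R] [AddCommGroup V] [Module k V]
  [AddCommMonoid N] [Module k N] [Module R N] [IsScalarTower k R N]

theorem bind_one_tmul_linear (v : V) (L : V →ₗ[k] N) :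
    (bind ((1 : R) ⊗ₜ[k] v) fun v => L v) = L v :=
  (bind_tmul_linear 1 v L).trans (one_smul _ _)

end BindOne

section Antipode

variable {k R H : Type*} [Field k] [CommRing R] [Algebra k R] [Ring H] [HopfAlgebra k H]
  [Coalgebra.IsCocomm k H]
variable {ω : (WithConv (H ⊗[k] (H ⊗[k] H) →ₗ[k] k))ˣ} (hω : IsNormalizedThreeCocycle ω)
include hω

theorem om_double_antipode (g x : Point k R H) :
    ((om ω x g⁻¹ g)⁻¹ * om ω (x * g⁻¹) g x⁻¹) *
      (om ω (x⁻¹ * (x * g * x⁻¹)) x x⁻¹ * om ω x x⁻¹ x) *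
      (om ω (x⁻¹ * (x * g * x⁻¹))⁻¹ (x⁻¹ * (x * g * x⁻¹)) (x⁻¹ * (x * g * x⁻¹))⁻¹ *
        ((om ω (x⁻¹ * (x * g * x⁻¹)) (x * g * x⁻¹)⁻¹ x)⁻¹ * om ω x⁻¹ (x * g * x⁻¹) (x * g * x⁻¹)⁻¹ *
          om ω x⁻¹ x x⁻¹ * om ω (x * g * x⁻¹) (x * g * x⁻¹)⁻¹ (x * g * x⁻¹)) *
        (om ω (x * g * x⁻¹)⁻¹ x x⁻¹)⁻¹) * (om ω g x⁻¹ x)⁻¹ =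
    (om ω (x * g * x⁻¹)⁻¹ x x⁻¹)⁻¹ * ((tht ω (x * g * x⁻¹) x x⁻¹)⁻¹ *
        (gam ω (x * g * x⁻¹)⁻¹ (x * g * x⁻¹) x)⁻¹ * tht ω g x⁻¹ 1) := by
  apply Additive.ofMul.injective
  simp only [ofMul_mul, ofMul_inv, tht_additive, gam_additive]
  have h := hω.isGroupCocycle.double_antipode g x
  simp only [gF, omA, mul_assoc, inv_inv] at h ⊢
  linear_combination (norm := abel) h

variable [FiniteDimensional k H]

theorem val_doubleAntipode (g x : Point k R H) (φ : Module.Dual k H) :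
    Val (evD k g ∘ₗ wMap ω) ((dualOmega ω).doubleAntipode.baseChange R (x.bidual ⊠ (1 ⊗ₜ φ)))
      (((om ω (x * g * x⁻¹)⁻¹ x x⁻¹)⁻¹ * ((tht ω (x * g * x⁻¹) x x⁻¹)⁻¹ *
        (gam ω (x * g * x⁻¹)⁻¹ (x * g * x⁻¹) x)⁻¹ * tht ω g x⁻¹ 1) : Rˣ) * ev (g⁻¹).val φ)
      (x⁻¹).val := by
  rw [Val, QuasiHopfData.doubleAntipode, baseChange_lift₂_box, bind_comm]
  simp only [one_tmul_sum₂, ← bind_liftBaseChange, liftBaseChange_sum₂,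
    LinearMap.liftBaseChange_tmul, one_smul, LinearMap.comp_apply]
  simp only [bind_sum₂]
  have B := bind_wMap_incl_mul hω g x x⁻¹ (T := (dualOmega ω).antipodeInv.dualMap)
    (baseChange_antipodeInv_bidual ω x)
  simp only [LinearMap.dualMap_apply'] at B
  simp only [B, ev_dualOmega_mul, ev_antipodeInv, ev_dualOmega_antipode, inv_inv]
  simp only [bind_smul_const, bind_mul_right, bind_one_tmul_linear, sum₂_smul_const]
  rw [← om_double_antipode hω]
  congr 1
  rw [sum₂_evT _ (((om ω (x⁻¹ * (x * g * x⁻¹)) x x⁻¹ * om ω x x⁻¹ x) *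
      (om ω (x⁻¹ * (x * g * x⁻¹))⁻¹ (x⁻¹ * (x * g * x⁻¹)) (x⁻¹ * (x * g * x⁻¹))⁻¹ *
        ((om ω (x⁻¹ * (x * g * x⁻¹)) (x * g * x⁻¹)⁻¹ x)⁻¹ * om ω x⁻¹ (x * g * x⁻¹) (x * g * x⁻¹)⁻¹ *
          om ω x⁻¹ x x⁻¹ * om ω (x * g * x⁻¹) (x * g * x⁻¹)⁻¹ (x * g * x⁻¹)) *
        (om ω (x * g * x⁻¹)⁻¹ x x⁻¹)⁻¹) * (om ω g x⁻¹ x)⁻¹ : Rˣ) * ev (g⁻¹).val φ)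
      (ev g.val) (ev (x⁻¹).val), evT_drinfeldTwist hω, inv_inv]
  · push_cast; ring
  intro f₁ f₂
  rw [sum₂_evT _ (((om ω (x⁻¹ * (x * g * x⁻¹)) x x⁻¹ * om ω x x⁻¹ x) * (om ω g x⁻¹ x)⁻¹ : Rˣ) *
      ev (g⁻¹).val φ * (ev g.val f₁ * ev (x⁻¹).val f₂))
      (ev (x⁻¹).val) (ev (x * g * x⁻¹).val), evT_elementU hω, inv_inv]
  · push_cast; ring
  intro U₁ U₂
  rw [sum₂_evT _ (((om ω g x⁻¹ x)⁻¹ : Rˣ) * ev (g⁻¹).val φ * (ev g.val f₁ * ev (x⁻¹).val f₂) *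
      (ev (x⁻¹).val U₁ * ev (x * g * x⁻¹).val U₂))
      (ev (x⁻¹ * (x * g * x⁻¹)).val) (ev x.val), evT_pR]
  · push_cast; ring
  intro p₁ p₂
  rw [sum₂_evT _ (((om ω g x⁻¹ x)⁻¹ : Rˣ) * ev (g⁻¹).val φ * (ev g.val f₁ * ev (x⁻¹).val f₂) *
      (ev (x⁻¹).val U₁ * ev (x * g * x⁻¹).val U₂) * ev x.val p₂)
      (ev (x⁻¹).val) (ev (x * g * x⁻¹).val), evT_dualOmega_comul]
  · ring
  · intro v w; ring

end Antipode

section MapAntipode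

universe u v
variable {k : Type u} {H : Type v} [Field k] [Ring H] [HopfAlgebra k H] [Coalgebra.IsCocomm k H]
  [FiniteDimensional k H]
variable {ω : (WithConv (H ⊗[k] (H ⊗[k] H) →ₗ[k] k))ˣ} (hω : IsNormalizedThreeCocycle ω)
include hω

theorem wMap_antipode :
    wMap ω ∘ₗ (dualOmega ω).doubleAntipode = crossedAntipode ω ∘ₗ wMap ω := by
  refine double_ext (Probe.points k H) ?_
  rintro R _ _ _ ⟨g, rfl⟩ x φ
  obtain ⟨Φ, h, hΦ⟩ := wMap_generators ω x φ
  rw [LinearMap.baseChange_comp, LinearMap.comp_apply, ← liftBaseChange_comp_apply,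
    val_doubleAntipode hω, LinearMap.baseChange_comp, LinearMap.comp_apply, h,
    liftBaseChange_crossedAntipode, hΦ]
  have e : x⁻¹ * (x * g * x⁻¹)⁻¹ * x = g⁻¹ := by group
  rw [e]
  congr 1
  push_cast
  ring

end MapAntipode

end

section

theorem injective_of_surjective_of_finrank_eq {k V W : Type*} [Field k] [AddCommGroup V] [Module k V]
    [AddCommGroup W] [Module k W] [FiniteDimensional k V] [FiniteDimensional k W]
    {f : V →ₗ[k] W} (hf : Function.Surjective f)
    (h : Module.finrank k V = Module.finrank k W) : Function.Injective f :=
  (LinearMap.injective_iff_surjective_of_finrank_eq_finrank h).2 hf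

/-! ### Bijectivity of `w` -/

section Section

universe u v
variable {k : Type u} {H : Type v} [Field k] [Ring H] [HopfAlgebra k H] [Coalgebra.IsCocomm k H]
  [FiniteDimensional k H]
variable (ω : (WithConv (H ⊗[k] (H ⊗[k] H) →ₗ[k] k))ˣ)

/-- A right inverse of `wMap`:
`φ # h ↦ (ε ⋈ φ ω(·, h, S(h))) (h ⋈ ε)`. -/
def wSection : Module.Dual k H ⊗[k] H →ₗ[k] Module.Dual k (Module.Dual k H) ⊗[k] Module.Dual k H :=
  lift₂ fun φ h =>
    sum₂ (Coalgebra.comul (R := k) h) fun h₁ t => sum₂ (Coalgebra.comul (R := k) t) fun h₂ h₃ =>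
      (dualOmega ω).doubleMul ((dualOmega ω).doubleIncl
          (conv φ (firstSlot ω.1 h₁ (HopfAlgebra.antipode k h₂))))
        (Module.Dual.eval k H h₃ ⊗ₜ Coalgebra.counit)

variable {ω} (hω : IsNormalizedThreeCocycle ω)
include hω

theorem bind_wMap_incl_eval {R : Type*} [CommRing R] [Algebra k R] (g x : Point k R H)
    (a b : Module.Dual k H) :
    (bind x.val fun h => evD k g (wMap ω ((dualOmega ω).doubleMul ((dualOmega ω).doubleIncl b)
      (Module.Dual.eval k H h ⊗ₜ a)))) =
      (ev g.val b * (((om ω g x x⁻¹)⁻¹ : Rˣ) * ev (x⁻¹ * g * x).val a)) • x.val := by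
  have h := val_wMap_incl_mul hω (val_wMap_tmul ω g x a) b
  rw [Val, ← liftBaseChange_comp_apply] at h
  rw [← h]
  refine (bind_linear x.val ((evD k g ∘ₗ wMap ω ∘ₗ
    (dualOmega ω).doubleMul ((dualOmega ω).doubleIncl b)) ∘ₗ
    (TensorProduct.mk k _ _).flip a ∘ₗ (Module.evalEquiv k H).toLinearMap)).trans ?_
  rw [liftBaseChange_comp_apply, LinearMap.baseChange_comp, LinearMap.comp_apply,
    baseChange_flip_mk]
  rfl

/-- On `h ⋈ ε` the conjugation in `w` is invisible, so `φ` is placed in the left factor, where it is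
not conjugated; the value of `ω` multiplied to it cancels the scalar of `w`. -/
theorem wMap_comp_wSection : wMap ω ∘ₗ wSection ω = LinearMap.id := by
  refine crossed_ext (Probe.points k H) ?_
  rintro R _ _ _ ⟨g, rfl⟩ φ x
  rw [LinearMap.baseChange_comp, LinearMap.comp_apply, ← liftBaseChange_comp_apply,
    LinearMap.baseChange_id, LinearMap.id_apply, liftBaseChange_evD_box, wSection,
    baseChange_lift₂_box]
  simp only [one_tmul_sum₂, x.isPoint.bind_comul, ← bind_liftBaseChange,
    LinearMap.liftBaseChange_tmul, one_smul, LinearMap.comp_apply]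
  simp only [bind_wMap_incl_eval hω, Point.ev_conv, ev_firstSlot, Point.ev_counit, mul_one,
    one_tmul_apply (HopfAlgebra.antipode k), bind_smul_const, bind_mul_right, bind_mul, bind_ev,
    bind_box_left, bind_box_right, bind_one_tmul, bind_baseChange, bind_one_tmul_linear,
    ← Point.val_inv, ev_om]
  rw [mul_assoc, Units.mul_inv, mul_one]

theorem wMap_bijective : Function.Bijective (wMap ω) := by
  have hs : Function.Surjective (wMap ω) := fun b =>
    ⟨wSection ω b, LinearMap.congr_fun (wMap_comp_wSection hω) b⟩
  refine ⟨injective_of_surjective_of_finrank_eq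
    (V := Module.Dual k (Module.Dual k H) ⊗[k] Module.Dual k H) (W := Module.Dual k H ⊗[k] H)
    hs ?_, hs⟩
  rw [Module.finrank_tensorProduct, Module.finrank_tensorProduct, Subspace.dual_finrank_eq,
    Subspace.dual_finrank_eq]

end Section

section SumFinset

variable {k R V W M A K ι : Type*} [Field k] [AddCommGroup V] [Module k V] [AddCommGroup W]
  [Module k W] [AddCommMonoid M] [Module k M]

theorem sum_sum₂ (s : Finset ι) (t : V ⊗[k] W) (F : ι → V → W → M) :
    ∑ i ∈ s, sum₂ t (F i) = sum₂ t fun a b => ∑ i ∈ s, F i a b := by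
  have h : (lift₂ fun a b => ∑ i ∈ s, F i a b : V ⊗[k] W →ₗ[k] M) = ∑ i ∈ s, lift₂ (F i) := by
    refine ((Module.Basis.ofVectorSpace k V).tensorProduct
      (Module.Basis.ofVectorSpace k W)).ext fun i => ?_
    simp only [lift₂, LinearMap.sum_apply, Module.Basis.constr_basis]
  rw [sum₂, h, LinearMap.sum_apply]
  rfl

variable [AddCommGroup A] [Module k A] [CommRing R] [Algebra k R] [AddCommMonoid K] [Module k K]

theorem box_finset_sum (s : Finset ι) (y : R ⊗[k] V) (F : ι → R ⊗[k] W) :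
    ∑ i ∈ s, y ⊠ F i = y ⊠ ∑ i ∈ s, F i := by
  induction s using Finset.cons_induction with
  | empty => simp
  | cons a s ha ih => rw [Finset.sum_cons, Finset.sum_cons, ih, box_add]

variable [FiniteDimensional k A]

theorem boxMap_doubleR (Q : QuasiHopfData k A) (E E' : Module.Dual k A ⊗[k] A →ₗ[k] R ⊗[k] K) :
    boxMap E E' Q.doubleR = sum₂ Q.pR fun p₁ p₂ => sum₂ (Q.comul p₁) fun p₁₁ p₁₂ =>
      ∑ i, E (Q.doubleIncl (Q.mul (Q.mul (Q.antipodeInv p₂) (Module.finBasis k A i)) p₁₁)) ⊠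
        E' ((Module.finBasis k A).coord i ⊗ₜ[k] p₁₂) := by
  rw [QuasiHopfData.doubleR, map_sum]
  simp only [map_sum₂, boxMap_tmul, sum_sum₂]

end SumFinset

end

section

theorem map_map_of_comp_eq {k A B C : Type*} [Field k] [AddCommGroup A] [Module k A]
    [AddCommGroup B] [Module k B] [AddCommGroup C] [Module k C] {f : A →ₗ[k] B} {w : B →ₗ[k] C}
    {i : A →ₗ[k] C} (h : w ∘ₗ f = i) (t : A ⊗[k] (A ⊗[k] A)) :
    TensorProduct.map w (TensorProduct.map w w) (TensorProduct.map f (TensorProduct.map f f) t) =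
      TensorProduct.map i (TensorProduct.map i i) t := by
  rw [← LinearMap.comp_apply, ← TensorProduct.map_comp, ← TensorProduct.map_comp, h]

/-! ### The `R`-matrix of the double under `w` -/

section RMatrix

universe u v
variable {k : Type u} {H : Type v} [Field k] [Ring H] [HopfAlgebra k H] [Coalgebra.IsCocomm k H]
  [FiniteDimensional k H]
variable {ω : (WithConv (H ⊗[k] (H ⊗[k] H) →ₗ[k] k))ˣ} (hω : IsNormalizedThreeCocycle ω)

theorem sum_ev_smul_coord {R : Type*} [CommRing R] [Algebra k R] (g : Point k R H) :
    ∑ i, ev g.val (Module.finBasis k (Module.Dual k H) i) •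
      ((1 : R) ⊗ₜ[k] (Module.finBasis k (Module.Dual k H)).coord i) = g.bidual := by
  refine bidual_ext fun a => ?_
  rw [ev_bidual]
  conv_rhs => rw [← (Module.finBasis k (Module.Dual k H)).sum_repr a, map_sum]
  refine (map_sum (LinearMap.liftBaseChange R (Algebra.linearMap k R ∘ₗ
    Module.Dual.eval k (Module.Dual k H) a)) _ _).trans (Finset.sum_congr rfl fun i _ => ?_)
  rw [map_smul, LinearMap.liftBaseChange_tmul, one_smul, map_smul, smul_eq_mul, mul_comm,
    Algebra.smul_def]
  rfl

include hω

theorem om_double_R {R : Type*} [CommRing R] [Algebra k R] (g h : Point k R H) :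
    om ω (h * g) g⁻¹ g * om ω g⁻¹ g g⁻¹ * (om ω h g g⁻¹)⁻¹ = 1 := by
  rw [mul_inv_eq_one]
  exact hω.isGroupCocycle.double_R g h

theorem sum_ev_wMap {R : Type*} [CommRing R] [Algebra k R] (g h : Point k R H)
    (a : Module.Dual k H) :
    ∑ i, ev g.val (Module.finBasis k (Module.Dual k H) i) •
      evD k h (wMap ω ((Module.finBasis k (Module.Dual k H)).coord i ⊗ₜ[k] a)) =
      (((om ω h g g⁻¹)⁻¹ : Rˣ) * ev (g⁻¹ * h * g).val a) • g.val := by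
  have e := val_wMap_tmul ω h g a
  rw [Val, ← liftBaseChange_comp_apply, ← baseChange_flip_mk, ← liftBaseChange_comp_apply,
    ← sum_ev_smul_coord, map_sum] at e
  rw [← e]
  refine Finset.sum_congr rfl fun i _ => ?_
  rw [map_smul, LinearMap.liftBaseChange_tmul, one_smul]
  rfl

/-- The sum over dual bases reassembles the point `g` in the second factor. The remaining scalar is
a value of `p_R` times that of `w`, and it is `1` by `om_double_R`. -/
theorem wMap_R : TensorProduct.map (wMap ω) (wMap ω) (dualOmega ω).doubleR = DOmegaR k H := by
  refine (Probe.points k H).ext_tensor₂ ?_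
  rintro R _ _ _ _ ⟨g, rfl⟩ ⟨h, rfl⟩
  rw [val_one_tmul_iff.1 (val_R g h), one_smul, ← LinearMap.comp_apply, boxMap_comp_map,
    boxMap_doubleR]
  simp only [LinearMap.comp_apply, wMap_doubleIncl hω, evD_crossedIncl, ev_dualOmega_mul,
    ev_antipodeInv]
  have e : ∀ p₁₁ p₁₂ p₂ : Module.Dual k H,
      ∑ i, ((ev (g⁻¹).val p₂ * ev g.val (Module.finBasis k (Module.Dual k H) i) * ev g.val p₁₁) •
        (1 : Point k R H).val) ⊠
        evD k h (wMap ω ((Module.finBasis k (Module.Dual k H)).coord i ⊗ₜ[k] p₁₂)) =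
      (((om ω h g g⁻¹)⁻¹ : Rˣ) * ev (g⁻¹).val p₂ * (ev g.val p₁₁ * ev (g⁻¹ * h * g).val p₁₂)) •
        ((1 : Point k R H).val ⊠ g.val) := by
    intro p₁₁ p₁₂ p₂
    -- The value of the basis element at `g` is moved across `⊠`, so that the sum acts in the second
    -- factor only.
    have := sum_ev_wMap hω g h p₁₂
    calc _ = ∑ i, ((ev (g⁻¹).val p₂ * ev g.val p₁₁) • (1 : Point k R H).val) ⊠
          (ev g.val (Module.finBasis k (Module.Dual k H) i) •
            evD k h (wMap ω ((Module.finBasis k (Module.Dual k H)).coord i ⊗ₜ[k] p₁₂))) :=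
          Finset.sum_congr rfl fun i _ => by
            rw [box_smul, ← smul_box, smul_smul]; congr 2; ring
      _ = _ := by
        rw [box_finset_sum, this, smul_box, box_smul, smul_smul]; congr 1; ring
  simp only [e, sum₂_smul_const]
  rw [sum₂_evT _ (((om ω h g g⁻¹)⁻¹ : Rˣ) : R) (ev (g * (g⁻¹ * h * g)).val) (ev (g⁻¹).val),
    evT_pR, ← Units.val_mul, inv_inv]
  · have e₁ : g * (g⁻¹ * h * g) = h * g := by group
    rw [e₁, mul_comm, om_double_R hω, Units.val_one, one_smul]
  intro p₁ p₂
  rw [sum₂_evT _ (((om ω h g g⁻¹)⁻¹ : Rˣ) * ev (g⁻¹).val p₂) (ev g.val) (ev (g⁻¹ * h * g).val),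
    evT_dualOmega_comul]
  · ring
  · intro v w; ring

theorem wMap_map_doubleIncl (t : Module.Dual k H ⊗[k] (Module.Dual k H ⊗[k] Module.Dual k H)) :
    TensorProduct.map (wMap ω) (TensorProduct.map (wMap ω) (wMap ω))
      (TensorProduct.map (dualOmega ω).doubleIncl
        (TensorProduct.map (dualOmega ω).doubleIncl (dualOmega ω).doubleIncl) t) =
      TensorProduct.map crossedIncl (TensorProduct.map crossedIncl crossedIncl) t :=
  map_map_of_comp_eq (A := Module.Dual k H) (B := Module.Dual k (Module.Dual k H) ⊗[k] Module.Dual k H)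
    (C := Module.Dual k H ⊗[k] H) (wMap_comp_doubleIncl hω) t

theorem wMap_isIsomorphism : IsIsomorphism (dualOmega ω).quantumDouble (dualOmega ω).doubleR
    (DOmega ω) (DOmegaR k H) (wMap ω) where
  bijective := wMap_bijective hω
  map_mul := wMap_doubleMul hω
  map_one := wMap_doubleIncl hω _
  map_comul := LinearMap.congr_fun (wMap_comul hω)
  map_counit := LinearMap.congr_fun (wMap_counit hω)
  map_reassoc := wMap_map_doubleIncl hω _
  map_reassocInv := wMap_map_doubleIncl hω _
  map_antipode := LinearMap.congr_fun (wMap_antipode hω)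
  map_alpha := wMap_doubleIncl hω _
  map_beta := wMap_doubleIncl hω _
  map_R := wMap_R hω

end RMatrix

/-! ### Transport of the laws to the double -/

section Isomorphism

variable {k A B : Type*} [Field k] [AddCommGroup A] [Module k A] [AddCommGroup B] [Module k B]
  {Q : QuasiHopfData k A} {R : A ⊗[k] A} {Q' : QuasiHopfData k B} {R' : B ⊗[k] B} {w : A →ₗ[k] B}

/-- The inverse is a surjective homomorphism in the opposite direction, along which the axioms pass
from `Q'` to `Q`. In this way the laws of the quantum double follow from those of `D^ω(H)`. -/
theorem IsIsomorphism.exists_inverse (h : IsIsomorphism Q R Q' R' w) :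
    ∃ v : B →ₗ[k] A, Function.Surjective v ∧ Q'.IsHom Q v ∧ TensorProduct.map v v R' = R := by
  obtain ⟨e, rfl⟩ : ∃ e : A ≃ₗ[k] B, e.toLinearMap = w :=
    ⟨LinearEquiv.ofBijective w h.bijective, rfl⟩
  have e₁ : ∀ b, e (e.symm b) = b := e.apply_symm_apply
  have h₁ : e.symm.toLinearMap ∘ₗ e.toLinearMap = LinearMap.id :=
    LinearMap.ext e.symm_apply_apply
  have h₂ : ∀ t, TensorProduct.map e.symm.toLinearMap e.symm.toLinearMap
      (TensorProduct.map e.toLinearMap e.toLinearMap t) = t := fun t => by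
    rw [← LinearMap.comp_apply, ← TensorProduct.map_comp, h₁, TensorProduct.map_id,
      LinearMap.id_apply]
  have h₃ : ∀ t, TensorProduct.map e.symm.toLinearMap
      (TensorProduct.map e.symm.toLinearMap e.symm.toLinearMap)
      (TensorProduct.map e.toLinearMap (TensorProduct.map e.toLinearMap e.toLinearMap) t) = t :=
    fun t => by
      rw [← LinearMap.comp_apply, ← TensorProduct.map_comp, ← TensorProduct.map_comp, h₁,
        TensorProduct.map_id, TensorProduct.map_id, LinearMap.id_apply]
  refine ⟨e.symm.toLinearMap, e.symm.surjective, ⟨fun a b => ?_, ?_, fun a => ?_, fun a => ?_, ?_,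
    ?_, fun a => ?_, ?_, ?_⟩, by rw [← h.map_R, h₂]⟩
  · refine e.symm_apply_eq.2 ((h.map_mul _ _).trans ?_).symm
    exact congrArg₂ (fun a b => Q'.mul a b) (e₁ a) (e₁ b)
  · exact e.symm_apply_eq.2 h.map_one.symm
  · rw [← h₂ (Q.comul _), h.map_comul]
    exact congrArg (fun b => TensorProduct.map _ _ (Q'.comul b)) (e₁ a).symm
  · rw [← h.map_counit]
    exact congrArg Q'.counit (e₁ a)
  · rw [← h.map_reassoc, h₃]
  · rw [← h.map_reassocInv, h₃]
  · refine e.symm_apply_eq.2 ((h.map_antipode _).trans ?_).symm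
    exact congrArg Q'.antipode (e₁ a)
  · exact e.symm_apply_eq.2 h.map_alpha.symm
  · exact e.symm_apply_eq.2 h.map_beta.symm

theorem IsIsomorphism.isQuasiHopf (h : IsIsomorphism Q R Q' R' w) (hQ : Q'.IsQuasiHopf) :
    Q.IsQuasiHopf := by
  obtain ⟨v, hv, hv', -⟩ := h.exists_inverse
  exact hv'.isQuasiHopf hv hQ

theorem IsIsomorphism.isRMatrix (h : IsIsomorphism Q R Q' R' w) (hR : Q'.IsRMatrix R') :
    Q.IsRMatrix R := by
  obtain ⟨v, hv, hv', hvR⟩ := h.exists_inverse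
  exact hvR ▸ hv'.isRMatrix hv hR

end Isomorphism

end

end QuasiHopf

end

theorem mainTheorem3 {k H : Type*} [Field k] [Ring H] [HopfAlgebra k H] [Coalgebra.IsCocomm k H]
    [FiniteDimensional k H] (ω : (WithConv (H ⊗[k] (H ⊗[k] H) →ₗ[k] k))ˣ)
    (hω : QuasiHopf.IsNormalizedThreeCocycle ω) :
    (QuasiHopf.dualOmega ω).IsQuasiHopf ∧
    (QuasiHopf.dualOmega ω).quantumDouble.IsQuasiHopf ∧
    (QuasiHopf.dualOmega ω).quantumDouble.IsRMatrix (QuasiHopf.dualOmega ω).doubleR ∧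
    (QuasiHopf.DOmega ω).IsQuasiHopf ∧
    (QuasiHopf.DOmega ω).IsRMatrix (QuasiHopf.DOmegaR k H) ∧
    QuasiHopf.IsIsomorphism
      (QuasiHopf.dualOmega ω).quantumDouble (QuasiHopf.dualOmega ω).doubleR
      (QuasiHopf.DOmega ω) (QuasiHopf.DOmegaR k H) (QuasiHopf.wMap ω) := by exact
  have iso := QuasiHopf.wMap_isIsomorphism hω
  ⟨hω.dualOmega_isQuasiHopf, iso.isQuasiHopf hω.DOmega_isQuasiHopf,
    iso.isRMatrix hω.DOmega_isRMatrix, hω.DOmega_isQuasiHopf, hω.DOmega_isRMatrix, iso⟩
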